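/- Let $\kappa\ge 0$ be an integer, $\alpha\in[0,1]$, $\gamma:=\kappa+\alpha$, and let $\Omega\subset\mathbb R$ be open. Let $\phi$ be a real-valued phase on $\Omega$ which is locally $C^{\kappa+1,\alpha}$ in $\Omega$ (the derivative $\phi^{(\kappa+1)}$ exists, is continuous, and is locally Hölder continuous with exponent $\alpha$) and satisfies $\phi'>0$ on $\Omega$. Let $\ell:\Omega\to[0,\infty)$ be admissible with constants $A,c>0$, which means: $|\ell(x)-\ell(y)|\le|x-y|$ for all $x,y\in\Omega$; $\ell$ vanishes on $\partial\Omega$, i.e. $\ell(x)\to0$ as $x\in\Omega$ tends to any point of $\partial\Omega$; $$|\phi^{(j+1)}(x)|\,\ell(x)^j\le A\,|\phi'(x)|\qquad\text{for } x\in\Omega,\ 1\le j\le\kappa;$$ and $$\frac{|\phi^{(\kappa+1)}(x)-\phi^{(\kappa+1)}(y)|}{|x-y|^\alpha}\,\ell(x)^{\kappa+\alpha}\le A\,|\phi'(x)|\qquad\text{for } x,y\in\Omega,\ 0<|x-y|\le c\,\ell(x).$$ Let $C_-$ be the Fourier multiplier operator with symbol $\mathbf 1_{\xi<0}$, extended by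 continuity from the Schwartz functions to $L^p(\mathbb R)$. Let $p\in(1,\infty)$, let $k\ge\gamma$ be an integer, and let $q\in[1,p]$ satisfy $$\frac1q\le\frac1p+k-\gamma .$$ Then, for all $t>0$ and all complex-valued $f\in L^p(\Omega)$ such that $f/(\phi')^\gamma$ has a locally integrable weak derivative of order $k$ on $\Omega$, $$\|C_-(e^{it\phi}f\mathbf 1_\Omega)\|_{L^p(\mathbb R)}\le \frac{C}{t^{\gamma}}\left[\left\|\frac{f}{(\phi'\ell)^\gamma}\right\|_{L^p(\Omega)}+\left\|\ell^{\,k-\gamma+\frac1p-\frac1q}\,\frac{d^k}{dx^k}\left(\frac{f}{(\phi')^\gamma}\right)\right\|_{L^q(\Omega)}\right],$$ where $C$ depends only on $k,\kappa,\alpha,p,q$ and on the admissibility constants $A,c$ (in particular, not on $\Omega,\phi,\ell,f,t$). The right-hand side may be infinite; at points where $\phi'\ell=0$ and $\gamma>0$ the quotient $f/(\phi'\ell)^\gamma$ is read as $0$ if $f=0$ and as $\infty$ otherwise. -/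

import Mathlib

open MeasureTheory Filter Topology Set
open scoped ENNReal NNReal FourierTransform SchwartzMap ContDiff

/-- The hypotheses on the phase: `φ` is locally `C^{κ+1,α}` on the open set `Ω`, i.e. it is
`κ + 1` times continuously differentiable on `Ω` and its derivative of order `κ + 1` is locally
Hölder continuous on `Ω` with exponent `α`; moreover `φ' > 0` on `Ω`. -/
structure IsPhase (κ : ℕ) (α : ℝ) (Ω : Set ℝ) (φ : ℝ → ℝ) : Prop where
  contDiffOn : ContDiffOn ℝ ((κ + 1 : ℕ) : WithTop ℕ∞) φ Ω
  holder : ∀ x ∈ Ω, ∃ ε > 0, ∃ K : ℝ, ∀ y ∈ Ω, ∀ z ∈ Ω, |y - x| < ε → |z - x| < ε →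
    |iteratedDeriv (κ + 1) φ y - iteratedDeriv (κ + 1) φ z| ≤ K * |y - z| ^ α
  deriv_pos : ∀ x ∈ Ω, 0 < deriv φ x

/-- `ℓ` is admissible for the phase `φ` on `Ω`, where `A` is the implicit constant in the two
derivative bounds and `c` is the implicit constant in the condition `|y - x| << ℓ x`.
Only the values of `ℓ` on `Ω` matter; that `ℓ` vanishes on the boundary of `Ω` means that
`ℓ` tends to `0` at every boundary point. -/
structure IsAdmissible (κ : ℕ) (α : ℝ) (Ω : Set ℝ) (φ ℓ : ℝ → ℝ) (A c : ℝ) : Prop where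
  nonneg : ∀ x ∈ Ω, 0 ≤ ℓ x
  lipschitz : ∀ x ∈ Ω, ∀ y ∈ Ω, |ℓ x - ℓ y| ≤ |x - y|
  boundary : ∀ x ∈ frontier Ω, Tendsto ℓ (𝓝[Ω] x) (𝓝 0)
  deriv_bound : ∀ x ∈ Ω, ∀ j : ℕ, 1 ≤ j → j ≤ κ →
    |iteratedDeriv (j + 1) φ x| * ℓ x ^ j ≤ A * |deriv φ x|
  holder_bound : ∀ x ∈ Ω, ∀ y ∈ Ω, y ≠ x → |y - x| ≤ c * ℓ x →
    |iteratedDeriv (κ + 1) φ x - iteratedDeriv (κ + 1) φ y| / |x - y| ^ α * ℓ x ^ ((κ : ℝ) + α)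
      ≤ A * |deriv φ x|

/-- `G` is the weak derivative of order `k` of `F` on the open set `Ω`; both are locally integrable
on `Ω`, and the test functions are smooth with compact support inside `Ω`. -/
def IsWeakDeriv (k : ℕ) (Ω : Set ℝ) (F G : ℝ → ℂ) : Prop :=
  LocallyIntegrableOn F Ω volume ∧ LocallyIntegrableOn G Ω volume ∧
    ∀ ψ : ℝ → ℝ, ContDiff ℝ ∞ ψ → HasCompactSupport ψ → tsupport ψ ⊆ Ω →
      ∫ x, iteratedDeriv k ψ x • F x = (-1) ^ k * ∫ x, ψ x • G x

/-- The Fourier multiplier operator with symbol `1_{ξ < 0}` on Schwartz functions. -/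
noncomputable def cMinusSchwartz (u : 𝓢(ℝ, ℂ)) : ℝ → ℂ :=
  𝓕⁻ ((Iio (0 : ℝ)).indicator (𝓕 (u : ℝ → ℂ)))

/-- `h = C_- g` in `L^p(ℝ)`, where `C_-` is the Fourier multiplier operator with symbol
`1_{ξ < 0}`, extended by continuity from the Schwartz functions to `L^p(ℝ)`. -/
def IsCMinus (p : ℝ≥0∞) (g h : ℝ → ℂ) : Prop :=
  MemLp g p volume ∧ MemLp h p volume ∧ ∃ u : ℕ → 𝓢(ℝ, ℂ),
    Tendsto (fun n => eLpNorm (fun x => u n x - g x) p volume) atTop (𝓝 0) ∧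
    Tendsto (fun n => eLpNorm (fun x => cMinusSchwartz (u n) x - h x) p volume) atTop (𝓝 0)

/-- The function `e^{i t φ} f 1_Ω`. -/
noncomputable def oscillating (t : ℝ) (φ : ℝ → ℝ) (f : ℝ → ℂ) (Ω : Set ℝ) : ℝ → ℂ :=
  Ω.indicator fun x => Complex.exp (Complex.I * ((t * φ x : ℝ) : ℂ)) * f x

/-- The norm of `f / (φ' ℓ) ^ γ` in `L^p(Ω)`, with values in `[0, ∞]`: where the denominator
vanishes, the quotient is `0` if `f` vanishes too, and infinite otherwise. -/
noncomputable def weightedNorm (p γ : ℝ) (Ω : Set ℝ) (φ ℓ : ℝ → ℝ) (f : ℝ → ℂ) : ℝ≥0∞ :=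
  eLpNorm (fun x => ‖f x‖ₑ / ENNReal.ofReal ((deriv φ x * ℓ x) ^ γ)) (ENNReal.ofReal p)
    (volume.restrict Ω)

/-! By duality the norm of `C_-(e^{itφ} f 1_Ω)` is tested against Schwartz functions `v` in
`L^{p'}`. The transpose of `C_-` is the projection to positive frequencies
(`integral_cMinusSchwartz_mul`), so the quantity to bound is `∫_Ω e^{itφ} f H`, where `H` is the
boundary value of a function holomorphic in the upper half plane whose nontangential maximal
function has a majorant `N` with `‖N‖_{p'} ≲ ‖v‖_{p'}` (`exists_nontangential_majorant`, from M.
Riesz' inequality, the Poisson representation and the Hardy–Littlewood inequality).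

If `φ` were analytic, `e^{itφ}` would decay like `e^{-tφ'y}` at height `y`, because `φ' > 0`, and
the contour could be moved upwards. For finite smoothness an almost analytic extension replaces
this. Write `f = (φ')^γ F` and extend each of `φ`, `φ'`, `F` to `x + iy` by averaging at scale `y`
against one kernel (`ExtensionKernel`), designed so that the antiholomorphic derivative of an
average is `y⁻¹` times an average against the derivative of order `M + 1` of a bump. Such a kernel
annihilates polynomials of degree at most `M`, and its derivatives can be moved onto the averaged
function. The admissibility bounds then make the antiholomorphic derivative of the extended phase
`O(φ' (y/ℓ)^γ)` and that of the logarithm of the extended `φ'` `O(y⁻¹ (y/ℓ)^γ)`, while that of the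
extended `F` is `y^{k-1}` times an average of `F^{(k)}`. A cutoff to `y ≲ ℓ(x)` costs `O(y⁻¹)` where
`y ≈ ℓ`. All this is `ScaledPhase.exists_extension`.

Green's theorem bounds the boundary integral by the area integral of the antiholomorphic derivative,
to which `H` contributes only as a factor. With `m = φ'`, integration in `y` turns the terms with
`(y/ℓ)^γ` into `|f| N ∫ e^{-ctmy} (y/ℓ)^γ dy/y ≈ |f| N (tmℓ)^{-γ}`. The term with `F^{(k)}` is
treated with `|H| ≤ N^θ ‖N‖_{p'}^{1-θ} y^{-β}`, `β = 1/q - 1/p`. Since `β + γ ≤ k`, one has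
`y^{k-1-β} ≤ ℓ^{k-γ-β} y^{γ-1}` for `y ≤ ℓ`, and the result is `t^{-γ} ℓ^{k-γ-β} |F^{(k)}| N^θ` up
to that power of `‖N‖_{p'}`. Hölder's inequality with exponents `(p, p')` and `(q, q')` finishes the
estimate (`ScaledPhase.enorm_integral_mul_hardyExt_le`).

Three reductions surround this core. The scale `ℓ`, extended by zero, stays Lipschitz on the whole
line; it is truncated to a compactly supported `u ≤ ℓ`, and the extra boundary terms vanish as the
truncation is removed. Where `ℓ` vanishes, a finite right-hand side forces `f = 0`. For `γ = 0` the
claim is the boundedness of `C_-`. -/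

/-! ### The Hardy–Littlewood maximal inequality. -/

/-- The uncentred Hardy–Littlewood maximal function on the line. -/
noncomputable def maximalFn (w : ℝ → ℝ≥0∞) (x : ℝ) : ℝ≥0∞ :=
  ⨆ (b : ℝ × ℝ) (_ : x ∈ Metric.ball b.1 b.2),
    (ENNReal.ofReal (2 * b.2))⁻¹ * ∫⁻ y in Metric.ball b.1 b.2, w y

/-- Uncentred balls make every superlevel set a union of open balls, so the maximal function is
measurable whatever `w` is, and the balls are ready for a covering argument. -/
theorem setOf_lt_maximalFn (w : ℝ → ℝ≥0∞) (a : ℝ≥0∞) :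
    {x | a < maximalFn w x} = ⋃ b ∈ {b : ℝ × ℝ | a < (ENNReal.ofReal (2 * b.2))⁻¹ *
      ∫⁻ y in Metric.ball b.1 b.2, w y}, Metric.ball b.1 b.2 := by
  ext x
  simp only [maximalFn, mem_ofPred_eq, lt_iSup_iff, mem_iUnion]
  constructor
  · rintro ⟨b, hb, h⟩; exact ⟨b, h, hb⟩
  · rintro ⟨b, h, hb⟩; exact ⟨b, hb, h⟩

theorem measurable_maximalFn (w : ℝ → ℝ≥0∞) : Measurable (maximalFn w) := by
  refine measurable_of_Ioi fun a => ?_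
  have : maximalFn w ⁻¹' Ioi a = {x | a < maximalFn w x} := rfl
  rw [this, setOf_lt_maximalFn]
  exact (isOpen_biUnion fun b _ => Metric.isOpen_ball).measurableSet

theorem setLIntegral_ball_le_maximalFn (w : ℝ → ℝ≥0∞) {x c ρ : ℝ} (hx : x ∈ Metric.ball c ρ) :
    ∫⁻ y in Metric.ball c ρ, w y ≤ ENNReal.ofReal (2 * ρ) * maximalFn w x := by
  have hρ : 0 < ρ := dist_nonneg.trans_lt hx
  have h : (ENNReal.ofReal (2 * ρ))⁻¹ * ∫⁻ y in Metric.ball c ρ, w y ≤ maximalFn w x :=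
    le_iSup₂_of_le (c, ρ) hx le_rfl
  have h0 : ENNReal.ofReal (2 * ρ) ≠ 0 := by simp [hρ]
  calc _ = ENNReal.ofReal (2 * ρ) * ((ENNReal.ofReal (2 * ρ))⁻¹ *
        ∫⁻ y in Metric.ball c ρ, w y) := by
        rw [← mul_assoc, ENNReal.mul_inv_cancel h0 ENNReal.ofReal_ne_top, one_mul]
    _ ≤ _ := by gcongr

/-- Vitali covering: among the balls with average above `a`, a disjoint subfamily has fourfold
enlargements covering the superlevel set, and `w` has mass at least `a` times the length on each of
its balls. -/
theorem mul_volume_lt_maximalFn_le (w : ℝ → ℝ≥0∞) {a : ℝ} (ha : 0 < a) :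
    ENNReal.ofReal a * volume {x | ENNReal.ofReal a < maximalFn w x} ≤ 4 * ∫⁻ x, w x := by
  by_cases hw : ∫⁻ x, w x = ⊤
  · rw [hw]; simp
  set t := {b : ℝ × ℝ | ENNReal.ofReal a < (ENNReal.ofReal (2 * b.2))⁻¹ *
      ∫⁻ y in Metric.ball b.1 b.2, w y} with ht
  have hpos : ∀ b ∈ t, 0 < b.2 := by
    intro b hb
    by_contra hneg
    rw [ht, mem_ofPred_eq, Metric.ball_eq_empty.2 (not_lt.1 hneg)] at hb
    simp at hb
  have hbd : ∀ b ∈ t, ENNReal.ofReal (2 * b.2) * ENNReal.ofReal a ≤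
      ∫⁻ y in Metric.ball b.1 b.2, w y := by
    intro b hb
    have hb0 : ENNReal.ofReal (2 * b.2) ≠ 0 := by simp [hpos b hb]
    calc _ ≤ ENNReal.ofReal (2 * b.2) * ((ENNReal.ofReal (2 * b.2))⁻¹ *
        ∫⁻ y in Metric.ball b.1 b.2, w y) := by gcongr; exact le_of_lt hb
      _ = _ := by rw [← mul_assoc, ENNReal.mul_inv_cancel hb0 ENNReal.ofReal_ne_top, one_mul]
  -- The covering lemma needs bounded radii; finiteness of the total mass supplies the bound.
  have hR : ∀ b ∈ t, b.2 ≤ (∫⁻ x, w x).toReal / a := by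
    intro b hb
    have h1 := (hbd b hb).trans (setLIntegral_le_lintegral _ _)
    rw [← ENNReal.ofReal_mul (by linarith [hpos b hb])] at h1
    have h2 := (ENNReal.ofReal_le_iff_le_toReal hw).1 h1
    rw [le_div_iff₀ ha]
    nlinarith [hpos b hb, mul_pos (hpos b hb) ha]
  obtain ⟨u, hut, hdisj, hcov⟩ := Vitali.exists_disjoint_subfamily_covering_enlargement_ball t
    Prod.fst Prod.snd _ hR 4 (by norm_num)
  have hcount : u.Countable := hdisj.countable_of_isOpen (fun _ _ => Metric.isOpen_ball)
    fun b hb => ⟨b.1, Metric.mem_ball_self (hpos b (hut hb))⟩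
  have hsub : {x | ENNReal.ofReal a < maximalFn w x} ⊆ ⋃ b ∈ u, Metric.ball b.1 (4 * b.2) := by
    rw [setOf_lt_maximalFn]
    refine iUnion₂_subset fun b hb => ?_
    obtain ⟨b', hb', h⟩ := hcov b hb
    exact h.trans (subset_biUnion_of_mem (u := fun b : ℝ × ℝ => Metric.ball b.1 (4 * b.2)) hb')
  have := hcount.to_subtype
  calc ENNReal.ofReal a * volume {x | ENNReal.ofReal a < maximalFn w x}
      ≤ ENNReal.ofReal a * ∑' b : u, volume (Metric.ball b.1.1 (4 * b.1.2)) := by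
        gcongr
        exact (measure_mono hsub).trans (measure_biUnion_le volume hcount _)
    _ = ∑' b : u, ENNReal.ofReal a * volume (Metric.ball b.1.1 (4 * b.1.2)) :=
        ENNReal.tsum_mul_left.symm
    _ ≤ ∑' b : u, 4 * ∫⁻ y in Metric.ball b.1.1 b.1.2, w y := by
        refine ENNReal.tsum_le_tsum fun b => ?_
        rw [Real.volume_ball]
        calc _ = 4 * (ENNReal.ofReal (2 * b.1.2) * ENNReal.ofReal a) := by
              rw [show (4 : ℝ≥0∞) = ENNReal.ofReal 4 by simp,
                ← ENNReal.ofReal_mul ha.le,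
                ← ENNReal.ofReal_mul (by linarith [hpos b.1 (hut b.2)] : (0 : ℝ) ≤ 2 * b.1.2),
                ← ENNReal.ofReal_mul (by norm_num : (0 : ℝ) ≤ 4)]
              congr 1; ring
          _ ≤ _ := by gcongr; exact hbd b.1 (hut b.2)
    _ = 4 * ∑' b : u, ∫⁻ y in Metric.ball b.1.1 b.1.2, w y := ENNReal.tsum_mul_left
    _ = 4 * ∫⁻ y in ⋃ b ∈ u, Metric.ball b.1 b.2, w y := by
        rw [lintegral_biUnion hcount (fun _ _ => measurableSet_ball) hdisj]
    _ ≤ _ := by gcongr; exact Measure.restrict_le_self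

/-- The values of `w` not exceeding `a` add at most `a` to any average. This is the splitting of
Marcinkiewicz interpolation between weak `L^1` and `L^∞`. -/
theorem maximalFn_le_truncation (w : ℝ → ℝ≥0∞) (a : ℝ≥0∞) (x : ℝ) :
    maximalFn w x ≤ maximalFn ({y | a < w y}.indicator w) x + a := by
  refine iSup₂_le fun b hb => ?_
  have hρ : 0 < b.2 := dist_nonneg.trans_lt hb
  have h0 : ENNReal.ofReal (2 * b.2) ≠ 0 := by simp [hρ]
  have h1 : ∫⁻ y in Metric.ball b.1 b.2, w y ≤
      (∫⁻ y in Metric.ball b.1 b.2, {y | a < w y}.indicator w y) + a * ENNReal.ofReal (2 * b.2) := by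
    rw [← Real.volume_ball b.1, ← setLIntegral_const, ← lintegral_add_right _ measurable_const]
    refine lintegral_mono fun y => ?_
    by_cases hy : a < w y
    · simp [indicator, hy]
    · simp [indicator, hy, not_lt.1 hy]
  calc _ ≤ (ENNReal.ofReal (2 * b.2))⁻¹ * ((∫⁻ y in Metric.ball b.1 b.2,
        {y | a < w y}.indicator w y) + a * ENNReal.ofReal (2 * b.2)) := by gcongr
    _ = (ENNReal.ofReal (2 * b.2))⁻¹ * (∫⁻ y in Metric.ball b.1 b.2,
        {y | a < w y}.indicator w y) + a := by
        rw [mul_add, mul_comm a, ← mul_assoc, ENNReal.inv_mul_cancel h0 ENNReal.ofReal_ne_top,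
          one_mul]
    _ ≤ _ := by
        gcongr
        exact le_iSup₂_of_le (f := fun (b : ℝ × ℝ) (_ : x ∈ Metric.ball b.1 b.2) =>
          (ENNReal.ofReal (2 * b.2))⁻¹ * ∫⁻ y in Metric.ball b.1 b.2,
            {y | a < w y}.indicator w y) b hb le_rfl

theorem setLIntegral_rpow_Ioo {r : ℝ} (hr : 0 < r) {b : ℝ} (hb : 0 ≤ b) :
    ∫⁻ t in Ioo 0 b, ENNReal.ofReal (r * t ^ (r - 1)) = ENNReal.ofReal (b ^ r) := by
  have hint : IntervalIntegrable (fun t : ℝ => r * t ^ (r - 1)) volume 0 b :=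
    (intervalIntegral.intervalIntegrable_rpow' (by linarith)).const_mul r
  rw [← ofReal_integral_eq_lintegral_ofReal]
  · rw [← integral_Ioc_eq_integral_Ioo, ← intervalIntegral.integral_of_le hb,
      intervalIntegral.integral_const_mul, integral_rpow (Or.inl (by linarith))]
    congr 1
    rw [sub_add_cancel, Real.zero_rpow hr.ne']
    field_simp
    ring
  · exact (hint.1.mono_set Ioo_subset_Ioc_self)
  · filter_upwards [ae_restrict_mem measurableSet_Ioo] with t ht
    have := Real.rpow_nonneg ht.1.le (r - 1)
    positivity

/-- The layer cake formula for a single extended nonnegative number. -/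
theorem rpow_eq_setLIntegral_indicator {r : ℝ} (hr : 0 < r) (a : ℝ≥0∞) :
    a ^ r = ∫⁻ t in Ioi (0 : ℝ), {t : ℝ | ENNReal.ofReal t < a}.indicator
      (fun t => ENNReal.ofReal (r * t ^ (r - 1))) t := by
  have hm : MeasurableSet {t : ℝ | ENNReal.ofReal t < a} :=
    measurableSet_lt ENNReal.measurable_ofReal measurable_const
  rw [setLIntegral_indicator hm]
  induction a with
  | top =>
    have h1 : ∀ n : ℕ, ENNReal.ofReal ((n : ℝ) ^ r) ≤ ∫⁻ t in {t : ℝ | ENNReal.ofReal t < (⊤ : ℝ≥0∞)} ∩ Ioi 0,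
        ENNReal.ofReal (r * t ^ (r - 1)) := by
      intro n
      rw [← setLIntegral_rpow_Ioo hr n.cast_nonneg]
      exact lintegral_mono_set fun t ht => ⟨ENNReal.ofReal_lt_top, ht.1⟩
    rw [ENNReal.top_rpow_of_pos hr]
    refine (top_le_iff.1 (le_of_tendsto' (x := atTop) (a := (⊤ : ℝ≥0∞)) ?_ h1)).symm
    exact ENNReal.tendsto_ofReal_atTop.comp
      ((tendsto_rpow_atTop hr).comp tendsto_natCast_atTop_atTop)
  | coe a =>
    have : {t : ℝ | ENNReal.ofReal t < a} ∩ Ioi 0 = Ioo 0 (a : ℝ) := by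
      ext t
      simp only [mem_inter_iff, mem_ofPred_eq, mem_Ioi, mem_Ioo]
      constructor
      · rintro ⟨h, h0⟩
        rw [← ENNReal.ofReal_coe_nnreal, ENNReal.ofReal_lt_ofReal_iff'] at h
        exact ⟨h0, h.1⟩
      · rintro ⟨h0, h⟩
        refine ⟨?_, h0⟩
        rw [← ENNReal.ofReal_coe_nnreal]
        exact (ENNReal.ofReal_lt_ofReal_iff (h0.trans h)).2 h
    rw [this]
    refine Eq.trans ?_ (setLIntegral_rpow_Ioo hr a.coe_nonneg).symm
    rw [← ENNReal.ofReal_rpow_of_nonneg a.coe_nonneg hr.le,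
      ENNReal.ofReal_coe_nnreal]

/-- The Hardy–Littlewood maximal inequality in `L^r`, `1 < r`. -/
theorem lintegral_maximalFn_rpow_le {r : ℝ} (hr : 1 < r) :
    ∃ C : ℝ≥0, ∀ w : ℝ → ℝ≥0∞, Measurable w →
      ∫⁻ x, maximalFn w x ^ r ≤ C * ∫⁻ x, w x ^ r := by
  have hr0 : 0 < r := by linarith
  have hr1 : 0 < r - 1 := by linarith
  -- The weak bound with constant `4` at height `t / 2` gives `8 / t`; integrating `r t^{r-2}` up to
  -- `t = 2 w` gives `r / (r - 1) * (2 w)^{r-1}`.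
  refine ⟨(8 * (r / (r - 1)) * 2 ^ (r - 1)).toNNReal, fun w hw => ?_⟩
  have hmM := measurable_maximalFn w
  have hA : MeasurableSet {z : ℝ × ℝ | ENNReal.ofReal z.2 < maximalFn w z.1} :=
    measurableSet_lt (ENNReal.measurable_ofReal.comp measurable_snd) (hmM.comp measurable_fst)
  have hB : MeasurableSet {z : ℝ × ℝ | ENNReal.ofReal (z.2 / 2) < w z.1} :=
    measurableSet_lt (ENNReal.measurable_ofReal.comp (measurable_snd.div_const 2))
      (hw.comp measurable_fst)
  have hpow : Measurable fun t : ℝ => ENNReal.ofReal (r * t ^ (r - 1)) := by fun_prop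
  have step : ∀ t ∈ Ioi (0 : ℝ), (∫⁻ x, {t : ℝ | ENNReal.ofReal t < maximalFn w x}.indicator
      (fun t => ENNReal.ofReal (r * t ^ (r - 1))) t) ≤
      ∫⁻ x, 8 * {t : ℝ | ENNReal.ofReal (t / 2) < w x}.indicator
        (fun t => w x * ENNReal.ofReal (r * t ^ (r - 1 - 1))) t := by
    intro t ht
    have ht0 : 0 < t := ht
    have e1 : (∫⁻ x, {t : ℝ | ENNReal.ofReal t < maximalFn w x}.indicator
        (fun t => ENNReal.ofReal (r * t ^ (r - 1))) t) =
        ENNReal.ofReal (r * t ^ (r - 1)) * volume {x | ENNReal.ofReal t < maximalFn w x} := by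
      rw [← lintegral_indicator_const (measurableSet_lt measurable_const hmM)]
      rfl
    have e2 : (∫⁻ x, 8 * {t : ℝ | ENNReal.ofReal (t / 2) < w x}.indicator
        (fun t => w x * ENNReal.ofReal (r * t ^ (r - 1 - 1))) t) =
        8 * ENNReal.ofReal (r * t ^ (r - 1 - 1)) *
          ∫⁻ x, {y | ENNReal.ofReal (t / 2) < w y}.indicator w x := by
      have hms : MeasurableSet {y | ENNReal.ofReal (t / 2) < w y} :=
        measurableSet_lt measurable_const hw
      rw [← lintegral_const_mul _ (hw.indicator hms)]
      refine lintegral_congr fun x => ?_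
      by_cases hx : ENNReal.ofReal (t / 2) < w x
      · simp only [indicator, mem_ofPred_eq, hx, if_true]; ring
      · simp [indicator, hx]
    have e3 : ENNReal.ofReal (t / 2) * volume {x | ENNReal.ofReal t < maximalFn w x} ≤
        4 * ∫⁻ x, {y | ENNReal.ofReal (t / 2) < w y}.indicator w x := by
      refine le_trans ?_ (mul_volume_lt_maximalFn_le _ (half_pos ht0))
      refine mul_le_mul_right (measure_mono fun x (hx : ENNReal.ofReal t < maximalFn w x) => ?_) _
      have h1 := hx.trans_le (maximalFn_le_truncation w (ENNReal.ofReal (t / 2)) x)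
      by_contra hcon
      rw [mem_ofPred_eq, not_lt] at hcon
      refine absurd h1 (not_lt.2 ?_)
      calc _ ≤ ENNReal.ofReal (t / 2) + ENNReal.ofReal (t / 2) := by gcongr
        _ = ENNReal.ofReal t := by
          rw [← ENNReal.ofReal_add (by positivity) (by positivity), add_halves]
    rw [e1, e2]
    have e4 : ENNReal.ofReal (r * t ^ (r - 1)) =
        2 * ENNReal.ofReal (r * t ^ (r - 1 - 1)) * ENNReal.ofReal (t / 2) := by
      rw [show (2 : ℝ≥0∞) = ENNReal.ofReal 2 by simp, ← ENNReal.ofReal_mul (by norm_num),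
        ← ENNReal.ofReal_mul (by positivity)]
      congr 1
      rw [Real.rpow_sub_one ht0.ne' (r - 1)]
      field_simp
    calc _ = 2 * ENNReal.ofReal (r * t ^ (r - 1 - 1)) * (ENNReal.ofReal (t / 2) *
          volume {x | ENNReal.ofReal t < maximalFn w x}) := by rw [e4]; ring
      _ ≤ 2 * ENNReal.ofReal (r * t ^ (r - 1 - 1)) *
          (4 * ∫⁻ x, {y | ENNReal.ofReal (t / 2) < w y}.indicator w x) := by gcongr
      _ = _ := by
          rw [show (8 : ℝ≥0∞) = 2 * 4 by norm_num]; ring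
  have m1 : Measurable (Function.uncurry fun (x t : ℝ) =>
      {t : ℝ | ENNReal.ofReal t < maximalFn w x}.indicator
        (fun t => ENNReal.ofReal (r * t ^ (r - 1))) t) :=
    Measurable.indicator (hpow.comp measurable_snd) hA
  have m2 : Measurable (Function.uncurry fun (t x : ℝ) =>
      8 * {t : ℝ | ENNReal.ofReal (t / 2) < w x}.indicator
        (fun t => w x * ENNReal.ofReal (r * t ^ (r - 1 - 1))) t) := by
    have : Measurable fun z : ℝ × ℝ => {z : ℝ × ℝ | ENNReal.ofReal (z.1 / 2) < w z.2}.indicator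
        (fun z => w z.2 * ENNReal.ofReal (r * z.1 ^ (r - 1 - 1))) z := by
      refine Measurable.indicator (by fun_prop) ?_
      exact measurableSet_lt (ENNReal.measurable_ofReal.comp (measurable_fst.div_const 2))
        (hw.comp measurable_snd)
    exact this.const_mul 8
  calc ∫⁻ x, maximalFn w x ^ r
      = ∫⁻ x, ∫⁻ t in Ioi (0 : ℝ), {t : ℝ | ENNReal.ofReal t < maximalFn w x}.indicator
          (fun t => ENNReal.ofReal (r * t ^ (r - 1))) t := by
        simp_rw [← rpow_eq_setLIntegral_indicator hr0]
    _ = ∫⁻ t in Ioi (0 : ℝ), ∫⁻ x, {t : ℝ | ENNReal.ofReal t < maximalFn w x}.indicator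
          (fun t => ENNReal.ofReal (r * t ^ (r - 1))) t := by
        rw [lintegral_lintegral_swap]
        exact m1.aemeasurable
    _ ≤ ∫⁻ t in Ioi (0 : ℝ), ∫⁻ x, 8 * {t : ℝ | ENNReal.ofReal (t / 2) < w x}.indicator
        (fun t => w x * ENNReal.ofReal (r * t ^ (r - 1 - 1))) t :=
        setLIntegral_mono' measurableSet_Ioi step
    _ = ∫⁻ x, ∫⁻ t in Ioi (0 : ℝ), 8 * {t : ℝ | ENNReal.ofReal (t / 2) < w x}.indicator
        (fun t => w x * ENNReal.ofReal (r * t ^ (r - 1 - 1))) t := by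
        rw [lintegral_lintegral_swap]
        exact m2.aemeasurable
    _ ≤ ∫⁻ x, ENNReal.ofReal (8 * (r / (r - 1)) * 2 ^ (r - 1)) * w x ^ r := by
        refine lintegral_mono fun x => ?_
        have e5 : ∀ t : ℝ, 8 * {t : ℝ | ENNReal.ofReal (t / 2) < w x}.indicator
            (fun t => w x * ENNReal.ofReal (r * t ^ (r - 1 - 1))) t =
            (8 * w x * ENNReal.ofReal (r / (r - 1))) *
              {t : ℝ | ENNReal.ofReal t < 2 * w x}.indicator
              (fun t => ENNReal.ofReal ((r - 1) * t ^ (r - 1 - 1))) t := by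
          intro t
          have hiff : ENNReal.ofReal (t / 2) < w x ↔ ENNReal.ofReal t < 2 * w x := by
            rw [ENNReal.ofReal_div_of_pos two_pos, ENNReal.div_lt_iff (by simp) (by simp),
              mul_comm, ENNReal.ofReal_ofNat]
          simp only [indicator, mem_ofPred_eq, hiff]
          split_ifs
          · rw [mul_assoc (8 * w x), ← ENNReal.ofReal_mul (by positivity), mul_assoc]
            congr 3
            field_simp
          · simp
        simp_rw [e5]
        have m3 : Measurable fun t : ℝ => {t : ℝ | ENNReal.ofReal t < 2 * w x}.indicator
              (fun t => ENNReal.ofReal ((r - 1) * t ^ (r - 1 - 1))) t :=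
          Measurable.indicator (by fun_prop)
            (measurableSet_lt ENNReal.measurable_ofReal measurable_const)
        rw [lintegral_const_mul _ m3, ← rpow_eq_setLIntegral_indicator hr1,
          ENNReal.mul_rpow_of_nonneg _ _ hr1.le, ENNReal.ofReal_mul (by positivity),
          ENNReal.ofReal_mul (by norm_num), ← ENNReal.ofReal_rpow_of_pos two_pos]
        refine le_of_eq ?_
        have e6 : w x ^ r = w x * w x ^ (r - 1) := by
          conv_lhs => rw [show r = 1 + (r - 1) by ring]
          rw [ENNReal.rpow_add_of_nonneg _ _ zero_le_one hr1.le, ENNReal.rpow_one]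
        rw [e6]
        simp only [ENNReal.ofReal_ofNat]
        ring
    _ = _ := by
        rw [lintegral_const_mul _ (by fun_prop)]
        rfl

/-! ### The Poisson kernel of the half plane. -/

/-- The Poisson kernel of the upper half plane. -/
noncomputable def halfPlanePoisson (y u : ℝ) : ℝ := y / (Real.pi * (u ^ 2 + y ^ 2))

theorem halfPlanePoisson_pos {y : ℝ} (hy : 0 < y) (u : ℝ) : 0 < halfPlanePoisson y u := by
  unfold halfPlanePoisson; positivity

theorem halfPlanePoisson_neg (y u : ℝ) : halfPlanePoisson y (-u) = halfPlanePoisson y u := by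
  simp [halfPlanePoisson]

theorem continuous_halfPlanePoisson {y : ℝ} (hy : 0 < y) : Continuous (halfPlanePoisson y) := by
  unfold halfPlanePoisson
  refine continuous_const.div (by fun_prop) fun u => ?_
  positivity

theorem halfPlanePoisson_eq {y : ℝ} (hy : 0 < y) (u : ℝ) :
    halfPlanePoisson y u = (Real.pi * y)⁻¹ * (1 + (u / y) ^ 2)⁻¹ := by
  unfold halfPlanePoisson
  have := Real.pi_pos
  field_simp
  rw [add_comm]

theorem integrable_halfPlanePoisson {y : ℝ} (hy : 0 < y) : Integrable (halfPlanePoisson y) := by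
  have h : halfPlanePoisson y = fun u => (Real.pi * y)⁻¹ * (1 + (u / y) ^ 2)⁻¹ :=
    funext (halfPlanePoisson_eq hy)
  rw [h]
  exact (integrable_inv_one_add_sq.comp_div hy.ne').const_mul _

theorem integral_halfPlanePoisson {y : ℝ} (hy : 0 < y) : ∫ u, halfPlanePoisson y u = 1 := by
  simp_rw [halfPlanePoisson_eq hy]
  rw [integral_const_mul, Measure.integral_comp_div (fun u => (1 + u ^ 2)⁻¹) y,
    integral_univ_inv_one_add_sq, abs_of_pos hy, smul_eq_mul]
  have := Real.pi_pos
  field_simp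

theorem lintegral_halfPlanePoisson_sub {y : ℝ} (hy : 0 < y) (x : ℝ) :
    ∫⁻ s, ENNReal.ofReal (halfPlanePoisson y (x - s)) = 1 := by
  rw [lintegral_sub_left_eq_self (fun u => ENNReal.ofReal (halfPlanePoisson y u)) x,
    ← ofReal_integral_eq_lintegral_ofReal (integrable_halfPlanePoisson hy)
      (Eventually.of_forall fun u => (halfPlanePoisson_pos hy u).le),
    integral_halfPlanePoisson hy, ENNReal.ofReal_one]

/-- At distance `d y` from `x` the displaced kernel is at most `4 / (y (1 + d ^ 2))`, the shift by
`s y` costing a factor of order one. One dyadic ball with `2 ^ j` comparable to `d` therefore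
suffices; the sum over all `j` avoids choosing it measurably. -/
theorem halfPlanePoisson_le_tsum {y : ℝ} (hy : 0 < y) {x s τ : ℝ} (hs : |s| ≤ 1) :
    ENNReal.ofReal (halfPlanePoisson y (x + s * y - τ)) ≤
      ∑' j : ℕ, (Metric.ball x (2 ^ j * y)).indicator
        (fun _ => ENNReal.ofReal (16 / (y * 4 ^ j))) τ := by
  have hpi := Real.pi_gt_three
  have key : ∃ j : ℕ, |τ - x| < 2 ^ j * y ∧ halfPlanePoisson y (x + s * y - τ) ≤ 16 / (y * 4 ^ j) := by
    set d := |τ - x| / y with hd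
    have hd0 : 0 ≤ d := by positivity
    have hdy : |τ - x| = d * y := by rw [hd]; field_simp
    have hbound : halfPlanePoisson y (x + s * y - τ) ≤ 4 / (y * (1 + d ^ 2)) := by
      unfold halfPlanePoisson
      rw [div_le_div_iff₀ (by positivity) (by positivity)]
      have h1 : (τ - x) ^ 2 = d ^ 2 * y ^ 2 := by rw [← sq_abs, hdy]; ring
      obtain ⟨e, he, heabs⟩ : ∃ e, τ - x = e * y ∧ |e| = d :=
        ⟨(τ - x) / y, by field_simp, by rw [abs_div, abs_of_pos hy]⟩
      have h2 : (x + s * y - τ) = (s - e) * y := by linarith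
      rw [h2, ← heabs, sq_abs]
      have h3 : (1 + e ^ 2) ≤ 4 * ((s - e) ^ 2 + 1) := by
        have := abs_le.1 hs
        nlinarith [sq_nonneg (3 * e - 4 * s), sq_nonneg s, mul_nonneg (sub_nonneg.2 this.1) (sub_nonneg.2 this.2)]
      have h4 : y ^ 2 * (1 + e ^ 2) ≤ y ^ 2 * (4 * ((s - e) ^ 2 + 1)) := by gcongr
      have h5 : 0 ≤ ((s - e) ^ 2 + 1) * y ^ 2 := by positivity
      nlinarith
    by_cases h1 : d < 1
    · refine ⟨0, by rw [hdy]; nlinarith, hbound.trans ?_⟩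
      rw [div_le_div_iff₀ (by positivity) (by positivity)]
      nlinarith [sq_nonneg d]
    · push Not at h1
      obtain ⟨n, hn, hn'⟩ := exists_nat_pow_near h1 (one_lt_two)
      refine ⟨n + 1, by rw [hdy]; gcongr, hbound.trans ?_⟩
      rw [div_le_div_iff₀ (by positivity) (by positivity)]
      have h6 : (4 : ℝ) ^ (n + 1) ≤ 4 * d ^ 2 := by
        have : ((2 : ℝ) ^ n) ^ 2 ≤ d ^ 2 := by gcongr
        rw [← pow_mul, mul_comm n 2, pow_mul] at this
        norm_num at this
        rw [pow_succ]; linarith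
      nlinarith
  obtain ⟨j, hj, hP⟩ := key
  refine le_trans ?_ (ENNReal.le_tsum j)
  rw [indicator_of_mem (by rwa [Metric.mem_ball, Real.dist_eq])]
  exact ENNReal.ofReal_le_ofReal hP

/-- Poisson averages, nontangentially displaced, are controlled by the maximal function. -/
theorem lintegral_halfPlanePoisson_mul_le {y : ℝ} (hy : 0 < y) (w : ℝ → ℝ≥0∞) (x : ℝ) {s : ℝ}
    (hs : |s| ≤ 1) (hw : Measurable w) :
    ∫⁻ τ, ENNReal.ofReal (halfPlanePoisson y (x + s * y - τ)) * w τ ≤ 64 * maximalFn w x := by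
  calc _ ≤ ∫⁻ τ, ∑' j : ℕ, (Metric.ball x (2 ^ j * y)).indicator
        (fun τ => ENNReal.ofReal (16 / (y * 4 ^ j)) * w τ) τ := by
        refine lintegral_mono fun τ => ?_
        refine (mul_le_mul_left (halfPlanePoisson_le_tsum hy hs) _).trans ?_
        rw [← ENNReal.tsum_mul_right]
        refine ENNReal.tsum_le_tsum fun j => ?_
        rw [indicator_mul_left]
    _ = ∑' j : ℕ, ENNReal.ofReal (16 / (y * 4 ^ j)) * ∫⁻ τ in Metric.ball x (2 ^ j * y), w τ := by
        rw [lintegral_tsum]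
        · refine tsum_congr fun j => ?_
          rw [lintegral_indicator measurableSet_ball, lintegral_const_mul _ hw]
        · intro j
          exact ((hw.const_mul _).indicator measurableSet_ball).aemeasurable
    -- The height `16 / (y 4 ^ j)` times the length `2 * 2 ^ j y` of the ball is `32 * 2 ^ (-j)`,
    -- which sums to `64`.
    _ ≤ ∑' j : ℕ, 32 * (2⁻¹ : ℝ≥0∞) ^ j * maximalFn w x := by
        refine ENNReal.tsum_le_tsum fun j => ?_
        have hx : x ∈ Metric.ball x (2 ^ j * y) := Metric.mem_ball_self (by positivity)
        calc _ ≤ ENNReal.ofReal (16 / (y * 4 ^ j)) * (ENNReal.ofReal (2 * (2 ^ j * y)) *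
              maximalFn w x) := by gcongr; exact setLIntegral_ball_le_maximalFn w hx
          _ = _ := by
            rw [← mul_assoc, ← ENNReal.ofReal_mul (by positivity)]
            congr 1
            rw [show (16 / (y * 4 ^ j) * (2 * (2 ^ j * y)) : ℝ) = 32 * (2⁻¹ : ℝ) ^ j by
              rw [show (4 : ℝ) = 2 * 2 by norm_num, mul_pow, inv_pow]; field_simp; norm_num,
              ENNReal.ofReal_mul (by norm_num), ENNReal.ofReal_pow (by norm_num),
              ENNReal.ofReal_inv_of_pos two_pos]
            simp
    _ = 64 * maximalFn w x := by
        rw [ENNReal.tsum_mul_right, ENNReal.tsum_mul_left, ENNReal.tsum_geometric,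
          ENNReal.one_sub_inv_two, inv_inv]
        norm_num

/-- Jensen's inequality for Poisson averages. -/
theorem rpow_lintegral_halfPlanePoisson_le {r : ℝ} (hr : 1 < r) {y : ℝ} (hy : 0 < y) (x : ℝ)
    {w : ℝ → ℝ≥0∞} (hw : AEMeasurable w) :
    (∫⁻ s, ENNReal.ofReal (halfPlanePoisson y (x - s)) * w s) ^ r ≤
      ∫⁻ s, ENNReal.ofReal (halfPlanePoisson y (x - s)) * w s ^ r := by
  have hpq := Real.HolderConjugate.conjExponent hr
  set P : ℝ → ℝ≥0∞ := fun s => ENNReal.ofReal (halfPlanePoisson y (x - s)) with hP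
  have hPm : Measurable P := by
    have := (continuous_halfPlanePoisson hy).measurable
    fun_prop
  have hr0 : 0 < r := by linarith
  have hq0 : 0 < r.conjExponent := hpq.symm.pos
  -- Hölder after splitting the kernel as `P ^ (1 / r') * P ^ (1 / r)`; the first factor integrates
  -- to one because `P` has total mass one.
  have h := ENNReal.lintegral_mul_le_Lp_mul_Lq volume hpq.symm
    (f := fun s => P s ^ (1 / r.conjExponent)) (g := fun s => P s ^ (1 / r) * w s)
    (hPm.pow_const _).aemeasurable ((hPm.pow_const _).aemeasurable.mul hw)
  have e1 : ∀ s, ((fun s => P s ^ (1 / r.conjExponent)) * fun s => P s ^ (1 / r) * w s) s =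
      P s * w s := by
    intro s
    simp only [Pi.mul_apply]
    rw [← mul_assoc, ← ENNReal.rpow_add_of_nonneg _ _ (by positivity) (by positivity)]
    have : 1 / r.conjExponent + 1 / r = 1 := by
      have := hpq.symm.inv_add_inv_eq_one
      simpa [one_div] using this
    rw [this, ENNReal.rpow_one]
  have e2 : ∀ s, (P s ^ (1 / r.conjExponent)) ^ r.conjExponent = P s := by
    intro s
    rw [← ENNReal.rpow_mul, one_div_mul_cancel hq0.ne', ENNReal.rpow_one]
  have e3 : ∀ s, (P s ^ (1 / r) * w s) ^ r = P s * w s ^ r := by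
    intro s
    rw [ENNReal.mul_rpow_of_nonneg _ _ hr0.le, ← ENNReal.rpow_mul, one_div_mul_cancel hr0.ne',
      ENNReal.rpow_one]
  simp_rw [e1, e2, e3] at h
  rw [lintegral_halfPlanePoisson_sub hy x, ENNReal.one_rpow, one_mul] at h
  calc _ ≤ ((∫⁻ s, P s * w s ^ r) ^ (1 / r)) ^ r := by gcongr
    _ = _ := by rw [← ENNReal.rpow_mul, one_div_mul_cancel hr0.ne', ENNReal.rpow_one]

/-- Jensen's inequality pointwise, then Tonelli: the kernel has mass one in either variable. -/
theorem lintegral_rpow_halfPlanePoisson_le {r : ℝ} (hr : 1 < r) {y : ℝ} (hy : 0 < y)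
    {w : ℝ → ℝ≥0∞} (hw : AEMeasurable w) :
    ∫⁻ x, (∫⁻ s, ENNReal.ofReal (halfPlanePoisson y (x - s)) * w s) ^ r ≤ ∫⁻ s, w s ^ r := by
  have hm : Measurable fun z : ℝ × ℝ => ENNReal.ofReal (halfPlanePoisson y (z.1 - z.2)) := by
    have := (continuous_halfPlanePoisson hy).measurable
    fun_prop
  calc _ ≤ ∫⁻ x, ∫⁻ s, ENNReal.ofReal (halfPlanePoisson y (x - s)) * w s ^ r :=
        lintegral_mono fun x => rpow_lintegral_halfPlanePoisson_le hr hy x hw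
    _ = ∫⁻ s, ∫⁻ x, ENNReal.ofReal (halfPlanePoisson y (x - s)) * w s ^ r := by
        rw [lintegral_lintegral_swap]
        exact hm.aemeasurable.mul ((hw.pow_const r).comp_quasiMeasurePreserving
          Measure.quasiMeasurePreserving_snd)
    _ = _ := by
        refine lintegral_congr fun s => ?_
        rw [lintegral_mul_const'' _ (by
          have := (continuous_halfPlanePoisson hy).measurable
          fun_prop)]
        have : ∀ x, halfPlanePoisson y (x - s) = halfPlanePoisson y (s - x) := fun x => by
          rw [← halfPlanePoisson_neg, neg_sub]
        simp_rw [this]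
        rw [lintegral_halfPlanePoisson_sub hy, one_mul]

/-! ### The Cauchy integral and M. Riesz' inequality. -/

/-- The Cauchy integral of a function on the real line. -/
noncomputable def cauchyInt (v : ℝ → ℂ) (z : ℂ) : ℂ :=
  (2 * Real.pi * Complex.I)⁻¹ * ∫ s : ℝ, v s / ((s : ℂ) - z)

theorem im_le_norm_ofReal_sub (s : ℝ) (z : ℂ) : z.im ≤ ‖(s : ℂ) - z‖ := by
  have := Complex.abs_im_le_norm ((s : ℂ) - z)
  simp only [Complex.sub_im, Complex.ofReal_im, zero_sub, abs_neg] at this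
  exact (le_abs_self _).trans this

theorem ofReal_sub_ne_zero {z : ℂ} (hz : 0 < z.im) (s : ℝ) : (s : ℂ) - z ≠ 0 := by
  rw [← norm_pos_iff]
  exact hz.trans_le (im_le_norm_ofReal_sub s z)

theorem integrable_div_ofReal_sub {v : ℝ → ℂ} (hv : Integrable v) {z : ℂ} (hz : 0 < z.im) :
    Integrable fun s : ℝ => v s / ((s : ℂ) - z) := by
  have hc : Continuous fun s : ℝ => ((s : ℂ) - z)⁻¹ :=
    Continuous.inv₀ (by fun_prop) (ofReal_sub_ne_zero hz)
  refine hv.mul_bdd (c := z.im⁻¹) hc.aestronglyMeasurable (Eventually.of_forall fun s => ?_)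
  rw [norm_inv]
  exact inv_anti₀ hz (im_le_norm_ofReal_sub s z)

theorem differentiableAt_cauchyInt {v : ℝ → ℂ} (hv : Integrable v) {z : ℂ} (hz : 0 < z.im) :
    DifferentiableAt ℂ (cauchyInt v) z := by
  have hU : {w : ℂ | z.im / 2 < w.im} ∈ 𝓝 z :=
    (isOpen_lt continuous_const Complex.continuous_im).mem_nhds (half_lt_self hz)
  have h := hasDerivAt_integral_of_dominated_loc_of_deriv_le (μ := volume)
    (F := fun (w : ℂ) (s : ℝ) => v s / ((s : ℂ) - w))
    (F' := fun (w : ℂ) (s : ℝ) => v s / ((s : ℂ) - w) ^ 2) (x₀ := z)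
    (bound := fun s => ‖v s‖ * (z.im / 2)⁻¹ ^ 2) hU ?_ (integrable_div_ofReal_sub hv hz) ?_ ?_
    (hv.norm.mul_const _) ?_
  · exact (h.2.differentiableAt).const_mul _
  · filter_upwards [hU] with w hw
    exact (integrable_div_ofReal_sub hv ((half_pos hz).trans hw)).aestronglyMeasurable
  · have hc : Continuous fun s : ℝ => (((s : ℂ) - z) ^ 2)⁻¹ :=
      Continuous.inv₀ (by fun_prop) fun s => pow_ne_zero 2 (ofReal_sub_ne_zero hz s)
    exact hv.aestronglyMeasurable.mul hc.aestronglyMeasurable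
  · refine Eventually.of_forall fun s w hw => ?_
    rw [norm_div, norm_pow, div_eq_mul_inv, inv_pow]
    gcongr
    exact hw.le.trans (im_le_norm_ofReal_sub s w)
  · refine Eventually.of_forall fun s w hw => ?_
    have h0 := ofReal_sub_ne_zero ((half_pos hz).trans hw) s
    have h1 : HasDerivAt (fun w : ℂ => (s : ℂ) - w) (-1) w := by
      simpa using (hasDerivAt_id w).const_sub (s : ℂ)
    have h2 := (h1.inv h0).const_mul (v s)
    simp only [div_eq_mul_inv]
    convert! h2 using 1
    simp [div_eq_mul_inv]

/-- From `z / (s - z) = s / (s - z) - 1`, an integrable first moment gives decay of order `1 / |z|`.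
A power greater than one of the Cauchy integral then decays fast enough for contour integration. -/
theorem exists_cauchyInt_bound {v : ℝ → ℂ} (hv : Integrable v)
    (hv' : Integrable fun s : ℝ => (s : ℂ) * v s) {y : ℝ} (hy : 0 < y) :
    ∃ C, 0 ≤ C ∧ ∀ z : ℂ, y ≤ z.im → ‖cauchyInt v z‖ ≤ C / (1 + ‖z‖) := by
  set a := ‖(2 * Real.pi * Complex.I : ℂ)⁻¹‖ with ha
  set B1 := ∫ s, ‖v s‖ with hB1
  set B2 := ∫ s : ℝ, ‖(s : ℂ) * v s‖ with hB2
  refine ⟨a * (B1 / y + (B2 / y + B1)), by positivity, fun z hz => ?_⟩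
  have hz0 : 0 < z.im := hy.trans_le hz
  rw [le_div_iff₀ (by positivity), cauchyInt, norm_mul, mul_assoc]
  refine mul_le_mul_of_nonneg_left ?_ (norm_nonneg _)
  have h1 : ‖∫ s : ℝ, v s / ((s : ℂ) - z)‖ ≤ B1 / y := by
    rw [hB1, ← integral_div]
    refine norm_integral_le_of_norm_le (hv.norm.div_const y) (Eventually.of_forall fun s => ?_)
    rw [norm_div, div_eq_mul_inv, div_eq_mul_inv]
    gcongr
    exact hz.trans (im_le_norm_ofReal_sub s z)
  have h2 : ‖z * ∫ s : ℝ, v s / ((s : ℂ) - z)‖ ≤ B2 / y + B1 := by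
    rw [hB1, hB2, ← integral_div, ← integral_add (hv'.norm.div_const y) hv.norm,
      ← integral_const_mul]
    refine norm_integral_le_of_norm_le ((hv'.norm.div_const y).add hv.norm)
      (Eventually.of_forall fun s => ?_)
    have h0 := ofReal_sub_ne_zero hz0 s
    have : z * (v s / ((s : ℂ) - z)) = s * v s / ((s : ℂ) - z) - v s := by
      field_simp; ring
    rw [this]
    refine (norm_sub_le _ _).trans ?_
    rw [norm_div, div_eq_mul_inv, div_eq_mul_inv]
    gcongr
    exact hz.trans (im_le_norm_ofReal_sub s z)
  rw [norm_mul] at h2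
  nlinarith

theorem integrable_of_norm_le_one_add_norm_rpow {h : ℝ → ℂ} (hm : AEStronglyMeasurable h) {C r : ℝ}
    (hr : 1 < r) (hb : ∀ x, ‖h x‖ ≤ C * (1 + ‖x‖) ^ (-r)) : Integrable h := by
  have h1 : Integrable fun x : ℝ => C * (1 + ‖x‖) ^ (-r) :=
    (integrable_one_add_norm (by simpa using hr)).const_mul C
  exact h1.mono' hm (Eventually.of_forall hb)

/-- Cauchy's theorem on a horizontal line, for functions decaying faster than `|z|⁻¹`. -/
theorem integral_horizontal_eq_zero {h : ℂ → ℂ} {y C r : ℝ} (hr : 1 < r) (hC : 0 ≤ C)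
    (hd : ∀ z : ℂ, y ≤ z.im → DifferentiableAt ℂ h z)
    (hb : ∀ z : ℂ, y ≤ z.im → ‖h z‖ ≤ C * (1 + ‖z‖) ^ (-r)) :
    Integrable (fun x : ℝ => h (x + y * Complex.I)) ∧
      ∫ x : ℝ, h (x + y * Complex.I) = 0 := by
  have him : ∀ x y : ℝ, ((x : ℂ) + y * Complex.I).im = y := by simp
  have hre : ∀ x y : ℝ, ((x : ℂ) + y * Complex.I).re = x := by simp
  have hcont : Continuous fun x : ℝ => h (x + y * Complex.I) := by
    rw [continuous_iff_continuousAt]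
    intro x
    have h1 : ContinuousAt h (x + y * Complex.I) := (hd _ (him x y).ge).continuousAt
    exact ContinuousAt.comp (f := fun x : ℝ => (x : ℂ) + y * Complex.I) h1 (by fun_prop)
  have hint : Integrable (fun x : ℝ => h (x + y * Complex.I)) := by
    refine integrable_of_norm_le_one_add_norm_rpow (C := C) hcont.aestronglyMeasurable hr
      fun x => (hb _ (him x y).ge).trans ?_
    refine mul_le_mul_of_nonneg_left ?_ hC
    refine Real.rpow_le_rpow_of_nonpos (by positivity) ?_ (by linarith)
    have := Complex.abs_re_le_norm ((x : ℂ) + y * Complex.I)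
    rw [hre] at this
    rw [Real.norm_eq_abs]; linarith
  refine ⟨hint, ?_⟩
  have hlim := intervalIntegral_tendsto_integral hint tendsto_neg_atTop_atBot tendsto_id
  refine tendsto_nhds_unique hlim ?_
  have hdecay : Tendsto (fun R : ℝ => 6 * C * (1 + R) ^ (-(r - 1))) atTop (𝓝 0) := by
    rw [← mul_zero (6 * C)]
    exact ((tendsto_rpow_neg_atTop (by linarith : 0 < r - 1)).comp
      (tendsto_atTop_add_const_left atTop 1 tendsto_id)).const_mul _
  refine squeeze_zero_norm' ?_ hdecay
  filter_upwards [eventually_gt_atTop (|y|), eventually_gt_atTop 0] with R hRy hR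
  have hbR : ∀ z : ℂ, y ≤ z.im → R ≤ ‖z‖ → ‖h z‖ ≤ C * (1 + R) ^ (-r) := fun z hz hzR =>
    (hb z hz).trans (mul_le_mul_of_nonneg_left
      (Real.rpow_le_rpow_of_nonpos (by positivity) (by linarith) (by linarith)) hC)
  have hyle := neg_abs_le y
  -- The rectangle has base `[-R, R]` at height `y` and height `2 R`, so its three other sides have
  -- length `2 R` and stay at distance at least `R` from the origin. Together they contribute at
  -- most `6 C (1 + R) ^ (1 - r)`.
  have hrect := Complex.integral_boundary_rect_eq_zero_of_differentiableOn h
    (((-R : ℝ) : ℂ) + y * Complex.I) (((R : ℝ) : ℂ) + ((y + 2 * R : ℝ) : ℂ) * Complex.I) (by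
      intro z hz
      rw [him, him, Complex.mem_reProdIm, uIcc_of_le (a := y) (by linarith)] at hz
      exact (hd z hz.2.1).differentiableWithinAt)
  rw [him, him, hre, hre] at hrect
  have e1 : ‖∫ x : ℝ in -R..R, h (x + ((y + 2 * R : ℝ) : ℂ) * Complex.I)‖ ≤
      C * (1 + R) ^ (-r) * |R - -R| := by
    refine intervalIntegral.norm_integral_le_of_norm_le_const fun x _ => hbR _ ?_ ?_
    · rw [him]; linarith
    · have := Complex.abs_im_le_norm ((x : ℂ) + ((y + 2 * R : ℝ) : ℂ) * Complex.I)
      rw [him] at this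
      exact le_trans (by linarith [le_abs_self (y + 2 * R)]) this
  have hside : ∀ a : ℝ, R ≤ |a| → ‖∫ t : ℝ in y..(y + 2 * R), h (a + t * Complex.I)‖ ≤
      C * (1 + R) ^ (-r) * |y + 2 * R - y| := by
    intro a ha
    refine intervalIntegral.norm_integral_le_of_norm_le_const fun t ht => hbR _ ?_ ?_
    · rw [him]; rw [uIoc_of_le (by linarith)] at ht; exact ht.1.le
    · have := Complex.abs_re_le_norm ((a : ℂ) + t * Complex.I)
      rw [hre] at this
      exact ha.trans this
  have e2 := hside R (le_abs_self R)
  have e3 := hside (-R) (by rw [abs_neg]; exact le_abs_self R)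
  rw [show |R - -R| = 2 * R by rw [abs_of_pos] <;> linarith] at e1
  rw [show |y + 2 * R - y| = 2 * R by rw [abs_of_pos] <;> linarith] at e2 e3
  have hpow : (1 + R) ^ (-r) * R ≤ (1 + R) ^ (-(r - 1)) := by
    rw [show -(r - 1) = -r + 1 by ring, Real.rpow_add_one (by positivity)]
    gcongr; linarith
  have hA : (∫ x : ℝ in -R..R, h (x + y * Complex.I)) =
      (∫ x : ℝ in -R..R, h (x + ((y + 2 * R : ℝ) : ℂ) * Complex.I)) -
      Complex.I • (∫ t : ℝ in y..(y + 2 * R), h ((R : ℝ) + t * Complex.I)) +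
      Complex.I • (∫ t : ℝ in y..(y + 2 * R), h ((-R : ℝ) + t * Complex.I)) := by
    linear_combination (exp := 1) hrect
  have hA' : ‖∫ x : ℝ in -R..R, h (x + y * Complex.I)‖ ≤
      C * (1 + R) ^ (-r) * (2 * R) + C * (1 + R) ^ (-r) * (2 * R) +
        C * (1 + R) ^ (-r) * (2 * R) := by
    rw [hA]
    refine (norm_add_le _ _).trans (add_le_add ((norm_sub_le _ _).trans (add_le_add e1 ?_)) ?_)
    · rw [norm_smul, Complex.norm_I, one_mul]; exact e2
    · rw [norm_smul, Complex.norm_I, one_mul]; exact e3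
  refine hA'.trans ?_
  have := mul_le_mul_of_nonneg_left hpow hC
  linarith

/-- If the argument of `w` is close to `±π/2`, then `r` times its modulus lies between `π/2` and `π`
(here `r ≤ 2` enters), so `-Re (w ^ r)` is comparable to `|w| ^ r`. Otherwise `Re w` is comparable
to `|w|`, and a large `B` absorbs the remaining term. -/
theorem exists_norm_rpow_le_re {r : ℝ} (hr : 1 < r) (hr2 : r ≤ 2) :
    ∃ B b : ℝ, 0 ≤ B ∧ ∀ w : ℂ, 0 < w.re → ‖w‖ ^ r ≤ B * w.re ^ r - b * (w ^ (r : ℂ)).re := by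
  have hpi := Real.pi_pos
  -- The threshold between the two regimes: above `π / (2 r)` the cosine of `r θ` is already
  -- negative.
  obtain ⟨θ₀, h1, h2⟩ : ∃ θ₀, Real.pi / (2 * r) < θ₀ ∧ θ₀ < Real.pi / 2 := by
    refine exists_between ?_
    gcongr
    linarith
  have hθ₀ : 0 < θ₀ := lt_trans (by positivity) h1
  have hrθ : Real.pi / 2 < r * θ₀ := by
    rw [div_lt_iff₀ (by positivity)] at h1
    nlinarith
  have hneg : 0 < -Real.cos (r * θ₀) := by
    have := Real.cos_neg_of_pi_div_two_lt_of_lt hrθ (by nlinarith)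
    linarith
  have hcos0 : 0 < Real.cos θ₀ := Real.cos_pos_of_mem_Ioo ⟨by linarith, h2⟩
  set b := (-Real.cos (r * θ₀))⁻¹ with hb
  have hb0 : 0 < b := inv_pos.2 hneg
  refine ⟨(1 + b) / Real.cos θ₀ ^ r, b, by positivity, fun w hw => ?_⟩
  have hw0 : w ≠ 0 := fun h => by simp [h] at hw
  have hn : 0 < ‖w‖ := norm_pos_iff.2 hw0
  have harg := Complex.abs_arg_lt_pi_div_two_iff.2 (Or.inl hw)
  set θ := |w.arg| with hθ
  have hcosθ : 0 < Real.cos θ := Real.cos_pos_of_mem_Ioo ⟨by linarith [abs_nonneg w.arg], harg⟩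
  have hre : w.re = ‖w‖ * Real.cos θ := by
    rw [hθ, Real.cos_abs, Complex.norm_mul_cos_arg]
  have hpow : (w ^ (r : ℂ)).re = ‖w‖ ^ r * Real.cos (r * θ) := by
    rw [Complex.cpow_ofReal_re, mul_comm w.arg, ← Real.cos_abs (r * w.arg), abs_mul,
      abs_of_pos (by linarith : (0 : ℝ) < r)]
  rw [hpow, hre, Real.mul_rpow hn.le hcosθ.le]
  suffices h : 1 ≤ (1 + b) / Real.cos θ₀ ^ r * Real.cos θ ^ r - b * Real.cos (r * θ) by
    have := mul_le_mul_of_nonneg_left h (Real.rpow_nonneg hn.le r)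
    linarith
  have hθ0 : 0 ≤ θ := abs_nonneg _
  rcases le_total θ θ₀ with h | h
  · have h3 : Real.cos θ₀ ≤ Real.cos θ :=
      Real.cos_le_cos_of_nonneg_of_le_pi hθ0 (by linarith) h
    have h4 : (1 + b) ≤ (1 + b) / Real.cos θ₀ ^ r * Real.cos θ ^ r := by
      rw [div_mul_eq_mul_div, le_div_iff₀ (by positivity)]
      gcongr
    have h5 : b * Real.cos (r * θ) ≤ b * 1 := by gcongr; exact Real.cos_le_one _
    linarith
  · have h3 : Real.cos (r * θ) ≤ Real.cos (r * θ₀) :=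
      Real.cos_le_cos_of_nonneg_of_le_pi (by positivity) (by nlinarith) (by gcongr)
    have h4 : 0 ≤ (1 + b) / Real.cos θ₀ ^ r * Real.cos θ ^ r := by positivity
    have h5 : b * Real.cos (r * θ) ≤ b * Real.cos (r * θ₀) := by gcongr
    have h6 : b * -Real.cos (r * θ₀) = 1 := inv_mul_cancel₀ hneg.ne'
    linarith

/-- The real part of `1 / (π i (s - z))` is the Poisson kernel. It is positive, so for `g ≥ 0`
powers of twice the Cauchy integral have a holomorphic branch. -/
theorem re_cauchyInt_ofReal {g : ℝ → ℝ} (hg : Integrable g) {z : ℂ} (hz : 0 < z.im) :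
    (2 * cauchyInt (fun s => (g s : ℂ)) z).re = ∫ s, halfPlanePoisson z.im (z.re - s) * g s := by
  have hpi := Real.pi_pos
  have e1 : 2 * cauchyInt (fun s => (g s : ℂ)) z =
      ∫ s : ℝ, (Real.pi * Complex.I : ℂ)⁻¹ * ((g s : ℂ) / ((s : ℂ) - z)) := by
    rw [cauchyInt, integral_const_mul, ← mul_assoc]
    congr 1
    have : (Real.pi : ℂ) ≠ 0 := by exact_mod_cast hpi.ne'
    field_simp
  rw [e1]
  have hi := (integrable_div_ofReal_sub hg.ofReal hz).const_mul (Real.pi * Complex.I : ℂ)⁻¹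
  refine (integral_re hi).symm.trans (integral_congr_ae (Eventually.of_forall fun s => ?_))
  have hden : (s - z.re) ^ 2 + z.im ^ 2 ≠ 0 := by positivity
  have hns : Complex.normSq ((s : ℂ) - z) = (s - z.re) ^ 2 + z.im ^ 2 := by
    simp [Complex.normSq_apply]; ring
  have hden' : (z.re - s) ^ 2 + z.im ^ 2 ≠ 0 := by positivity
  have e2 : (Real.pi * Complex.I : ℂ)⁻¹ * ((g s : ℂ) / ((s : ℂ) - z)) =
      ((g s / Real.pi : ℝ) : ℂ) * (-Complex.I * ((s : ℂ) - z)⁻¹) := by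
    push_cast
    rw [mul_inv, Complex.inv_I]
    ring
  refine (congrArg Complex.re e2).trans ?_
  rw [Complex.re_ofReal_mul]
  have e3 : (-Complex.I * ((s : ℂ) - z)⁻¹).re = z.im / ((s - z.re) ^ 2 + z.im ^ 2) := by
    simp [Complex.inv_im, hns]
  rw [e3]
  unfold halfPlanePoisson
  have : (s - z.re) ^ 2 = (z.re - s) ^ 2 := by ring
  rw [this]
  field_simp

theorem cauchyInt_re_pos {g : ℝ → ℝ} (hg : Integrable g) (hg0 : ∀ s, 0 ≤ g s)
    (hgne : ∫ s, g s ≠ 0) {z : ℂ} (hz : 0 < z.im) :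
    0 < (2 * cauchyInt (fun s => (g s : ℂ)) z).re := by
  rw [re_cauchyInt_ofReal hg hz]
  have hP : Integrable fun s => halfPlanePoisson z.im (z.re - s) * g s := by
    refine hg.bdd_mul (c := (Real.pi * z.im)⁻¹) ?_ (Eventually.of_forall fun s => ?_)
    · exact ((continuous_halfPlanePoisson hz).comp (by fun_prop)).aestronglyMeasurable
    · rw [Real.norm_of_nonneg (halfPlanePoisson_pos hz _).le, halfPlanePoisson_eq hz]
      have := Real.pi_pos
      refine mul_le_of_le_one_right (by positivity) (inv_le_one_of_one_le₀ ?_)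
      linarith [sq_nonneg ((z.re - s) / z.im)]
  have hnn : ∀ s, 0 ≤ halfPlanePoisson z.im (z.re - s) * g s := fun s =>
    mul_nonneg (halfPlanePoisson_pos hz _).le (hg0 s)
  refine lt_of_le_of_ne (integral_nonneg hnn) fun h => hgne ?_
  have h1 := (integral_eq_zero_iff_of_nonneg hnn hP).1 h.symm
  refine integral_eq_zero_of_ae ?_
  filter_upwards [h1] with s hs
  exact (mul_eq_zero.1 hs).resolve_left (halfPlanePoisson_pos hz _).ne'

/-- M. Riesz' inequality for nonnegative functions, `1 < r ≤ 2`. -/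
theorem lintegral_cauchyInt_rpow_le_of_nonneg {r : ℝ} (hr : 1 < r) (hr2 : r ≤ 2) :
    ∃ C : ℝ≥0, ∀ g : ℝ → ℝ, Integrable g → Integrable (fun s => s * g s) → (∀ s, 0 ≤ g s) →
      ∀ y : ℝ, 0 < y → ∫⁻ x : ℝ, ‖cauchyInt (fun s => (g s : ℂ)) (x + y * Complex.I)‖ₑ ^ r ≤
        C * ∫⁻ s, ENNReal.ofReal (g s) ^ r := by
  obtain ⟨B, b, hB, hineq⟩ := exists_norm_rpow_le_re hr hr2
  have hr0 : 0 < r := by linarith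
  refine ⟨B.toNNReal, fun g hg hg' hg0 y hy => ?_⟩
  by_cases hgne : ∫ s, g s = 0
  · have h1 := (integral_eq_zero_iff_of_nonneg hg0 hg).1 hgne
    have : ∀ z, cauchyInt (fun s => (g s : ℂ)) z = 0 := by
      intro z
      rw [cauchyInt, integral_eq_zero_of_ae, mul_zero]
      filter_upwards [h1] with s hs
      simp [hs]
    simp [this, hr0]
  have him : ∀ x : ℝ, ((x : ℂ) + y * Complex.I).im = y := by simp
  have hre : ∀ x : ℝ, ((x : ℂ) + y * Complex.I).re = x := by simp
  have hgc : Integrable fun s => (g s : ℂ) := hg.ofReal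
  have hgc' : Integrable fun s : ℝ => (s : ℂ) * (g s : ℂ) := by
    simpa using hg'.ofReal (𝕜 := ℂ)
  set P : ℂ → ℂ := fun z => 2 * cauchyInt (fun s => (g s : ℂ)) z with hP
  have hPpos : ∀ z : ℂ, y ≤ z.im → 0 < (P z).re := fun z hz =>
    cauchyInt_re_pos hg hg0 hgne (hy.trans_le hz)
  obtain ⟨C, hC, hCb⟩ := exists_cauchyInt_bound hgc hgc' hy
  have hPb : ∀ z : ℂ, y ≤ z.im → ‖P z‖ ≤ 2 * C * (1 + ‖z‖)⁻¹ := by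
    intro z hz
    rw [hP, norm_mul, mul_assoc]
    simpa [div_eq_mul_inv] using hCb z hz
  have hPd : ∀ z : ℂ, y ≤ z.im → DifferentiableAt ℂ P z := fun z hz =>
    (differentiableAt_cauchyInt hgc (hy.trans_le hz)).const_mul 2
  have hPr : ∀ z : ℂ, y ≤ z.im → ‖P z‖ ^ r ≤ (2 * C) ^ r * (1 + ‖z‖) ^ (-r) := by
    intro z hz
    rw [Real.rpow_neg (by positivity), ← Real.inv_rpow (by positivity),
      ← Real.mul_rpow (by positivity) (by positivity)]
    gcongr
    exact hPb z hz
  -- The power is holomorphic since `Re P > 0`, and decays like `|z| ^ (-r)`, so its integral along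
  -- the line vanishes. The pointwise inequality then leaves only `(Re P) ^ r`, and `Re P` is a
  -- Poisson integral of `g`.
  obtain ⟨hint, hzero⟩ := integral_horizontal_eq_zero (h := fun z => P z ^ (r : ℂ)) (y := y)
    (C := (2 * C) ^ r) hr (by positivity)
    (fun z hz => (hPd z hz).cpow_const (Or.inl (hPpos z hz)))
    (fun z hz => by rw [Complex.norm_cpow_real]; exact hPr z hz)
  have hcont : Continuous fun x : ℝ => P (x + y * Complex.I) := by
    rw [continuous_iff_continuousAt]
    intro x
    exact ContinuousAt.comp (f := fun x : ℝ => (x : ℂ) + y * Complex.I)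
      (hPd _ (him x).ge).continuousAt (by fun_prop)
  have hintn : Integrable fun x : ℝ => ‖P (x + y * Complex.I)‖ ^ r := by
    simpa [Complex.norm_cpow_real] using hint.norm
  have hintre : Integrable fun x : ℝ => (P (x + y * Complex.I)).re ^ r := by
    refine hintn.mono' ?_ (Eventually.of_forall fun x => ?_)
    · exact ((Complex.continuous_re.comp hcont).rpow_const
        fun x => Or.inr hr0.le).aestronglyMeasurable
    · have h0 := (hPpos _ (him x).ge).le
      rw [Real.norm_of_nonneg (Real.rpow_nonneg h0 _)]
      exact Real.rpow_le_rpow h0 (Complex.re_le_norm _) hr0.le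
  have hintre' : Integrable fun x : ℝ => (P (x + y * Complex.I) ^ (r : ℂ)).re := hint.re
  have hmain : ∫ x : ℝ, ‖P (x + y * Complex.I)‖ ^ r ≤
      B * ∫ x : ℝ, (P (x + y * Complex.I)).re ^ r := by
    have h0 : ∫ x : ℝ, (P (x + y * Complex.I) ^ (r : ℂ)).re = 0 := by
      have := integral_re hint
      simp only [RCLike.re_to_complex] at this
      rw [this, hzero, Complex.zero_re]
    calc _ ≤ ∫ x : ℝ, (B * (P (x + y * Complex.I)).re ^ r -
          b * (P (x + y * Complex.I) ^ (r : ℂ)).re) :=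
          integral_mono hintn ((hintre.const_mul B).sub (hintre'.const_mul b)) fun x =>
            hineq _ (hPpos _ (him x).ge)
      _ = _ := by
          rw [integral_sub (hintre.const_mul B) (hintre'.const_mul b), integral_const_mul,
            integral_const_mul, h0, mul_zero, sub_zero]
  have hleft : ∫⁻ x : ℝ, ‖cauchyInt (fun s => (g s : ℂ)) (x + y * Complex.I)‖ₑ ^ r ≤
      ENNReal.ofReal (∫ x : ℝ, ‖P (x + y * Complex.I)‖ ^ r) := by
    rw [ofReal_integral_eq_lintegral_ofReal hintn (Eventually.of_forall fun x => by positivity)]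
    refine lintegral_mono fun x => ?_
    rw [← ENNReal.ofReal_rpow_of_nonneg (norm_nonneg _) hr0.le, ofReal_norm]
    refine ENNReal.rpow_le_rpow ?_ hr0.le
    rw [hP]
    simp only [enorm_mul]
    refine le_mul_of_one_le_left' ?_
    rw [← ofReal_norm]
    simp
  have hright : ENNReal.ofReal (∫ x : ℝ, (P (x + y * Complex.I)).re ^ r) ≤
      ∫⁻ s, ENNReal.ofReal (g s) ^ r := by
    rw [ofReal_integral_eq_lintegral_ofReal hintre (Eventually.of_forall fun x =>
      Real.rpow_nonneg (hPpos _ (him x).ge).le _)]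
    refine le_trans (le_of_eq (lintegral_congr fun x => ?_))
      (lintegral_rpow_halfPlanePoisson_le hr hy hg.aemeasurable.ennreal_ofReal)
    rw [← ENNReal.ofReal_rpow_of_nonneg (hPpos _ (him x).ge).le hr0.le]
    congr 1
    rw [hP]
    simp only
    rw [re_cauchyInt_ofReal hg (by rw [him]; exact hy), him, hre]
    have hnn : ∀ s, 0 ≤ halfPlanePoisson y (x - s) * g s := fun s =>
      mul_nonneg (halfPlanePoisson_pos hy _).le (hg0 s)
    rw [ofReal_integral_eq_lintegral_ofReal _ (Eventually.of_forall hnn)]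
    · refine lintegral_congr fun s => ?_
      rw [ENNReal.ofReal_mul (halfPlanePoisson_pos hy _).le]
    -- A non-integrable integrand would have Bochner integral zero, contradicting the positivity of
    -- `Re P`.
    · by_contra hni
      have := hPpos _ (him x).ge
      rw [hP] at this
      simp only at this
      rw [re_cauchyInt_ofReal hg (by rw [him]; exact hy), him, hre, integral_undef hni] at this
      exact lt_irrefl _ this
  refine hleft.trans ((ENNReal.ofReal_le_ofReal hmain).trans ?_)
  rw [ENNReal.ofReal_mul hB]
  exact mul_le_mul_right hright _

theorem cauchyInt_add {v w : ℝ → ℂ} (hv : Integrable v) (hw : Integrable w) {z : ℂ}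
    (hz : 0 < z.im) : cauchyInt (fun s => v s + w s) z = cauchyInt v z + cauchyInt w z := by
  simp only [cauchyInt, add_div]
  rw [integral_add (integrable_div_ofReal_sub hv hz) (integrable_div_ofReal_sub hw hz), mul_add]

theorem cauchyInt_const_mul (c : ℂ) (v : ℝ → ℂ) (z : ℂ) :
    cauchyInt (fun s => c * v s) z = c * cauchyInt v z := by
  simp only [cauchyInt, mul_div_assoc, integral_const_mul]
  ring

theorem enorm_add_four_rpow_le {r : ℝ} (hr : 0 ≤ r) (a b c d : ℂ) :
    ‖a + b + c + d‖ₑ ^ r ≤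
      4 ^ r * (‖a‖ₑ ^ r + ‖b‖ₑ ^ r + ‖c‖ₑ ^ r + ‖d‖ₑ ^ r) := by
  set m := max (max ‖a‖ₑ ‖b‖ₑ) (max ‖c‖ₑ ‖d‖ₑ) with hm
  have ha : ‖a‖ₑ ≤ m := (le_max_left _ _).trans (le_max_left _ _)
  have hb : ‖b‖ₑ ≤ m := (le_max_right _ _).trans (le_max_left _ _)
  have hc : ‖c‖ₑ ≤ m := (le_max_left _ _).trans (le_max_right _ _)
  have hd : ‖d‖ₑ ≤ m := (le_max_right _ _).trans (le_max_right _ _)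
  have h1 : ‖a + b + c + d‖ₑ ≤ 4 * m := by
    calc _ ≤ ‖a‖ₑ + ‖b‖ₑ + ‖c‖ₑ + ‖d‖ₑ :=
          (enorm_add_le _ _).trans (add_le_add ((enorm_add_le _ _).trans
            (add_le_add (enorm_add_le _ _) le_rfl)) le_rfl)
      _ ≤ m + m + m + m := by gcongr
      _ = 4 * m := by ring
  calc _ ≤ (4 * m) ^ r := by gcongr
    _ = 4 ^ r * m ^ r := ENNReal.mul_rpow_of_nonneg _ _ hr
    _ ≤ _ := by
      gcongr
      rcases max_choice (max ‖a‖ₑ ‖b‖ₑ) (max ‖c‖ₑ ‖d‖ₑ) with h | h <;> rw [hm, h]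
      · rcases max_choice ‖a‖ₑ ‖b‖ₑ with h | h <;> rw [h]
        · rw [add_assoc, add_assoc]; exact le_self_add
        · rw [add_comm (‖a‖ₑ ^ r), add_assoc, add_assoc]; exact le_self_add
      · rcases max_choice ‖c‖ₑ ‖d‖ₑ with h | h <;> rw [h]
        · rw [add_right_comm]; exact le_add_self
        · exact le_add_self

/-- Linearity: the positive and negative parts of the real and imaginary parts are nonnegative
functions dominated by `|v|`, with the same integrability of the first moment. -/
theorem lintegral_cauchyInt_rpow_le_of_le_two {r : ℝ} (hr : 1 < r) (hr2 : r ≤ 2) :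
    ∃ C : ℝ≥0, ∀ v : ℝ → ℂ, Integrable v → Integrable (fun s : ℝ => (s : ℂ) * v s) →
      ∀ y : ℝ, 0 < y → ∫⁻ x : ℝ, ‖cauchyInt v (x + y * Complex.I)‖ₑ ^ r ≤
        C * ∫⁻ s, ‖v s‖ₑ ^ r := by
  obtain ⟨C, hC⟩ := lintegral_cauchyInt_rpow_le_of_nonneg hr hr2
  have hr0 : 0 < r := by linarith
  refine ⟨4 ^ r * (C + C + C + C), fun v hv hv' y hy => ?_⟩
  have him : ∀ x : ℝ, 0 < ((x : ℂ) + y * Complex.I).im := by simpa using hy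
  have part : ∀ L : ℂ →L[ℝ] ℝ, (∀ w, |L w| ≤ ‖w‖) →
      Integrable (fun s => max (L (v s)) 0) ∧
      ∫⁻ x : ℝ, ‖cauchyInt (fun s => ((max (L (v s)) 0 : ℝ) : ℂ)) (x + y * Complex.I)‖ₑ ^ r ≤
        C * ∫⁻ s, ‖v s‖ₑ ^ r := by
    intro L hL
    have h1 : Integrable (fun s => max (L (v s)) 0) := (L.integrable_comp hv).pos_part
    have h2 : Integrable (fun s => s * max (L (v s)) 0) := by
      refine hv'.norm.mono' (measurable_id.aestronglyMeasurable.mul h1.aestronglyMeasurable)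
        (Eventually.of_forall fun s => ?_)
      rw [norm_mul, norm_mul, Complex.norm_real]
      gcongr
      rw [Real.norm_of_nonneg (le_max_right _ _)]
      exact max_le ((le_abs_self _).trans (hL _)) (norm_nonneg _)
    refine ⟨h1, (hC _ h1 h2 (fun s => le_max_right _ _) y hy).trans ?_⟩
    gcongr with s
    rw [← ofReal_norm]
    exact ENNReal.ofReal_le_ofReal (max_le ((le_abs_self _).trans (hL _)) (norm_nonneg _))
  obtain ⟨i1, b1⟩ := part Complex.reCLM fun w => Complex.abs_re_le_norm w
  obtain ⟨i2, b2⟩ := part (-Complex.reCLM) fun w => by simpa using Complex.abs_re_le_norm w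
  obtain ⟨i3, b3⟩ := part Complex.imCLM fun w => Complex.abs_im_le_norm w
  obtain ⟨i4, b4⟩ := part (-Complex.imCLM) fun w => by simpa using Complex.abs_im_le_norm w
  set g1 : ℝ → ℂ := fun s => ((max (Complex.reCLM (v s)) 0 : ℝ) : ℂ) with hg1
  set g2 : ℝ → ℂ := fun s => ((max ((-Complex.reCLM) (v s)) 0 : ℝ) : ℂ) with hg2
  set g3 : ℝ → ℂ := fun s => ((max (Complex.imCLM (v s)) 0 : ℝ) : ℂ) with hg3
  set g4 : ℝ → ℂ := fun s => ((max ((-Complex.imCLM) (v s)) 0 : ℝ) : ℂ) with hg4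
  have hdec : v = fun s => g1 s + (-1) * g2 s + Complex.I * g3 s + (-Complex.I) * g4 s := by
    funext s
    have hmax : ∀ a : ℝ, a = max a 0 - max (-a) 0 := fun a => by
      rcases le_total a 0 with h | h
      · rw [max_eq_right h, max_eq_left (by linarith)]; ring
      · rw [max_eq_left h, max_eq_right (by linarith)]; ring
    have e1 := congrArg (Complex.ofReal) (hmax (v s).re)
    have e2 := congrArg (Complex.ofReal) (hmax (v s).im)
    rw [Complex.ofReal_sub] at e1 e2
    conv_lhs => rw [← Complex.re_add_im (v s), e1, e2]
    simp only [hg1, hg2, hg3, hg4, Complex.reCLM_apply, Complex.imCLM_apply,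
      _root_.neg_apply]
    ring
  have j1 : Integrable g1 := i1.ofReal
  have j2 : Integrable fun s => (-1) * g2 s := i2.ofReal.const_mul _
  have j3 : Integrable fun s => Complex.I * g3 s := i3.ofReal.const_mul _
  have j4 : Integrable fun s => (-Complex.I) * g4 s := i4.ofReal.const_mul _
  have j12 : Integrable fun s => g1 s + (-1) * g2 s := j1.add j2
  have j123 : Integrable fun s => g1 s + (-1) * g2 s + Complex.I * g3 s := j12.add j3
  have hsum : ∀ x : ℝ, cauchyInt v (x + y * Complex.I) =
      cauchyInt g1 (x + y * Complex.I) + (-1) * cauchyInt g2 (x + y * Complex.I) +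
      Complex.I * cauchyInt g3 (x + y * Complex.I) +
        (-Complex.I) * cauchyInt g4 (x + y * Complex.I) := by
    intro x
    rw [← cauchyInt_const_mul (-1), ← cauchyInt_const_mul Complex.I,
      ← cauchyInt_const_mul (-Complex.I), ← cauchyInt_add j1 j2 (him x),
      ← cauchyInt_add j12 j3 (him x), ← cauchyInt_add j123 j4 (him x)]
    exact congrArg (fun u => cauchyInt u _) hdec
  have hmeas : ∀ g : ℝ → ℂ, Integrable g →
      Measurable fun x : ℝ => ‖cauchyInt g (x + y * Complex.I)‖ₑ ^ r := by
    intro g hg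
    have : Continuous fun x : ℝ => cauchyInt g (x + y * Complex.I) := by
      rw [continuous_iff_continuousAt]
      intro x
      exact ContinuousAt.comp (f := fun x : ℝ => (x : ℂ) + y * Complex.I)
        (differentiableAt_cauchyInt hg (him x)).continuousAt (by fun_prop)
    exact (this.measurable.enorm).pow_const r
  have k2 : Integrable g2 := i2.ofReal
  have k3 : Integrable g3 := i3.ofReal
  calc ∫⁻ x : ℝ, ‖cauchyInt v (x + y * Complex.I)‖ₑ ^ r
      ≤ ∫⁻ x : ℝ, 4 ^ r * (‖cauchyInt g1 (x + y * Complex.I)‖ₑ ^ r +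
          ‖cauchyInt g2 (x + y * Complex.I)‖ₑ ^ r + ‖cauchyInt g3 (x + y * Complex.I)‖ₑ ^ r +
          ‖cauchyInt g4 (x + y * Complex.I)‖ₑ ^ r) := by
        refine lintegral_mono fun x => ?_
        rw [hsum]
        refine (enorm_add_four_rpow_le hr0.le _ _ _ _).trans_eq ?_
        have hI : ‖Complex.I‖ₑ = 1 := by rw [← ofReal_norm]; simp
        simp [enorm_mul, enorm_neg, hI]
    _ ≤ 4 ^ r * (C * (∫⁻ s, ‖v s‖ₑ ^ r) + C * (∫⁻ s, ‖v s‖ₑ ^ r) + C * (∫⁻ s, ‖v s‖ₑ ^ r) +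
          C * (∫⁻ s, ‖v s‖ₑ ^ r)) := by
        have k4 : Integrable g4 := i4.ofReal
        rw [lintegral_const_mul' _ _ (by simp), lintegral_add_right _ (hmeas _ k4),
          lintegral_add_right _ (hmeas _ k3), lintegral_add_right _ (hmeas _ k2)]
        gcongr
    _ = _ := by
        rw [ENNReal.coe_mul, ENNReal.coe_rpow_of_nonneg _ hr0.le]
        push_cast
        ring

theorem continuous_cauchyInt_horizontal {v : ℝ → ℂ} (hv : Integrable v) {y : ℝ} (hy : 0 < y) :
    Continuous fun x : ℝ => cauchyInt v (x + y * Complex.I) := by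
  rw [continuous_iff_continuousAt]
  intro x
  exact ContinuousAt.comp (f := fun x : ℝ => (x : ℂ) + y * Complex.I)
    (differentiableAt_cauchyInt hv (by simpa using hy)).continuousAt (by fun_prop)

/-- The transpose of the Cauchy integral on a horizontal line. -/
theorem integral_cauchyInt_mul {v w : ℝ → ℂ} (hv : Integrable v) (hw : Integrable w) {y : ℝ}
    (hy : 0 < y) :
    ∫ x : ℝ, cauchyInt v (x + y * Complex.I) * w x =
      ∫ s : ℝ, v s * (starRingEnd ℂ)
        (cauchyInt (fun x => (starRingEnd ℂ) (w x)) (s + y * Complex.I)) := by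
  have hc : Continuous fun z : ℝ × ℝ => ((z.2 : ℂ) - (z.1 + y * Complex.I))⁻¹ :=
    Continuous.inv₀ (by fun_prop) fun z => ofReal_sub_ne_zero (by simpa using hy) z.2
  have hint : Integrable (fun z : ℝ × ℝ => (w z.1 * v z.2) *
      ((2 * Real.pi * Complex.I)⁻¹ * ((z.2 : ℂ) - (z.1 + y * Complex.I))⁻¹))
      (volume.prod volume) := by
    refine (hw.mul_prod hv).mul_bdd (c := ‖(2 * Real.pi * Complex.I : ℂ)⁻¹‖ * y⁻¹)
      (by fun_prop) (Eventually.of_forall fun z => ?_)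
    rw [norm_mul, norm_inv ((z.2 : ℂ) - _)]
    gcongr
    have := im_le_norm_ofReal_sub z.2 (z.1 + y * Complex.I)
    simpa using this
  calc _ = ∫ x : ℝ, ∫ s : ℝ, (w x * v s) *
        ((2 * Real.pi * Complex.I)⁻¹ * ((s : ℂ) - (x + y * Complex.I))⁻¹) := by
        refine integral_congr_ae (Eventually.of_forall fun x => ?_)
        simp only [cauchyInt]
        rw [mul_comm, ← mul_assoc, ← integral_const_mul]
        refine integral_congr_ae (Eventually.of_forall fun s => ?_)
        simp only [div_eq_mul_inv]
        ring
    _ = ∫ s : ℝ, ∫ x : ℝ, (w x * v s) *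
        ((2 * Real.pi * Complex.I)⁻¹ * ((s : ℂ) - (x + y * Complex.I))⁻¹) :=
        integral_integral_swap hint
    _ = _ := by
        refine integral_congr_ae (Eventually.of_forall fun s => ?_)
        simp only [cauchyInt]
        rw [map_mul, ← integral_conj, ← integral_const_mul, ← integral_const_mul]
        refine integral_congr_ae (Eventually.of_forall fun x => ?_)
        simp only [map_div₀, map_sub, map_inv₀, map_mul, Complex.conj_conj, Complex.conj_ofReal,
          Complex.conj_I, map_add, map_ofNat]
        -- Conjugation reverses the vertical shift and the sign of the prefactor `1 / (2 π i)`;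
        -- exchanging `s` and `x` gives a second sign, so the two kernels agree.
        rw [show (x : ℂ) - (s + y * -Complex.I) = -((s : ℂ) - (x + y * Complex.I)) by ring,
          div_neg, show (2 * Real.pi * -Complex.I : ℂ)⁻¹ = -(2 * Real.pi * Complex.I)⁻¹ by
            rw [mul_neg, inv_neg], div_eq_mul_inv]
        ring

/-- M. Riesz' inequality for the Cauchy integral, `1 < r`. -/
theorem lintegral_cauchyInt_rpow_le {r : ℝ} (hr : 1 < r) :
    ∃ C : ℝ≥0, ∀ v : ℝ → ℂ, Integrable v → Integrable (fun s : ℝ => (s : ℂ) * v s) →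
      ∀ y : ℝ, 0 < y → ∫⁻ x : ℝ, ‖cauchyInt v (x + y * Complex.I)‖ₑ ^ r ≤
        C * ∫⁻ s, ‖v s‖ₑ ^ r := by
  rcases le_or_gt r 2 with hr2 | hr2
  · exact lintegral_cauchyInt_rpow_le_of_le_two hr hr2
  have hpq := Real.HolderConjugate.conjExponent hr
  set q := r.conjExponent with hq
  have hq1 : 1 < q := hpq.symm.lt
  have hr0 : 0 < r := by linarith
  have hq0 : 0 < q := by linarith
  have hq2 : q ≤ 2 := by
    have h := hpq.inv_add_inv_eq_one
    have h1 : r⁻¹ ≤ 2⁻¹ := by gcongr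
    have h2 : 2⁻¹ ≤ q⁻¹ := by linarith
    exact (inv_le_inv₀ two_pos hq0).1 h2
  obtain ⟨C, hC⟩ := lintegral_cauchyInt_rpow_le_of_le_two hq1 hq2
  refine ⟨C ^ (r / q), fun v hv hv' y hy => ?_⟩
  set H : ℝ → ℂ := fun x => cauchyInt v (x + y * Complex.I) with hH
  have hHc : Continuous H := continuous_cauchyInt_horizontal hv hy
  set V := ∫⁻ s, ‖v s‖ₑ ^ r with hV
  -- Duality with the case of the conjugate exponent `q ≤ 2`, tested on `|H| ^ (r - 2)` times the
  -- conjugate of `H`. The restriction to a compact interval makes `X` finite, so that `X ^ (1 / q)`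
  -- can be cancelled from `X ≤ V ^ (1 / r) * (C X) ^ (1 / q)`.
  have key : ∀ n : ℕ, ∫⁻ x in Icc (-(n : ℝ)) n, ‖H x‖ₑ ^ r ≤ C ^ (r / q) * V := by
    intro n
    set X := ∫⁻ x in Icc (-(n : ℝ)) n, ‖H x‖ₑ ^ r with hX
    set w₀ : ℝ → ℂ := fun x => ((‖H x‖ ^ (r - 2) : ℝ) : ℂ) * (starRingEnd ℂ) (H x) with hw₀
    have hw₀c : Continuous w₀ := by
      refine (Complex.continuous_ofReal.comp
        (hHc.norm.rpow_const fun x => Or.inr (by linarith))).mul (Complex.continuous_conj.comp hHc)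
    set w := (Icc (-(n : ℝ)) n).indicator w₀ with hw
    have hwint : Integrable w :=
      (hw₀c.continuousOn.integrableOn_compact isCompact_Icc).integrable_indicator
        measurableSet_Icc
    have hwint' : Integrable fun s : ℝ => (s : ℂ) * (starRingEnd ℂ) (w s) := by
      have h1 : Continuous fun s : ℝ => (s : ℂ) * (starRingEnd ℂ) (w₀ s) :=
        Complex.continuous_ofReal.mul (Complex.continuous_conj.comp hw₀c)
      have h2 := (h1.continuousOn.integrableOn_compact (μ := volume)
        (isCompact_Icc (a := -(n : ℝ)) (b := n))).integrable_indicator measurableSet_Icc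
      refine h2.congr (Eventually.of_forall fun s => ?_)
      by_cases hs : s ∈ Icc (-(n : ℝ)) n <;> simp [hw, hs]
    have hHw : ∀ x, H x * w₀ x = ((‖H x‖ ^ r : ℝ) : ℂ) := by
      intro x
      rw [hw₀, mul_left_comm, Complex.mul_conj, Complex.normSq_eq_norm_sq, ← Complex.ofReal_mul,
        ← Real.rpow_natCast, ← Real.rpow_add_of_nonneg (norm_nonneg _) (by linarith) (by norm_num)]
      congr 2
      push_cast; ring
    have hwn : ∀ x, ‖w₀ x‖ₑ ^ q = ‖H x‖ₑ ^ r := by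
      intro x
      have h1 : ‖w₀ x‖ = ‖H x‖ ^ (r - 1) := by
        rw [hw₀, norm_mul, Complex.norm_real, RCLike.norm_conj,
          Real.norm_of_nonneg (by positivity)]
        conv_lhs => rw [← Real.rpow_one ‖H x‖, ← Real.rpow_mul (norm_nonneg _), one_mul]
        rw [← Real.rpow_add_of_nonneg (norm_nonneg _) (by linarith) zero_le_one]
        congr 1; ring
      rw [← ofReal_norm, h1, ← ofReal_norm, ENNReal.ofReal_rpow_of_nonneg (by positivity) hq0.le,
        ENNReal.ofReal_rpow_of_nonneg (by positivity) hr0.le, ← Real.rpow_mul (norm_nonneg _),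
        hpq.sub_one_mul_conj]
    have hXtop : X ≠ ⊤ := by
      have h1 : Continuous fun x => ‖H x‖ ^ r := hHc.norm.rpow_const fun x => Or.inr hr0.le
      have h2 := (h1.continuousOn.integrableOn_compact (μ := volume)
        (isCompact_Icc (a := -(n : ℝ)) (b := n)))
      have h3 := h2.lintegral_lt_top
      refine ne_of_lt (lt_of_le_of_lt (lintegral_mono fun x => ?_) h3)
      rw [← ENNReal.ofReal_rpow_of_nonneg (norm_nonneg _) hr0.le, ofReal_norm]
    have hid : X = ‖∫ x, H x * w x‖ₑ := by
      have h1 : ∫ x, H x * w x = ((∫ x in Icc (-(n : ℝ)) n, ‖H x‖ ^ r : ℝ) : ℂ) := by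
        rw [← integral_complex_ofReal, ← integral_indicator measurableSet_Icc]
        refine integral_congr_ae (Eventually.of_forall fun x => ?_)
        by_cases hx : x ∈ Icc (-(n : ℝ)) n <;> simp [hw, hx, hHw]
      have h2 : Continuous fun x => ‖H x‖ ^ r := hHc.norm.rpow_const fun x => Or.inr hr0.le
      rw [h1, ← ofReal_norm, Complex.norm_real, Real.norm_of_nonneg
        (integral_nonneg fun x => by positivity), ofReal_integral_eq_lintegral_ofReal
        (h2.continuousOn.integrableOn_compact isCompact_Icc)
        (Eventually.of_forall fun x => by positivity)]
      refine lintegral_congr fun x => ?_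
      rw [← ENNReal.ofReal_rpow_of_nonneg (norm_nonneg _) hr0.le, ofReal_norm]
    have hwc : Integrable fun x => (starRingEnd ℂ) (w x) := by
      refine hwint.norm.mono' (Complex.continuous_conj.comp_aestronglyMeasurable
        hwint.aestronglyMeasurable) (Eventually.of_forall fun x => ?_)
      rw [RCLike.norm_conj]
    have hle : X ≤ V ^ (1 / r) * (C * X) ^ (1 / q) := by
      refine hid.trans_le ?_
      rw [integral_cauchyInt_mul hv hwint hy]
      refine (enorm_integral_le_lintegral_enorm _).trans ?_
      have h1 := ENNReal.lintegral_mul_le_Lp_mul_Lq volume hpq (f := fun s => ‖v s‖ₑ)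
        (g := fun s : ℝ => ‖cauchyInt (fun x => (starRingEnd ℂ) (w x)) (s + y * Complex.I)‖ₑ)
        hv.aestronglyMeasurable.enorm
        (continuous_cauchyInt_horizontal hwc hy).measurable.enorm.aemeasurable
      refine le_trans (le_of_eq (lintegral_congr fun s => ?_)) (h1.trans ?_)
      · rw [enorm_mul, RCLike.enorm_conj]; rfl
      · refine mul_le_mul_right (ENNReal.rpow_le_rpow ?_ (by positivity)) _
        refine (hC _ hwc hwint' y hy).trans (le_of_eq ?_)
        congr 1
        rw [hX, ← lintegral_indicator measurableSet_Icc]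
        refine lintegral_congr fun x => ?_
        by_cases hx : x ∈ Icc (-(n : ℝ)) n
        · simp [hw, hx, hwn]
        · simp [hw, hx, hq0]
    by_cases hX0 : X = 0
    · rw [hX0]; exact zero_le
    rw [ENNReal.mul_rpow_of_nonneg _ _ (by positivity), ← mul_assoc] at hle
    have hexp : 1 / r + 1 / q = 1 := by
      have := hpq.inv_add_inv_eq_one
      simpa [one_div] using this
    have hsplit : X = X ^ (1 / r) * X ^ (1 / q) := by
      rw [← ENNReal.rpow_add_of_nonneg _ _ (by positivity) (by positivity), hexp,
        ENNReal.rpow_one]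
    nth_rw 1 [hsplit] at hle
    have hXq0 : X ^ (1 / q) ≠ 0 := by
      rw [Ne, ENNReal.rpow_eq_zero_iff]; push Not
      exact ⟨fun h => absurd h hX0, fun h => absurd h hXtop⟩
    have hXqt : X ^ (1 / q) ≠ ⊤ := ENNReal.rpow_ne_top_of_nonneg (by positivity) hXtop
    rw [ENNReal.mul_le_mul_iff_left hXq0 hXqt] at hle
    calc X = (X ^ (1 / r)) ^ r := by
          rw [← ENNReal.rpow_mul, one_div_mul_cancel hr0.ne', ENNReal.rpow_one]
      _ ≤ (V ^ (1 / r) * C ^ (1 / q)) ^ r := by gcongr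
      _ = _ := by
          rw [ENNReal.mul_rpow_of_nonneg _ _ hr0.le, ← ENNReal.rpow_mul, ← ENNReal.rpow_mul,
            one_div_mul_cancel hr0.ne', ENNReal.rpow_one, mul_comm, one_div_mul_eq_div]
  rw [ENNReal.coe_rpow_of_nonneg _ (by positivity)]
  have hmono : Monotone fun n : ℕ => Icc (-(n : ℝ)) n := fun a b hab =>
    Icc_subset_Icc (by simpa using hab) (by simpa using hab)
  have hunion : (⋃ n : ℕ, Icc (-(n : ℝ)) n) = univ := by
    refine eq_univ_of_forall fun x => mem_iUnion.2 ?_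
    obtain ⟨n, hn⟩ := exists_nat_ge |x|
    exact ⟨n, abs_le.1 hn⟩
  rw [← setLIntegral_univ, ← hunion, setLIntegral_iUnion_of_directed _ hmono.directed_le]
  exact iSup_le key

/-! ### The projection to positive frequencies and its holomorphic extension. -/

theorem cexp_two_pi_norm (ξ : ℝ) (z : ℂ) :
    ‖Complex.exp (2 * Real.pi * Complex.I * ξ * z)‖ = Real.exp (-(2 * Real.pi * ξ * z.im)) := by
  rw [Complex.norm_exp]
  congr 1
  simp

/-- The point of the closed upper half plane below which there is nothing left of `z`. -/
noncomputable def upperClamp (z : ℂ) : ℂ := z.re + (max z.im 0 : ℝ) * Complex.I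

theorem upperClamp_im (z : ℂ) : (upperClamp z).im = max z.im 0 := by simp [upperClamp]

theorem upperClamp_of_nonneg {z : ℂ} (hz : 0 ≤ z.im) : upperClamp z = z := by
  rw [upperClamp, max_eq_left hz, Complex.re_add_im]

theorem continuous_upperClamp : Continuous upperClamp := by
  unfold upperClamp
  have h1 : Continuous fun z : ℂ => max z.im 0 := Complex.continuous_im.max continuous_const
  exact (Complex.continuous_ofReal.comp Complex.continuous_re).add
    ((Complex.continuous_ofReal.comp h1).mul continuous_const)

/-- The extension to the closed upper half plane of the projection of a Schwartz function
to positive frequencies. -/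
noncomputable def hardyExt (v : 𝓢(ℝ, ℂ)) (z : ℂ) : ℂ :=
  ∫ ξ in Ioi (0 : ℝ), (𝓕 v) ξ * Complex.exp (2 * Real.pi * Complex.I * ξ * upperClamp z)

theorem norm_hardyExt_integrand_le (v : 𝓢(ℝ, ℂ)) (z : ℂ) {ξ : ℝ} (hξ : 0 < ξ) :
    ‖(𝓕 v) ξ * Complex.exp (2 * Real.pi * Complex.I * ξ * upperClamp z)‖ ≤ ‖(𝓕 v) ξ‖ := by
  rw [norm_mul, cexp_two_pi_norm, upperClamp_im]
  refine mul_le_of_le_one_right (norm_nonneg _) (Real.exp_le_one_iff.2 ?_)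
  have := Real.pi_pos
  have : 0 ≤ 2 * Real.pi * ξ * max z.im 0 := by positivity
  linarith

/-- Clamping the imaginary part at zero keeps the exponential bounded by one on the whole plane, so
dominated convergence applies everywhere and passing to the boundary is plain continuity. -/
theorem continuous_hardyExt (v : 𝓢(ℝ, ℂ)) : Continuous (hardyExt v) := by
  have hu := continuous_upperClamp
  have hv := (𝓕 v).continuous
  refine continuous_of_dominated (bound := fun ξ => ‖(𝓕 v) ξ‖) (fun z => ?_) (fun z => ?_)
    (𝓕 v).integrable.norm.integrableOn (Eventually.of_forall fun ξ => by fun_prop)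
  · exact Continuous.aestronglyMeasurable (by fun_prop)
  · filter_upwards [ae_restrict_mem measurableSet_Ioi] with ξ hξ
    exact norm_hardyExt_integrand_le v z hξ

theorem norm_hardyExt_le (v : 𝓢(ℝ, ℂ)) (z : ℂ) : ‖hardyExt v z‖ ≤ ∫ ξ, ‖(𝓕 v) ξ‖ := by
  refine (norm_integral_le_of_norm_le (𝓕 v).integrable.norm.integrableOn ?_).trans
    (setIntegral_le_integral (𝓕 v).integrable.norm (Eventually.of_forall fun _ => norm_nonneg _))
  filter_upwards [ae_restrict_mem measurableSet_Ioi] with ξ hξ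
  exact norm_hardyExt_integrand_le v z hξ

theorem fourier_apply_eq (v : 𝓢(ℝ, ℂ)) (ξ : ℝ) :
    (𝓕 v) ξ = ∫ s : ℝ, v s * Complex.exp (-(2 * Real.pi * Complex.I * ξ * s)) := by
  have h := congrFun (SchwartzMap.fourier_coe v) ξ
  rw [h, Real.fourier_real_eq_integral_exp_smul]
  refine integral_congr_ae (Eventually.of_forall fun s => ?_)
  simp only [smul_eq_mul]
  rw [mul_comm]
  congr 2
  push_cast; ring

/-- Fubini and `∫_0^∞ e^{2πiξ(z-s)} dξ = 1 / (2πi (s - z))`. This carries M. Riesz' inequality and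
holomorphy over to the frequency projection. -/
theorem hardyExt_eq_cauchyInt (v : 𝓢(ℝ, ℂ)) {z : ℂ} (hz : 0 < z.im) :
    hardyExt v z = cauchyInt v z := by
  have hpi := Real.pi_pos
  have hint : Integrable (Function.uncurry fun (ξ s : ℝ) => v s *
      Complex.exp (2 * Real.pi * Complex.I * ξ * (z - s)))
      ((volume.restrict (Ioi 0)).prod volume) := by
    have h1 : Integrable (fun ξ : ℝ => Real.exp (-(2 * Real.pi * z.im) * ξ))
        (volume.restrict (Ioi 0)) := integrableOn_exp_mul_Ioi (by
          have : 0 < 2 * Real.pi * z.im := by positivity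
          linarith) 0
    have h2 := h1.mul_prod (v.integrable (μ := volume)).norm
    refine h2.mono' ?_ (Eventually.of_forall fun p => ?_)
    · have := v.continuous
      exact Continuous.aestronglyMeasurable (by unfold Function.uncurry; fun_prop)
    · simp only [Function.uncurry]
      rw [norm_mul, cexp_two_pi_norm, mul_comm]
      refine le_of_eq ?_
      congr 2
      simp; ring
  calc hardyExt v z = ∫ ξ in Ioi (0 : ℝ), ∫ s : ℝ, v s *
        Complex.exp (2 * Real.pi * Complex.I * ξ * (z - s)) := by
        refine integral_congr_ae (Eventually.of_forall fun ξ => ?_)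
        simp only
        rw [upperClamp_of_nonneg hz.le, fourier_apply_eq, ← integral_mul_const]
        refine integral_congr_ae (Eventually.of_forall fun s => ?_)
        simp only
        rw [mul_assoc, ← Complex.exp_add]
        congr 2; ring
    _ = ∫ s : ℝ, ∫ ξ in Ioi (0 : ℝ), v s *
        Complex.exp (2 * Real.pi * Complex.I * ξ * (z - s)) := integral_integral_swap hint
    _ = cauchyInt v z := by
        rw [cauchyInt, ← integral_const_mul]
        refine integral_congr_ae (Eventually.of_forall fun s => ?_)
        simp only
        rw [integral_const_mul]
        have hre : (2 * Real.pi * Complex.I * (z - s)).re < 0 := by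
          simp; positivity
        have h1 := integral_exp_mul_complex_Ioi hre 0
        have h2 : ∀ ξ : ℝ, Complex.exp (2 * Real.pi * Complex.I * ξ * (z - s)) =
            Complex.exp (2 * Real.pi * Complex.I * (z - s) * ξ) := fun ξ => by congr 1; ring
        simp_rw [h2]
        rw [h1]
        have h3 : (s : ℂ) - z ≠ 0 := ofReal_sub_ne_zero hz s
        have h4 : z - s ≠ 0 := fun h => h3 (by rw [← neg_sub, h, neg_zero])
        have h5 : (Real.pi : ℂ) ≠ 0 := by exact_mod_cast hpi.ne'
        simp only [Complex.ofReal_zero, mul_zero, Complex.exp_zero]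
        rw [← neg_sub (z : ℂ) s]
        field_simp

theorem differentiableAt_hardyExt (v : 𝓢(ℝ, ℂ)) {z : ℂ} (hz : 0 < z.im) :
    DifferentiableAt ℂ (hardyExt v) z := by
  refine (differentiableAt_cauchyInt v.integrable hz).congr_of_eventuallyEq ?_
  filter_upwards [(isOpen_lt continuous_const Complex.continuous_im).mem_nhds hz] with w hw
  exact hardyExt_eq_cauchyInt v hw

theorem integrable_ofReal_mul_schwartz (v : 𝓢(ℝ, ℂ)) : Integrable fun s : ℝ => (s : ℂ) * v s := by
  have h := v.integrable_pow_mul volume 1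
  refine h.mono' ?_ (Eventually.of_forall fun s => ?_)
  · exact (Complex.continuous_ofReal.mul v.continuous).aestronglyMeasurable
  · simp

/-- The bound for the Cauchy integral is uniform in the height; Fatou's lemma along heights `1 / (n
+ 1)` reaches the real axis. -/
theorem lintegral_hardyExt_rpow_le {r : ℝ} (hr : 1 < r) :
    ∃ C : ℝ≥0, ∀ v : 𝓢(ℝ, ℂ), ∫⁻ x : ℝ, ‖hardyExt v x‖ₑ ^ r ≤ C * ∫⁻ s, ‖v s‖ₑ ^ r := by
  obtain ⟨C, hC⟩ := lintegral_cauchyInt_rpow_le hr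
  have hr0 : 0 < r := by linarith
  refine ⟨C, fun v => ?_⟩
  have hc := continuous_hardyExt v
  have hlim : ∀ x : ℝ, Tendsto (fun n : ℕ =>
      ‖hardyExt v (x + (1 / ((n : ℝ) + 1) : ℝ) * Complex.I)‖ₑ ^ r) atTop
      (𝓝 (‖hardyExt v x‖ₑ ^ r)) := by
    intro x
    have h1 : Tendsto (fun n : ℕ => (x : ℂ) + (1 / ((n : ℝ) + 1) : ℝ) * Complex.I) atTop
        (𝓝 (x + (0 : ℝ) * Complex.I)) :=
      tendsto_const_nhds.add (((Complex.continuous_ofReal.tendsto _).comp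
        tendsto_one_div_add_atTop_nhds_zero_nat).mul_const _)
    rw [Complex.ofReal_zero, zero_mul, add_zero] at h1
    exact ((ENNReal.continuous_rpow_const.comp hc.enorm).tendsto _).comp h1
  calc ∫⁻ x : ℝ, ‖hardyExt v x‖ₑ ^ r
      = ∫⁻ x : ℝ, liminf (fun n : ℕ =>
          ‖hardyExt v (x + (1 / ((n : ℝ) + 1) : ℝ) * Complex.I)‖ₑ ^ r) atTop :=
        lintegral_congr fun x => (hlim x).liminf_eq.symm
    _ ≤ liminf (fun n : ℕ => ∫⁻ x : ℝ,
          ‖hardyExt v (x + (1 / ((n : ℝ) + 1) : ℝ) * Complex.I)‖ₑ ^ r) atTop := by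
        refine lintegral_liminf_le fun n => ?_
        have : Measurable fun x : ℝ =>
            hardyExt v (x + (1 / ((n : ℝ) + 1) : ℝ) * Complex.I) :=
          (hc.comp (by fun_prop)).measurable
        exact this.enorm.pow_const r
    _ ≤ C * ∫⁻ s, ‖v s‖ₑ ^ r := by
        refine (liminf_le_liminf (Eventually.of_forall fun n => ?_)).trans
          (liminf_const _).le
        have hn : (0 : ℝ) < 1 / ((n : ℝ) + 1) := by positivity
        refine le_trans (le_of_eq (lintegral_congr fun x => ?_))
          (hC v v.integrable (integrable_ofReal_mul_schwartz v) _ hn)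
        rw [hardyExt_eq_cauchyInt v (by
          simp only [Complex.add_im, Complex.ofReal_im, Complex.mul_im, Complex.ofReal_re,
            Complex.I_im, Complex.I_re, mul_one, mul_zero, zero_add, add_zero]
          exact hn)]

theorem integrable_exp_neg_mul_abs {y : ℝ} (hy : 0 < y) :
    Integrable fun ξ : ℝ => Real.exp (-(2 * Real.pi * y) * |ξ|) := by
  have hpi := Real.pi_pos
  have h0 : -(2 * Real.pi * y) < 0 := by
    have : 0 < 2 * Real.pi * y := by positivity
    linarith
  have h1 := integrableOn_exp_mul_Ioi h0 0
  rw [← integrableOn_univ, ← Iic_union_Ioi (a := (0 : ℝ)), integrableOn_union]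
  constructor
  · have h2 := integrableOn_exp_mul_Iic (a := 2 * Real.pi * y) (by linarith) 0
    refine h2.congr_fun (fun ξ hξ => ?_) measurableSet_Iic
    simp only
    rw [abs_of_nonpos hξ]; congr 1; ring
  · refine h1.congr_fun (fun ξ hξ => ?_) measurableSet_Ioi
    simp only
    rw [abs_of_pos hξ]

theorem fourierInv_exp_neg_mul_abs {y : ℝ} (hy : 0 < y) (u : ℝ) :
    𝓕⁻ (fun ξ : ℝ => (Real.exp (-(2 * Real.pi * y) * |ξ|) : ℂ)) u = halfPlanePoisson y u := by
  have hpi := Real.pi_pos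
  have hpic : (Real.pi : ℂ) ≠ 0 := by exact_mod_cast hpi.ne'
  rw [Real.fourierInv_eq']
  have e0 : ∀ ξ : ℝ, Complex.exp (((2 * Real.pi * inner ℝ ξ u : ℝ) : ℂ) * Complex.I) •
      (Real.exp (-(2 * Real.pi * y) * |ξ|) : ℂ) =
      Complex.exp (2 * Real.pi * (u * Complex.I) * ξ + -(2 * Real.pi * y) * |ξ|) := by
    intro ξ
    rw [smul_eq_mul, Complex.ofReal_exp, ← Complex.exp_add]
    congr 1
    simp
    ring
  simp_rw [e0]
  have hi : Integrable fun ξ : ℝ =>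
      Complex.exp (2 * Real.pi * (u * Complex.I) * ξ + -(2 * Real.pi * y) * |ξ|) := by
    refine (integrable_exp_neg_mul_abs hy).mono' (Continuous.aestronglyMeasurable (by fun_prop))
      (Eventually.of_forall fun ξ => ?_)
    rw [Complex.norm_exp]
    simp
  rw [← intervalIntegral.integral_Iic_add_Ioi (b := (0 : ℝ)) hi.integrableOn hi.integrableOn]
  have e1 : ∫ ξ in Ioi (0 : ℝ),
      Complex.exp (2 * Real.pi * (u * Complex.I) * ξ + -(2 * Real.pi * y) * |ξ|) =
      -1 / (2 * Real.pi * (u * Complex.I - y)) := by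
    rw [← integral_congr_ae (g := fun ξ : ℝ => Complex.exp (2 * Real.pi *
      (u * Complex.I) * ξ + -(2 * Real.pi * y) * |ξ|)) (f := fun ξ : ℝ =>
        Complex.exp ((2 * Real.pi * (u * Complex.I - y)) * ξ))]
    · rw [integral_exp_mul_complex_Ioi (by simp; positivity)]
      simp
    · filter_upwards [ae_restrict_mem measurableSet_Ioi] with ξ hξ
      rw [abs_of_pos hξ]; congr 1; ring
  have e2 : ∫ ξ in Iic (0 : ℝ),
      Complex.exp (2 * Real.pi * (u * Complex.I) * ξ + -(2 * Real.pi * y) * |ξ|) =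
      1 / (2 * Real.pi * (u * Complex.I + y)) := by
    rw [← integral_congr_ae (g := fun ξ : ℝ => Complex.exp (2 * Real.pi *
      (u * Complex.I) * ξ + -(2 * Real.pi * y) * |ξ|)) (f := fun ξ : ℝ =>
        Complex.exp ((2 * Real.pi * (u * Complex.I + y)) * ξ))]
    · rw [integral_exp_mul_complex_Iic (by simp; positivity)]
      simp
    · filter_upwards [ae_restrict_mem measurableSet_Iic] with ξ hξ
      rw [abs_of_nonpos hξ]; push_cast; congr 1; ring
  rw [e1, e2, halfPlanePoisson]
  have h1 : (u * Complex.I - y : ℂ) ≠ 0 := fun h => by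
    have := congrArg Complex.re h; simp at this; exact hy.ne' this
  have h2 : (u * Complex.I + y : ℂ) ≠ 0 := fun h => by
    have := congrArg Complex.re h; simp at this; exact hy.ne' this
  have h3 : ((u : ℂ) ^ 2 + y ^ 2) ≠ 0 := by
    have : u ^ 2 + y ^ 2 ≠ 0 := by positivity
    exact_mod_cast this
  push_cast
  field_simp
  linear_combination (-2 * (u : ℂ) ^ 2 * y) * Complex.I_sq

/-- Fourier inversion for `e^{-2πy|ξ|}`, which is continuous and integrable with the integrable
inverse transform just computed. -/
theorem integral_halfPlanePoisson_mul_cexp {y : ℝ} (hy : 0 < y) (ξ : ℝ) :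
    ∫ u : ℝ, (halfPlanePoisson y u : ℂ) * Complex.exp (-(2 * Real.pi * Complex.I * ξ * u)) =
      Real.exp (-(2 * Real.pi * y) * |ξ|) := by
  set E : ℝ → ℂ := fun ξ : ℝ => (Real.exp (-(2 * Real.pi * y) * |ξ|) : ℂ) with hE
  have hinv : 𝓕⁻ E = fun u => (halfPlanePoisson y u : ℂ) :=
    funext (fourierInv_exp_neg_mul_abs hy)
  have hEc : Continuous E := by fun_prop
  have hEi : Integrable E := (integrable_exp_neg_mul_abs hy).ofReal
  have hFi : Integrable (𝓕 E) := by
    have h1 : 𝓕 E = fun u => 𝓕⁻ E (-u) := by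
      funext u
      rw [Real.fourierInv_eq_fourier_neg, neg_neg]
    rw [h1, hinv]
    simpa [halfPlanePoisson_neg] using (integrable_halfPlanePoisson hy).ofReal (𝕜 := ℂ)
  have h := congrFun (hEc.fourier_fourierInv_eq hEi hFi) ξ
  rw [hinv, Real.fourier_real_eq_integral_exp_smul] at h
  refine Eq.trans ?_ h
  refine integral_congr_ae (Eventually.of_forall fun u => ?_)
  simp only [smul_eq_mul]
  rw [mul_comm]
  congr 2
  push_cast; ring

/-- The Poisson representation of `hardyExt` in terms of its boundary values. -/
theorem hardyExt_eq_poisson (v : 𝓢(ℝ, ℂ)) (x : ℝ) {y : ℝ} (hy : 0 < y) :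
    hardyExt v (x + y * Complex.I) =
      ∫ τ : ℝ, (halfPlanePoisson y (x - τ) : ℂ) * hardyExt v τ := by
  have hpi := Real.pi_pos
  have hclamp : ∀ τ : ℝ, upperClamp τ = τ := fun τ => upperClamp_of_nonneg (by simp)
  have hint : Integrable (Function.uncurry fun (u ξ : ℝ) => (halfPlanePoisson y u : ℂ) *
      ((𝓕 v) ξ * Complex.exp (2 * Real.pi * Complex.I * ξ * ((x - u : ℝ) : ℂ))))
      (volume.prod (volume.restrict (Ioi 0))) := by
    have h1 := (integrable_halfPlanePoisson hy).norm.mul_prod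
      ((𝓕 v).integrable (μ := volume)).norm.integrableOn.integrable (ν := volume.restrict (Ioi 0))
    refine h1.mono' ?_ (Eventually.of_forall fun p => ?_)
    · have := (𝓕 v).continuous
      have := continuous_halfPlanePoisson hy
      exact Continuous.aestronglyMeasurable (by unfold Function.uncurry; fun_prop)
    · simp only [Function.uncurry]
      rw [norm_mul, norm_mul, cexp_two_pi_norm, Complex.norm_real]
      simp
  symm
  calc ∫ τ : ℝ, (halfPlanePoisson y (x - τ) : ℂ) * hardyExt v τ
      = ∫ u : ℝ, (halfPlanePoisson y u : ℂ) * hardyExt v ((x - u : ℝ) : ℂ) := by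
        rw [← integral_sub_left_eq_self _ volume x]
        simp
    _ = ∫ u : ℝ, ∫ ξ in Ioi (0 : ℝ), (halfPlanePoisson y u : ℂ) *
        ((𝓕 v) ξ * Complex.exp (2 * Real.pi * Complex.I * ξ * ((x - u : ℝ) : ℂ))) := by
        refine integral_congr_ae (Eventually.of_forall fun u => ?_)
        simp only
        rw [integral_const_mul, hardyExt, hclamp]
    _ = ∫ ξ in Ioi (0 : ℝ), ∫ u : ℝ, (halfPlanePoisson y u : ℂ) *
        ((𝓕 v) ξ * Complex.exp (2 * Real.pi * Complex.I * ξ * ((x - u : ℝ) : ℂ))) :=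
        integral_integral_swap hint
    _ = hardyExt v (x + y * Complex.I) := by
        rw [hardyExt, upperClamp_of_nonneg (by simpa using hy.le)]
        refine integral_congr_ae ?_
        filter_upwards [ae_restrict_mem measurableSet_Ioi] with ξ hξ
        have e : ∀ u : ℝ, (halfPlanePoisson y u : ℂ) *
            ((𝓕 v) ξ * Complex.exp (2 * Real.pi * Complex.I * ξ * ((x - u : ℝ) : ℂ))) =
            ((𝓕 v) ξ * Complex.exp (2 * Real.pi * Complex.I * ξ * x)) *
              ((halfPlanePoisson y u : ℂ) *
                Complex.exp (-(2 * Real.pi * Complex.I * ξ * u))) := by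
          intro u
          have : 2 * Real.pi * Complex.I * ξ * ((x - u : ℝ) : ℂ) =
            2 * Real.pi * Complex.I * ξ * x + -(2 * Real.pi * Complex.I * ξ * u) := by
              push_cast; ring
          rw [this, Complex.exp_add]; ring
        simp_rw [e]
        -- On `ξ > 0` the Poisson multiplier `e^{-2πyξ}` is exactly what the exponential at `x + iy`
        -- gains over the exponential at `x`.
        rw [integral_const_mul, integral_halfPlanePoisson_mul_cexp hy, mul_assoc,
          Complex.ofReal_exp, ← Complex.exp_add, abs_of_pos hξ]
        congr 2
        push_cast
        linear_combination (-2 * (Real.pi : ℂ) * ξ * y) * Complex.I_sq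

/-- The nontangential maximal function of `hardyExt v` has a majorant in `L^r`, `1 < r`. -/
theorem exists_nontangential_majorant {r : ℝ} (hr : 1 < r) :
    ∃ C : ℝ≥0, ∀ v : 𝓢(ℝ, ℂ), ∃ N : ℝ → ℝ≥0∞, Measurable N ∧
      (∀ x s y : ℝ, |s| ≤ 1 → 0 < y →
        ‖hardyExt v ((x + s * y : ℝ) + y * Complex.I)‖ₑ ≤ N x) ∧
      ∫⁻ x, N x ^ r ≤ C * ∫⁻ x, ‖v x‖ₑ ^ r := by
  obtain ⟨C₁, hC₁⟩ := lintegral_maximalFn_rpow_le hr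
  obtain ⟨C₂, hC₂⟩ := lintegral_hardyExt_rpow_le hr
  have hr0 : 0 < r := by linarith
  refine ⟨64 ^ r * (C₁ * C₂), fun v => ?_⟩
  set w : ℝ → ℝ≥0∞ := fun τ => ‖hardyExt v τ‖ₑ with hw
  have hwm : Measurable w :=
    ((continuous_hardyExt v).comp Complex.continuous_ofReal).measurable.enorm
  refine ⟨fun x => 64 * maximalFn w x, (measurable_maximalFn w).const_mul _,
    fun x s y hs hy => ?_, ?_⟩
  · rw [hardyExt_eq_poisson v _ hy]
    refine (enorm_integral_le_lintegral_enorm _).trans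
      (le_trans (le_of_eq (lintegral_congr fun τ => ?_))
        (lintegral_halfPlanePoisson_mul_le hy w x hs hwm))
    rw [enorm_mul, ← ofReal_norm (_ : ℂ), Complex.norm_real,
      Real.norm_of_nonneg (halfPlanePoisson_pos hy _).le]
  · simp_rw [ENNReal.mul_rpow_of_nonneg _ _ hr0.le]
    rw [lintegral_const_mul _ ((measurable_maximalFn w).pow_const r), ENNReal.coe_mul,
      ENNReal.coe_mul, ENNReal.coe_rpow_of_nonneg _ hr0.le, mul_assoc, mul_assoc]
    push_cast
    gcongr
    refine (hC₁ w hwm).trans ?_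
    gcongr
    exact hC₂ v

/-! ### The operator `C_-` on `L^p`: transpose, existence, duality. -/

theorem cMinusSchwartz_eq (u : 𝓢(ℝ, ℂ)) (x : ℝ) :
    cMinusSchwartz u x = u x - hardyExt u x := by
  have hclamp : upperClamp (x : ℂ) = x := upperClamp_of_nonneg (by simp)
  have hi : Integrable fun ξ : ℝ => (𝓕 u) ξ * Complex.exp (2 * Real.pi * Complex.I * ξ * x) := by
    refine ((𝓕 u).integrable (μ := volume)).norm.mono' ?_ (Eventually.of_forall fun ξ => ?_)
    · have := (𝓕 u).continuous
      exact Continuous.aestronglyMeasurable (by fun_prop)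
    · rw [norm_mul, cexp_two_pi_norm]; simp
  have hu : u x = ∫ ξ : ℝ, (𝓕 u) ξ * Complex.exp (2 * Real.pi * Complex.I * ξ * x) := by
    have h1 : 𝓕⁻ (𝓕 u) = u := FourierTransform.fourierInv_fourier_eq u
    conv_lhs => rw [← h1]
    rw [congrFun (SchwartzMap.fourierInv_coe (𝓕 u)) x, Real.fourierInv_eq']
    refine integral_congr_ae (Eventually.of_forall fun ξ => ?_)
    simp only [smul_eq_mul]
    rw [mul_comm]
    congr 2
    simp; ring
  have hm : cMinusSchwartz u x =
      ∫ ξ in Iic (0 : ℝ), (𝓕 u) ξ * Complex.exp (2 * Real.pi * Complex.I * ξ * x) := by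
    rw [cMinusSchwartz, Real.fourierInv_eq', integral_Iic_eq_integral_Iio,
      ← integral_indicator measurableSet_Iio]
    refine integral_congr_ae (Eventually.of_forall fun ξ => ?_)
    simp only [smul_eq_mul]
    by_cases hξ : ξ ∈ Iio (0 : ℝ)
    · rw [indicator_of_mem hξ, indicator_of_mem hξ, mul_comm, SchwartzMap.fourier_coe]
      congr 2
      simp; ring
    · rw [indicator_of_notMem hξ, indicator_of_notMem hξ, mul_zero]
  rw [hm, hu, hardyExt, hclamp,
    ← intervalIntegral.integral_Iic_add_Ioi (b := (0 : ℝ)) hi.integrableOn hi.integrableOn]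
  ring

/-- On the frequency side, exchanging `u` and `v` amounts to reflecting the half line. Subtracting
this from the full pairing shows that the two half-line projections are transposes of each other. -/
theorem integral_mul_hardyExt_comm (u v : 𝓢(ℝ, ℂ)) :
    ∫ x : ℝ, u x * hardyExt v x = ∫ ξ in Ioi (0 : ℝ), (𝓕 v) ξ * (𝓕 u) (-ξ) := by
  have hclamp : ∀ τ : ℝ, upperClamp τ = τ := fun τ => upperClamp_of_nonneg (by simp)
  have hint : Integrable (Function.uncurry fun (x ξ : ℝ) => u x *
      ((𝓕 v) ξ * Complex.exp (2 * Real.pi * Complex.I * ξ * x)))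
      (volume.prod (volume.restrict (Ioi 0))) := by
    have h1 := (u.integrable (μ := volume)).norm.mul_prod
      ((𝓕 v).integrable (μ := volume)).norm.integrableOn.integrable (ν := volume.restrict (Ioi 0))
    refine h1.mono' ?_ (Eventually.of_forall fun p => ?_)
    · have := (𝓕 v).continuous
      have := u.continuous
      exact Continuous.aestronglyMeasurable (by unfold Function.uncurry; fun_prop)
    · simp only [Function.uncurry]
      rw [norm_mul, norm_mul, cexp_two_pi_norm]
      simp
  calc ∫ x : ℝ, u x * hardyExt v x = ∫ x : ℝ, ∫ ξ in Ioi (0 : ℝ), u x *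
      ((𝓕 v) ξ * Complex.exp (2 * Real.pi * Complex.I * ξ * x)) := by
        refine integral_congr_ae (Eventually.of_forall fun x => ?_)
        simp only
        rw [integral_const_mul, hardyExt, hclamp]
    _ = ∫ ξ in Ioi (0 : ℝ), ∫ x : ℝ, u x *
      ((𝓕 v) ξ * Complex.exp (2 * Real.pi * Complex.I * ξ * x)) := integral_integral_swap hint
    _ = _ := by
        refine integral_congr_ae (Eventually.of_forall fun ξ => ?_)
        simp only
        rw [fourier_apply_eq u, ← integral_const_mul]
        refine integral_congr_ae (Eventually.of_forall fun x => ?_)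
        simp only
        rw [mul_left_comm]
        congr 3
        push_cast; ring

theorem integral_mul_eq_fourier (u v : 𝓢(ℝ, ℂ)) :
    ∫ x : ℝ, u x * v x = ∫ ξ : ℝ, (𝓕 v) ξ * (𝓕 u) (-ξ) := by
  have hint : Integrable (Function.uncurry fun (x ξ : ℝ) => u x *
      ((𝓕 v) ξ * Complex.exp (2 * Real.pi * Complex.I * ξ * x)))
      (volume.prod volume) := by
    have h1 := (u.integrable (μ := volume)).norm.mul_prod
      ((𝓕 v).integrable (μ := volume)).norm
    refine h1.mono' ?_ (Eventually.of_forall fun p => ?_)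
    · have := (𝓕 v).continuous
      have := u.continuous
      exact Continuous.aestronglyMeasurable (by unfold Function.uncurry; fun_prop)
    · simp only [Function.uncurry]
      rw [norm_mul, norm_mul, cexp_two_pi_norm]
      simp
  have hv : ∀ x, v x = ∫ ξ : ℝ, (𝓕 v) ξ * Complex.exp (2 * Real.pi * Complex.I * ξ * x) := by
    intro x
    have h1 : 𝓕⁻ (𝓕 v) = v := FourierTransform.fourierInv_fourier_eq v
    conv_lhs => rw [← h1]
    rw [congrFun (SchwartzMap.fourierInv_coe (𝓕 v)) x, Real.fourierInv_eq']
    refine integral_congr_ae (Eventually.of_forall fun ξ => ?_)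
    simp only [smul_eq_mul]
    rw [mul_comm]
    congr 2
    simp; ring
  calc ∫ x : ℝ, u x * v x = ∫ x : ℝ, ∫ ξ : ℝ, u x *
      ((𝓕 v) ξ * Complex.exp (2 * Real.pi * Complex.I * ξ * x)) := by
        refine integral_congr_ae (Eventually.of_forall fun x => ?_)
        simp only
        rw [integral_const_mul, hv x]
    _ = ∫ ξ : ℝ, ∫ x : ℝ, u x *
      ((𝓕 v) ξ * Complex.exp (2 * Real.pi * Complex.I * ξ * x)) := integral_integral_swap hint
    _ = _ := by
        refine integral_congr_ae (Eventually.of_forall fun ξ => ?_)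
        simp only
        rw [fourier_apply_eq u, ← integral_const_mul]
        refine integral_congr_ae (Eventually.of_forall fun x => ?_)
        simp only
        rw [mul_left_comm]
        congr 3
        push_cast; ring

theorem integrable_schwartz_mul_hardyExt (u v : 𝓢(ℝ, ℂ)) :
    Integrable fun x : ℝ => u x * hardyExt v x :=
  (u.integrable (μ := volume)).mul_bdd (c := ∫ ξ, ‖(𝓕 v) ξ‖)
    ((continuous_hardyExt v).comp Complex.continuous_ofReal).aestronglyMeasurable
    (Eventually.of_forall fun x => norm_hardyExt_le v x)

/-- The transpose of the projection to negative frequencies is the projection to positive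
frequencies. -/
theorem integral_cMinusSchwartz_mul (u v : 𝓢(ℝ, ℂ)) :
    ∫ x : ℝ, cMinusSchwartz u x * v x = ∫ x : ℝ, u x * hardyExt v x := by
  have hi1 : Integrable fun x : ℝ => u x * v x := by
    obtain ⟨C, hC⟩ := v.decay 0 0
    refine (u.integrable (μ := volume)).mul_bdd (c := C) v.continuous.aestronglyMeasurable
      (Eventually.of_forall fun x => ?_)
    simpa using hC.2 x
  have hi2 := integrable_schwartz_mul_hardyExt v u
  have hi3 : Integrable fun ξ : ℝ => (𝓕 v) ξ * (𝓕 u) (-ξ) := by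
    obtain ⟨C, hC⟩ := (𝓕 u).decay 0 0
    refine ((𝓕 v).integrable (μ := volume)).mul_bdd (c := C)
      ((𝓕 u).continuous.comp continuous_neg).aestronglyMeasurable
      (Eventually.of_forall fun x => ?_)
    simpa using hC.2 (-x)
  have e1 : ∀ x : ℝ, cMinusSchwartz u x * v x = u x * v x - v x * hardyExt u x := fun x => by
    rw [cMinusSchwartz_eq]; ring
  simp_rw [e1]
  rw [integral_sub hi1 hi2, integral_mul_hardyExt_comm, integral_mul_hardyExt_comm,
    integral_mul_eq_fourier,
    ← intervalIntegral.integral_Iic_add_Ioi (b := (0 : ℝ)) hi3.integrableOn hi3.integrableOn]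
  have e2 : ∫ ξ in Ioi (0 : ℝ), (𝓕 u) ξ * (𝓕 v) (-ξ) =
      ∫ ξ in Iic (0 : ℝ), (𝓕 v) ξ * (𝓕 u) (-ξ) := by
    have := integral_comp_neg_Ioi (0 : ℝ) fun ξ => (𝓕 v) ξ * (𝓕 u) (-ξ)
    simp only [neg_neg, neg_zero] at this
    rw [← this]
    refine integral_congr_ae (Eventually.of_forall fun ξ => ?_)
    simp only
    rw [mul_comm]
  rw [e2]
  ring

theorem eLpNorm_ofReal_eq {E : Type*} [TopologicalSpace E] [ContinuousENorm E] {p : ℝ}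
    (hp : 0 < p) (f : ℝ → E) (μ : Measure ℝ) :
    eLpNorm f (ENNReal.ofReal p) μ = (∫⁻ x, ‖f x‖ₑ ^ p ∂μ) ^ (1 / p) := by
  rw [eLpNorm_eq_lintegral_rpow_enorm_toReal (by simpa using hp) ENNReal.ofReal_ne_top,
    ENNReal.toReal_ofReal hp.le]

theorem enorm_integral_mul_le {p q : ℝ} (hpq : p.HolderConjugate q) {f g : ℝ → ℂ}
    (hf : AEStronglyMeasurable f) (hg : AEStronglyMeasurable g) :
    ‖∫ x, f x * g x‖ₑ ≤
      eLpNorm f (ENNReal.ofReal p) volume * eLpNorm g (ENNReal.ofReal q) volume := by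
  rw [eLpNorm_ofReal_eq hpq.pos, eLpNorm_ofReal_eq hpq.symm.pos]
  refine (enorm_integral_le_lintegral_enorm _).trans ?_
  refine le_trans (le_of_eq (lintegral_congr fun x => ?_))
    (ENNReal.lintegral_mul_le_Lp_mul_Lq volume hpq hf.enorm hg.enorm)
  rw [enorm_mul]; rfl

theorem integrable_mul_of_memLp {p q : ℝ} (hpq : p.HolderConjugate q) {f g : ℝ → ℂ}
    (hf : MemLp f (ENNReal.ofReal p) volume) (hg : MemLp g (ENNReal.ofReal q) volume) :
    Integrable fun x => f x * g x := by
  refine ⟨hf.1.mul hg.1, ?_⟩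
  have h := ENNReal.lintegral_mul_le_Lp_mul_Lq volume hpq hf.1.enorm hg.1.enorm
  rw [← eLpNorm_ofReal_eq hpq.pos, ← eLpNorm_ofReal_eq hpq.symm.pos] at h
  refine lt_of_le_of_lt ?_ (ENNReal.mul_lt_top hf.2 hg.2)
  refine le_trans (le_of_eq (lintegral_congr fun x => ?_)) h
  rw [enorm_mul]; rfl

theorem exists_schwartz_eLpNorm_sub_le {p : ℝ} (hp : 1 ≤ p) {g : ℝ → ℂ}
    (hg : MemLp g (ENNReal.ofReal p) volume) {ε : ℝ} (hε : 0 < ε) :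
    ∃ u : 𝓢(ℝ, ℂ), eLpNorm (fun x => u x - g x) (ENNReal.ofReal p) volume ≤ ENNReal.ofReal ε := by
  obtain ⟨w, hw, hw', hle⟩ := hg.exist_eLpNorm_sub_le ENNReal.ofReal_ne_top
    (by rw [← ENNReal.ofReal_one]; exact ENNReal.ofReal_le_ofReal hp) hε
  refine ⟨hw.toSchwartzMap hw', ?_⟩
  rw [← eLpNorm_neg] at hle
  refine le_trans (le_of_eq (congrArg (fun k => eLpNorm k _ _) ?_)) hle
  funext x
  simp

theorem memLp_schwartz (u : 𝓢(ℝ, ℂ)) (p : ℝ) : MemLp u (ENNReal.ofReal p) volume :=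
  u.memLp _ volume

theorem eLpNorm_hardyExt_le {p : ℝ} (hp : 1 < p) :
    ∃ C : ℝ≥0, ∀ v : 𝓢(ℝ, ℂ), eLpNorm (fun x : ℝ => hardyExt v x) (ENNReal.ofReal p) volume ≤
      C * eLpNorm v (ENNReal.ofReal p) volume := by
  obtain ⟨C, hC⟩ := lintegral_hardyExt_rpow_le hp
  have hp0 : 0 < p := by linarith
  refine ⟨C ^ (1 / p), fun v => ?_⟩
  rw [eLpNorm_ofReal_eq hp0, eLpNorm_ofReal_eq hp0, ENNReal.coe_rpow_of_nonneg _ (by positivity),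
    ← ENNReal.mul_rpow_of_nonneg _ _ (by positivity)]
  exact ENNReal.rpow_le_rpow (hC v) (by positivity)

theorem memLp_hardyExt {p : ℝ} (hp : 1 < p) (v : 𝓢(ℝ, ℂ)) :
    MemLp (fun x : ℝ => hardyExt v x) (ENNReal.ofReal p) volume := by
  obtain ⟨C, hC⟩ := eLpNorm_hardyExt_le hp
  exact ⟨((continuous_hardyExt v).comp Complex.continuous_ofReal).aestronglyMeasurable,
    (hC v).trans_lt (ENNReal.mul_lt_top ENNReal.coe_lt_top (memLp_schwartz v p).2)⟩

theorem memLp_cMinusSchwartz {p : ℝ} (hp : 1 < p) (v : 𝓢(ℝ, ℂ)) :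
    MemLp (cMinusSchwartz v) (ENNReal.ofReal p) volume := by
  have h : cMinusSchwartz v = (v : ℝ → ℂ) - fun x : ℝ => hardyExt v x :=
    funext (cMinusSchwartz_eq v)
  rw [h]
  exact (memLp_schwartz v p).sub (memLp_hardyExt hp v)

theorem hardyExt_sub (u v : 𝓢(ℝ, ℂ)) (x : ℝ) :
    hardyExt (u - v) x = hardyExt u x - hardyExt v x := by
  have hi : ∀ w : 𝓢(ℝ, ℂ), Integrable (fun ξ : ℝ => (𝓕 w) ξ *
      Complex.exp (2 * Real.pi * Complex.I * ξ * upperClamp x)) (volume.restrict (Ioi 0)) := by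
    intro w
    refine ((𝓕 w).integrable (μ := volume)).norm.integrableOn.integrable.mono'
      (Continuous.aestronglyMeasurable ?_) ?_
    · have := (𝓕 w).continuous
      fun_prop
    · filter_upwards [ae_restrict_mem measurableSet_Ioi] with ξ hξ
      exact norm_hardyExt_integrand_le w x hξ
  have hF : 𝓕 (u - v) = 𝓕 u - 𝓕 v :=
    map_sub (FourierTransform.fourierCLM ℂ 𝓢(ℝ, ℂ)) u v
  rw [hardyExt, hardyExt, hardyExt, ← integral_sub (hi u) (hi v), hF]
  refine integral_congr_ae (Eventually.of_forall fun ξ => ?_)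
  simp only [_root_.sub_apply]
  ring

theorem eLpNorm_cMinusSchwartz_sub_le {p : ℝ} (hp : 1 < p) :
    ∃ C : ℝ≥0, ∀ u v : 𝓢(ℝ, ℂ),
      eLpNorm (cMinusSchwartz u - cMinusSchwartz v) (ENNReal.ofReal p) volume ≤
        C * eLpNorm (fun x => u x - v x) (ENNReal.ofReal p) volume := by
  obtain ⟨C, hC⟩ := eLpNorm_hardyExt_le hp
  have hp1 : 1 ≤ ENNReal.ofReal p := by
    rw [← ENNReal.ofReal_one]; exact ENNReal.ofReal_le_ofReal hp.le
  refine ⟨1 + C, fun u v => ?_⟩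
  have h : cMinusSchwartz u - cMinusSchwartz v =
      ((u - v : 𝓢(ℝ, ℂ)) : ℝ → ℂ) - fun x : ℝ => hardyExt (u - v) x := by
    funext x
    simp only [Pi.sub_apply, cMinusSchwartz_eq, hardyExt_sub, _root_.sub_apply]
    ring
  have h2 : (fun x => u x - v x) = ((u - v : 𝓢(ℝ, ℂ)) : ℝ → ℂ) := by
    funext x; simp
  rw [h, h2]
  refine (eLpNorm_sub_le (memLp_schwartz _ p).1 (memLp_hardyExt hp _).1 hp1).trans ?_
  push_cast
  rw [add_mul, one_mul]
  gcongr
  exact hC _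

/-- Existence of `C_- g` for `g` in `L^p`. -/
theorem exists_isCMinus {p : ℝ} (hp : 1 < p) {g : ℝ → ℂ}
    (hg : MemLp g (ENNReal.ofReal p) volume) : ∃ h, IsCMinus (ENNReal.ofReal p) g h := by
  obtain ⟨C, hC⟩ := eLpNorm_cMinusSchwartz_sub_le hp
  have hp1 : 1 ≤ ENNReal.ofReal p := by
    rw [← ENNReal.ofReal_one]; exact ENNReal.ofReal_le_ofReal hp.le
  have hε : ∀ n : ℕ, (0 : ℝ) < (1 / 2) ^ n := fun n => by positivity
  choose u hu using fun n : ℕ => exists_schwartz_eLpNorm_sub_le hp.le hg (hε n)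
  have hto : Tendsto (fun n : ℕ => ENNReal.ofReal ((1 / 2) ^ n)) atTop (𝓝 0) := by
    rw [← ENNReal.ofReal_zero]
    exact (ENNReal.continuous_ofReal.tendsto 0).comp
      (tendsto_pow_atTop_nhds_zero_of_lt_one (by norm_num) (by norm_num))
  -- Two approximants within `2 ^ (-N)` of `g` have images within `2 C * 2 ^ (-N)`; the added `1`
  -- makes the required inequality strict.
  set B : ℕ → ℝ≥0∞ := fun n => ((2 * C + 1 : ℝ≥0) : ℝ≥0∞) * ENNReal.ofReal ((1 / 2) ^ n) with hB
  have hBsum : ∑' n, B n ≠ ⊤ := by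
    rw [ENNReal.tsum_mul_left]
    refine ENNReal.mul_ne_top ENNReal.coe_ne_top ?_
    have : ∀ n : ℕ, ENNReal.ofReal ((1 / 2 : ℝ) ^ n) = (2⁻¹ : ℝ≥0∞) ^ n := fun n => by
      rw [ENNReal.ofReal_pow (by norm_num), one_div, ENNReal.ofReal_inv_of_pos two_pos]
      simp
    simp_rw [this, ENNReal.tsum_geometric, ENNReal.one_sub_inv_two, inv_inv]
    simp
  obtain ⟨h, hh, hlim⟩ := Lp.cauchy_complete_eLpNorm hp1 (fun n => memLp_cMinusSchwartz hp (u n))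
    hBsum (fun N n m hn hm => by
      have hle : ∀ n, N ≤ n → eLpNorm (fun x => u n x - g x) (ENNReal.ofReal p) volume ≤
          ENNReal.ofReal ((1 / 2) ^ N) := fun n hn => (hu n).trans
        (ENNReal.ofReal_le_ofReal (pow_le_pow_of_le_one (by norm_num) (by norm_num) hn))
      have h1 : eLpNorm (fun x => u n x - u m x) (ENNReal.ofReal p) volume ≤
          ENNReal.ofReal ((1 / 2) ^ N) + ENNReal.ofReal ((1 / 2) ^ N) := by
        have e : (fun x => u n x - u m x) =
            (fun x => u n x - g x) - fun x => u m x - g x := by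
          funext x; simp
        rw [e]
        exact (eLpNorm_sub_le ((memLp_schwartz _ p).sub hg).1 ((memLp_schwartz _ p).sub hg).1
          hp1).trans (add_le_add (hle n hn) (hle m hm))
      refine ((hC _ _).trans (mul_le_mul_right h1 _)).trans_lt ?_
      have h2 : ENNReal.ofReal ((1 / 2) ^ N) ≠ 0 := by simp
      have h3 : (C : ℝ≥0∞) * (ENNReal.ofReal ((1 / 2) ^ N) + ENNReal.ofReal ((1 / 2) ^ N)) =
          ((2 * C : ℝ≥0) : ℝ≥0∞) * ENNReal.ofReal ((1 / 2) ^ N) := by push_cast; ring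
      rw [h3, hB]
      refine (ENNReal.mul_lt_mul_iff_left h2 ENNReal.ofReal_ne_top).2 ?_
      exact_mod_cast lt_add_one (2 * C))
  refine ⟨h, hg, hh, u, ?_, hlim⟩
  exact tendsto_of_tendsto_of_tendsto_of_le_of_le tendsto_const_nhds hto (fun _ => zero_le) hu

theorem tendsto_integral_mul_of_tendsto_eLpNorm {p q : ℝ} (hpq : p.HolderConjugate q)
    {u : ℕ → ℝ → ℂ} {g w : ℝ → ℂ} (hu : ∀ n, MemLp (u n) (ENNReal.ofReal p) volume)
    (hg : MemLp g (ENNReal.ofReal p) volume) (hw : MemLp w (ENNReal.ofReal q) volume)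
    (hlim : Tendsto (fun n => eLpNorm (fun x => u n x - g x) (ENNReal.ofReal p) volume)
      atTop (𝓝 0)) :
    Tendsto (fun n => ∫ x, u n x * w x) atTop (𝓝 (∫ x, g x * w x)) := by
  rw [tendsto_iff_edist_tendsto_0]
  have h0 : Tendsto (fun n => eLpNorm (fun x => u n x - g x) (ENNReal.ofReal p) volume *
      eLpNorm w (ENNReal.ofReal q) volume) atTop (𝓝 0) := by
    rw [← zero_mul (eLpNorm w (ENNReal.ofReal q) volume)]
    exact ENNReal.Tendsto.mul_const hlim (Or.inr hw.2.ne)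
  refine tendsto_of_tendsto_of_tendsto_of_le_of_le tendsto_const_nhds h0 (fun _ => zero_le)
    fun n => ?_
  simp only
  rw [edist_eq_enorm_sub, ← integral_sub (integrable_mul_of_memLp hpq (hu n) hw)
    (integrable_mul_of_memLp hpq hg hw)]
  simp_rw [← sub_mul]
  exact enorm_integral_mul_le hpq ((hu n).sub hg).1 hw.1

/-- Both pairings are continuous along the approximating sequence by Hölder's inequality, so the
transposition formula survives the limit. Through it every estimate for `h` becomes an integral of
`g` against a boundary value of a holomorphic function. -/
theorem IsCMinus.integral_mul_eq {p q : ℝ} (hpq : p.HolderConjugate q) {g h : ℝ → ℂ}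
    (hgh : IsCMinus (ENNReal.ofReal p) g h) (v : 𝓢(ℝ, ℂ)) :
    ∫ x, h x * v x = ∫ x : ℝ, g x * hardyExt v x := by
  obtain ⟨hg, hh, u, hu, hCu⟩ := hgh
  have h1 := tendsto_integral_mul_of_tendsto_eLpNorm hpq (fun n => memLp_schwartz (u n) p) hg
    (memLp_hardyExt hpq.symm.lt v) hu
  have h2 := tendsto_integral_mul_of_tendsto_eLpNorm hpq
    (fun n => memLp_cMinusSchwartz hpq.lt (u n)) hh (memLp_schwartz v q) hCu
  simp_rw [integral_cMinusSchwartz_mul] at h2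
  exact tendsto_nhds_unique h2 h1

/-- The `L^p` norm is determined by duality with Schwartz functions. -/
theorem eLpNorm_le_of_forall_schwartz {p q : ℝ} (hpq : p.HolderConjugate q) {h : ℝ → ℂ}
    (hh : MemLp h (ENNReal.ofReal p) volume) {B : ℝ≥0∞}
    (hB : ∀ v : 𝓢(ℝ, ℂ), ‖∫ x, h x * v x‖ₑ ≤ B * eLpNorm v (ENNReal.ofReal q) volume) :
    eLpNorm h (ENNReal.ofReal p) volume ≤ B := by
  by_cases hBtop : B = ⊤
  · rw [hBtop]; exact le_top
  have hp0 := hpq.pos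
  have hq0 := hpq.symm.pos
  have hp1 := hpq.lt
  have hq1 : 1 ≤ ENNReal.ofReal q := by
    rw [← ENNReal.ofReal_one]; exact ENNReal.ofReal_le_ofReal hpq.symm.lt.le
  set X := ∫⁻ x, ‖h x‖ₑ ^ p with hX
  have hnorm : eLpNorm h (ENNReal.ofReal p) volume = X ^ (1 / p) := eLpNorm_ofReal_eq hp0 _ _
  have hXtop : X ≠ ⊤ := by
    intro hcon
    have := hh.2
    rw [hnorm, hcon, ENNReal.top_rpow_of_pos (by positivity)] at this
    exact lt_irrefl _ this
  -- The extremal function of Hölder's inequality. Its zeros are harmless: the quotient there is `0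
  -- / 0 = 0`.
  set w : ℝ → ℂ := fun x => (((‖h x‖ ^ (p - 1) / ‖h x‖ : ℝ)) : ℂ) * (starRingEnd ℂ) (h x) with hw
  have hwn : ∀ x, ‖w x‖ = ‖h x‖ ^ (p - 1) := by
    intro x
    rw [hw, norm_mul, Complex.norm_real, RCLike.norm_conj, Real.norm_of_nonneg (by positivity)]
    by_cases h0 : ‖h x‖ = 0
    · rw [h0, Real.zero_rpow (by linarith)]; simp
    · field_simp
  have hhw : ∀ x, h x * w x = ((‖h x‖ ^ p : ℝ) : ℂ) := by
    intro x
    rw [hw, mul_left_comm, Complex.mul_conj, Complex.normSq_eq_norm_sq, ← Complex.ofReal_mul]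
    congr 1
    by_cases h0 : ‖h x‖ = 0
    · rw [h0, Real.zero_rpow (by linarith), Real.zero_rpow (by linarith)]; simp
    · rw [Real.rpow_sub_one h0]; field_simp
  have hwm : AEStronglyMeasurable w := by
    have h1 : AEMeasurable h := hh.1.aemeasurable
    have : AEMeasurable w := by
      refine AEMeasurable.mul ?_ (Complex.continuous_conj.measurable.comp_aemeasurable h1)
      exact Complex.measurable_ofReal.comp_aemeasurable
        ((h1.norm.pow_const _).div h1.norm)
    exact this.aestronglyMeasurable
  have hwq : ∀ x, ‖w x‖ₑ ^ q = ‖h x‖ₑ ^ p := by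
    intro x
    rw [← ofReal_norm, hwn, ← ofReal_norm, ENNReal.ofReal_rpow_of_nonneg (by positivity) hq0.le,
      ENNReal.ofReal_rpow_of_nonneg (by positivity) hp0.le, ← Real.rpow_mul (norm_nonneg _),
      hpq.sub_one_mul_conj]
  have hwnorm : eLpNorm w (ENNReal.ofReal q) volume = X ^ (1 / q) := by
    rw [eLpNorm_ofReal_eq hq0]
    simp_rw [hwq]
    rfl
  have hwL : MemLp w (ENNReal.ofReal q) volume :=
    ⟨hwm, by rw [hwnorm]; exact (ENNReal.rpow_ne_top_of_nonneg (by positivity) hXtop).lt_top⟩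
  have hXi : ‖∫ x, h x * w x‖ₑ = X := by
    simp_rw [hhw]
    rw [integral_complex_ofReal, ← ofReal_norm, Complex.norm_real, Real.norm_of_nonneg
        (integral_nonneg fun x => by positivity), ofReal_integral_eq_lintegral_ofReal]
    · refine lintegral_congr fun x => ?_
      rw [← ENNReal.ofReal_rpow_of_nonneg (norm_nonneg _) hp0.le, ofReal_norm]
    · have := integrable_mul_of_memLp hpq hh hwL
      simp_rw [hhw] at this
      have := this.re
      simpa using this
    · exact Eventually.of_forall fun x => by positivity
  have hle : X ≤ B * X ^ (1 / q) := by
    -- The extremal function is not Schwartz, so the hypothesis is used for approximants within `1 /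
    -- (n + 1)`; both errors vanish in the limit because `B` and `X` are finite.
    have happ : ∀ n : ℕ, X ≤ B * (X ^ (1 / q) + ENNReal.ofReal (1 / ((n : ℝ) + 1))) +
        X ^ (1 / p) * ENNReal.ofReal (1 / ((n : ℝ) + 1)) := by
      intro n
      obtain ⟨v, hv⟩ := exists_schwartz_eLpNorm_sub_le hpq.symm.lt.le hwL
        (show (0 : ℝ) < 1 / ((n : ℝ) + 1) by positivity)
      have hvL := memLp_schwartz v q
      have hvn : eLpNorm v (ENNReal.ofReal q) volume ≤
          X ^ (1 / q) + ENNReal.ofReal (1 / ((n : ℝ) + 1)) := by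
        have e : (v : ℝ → ℂ) = w + fun x => v x - w x := by funext x; simp
        rw [e, ← hwnorm]
        exact (eLpNorm_add_le hwm (hvL.sub hwL).1 hq1).trans (add_le_add le_rfl hv)
      have e : ∫ x, h x * w x = (∫ x, h x * v x) - ∫ x, h x * (v x - w x) := by
        have hi : Integrable fun x => h x * (v x - w x) :=
          integrable_mul_of_memLp hpq hh (hvL.sub hwL)
        rw [← integral_sub (integrable_mul_of_memLp hpq hh hvL) hi]
        refine integral_congr_ae (Eventually.of_forall fun x => ?_)
        simp only
        ring
      refine (hXi.symm.trans (congrArg _ e)).trans_le ?_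
      refine (enorm_sub_le).trans (add_le_add ((hB v).trans ?_) ?_)
      · gcongr
      · refine (enorm_integral_mul_le hpq hh.1 (hvL.sub hwL).1).trans ?_
        rw [hnorm]
        gcongr
        exact hv
    have hlim : Tendsto (fun n : ℕ => B * (X ^ (1 / q) + ENNReal.ofReal (1 / ((n : ℝ) + 1))) +
        X ^ (1 / p) * ENNReal.ofReal (1 / ((n : ℝ) + 1))) atTop
        (𝓝 (B * (X ^ (1 / q) + 0) + X ^ (1 / p) * 0)) := by
      have h0 : Tendsto (fun n : ℕ => ENNReal.ofReal (1 / ((n : ℝ) + 1))) atTop (𝓝 0) := by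
        rw [← ENNReal.ofReal_zero]
        exact (ENNReal.continuous_ofReal.tendsto 0).comp tendsto_one_div_add_atTop_nhds_zero_nat
      exact (ENNReal.Tendsto.const_mul (tendsto_const_nhds.add h0) (Or.inr hBtop)).add
        (ENNReal.Tendsto.const_mul h0
          (Or.inr (ENNReal.rpow_ne_top_of_nonneg (by positivity) hXtop)))
    rw [add_zero, mul_zero, add_zero] at hlim
    exact ge_of_tendsto' hlim happ
  rw [hnorm]
  by_cases hX0 : X = 0
  · rw [hX0, ENNReal.zero_rpow_of_pos (by positivity)]; exact zero_le
  have hexp : 1 / p + 1 / q = 1 := by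
    have := hpq.inv_add_inv_eq_one
    simpa [one_div] using this
  have hsplit : X = X ^ (1 / p) * X ^ (1 / q) := by
    rw [← ENNReal.rpow_add_of_nonneg _ _ (by positivity) (by positivity), hexp,
      ENNReal.rpow_one]
  nth_rw 1 [hsplit] at hle
  have hXq0 : X ^ (1 / q) ≠ 0 := by
    rw [Ne, ENNReal.rpow_eq_zero_iff]; push Not
    exact ⟨fun h => absurd h hX0, fun h => absurd h hXtop⟩
  have hXqt : X ^ (1 / q) ≠ ⊤ := ENNReal.rpow_ne_top_of_nonneg (by positivity) hXtop
  rwa [ENNReal.mul_le_mul_iff_left hXq0 hXqt] at hle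

/-- Duality with the bound for positive frequencies in the conjugate exponent. This alone settles
the case `γ = 0` of the theorem. -/
theorem IsCMinus.eLpNorm_le {p : ℝ} (hp : 1 < p) :
    ∃ C : ℝ≥0, ∀ g h : ℝ → ℂ, IsCMinus (ENNReal.ofReal p) g h →
      eLpNorm h (ENNReal.ofReal p) volume ≤ C * eLpNorm g (ENNReal.ofReal p) volume := by
  have hpq := Real.HolderConjugate.conjExponent hp
  obtain ⟨C, hC⟩ := eLpNorm_hardyExt_le hpq.symm.lt
  refine ⟨C, fun g h hgh => eLpNorm_le_of_forall_schwartz hpq hgh.2.1 fun v => ?_⟩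
  rw [hgh.integral_mul_eq hpq]
  refine (enorm_integral_mul_le hpq hgh.1.1 (memLp_hardyExt hpq.symm.lt v).1).trans ?_
  rw [mul_comm (C : ℝ≥0∞), mul_assoc]
  exact mul_le_mul_right (hC v) _

/-! ### Kernels for almost analytic extension. -/

/-- Smooth functions on the line supported in `[-1, 1]`. -/
structure IsUnitKernel (K : ℝ → ℂ) : Prop where
  contDiff : ContDiff ℝ ((⊤ : ℕ∞) : WithTop ℕ∞) K
  eq_zero : ∀ s, 1 < |s| → K s = 0

namespace IsUnitKernel

variable {K : ℝ → ℂ}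

lemma hasCompactSupport (hK : IsUnitKernel K) : HasCompactSupport K := by
  refine HasCompactSupport.intro (isCompact_Icc (a := (-1 : ℝ)) (b := 1)) fun s hs => hK.eq_zero s ?_
  by_contra h
  exact hs (abs_le.1 (not_lt.1 h))

lemma continuous (hK : IsUnitKernel K) : Continuous K := hK.contDiff.continuous

lemma integrable (hK : IsUnitKernel K) : Integrable K :=
  hK.continuous.integrable_of_hasCompactSupport hK.hasCompactSupport

lemma differentiable (hK : IsUnitKernel K) : Differentiable ℝ K :=
  hK.contDiff.differentiable (by simp)

lemma deriv (hK : IsUnitKernel K) : IsUnitKernel (deriv K) := by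
  refine ⟨hK.contDiff.deriv' , fun s hs => ?_⟩
  have : K =ᶠ[𝓝 s] fun _ => 0 := by
    have : ∀ᶠ u in 𝓝 s, 1 < |u| := continuous_abs.continuousAt.eventually_const_lt hs
    filter_upwards [this] with u hu using hK.eq_zero u hu
  rw [this.deriv_eq]; simp

lemma id_mul (hK : IsUnitKernel K) : IsUnitKernel fun s => (s : ℂ) * K s := by
  refine ⟨ContDiff.mul ?_ hK.contDiff, fun s hs => by simp [hK.eq_zero s hs]⟩
  exact Complex.ofRealCLM.contDiff

lemma bounded (hK : IsUnitKernel K) : ∃ C : ℝ, 0 < C ∧ ∀ s, ‖K s‖ ≤ C := by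
  obtain ⟨C, hC⟩ := hK.continuous.bounded_above_of_compact_support hK.hasCompactSupport
  exact ⟨max C 1, by positivity, fun s => (hC s).trans (le_max_left _ _)⟩

lemma integral_deriv (hK : IsUnitKernel K) : ∫ s, _root_.deriv K s = 0 :=
  integral_eq_zero_of_hasDerivAt_of_integrable (fun s => (hK.differentiable s).hasDerivAt)
    hK.deriv.integrable hK.integrable

end IsUnitKernel

/-- Integration by parts of arbitrary order against a smooth compactly supported function. -/
lemma integral_iteratedDeriv_mul {L : ℝ → ℝ} (hL : ContDiff ℝ ((⊤ : ℕ∞) : WithTop ℕ∞) L)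
    (hc : HasCompactSupport L) {g : ℕ → ℝ → ℂ}
    (hg : ∀ j s, HasDerivAt (g j) (g (j + 1) s) s) (n j : ℕ) :
    ∫ s, ((iteratedDeriv n L s : ℝ) : ℂ) * g j s = (-1) ^ n * ∫ s, (L s : ℂ) * g (j + n) s := by
  induction n generalizing j with
  | zero => simp
  | succ n ih =>
    have hcont : ∀ m, Continuous (g m) := fun m =>
      continuous_iff_continuousAt.2 fun s => (hg m s).continuousAt
    have hsm : ∀ m, Continuous (iteratedDeriv m L) := fun m => hL.continuous_iteratedDeriv m (by
      exact_mod_cast le_top)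
    have hcs : ∀ m, HasCompactSupport (iteratedDeriv m L) := by
      intro m
      induction m with
      | zero => simpa using hc
      | succ m ih => rw [iteratedDeriv_succ]; exact ih.deriv
    have hint : ∀ m i, Integrable fun s => ((iteratedDeriv m L s : ℝ) : ℂ) * g i s := by
      intro m i
      refine ((Complex.continuous_ofReal.comp (hsm m)).mul (hcont i)).integrable_of_hasCompactSupport ?_
      exact HasCompactSupport.mul_right ((hcs m).comp_left (by simp))
    have hd : ∀ s, HasDerivAt (fun s => ((iteratedDeriv n L s : ℝ) : ℂ))
        ((iteratedDeriv (n + 1) L s : ℝ) : ℂ) s := by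
      intro s
      apply HasDerivAt.ofReal_comp
      rw [iteratedDeriv_succ]
      exact ((hL.differentiable_iteratedDeriv n (by
        exact_mod_cast WithTop.coe_lt_top _)) s).hasDerivAt
    have h := integral_mul_deriv_eq_deriv_mul_of_integrable
      (u := fun s => ((iteratedDeriv n L s : ℝ) : ℂ)) (v := g j)
      (u' := fun s => ((iteratedDeriv (n + 1) L s : ℝ) : ℂ)) (v' := g (j + 1))
      (fun s _ => hd s) (fun s _ => hg j s) (hint n (j + 1)) (hint (n + 1) j) (hint n j)
    have h2 : ∫ s, ((iteratedDeriv (n + 1) L s : ℝ) : ℂ) * g j s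
        = -∫ s, ((iteratedDeriv n L s : ℝ) : ℂ) * g (j + 1) s := by rw [h, neg_neg]
    rw [h2, ih (j + 1), pow_succ, show j + 1 + n = j + (n + 1) by ring]
    ring

lemma one_sub_I_mul_ne_zero (s : ℝ) : (1 - Complex.I * s : ℂ) ≠ 0 := by
  intro h
  have := congrArg Complex.re h
  simp at this

lemma hasDerivAt_inv_pow_one_sub_I_mul (j : ℕ) (s : ℝ) :
    HasDerivAt (fun s : ℝ => Complex.I ^ j * (j.factorial : ℂ) * ((1 - Complex.I * s) ^ (j + 1))⁻¹)
      (Complex.I ^ (j + 1) * ((j + 1).factorial : ℂ) * ((1 - Complex.I * s) ^ (j + 1 + 1))⁻¹) s := by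
  have h0 : HasDerivAt (fun s : ℝ => (1 - Complex.I * s : ℂ)) (-Complex.I) s := by
    simpa using ((HasDerivAt.ofReal_comp (hasDerivAt_id s)).const_mul Complex.I).const_sub 1
  have h1 := ((h0.pow (j + 1)).inv (pow_ne_zero _ (one_sub_I_mul_ne_zero s))).const_mul
    (Complex.I ^ j * (j.factorial : ℂ))
  refine h1.congr_deriv ?_
  have hne := one_sub_I_mul_ne_zero s
  simp only [Nat.add_sub_cancel, Pi.pow_apply]
  rw [Nat.factorial_succ]
  push_cast
  field_simp
  ring

/-- A smooth kernel `K` supported in `[-1, 1]` with `∫ K = 1`, `∫ s K = -i`, for which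
`(1 - i s) K` is a multiple of the derivative of order `M` of a real bump function. -/
structure ExtensionKernel (M : ℕ) where
  bump : ℝ → ℝ
  contDiff_bump : ContDiff ℝ ((⊤ : ℕ∞) : WithTop ℕ∞) bump
  tsupport_bump : tsupport bump ⊆ Icc (-1) 1
  const : ℂ
  ker : ℝ → ℂ
  isUnitKernel : IsUnitKernel ker
  integral_ker : ∫ s, ker s = 1
  integral_id_mul_ker : ∫ s : ℝ, (s : ℂ) * ker s = -Complex.I
  mul_ker : ∀ s : ℝ, (1 - Complex.I * s) * ker s = const * ((iteratedDeriv M bump s : ℝ) : ℂ)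

lemma tsupport_iteratedDeriv_subset (L : ℝ → ℝ) (n : ℕ) :
    tsupport (iteratedDeriv n L) ⊆ tsupport L := by
  induction n with
  | zero => simp
  | succ n ih => rw [iteratedDeriv_succ]; exact fun s hs => ih (tsupport_deriv_subset hs)

/-- Near `s = 0` the weight has real part above `1/2`, so a bump concentrated there has an integral
with positive real part. -/
lemma exists_bump_integral_ne_zero (M : ℕ) : ∃ L : ℝ → ℝ,
    ContDiff ℝ ((⊤ : ℕ∞) : WithTop ℕ∞) L ∧ tsupport L ⊆ Icc (-1) 1 ∧
    ∫ s : ℝ, (L s : ℂ) * ((1 - Complex.I * s) ^ (M + 1))⁻¹ ≠ 0 := by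
  set w : ℝ → ℂ := fun s => ((1 - Complex.I * s) ^ (M + 1))⁻¹ with hw
  have hwc : Continuous w := by
    refine Continuous.inv₀ (by fun_prop) fun s => pow_ne_zero _ (one_sub_I_mul_ne_zero s)
  have hev : ∀ᶠ s in 𝓝 (0 : ℝ), 1 / 2 < (w s).re := by
    refine (Complex.continuous_re.comp hwc).continuousAt.eventually_const_lt ?_
    simp [hw]; norm_num
  obtain ⟨δ, hδ, hball⟩ := Metric.eventually_nhds_iff_ball.1 hev
  set b : ContDiffBump (0 : ℝ) :=
    ⟨min δ 1 / 4, min δ 1 / 2, by positivity, by linarith [lt_min hδ one_pos]⟩ with hb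
  have hts : tsupport (b : ℝ → ℝ) = Metric.closedBall 0 (min δ 1 / 2) := b.tsupport_eq
  have hpos : 0 < min δ 1 := lt_min hδ one_pos
  refine ⟨b, b.contDiff, ?_, ?_⟩
  · rw [hts, Real.closedBall_eq_Icc]
    have := min_le_right δ 1
    exact Icc_subset_Icc (by linarith) (by linarith)
  · have hint : Integrable fun s => (b s : ℂ) * w s := by
      refine ((Complex.continuous_ofReal.comp b.continuous).mul hwc).integrable_of_hasCompactSupport ?_
      exact HasCompactSupport.mul_right (b.hasCompactSupport.comp_left (by simp))
    intro h0
    have hre : ∫ s, b s * (w s).re = 0 := by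
      have := congrArg Complex.re h0
      rw [← RCLike.re_eq_complex_re, ← integral_re hint] at this
      simpa using this
    have hge : ∫ s, b s * (1 / 2) ≤ ∫ s, b s * (w s).re := by
      refine integral_mono (b.integrable.mul_const _) ?_ fun s => ?_
      · simpa using hint.re
      · by_cases hs : s ∈ Metric.ball (0 : ℝ) δ
        · exact mul_le_mul_of_nonneg_left (hball s hs).le b.nonneg
        · have : b s = 0 := b.zero_of_le_dist (by
            have h1 := Metric.mem_ball.not.1 hs
            have h2 := min_le_left δ 1
            show min δ 1 / 2 ≤ _
            linarith)
          simp [this]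
    rw [integral_mul_const] at hge
    have := b.integral_pos (μ := volume)
    linarith

/-- The kernel is the normalised quotient of the derivative of order `M` of a bump by `1 - i s`. The
normalisation is nonzero because `M` integrations by parts turn it into a multiple of the integral
of the bump against `(1 - i s) ^ (-(M + 1))`. Since `M ≥ 1`, the integral of `(1 - i s) K` is that
of a derivative, hence zero, which fixes the first moment as `-i`. -/
lemma exists_extensionKernel (M : ℕ) (hM : 1 ≤ M) : Nonempty (ExtensionKernel M) := by
  obtain ⟨L, hL, hts, hne⟩ := exists_bump_integral_ne_zero M
  have hcL : HasCompactSupport L := (isCompact_Icc).of_isClosed_subset (isClosed_tsupport L) hts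
  have hI : ∫ s : ℝ, ((iteratedDeriv M L s : ℝ) : ℂ) * (1 - Complex.I * s)⁻¹ ≠ 0 := by
    have := integral_iteratedDeriv_mul hL hcL
      (g := fun j s => Complex.I ^ j * (j.factorial : ℂ) * ((1 - Complex.I * s) ^ (j + 1))⁻¹)
      hasDerivAt_inv_pow_one_sub_I_mul M 0
    simp only [pow_zero, Nat.factorial_zero, Nat.cast_one, mul_one, one_mul, zero_add, pow_one]
      at this
    rw [this]
    refine mul_ne_zero (by simp) ?_
    have h2 : ∀ s : ℝ, (L s : ℂ) * (Complex.I ^ M * (M.factorial : ℂ) * ((1 - Complex.I * s) ^ (M + 1))⁻¹)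
      = (Complex.I ^ M * (M.factorial : ℂ)) * ((L s : ℂ) * ((1 - Complex.I * s) ^ (M + 1))⁻¹) :=
      fun s => by ring
    simp_rw [h2]
    rw [integral_const_mul]
    exact mul_ne_zero (mul_ne_zero (by simp) (by exact_mod_cast M.factorial_ne_zero)) hne
  set I0 := ∫ s : ℝ, ((iteratedDeriv M L s : ℝ) : ℂ) * (1 - Complex.I * s)⁻¹ with hI0
  set K : ℝ → ℂ := fun s => I0⁻¹ * (((iteratedDeriv M L s : ℝ) : ℂ) * (1 - Complex.I * s)⁻¹) with hKdef
  have hzero : ∀ s, 1 < |s| → iteratedDeriv M L s = 0 := by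
    intro s hs
    refine image_eq_zero_of_notMem_tsupport fun h => ?_
    have := hts (tsupport_iteratedDeriv_subset L M h)
    exact absurd (abs_le.2 this) (not_le.2 hs)
  have hsm : ContDiff ℝ ((⊤ : ℕ∞) : WithTop ℕ∞) (iteratedDeriv M L) :=
    by
    rw [iteratedDeriv_eq_iterate]
    exact ContDiff.iterate_deriv M hL
  have hK : IsUnitKernel K := by
    refine ⟨contDiff_const.mul (ContDiff.mul ?_ (ContDiff.inv ?_ fun s => one_sub_I_mul_ne_zero s)), ?_⟩
    · exact Complex.ofRealCLM.contDiff.comp hsm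
    · exact contDiff_const.sub (contDiff_const.mul Complex.ofRealCLM.contDiff)
    · intro s hs; simp [hKdef, hzero s hs]
  have hmul : ∀ s : ℝ, (1 - Complex.I * s) * K s = I0⁻¹ * ((iteratedDeriv M L s : ℝ) : ℂ) := by
    intro s
    have := one_sub_I_mul_ne_zero s
    simp only [hKdef]; field_simp
  have h1 : ∫ s, K s = 1 := by
    simp only [hKdef]
    rw [integral_const_mul, inv_mul_cancel₀ hI]
  refine ⟨⟨L, hL, hts, I0⁻¹, K, hK, h1, ?_, hmul⟩⟩
  have h3 : ∫ s : ℝ, (1 - Complex.I * s) * K s = 0 := by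
    simp_rw [hmul]
    rw [integral_const_mul]
    have := integral_iteratedDeriv_mul hL hcL (g := fun j _ => if j = 0 then 1 else 0)
      (fun j s => by
        simp only [Nat.add_eq_zero_iff, one_ne_zero, and_false, if_false]
        exact hasDerivAt_const _ _) M 0
    simp only [if_true, mul_one, zero_add, show M ≠ 0 by omega, if_false, mul_zero,
      integral_zero] at this
    rw [this, mul_zero]
  have h4 : ∫ s : ℝ, (1 - Complex.I * s) * K s = 1 - Complex.I * ∫ s : ℝ, (s : ℂ) * K s := by
    conv_rhs => rw [← h1]
    rw [← integral_const_mul, ← integral_sub hK.integrable (hK.id_mul.integrable.const_mul _)]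
    congr 1; ext s; ring
  rw [h4] at h3
  linear_combination Complex.I * h3 + (∫ s : ℝ, (s : ℂ) * K s) * Complex.I_mul_I

/-- The average of `u` at scale `z.im` around `z.re`, with weight `K`. -/
noncomputable def kerExt (K u : ℝ → ℂ) (z : ℂ) : ℂ :=
  (z.im : ℂ)⁻¹ * ∫ r, K ((z.re - r) / z.im) * u r

/-- Twice the Wirtinger derivative with respect to the conjugate variable. -/
noncomputable def dbar (f : ℂ → ℂ) (z : ℂ) : ℂ := fderiv ℝ f z 1 + Complex.I * fderiv ℝ f z Complex.I

lemma kerExt_eq (K u : ℝ → ℂ) {z : ℂ} (hz : 0 < z.im) :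
    kerExt K u z = ∫ s, K s * u (z.re - s * z.im) := by
  have h1 := Measure.integral_comp_mul_right (fun r => K (r / z.im) * u (z.re - r)) z.im
  have h2 := integral_sub_left_eq_self (fun r => K ((z.re - r) / z.im) * u r) volume z.re
  simp only [sub_sub_cancel] at h2
  rw [h2] at h1
  simp only [mul_div_cancel_right₀ _ hz.ne'] at h1
  rw [h1, kerExt, abs_of_pos (inv_pos.2 hz), Complex.real_smul]
  push_cast; rfl

namespace IsUnitKernel

variable {K : ℝ → ℂ}

lemma kerExt_congr (hK : IsUnitKernel K) {u v : ℝ → ℂ} {z : ℂ} (hz : 0 < z.im)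
    (h : ∀ r, |r - z.re| ≤ z.im → u r = v r) : kerExt K u z = kerExt K v z := by
  unfold kerExt
  congr 2
  ext r
  by_cases hr : |r - z.re| ≤ z.im
  · rw [h r hr]
  · rw [hK.eq_zero _ (by rw [abs_div, abs_of_pos hz, one_lt_div hz, abs_sub_comm]; exact not_le.1 hr)]
    simp

lemma norm_kerExt_le (hK : IsUnitKernel K) {C : ℝ} (hC : ∀ s, ‖K s‖ ≤ C) {u : ℝ → ℂ} {z : ℂ}
    (hz : 0 < z.im) {δ : ℝ} (h : ∀ r, |r - z.re| ≤ z.im → ‖u r‖ ≤ δ) :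
    ‖kerExt K u z‖ ≤ 2 * C * δ := by
  rw [kerExt_eq K u hz]
  have hC0 : 0 ≤ C := (norm_nonneg _).trans (hC 0)
  have : ‖∫ s, K s * u (z.re - s * z.im)‖ ≤ ∫ s, (Icc (-1 : ℝ) 1).indicator (fun _ => C * δ) s := by
    refine norm_integral_le_of_norm_le ?_ (Eventually.of_forall fun s => ?_)
    · exact (integrable_indicator_iff measurableSet_Icc).2 (integrableOn_const (by simp))
    · by_cases hs : s ∈ Icc (-1 : ℝ) 1
      · rw [indicator_of_mem hs, norm_mul]
        refine mul_le_mul (hC s) (h _ ?_) (norm_nonneg _) hC0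
        rw [sub_sub_cancel_left, abs_neg, abs_mul, abs_of_pos hz]
        exact mul_le_of_le_one_left hz.le (abs_le.2 hs)
      · rw [indicator_of_notMem hs, hK.eq_zero s (not_le.1 fun h => hs (abs_le.1 h))]
        simp
  refine this.trans (le_of_eq ?_)
  rw [integral_indicator measurableSet_Icc, setIntegral_const, smul_eq_mul, measureReal_def,
    Real.volume_Icc, ENNReal.toReal_ofReal (by norm_num)]
  ring

lemma enorm_kerExt_le (hK : IsUnitKernel K) {C : ℝ≥0} (hC : ∀ s, ‖K s‖ ≤ C) (u : ℝ → ℂ) {z : ℂ}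
    (hz : 0 < z.im) :
    ‖kerExt K u z‖ₑ ≤ C * ∫⁻ s in Icc (-1 : ℝ) 1, ‖u (z.re - s * z.im)‖ₑ := by
  rw [kerExt_eq K u hz]
  refine (enorm_integral_le_lintegral_enorm _).trans ?_
  rw [← lintegral_const_mul' _ _ ENNReal.coe_ne_top, ← lintegral_indicator measurableSet_Icc]
  refine lintegral_mono fun s => ?_
  by_cases hs : s ∈ Icc (-1 : ℝ) 1
  · rw [indicator_of_mem hs, enorm_mul]
    gcongr
    rw [enorm_le_coe]
    exact hC s
  · rw [hK.eq_zero s (not_le.1 fun h => hs (abs_le.1 h))]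
    simp

lemma integrable_mul_comp (hK : IsUnitKernel K) {u : ℝ → ℂ} {z : ℂ} (hz : 0 < z.im)
    (hu : ContinuousOn u (Icc (z.re - z.im) (z.re + z.im))) :
    Integrable fun s => K s * u (z.re - s * z.im) := by
  have h1 : IntegrableOn (fun s => K s * u (z.re - s * z.im)) (Icc (-1 : ℝ) 1) := by
    refine ContinuousOn.integrableOn_Icc (hK.continuous.continuousOn.mul (hu.comp (by fun_prop) ?_))
    rintro s ⟨h1, h2⟩
    constructor <;> nlinarith
  rw [← integrable_indicator_iff measurableSet_Icc] at h1
  refine h1.congr (Eventually.of_forall fun s => ?_)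
  by_cases hs : s ∈ Icc (-1 : ℝ) 1
  · exact indicator_of_mem hs _
  · rw [indicator_of_notMem hs]
    simp only
    rw [hK.eq_zero s (not_le.1 fun h => hs (abs_le.1 h)), zero_mul]

lemma kerExt_sub (hK : IsUnitKernel K) {u v : ℝ → ℂ} {z : ℂ} (hz : 0 < z.im)
    (hu : ContinuousOn u (Icc (z.re - z.im) (z.re + z.im)))
    (hv : ContinuousOn v (Icc (z.re - z.im) (z.re + z.im))) :
    kerExt K (fun r => u r - v r) z = kerExt K u z - kerExt K v z := by
  rw [kerExt_eq K _ hz, kerExt_eq K _ hz, kerExt_eq K _ hz,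
    ← integral_sub (hK.integrable_mul_comp hz hu) (hK.integrable_mul_comp hz hv)]
  congr 1; ext s; ring

lemma norm_kerExt_sub_le (hK : IsUnitKernel K) {C : ℝ} (hC : ∀ s, ‖K s‖ ≤ C) {u v : ℝ → ℂ} {z : ℂ}
    (hz : 0 < z.im) (hu : ContinuousOn u (Icc (z.re - z.im) (z.re + z.im)))
    (hv : ContinuousOn v (Icc (z.re - z.im) (z.re + z.im)))
    {δ : ℝ} (h : ∀ r, |r - z.re| ≤ z.im → ‖u r - v r‖ ≤ δ) :
    ‖kerExt K u z - kerExt K v z‖ ≤ 2 * C * δ := by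
  rw [← hK.kerExt_sub hz hu hv]
  exact hK.norm_kerExt_le hC hz h

/-- With `s = (x - r) / y`, the derivatives of `y⁻¹ K(s)` in `x` and `y` are `y⁻² K'(s)` and `-y⁻²
(s K)'(s)`. Both partial derivatives are thus again averages with smooth kernels in `[-1, 1]`, and
`u` itself is never differentiated. -/
lemma hasFDerivAt_kerExt (hK : IsUnitKernel K) {u : ℝ → ℂ} (hu : Integrable u) {z : ℂ}
    (hz : 0 < z.im) :
    HasFDerivAt (kerExt K u)
      (Complex.reCLM.smulRight ((z.im : ℂ)⁻¹ * kerExt (_root_.deriv K) u z) -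
        Complex.imCLM.smulRight
          ((z.im : ℂ)⁻¹ * kerExt (_root_.deriv fun s : ℝ => (s : ℂ) * K s) u z)) z := by
  obtain ⟨C1, hC1, hK1⟩ := hK.deriv.bounded
  obtain ⟨C2, hC2, hK2⟩ := hK.id_mul.deriv.bounded
  obtain ⟨C0, hC0, hK0⟩ := hK.bounded
  have hKc := hK.continuous
  have hKc1 := hK.deriv.continuous
  have hKc2 := hK.id_mul.deriv.continuous
  set y0 := z.im
  set F : ℂ → ℝ → ℂ := fun w r => (w.im : ℂ)⁻¹ * (K ((w.re - r) / w.im) * u r) with hF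
  set F' : ℂ → ℝ → ℂ →L[ℝ] ℂ := fun w r =>
    Complex.reCLM.smulRight ((w.im : ℂ)⁻¹ * ((w.im : ℂ)⁻¹ * (_root_.deriv K ((w.re - r) / w.im) * u r)))
    - Complex.imCLM.smulRight ((w.im : ℂ)⁻¹ * ((w.im : ℂ)⁻¹ *
      (_root_.deriv (fun s : ℝ => (s : ℂ) * K s) ((w.re - r) / w.im) * u r))) with hF'
  have hsd : ∀ {K : ℝ → ℂ} (_ : Continuous K) (w : ℂ), AEStronglyMeasurable (fun r => K ((w.re - r) / w.im) * u r) := by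
    intro K hK w
    exact (hK.comp (by fun_prop : Continuous fun r => (w.re - r) / w.im)).aestronglyMeasurable.mul hu.1
  have hsi : ∀ {K : ℝ → ℂ} (_ : Continuous K) {C : ℝ} (_ : ∀ s, ‖K s‖ ≤ C) (w : ℂ),
      Integrable (fun r => K ((w.re - r) / w.im) * u r) := by
    intro K hK C hC w
    exact hu.bdd_mul (c := C) (hK.comp (by fun_prop : Continuous fun r => (w.re - r) / w.im)).aestronglyMeasurable
      (Eventually.of_forall fun s => hC _)
  have hsub : ∀ w ∈ Metric.ball z (y0 / 2), y0 / 2 < w.im := by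
    intro w hw
    have h1 : |(w - z).im| ≤ ‖w - z‖ := Complex.abs_im_le_norm _
    rw [Metric.mem_ball, dist_eq_norm] at hw
    have h2 := (abs_le.1 (h1.trans hw.le)).1
    have h3 := lt_of_le_of_lt h1 hw
    rw [abs_lt, Complex.sub_im] at h3
    have : z.im = y0 := rfl
    linarith [h3.1]
  have main := hasFDerivAt_integral_of_dominated_of_fderiv_le (μ := volume) (F := F) (F' := F')
    (x₀ := z) (s := Metric.ball z (y0 / 2))
    (bound := fun r => ((y0 / 2)⁻¹ * ((y0 / 2)⁻¹ * (C1 * ‖u r‖)) + (y0 / 2)⁻¹ * ((y0 / 2)⁻¹ * (C2 * ‖u r‖))))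
    (Metric.ball_mem_nhds z (by positivity))
    (Eventually.of_forall fun w => (hsd hKc w).const_mul _)
    ((hsi hKc hK0 z).const_mul _) ?_ ?_ ?_ ?_
  · have e1 : ∫ r, F' z r = Complex.reCLM.smulRight ((z.im : ℂ)⁻¹ * kerExt (_root_.deriv K) u z) -
        Complex.imCLM.smulRight
          ((z.im : ℂ)⁻¹ * kerExt (_root_.deriv fun s : ℝ => (s : ℂ) * K s) u z) := by
      have hi1 := ((hsi hKc1 hK1 z).const_mul (z.im : ℂ)⁻¹).const_mul (z.im : ℂ)⁻¹
      have hi2 := ((hsi hKc2 hK2 z).const_mul (z.im : ℂ)⁻¹).const_mul (z.im : ℂ)⁻¹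
      have j1 := (ContinuousLinearMap.smulRightL ℝ ℂ ℂ Complex.reCLM).integral_comp_comm hi1
      have j2 := (ContinuousLinearMap.smulRightL ℝ ℂ ℂ Complex.imCLM).integral_comp_comm hi2
      have k1 := (ContinuousLinearMap.smulRightL ℝ ℂ ℂ Complex.reCLM).integrable_comp hi1
      have k2 := (ContinuousLinearMap.smulRightL ℝ ℂ ℂ Complex.imCLM).integrable_comp hi2
      simp only [ContinuousLinearMap.smulRightL_apply_apply] at j1 j2 k1 k2
      simp only [hF']
      rw [integral_sub k1 k2, j1, j2]
      simp only [integral_const_mul, kerExt]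
    rw [← e1]
    refine main.congr_of_eventuallyEq (Eventually.of_forall fun w => ?_)
    simp only [hF, kerExt, integral_const_mul]
  · have k1 := (ContinuousLinearMap.smulRightL ℝ ℂ ℂ Complex.reCLM).continuous.comp_aestronglyMeasurable
      (((hsd hKc1 z).const_mul (z.im : ℂ)⁻¹).const_mul (z.im : ℂ)⁻¹)
    have k2 := (ContinuousLinearMap.smulRightL ℝ ℂ ℂ Complex.imCLM).continuous.comp_aestronglyMeasurable
      (((hsd hKc2 z).const_mul (z.im : ℂ)⁻¹).const_mul (z.im : ℂ)⁻¹)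
    exact k1.sub k2
  · refine Eventually.of_forall fun r w hw => ?_
    have hw' := hsub w hw
    have hwpos : 0 < w.im := lt_trans (by positivity) hw'
    have hinv : ‖((w.im : ℂ)⁻¹)‖ ≤ (y0 / 2)⁻¹ := by
      rw [norm_inv, Complex.norm_real, Real.norm_of_nonneg hwpos.le]
      exact inv_anti₀ (by positivity) hw'.le
    refine (norm_sub_le _ _).trans ?_
    rw [ContinuousLinearMap.norm_smulRight_apply, ContinuousLinearMap.norm_smulRight_apply,
      Complex.reCLM_norm, Complex.imCLM_norm, one_mul, one_mul]
    simp only [norm_mul]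
    gcongr
    · exact hK1 _
    · exact hK2 _
  · exact (((hu.norm.const_mul _).const_mul _).const_mul _).add
      (((hu.norm.const_mul _).const_mul _).const_mul _)
  · refine Eventually.of_forall fun r w hw => ?_
    have hwpos : 0 < w.im := lt_trans (by positivity) (hsub w hw)
    have hne : (w.im : ℂ) ≠ 0 := by exact_mod_cast hwpos.ne'
    have d1 : HasFDerivAt (fun w : ℂ => (w.re - r) / w.im)
        ((w.im)⁻¹ • Complex.reCLM - ((w.re - r) / w.im ^ 2) • Complex.imCLM) w := by
      have := ((Complex.reCLM.hasFDerivAt (x := w)).sub_const r).mul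
        ((hasDerivAt_inv hwpos.ne').comp_hasFDerivAt w (Complex.imCLM.hasFDerivAt (x := w)))
      refine (this.congr_of_eventuallyEq (Eventually.of_forall fun w => by simp [div_eq_mul_inv])).congr_fderiv ?_
      ext v
      simp
      field_simp
      ring
    have d2 := (hK.differentiable ((w.re - r) / w.im)).hasDerivAt.hasFDerivAt.comp w d1
    have d3 : HasFDerivAt (fun w : ℂ => ((w.im : ℝ) : ℂ)⁻¹)
        (-(Complex.imCLM.smulRight (((w.im : ℂ) ^ 2)⁻¹))) w := by
      have h := Complex.ofRealCLM.hasFDerivAt.comp w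
        ((hasDerivAt_inv hwpos.ne').comp_hasFDerivAt w (Complex.imCLM.hasFDerivAt (x := w)))
      refine (h.congr_of_eventuallyEq (Eventually.of_forall fun w => by simp)).congr_fderiv ?_
      ext v
      simp [mul_comm]
    have hder : _root_.deriv (fun s : ℝ => (s : ℂ) * K s) ((w.re - r) / w.im)
        = K ((w.re - r) / w.im) + (((w.re - r) / w.im : ℝ) : ℂ) * _root_.deriv K ((w.re - r) / w.im) := by
      have := (HasDerivAt.ofReal_comp (hasDerivAt_id ((w.re - r) / w.im))).mul
        (hK.differentiable ((w.re - r) / w.im)).hasDerivAt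
      have e := this.deriv
      simp only [id, Complex.ofReal_one, one_mul] at e
      exact e
    refine ((d3.mul d2).mul_const (u r)).congr_of_eventuallyEq (Eventually.of_forall fun w => ?_) |>.congr_fderiv ?_
    · simp only [hF]; simp; ring
    · simp only [hF', hder]
      ext v
      simp
      field_simp
      ring

end IsUnitKernel

namespace IsUnitKernel

variable {K : ℝ → ℂ}

lemma integrable_comp_mul (hK : IsUnitKernel K) {u : ℝ → ℂ} (hu : Integrable u) (z : ℂ) :
    Integrable fun r => K ((z.re - r) / z.im) * u r := by
  obtain ⟨C, -, hC⟩ := hK.bounded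
  exact hu.bdd_mul (c := C) (hK.continuous.comp
    (by fun_prop : Continuous fun r => (z.re - r) / z.im)).aestronglyMeasurable
    (Eventually.of_forall fun s => hC _)

lemma contDiffAt_kerExt (hK : IsUnitKernel K) {u : ℝ → ℂ} (hu : Integrable u) {z : ℂ}
    (hz : 0 < z.im) : ContDiffAt ℝ 1 (kerExt K u) z := by
  have hopen : IsOpen {w : ℂ | 0 < w.im} := isOpen_lt continuous_const Complex.continuous_im
  refine contDiffAt_one_iff.2 ⟨_, {w : ℂ | 0 < w.im}, hopen.mem_nhds hz, ?_,
    fun w hw => hK.hasFDerivAt_kerExt hu hw⟩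
  have hinv : ContinuousOn (fun w : ℂ => (w.im : ℂ)⁻¹) {w : ℂ | 0 < w.im} := by
    refine ContinuousOn.inv₀ (by fun_prop) fun w hw => ?_
    exact_mod_cast (ne_of_gt hw : w.im ≠ 0)
  have h1 : ContinuousOn (kerExt (_root_.deriv K) u) {w : ℂ | 0 < w.im} := fun w hw =>
    (hK.deriv.hasFDerivAt_kerExt hu hw).continuousAt.continuousWithinAt
  have h2 : ContinuousOn (kerExt (_root_.deriv fun s : ℝ => (s : ℂ) * K s) u) {w : ℂ | 0 < w.im} :=
    fun w hw => (hK.id_mul.deriv.hasFDerivAt_kerExt hu hw).continuousAt.continuousWithinAt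
  exact ((ContinuousLinearMap.smulRightL ℝ ℂ ℂ Complex.reCLM).continuous.comp_continuousOn
    (hinv.mul h1)).sub
    ((ContinuousLinearMap.smulRightL ℝ ℂ ℂ Complex.imCLM).continuous.comp_continuousOn (hinv.mul h2))

end IsUnitKernel

namespace ExtensionKernel

variable {M : ℕ} (K : ExtensionKernel M)

/-- Multiples of the derivatives of the bump function. -/
noncomputable def err (n : ℕ) (s : ℝ) : ℂ := K.const * ((iteratedDeriv n K.bump s : ℝ) : ℂ)

lemma contDiff_iteratedDeriv_bump (n : ℕ) :
    ContDiff ℝ ((⊤ : ℕ∞) : WithTop ℕ∞) (iteratedDeriv n K.bump) := by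
  rw [iteratedDeriv_eq_iterate]
  exact ContDiff.iterate_deriv n K.contDiff_bump

lemma iteratedDeriv_bump_eq_zero (n : ℕ) {s : ℝ} (hs : 1 < |s|) : iteratedDeriv n K.bump s = 0 := by
  refine image_eq_zero_of_notMem_tsupport fun h => ?_
  have := K.tsupport_bump (tsupport_iteratedDeriv_subset K.bump n h)
  exact absurd (abs_le.2 this) (not_le.2 hs)

lemma hasCompactSupport_bump : HasCompactSupport K.bump :=
  isCompact_Icc.of_isClosed_subset (isClosed_tsupport _) K.tsupport_bump

lemma isUnitKernel_err (n : ℕ) : IsUnitKernel (K.err n) := by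
  refine ⟨contDiff_const.mul (Complex.ofRealCLM.contDiff.comp (K.contDiff_iteratedDeriv_bump n)), ?_⟩
  intro s hs
  simp [err, K.iteratedDeriv_bump_eq_zero n hs]

/-- The combination is the derivative of `(1 - i s) K`, a multiple of a bump derivative by design.
It is the kernel that arises when the two partial derivatives of an average are combined into the
antiholomorphic one. -/
lemma deriv_ker_sub (s : ℝ) :
    deriv K.ker s - Complex.I * deriv (fun s : ℝ => (s : ℂ) * K.ker s) s = K.err (M + 1) s := by
  have h1 := (K.isUnitKernel.differentiable s).hasDerivAt.sub
    ((K.isUnitKernel.id_mul.differentiable s).hasDerivAt.const_mul Complex.I)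
  have h2 : HasDerivAt (K.err M) (K.err (M + 1) s) s := by
    refine HasDerivAt.const_mul _ (HasDerivAt.ofReal_comp ?_)
    rw [iteratedDeriv_succ]
    exact (((K.contDiff_iteratedDeriv_bump M).differentiable (by simp)) s).hasDerivAt
  refine h1.unique (h2.congr_of_eventuallyEq (Eventually.of_forall fun s => ?_))
  rw [err, ← K.mul_ker]
  simp only [Pi.sub_apply]
  ring

lemma dbar_kerExt {u : ℝ → ℂ} (hu : Integrable u) {z : ℂ} (hz : 0 < z.im) :
    dbar (kerExt K.ker u) z = (z.im : ℂ)⁻¹ * kerExt (K.err (M + 1)) u z := by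
  have h1 := K.isUnitKernel.deriv.integrable_comp_mul hu z
  have h2 := K.isUnitKernel.id_mul.deriv.integrable_comp_mul hu z
  have h3 : ∫ r, K.err (M + 1) ((z.re - r) / z.im) * u r
      = (∫ r, deriv K.ker ((z.re - r) / z.im) * u r) - Complex.I *
        ∫ r, deriv (fun s : ℝ => (s : ℂ) * K.ker s) ((z.re - r) / z.im) * u r := by
    rw [← integral_const_mul, ← integral_sub h1 (h2.const_mul _)]
    congr 1; ext r
    rw [← K.deriv_ker_sub]; ring
  rw [dbar, (K.isUnitKernel.hasFDerivAt_kerExt hu hz).fderiv]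
  simp only [_root_.sub_apply, ContinuousLinearMap.smulRight_apply, Complex.reCLM_apply,
    Complex.imCLM_apply, Complex.one_re, Complex.one_im, Complex.I_re, Complex.I_im, kerExt, h3]
  simp
  ring

/-- The moments `1` and `-i` make the average continue affine functions analytically. To first order
the extension of `φ` is therefore `φ(x) + i y φ'(x)`, the source of the exponential decay. -/
lemma kerExt_ker_affine (a b : ℂ) {z : ℂ} (hz : 0 < z.im) :
    kerExt K.ker (fun r => a + b * ((r : ℂ) - z.re)) z = a + Complex.I * z.im * b := by
  rw [kerExt_eq _ _ hz]
  have : ∀ s : ℝ, K.ker s * (a + b * (((z.re - s * z.im : ℝ) : ℂ) - z.re))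
      = a * K.ker s - b * z.im * ((s : ℂ) * K.ker s) := fun s => by push_cast; ring
  simp_rw [this]
  rw [integral_sub (K.isUnitKernel.integrable.const_mul _) (K.isUnitKernel.id_mul.integrable.const_mul _),
    integral_const_mul, integral_const_mul, K.integral_ker, K.integral_id_mul_ker]
  ring

lemma integral_err_mul_polynomial (P : Polynomial ℂ) (hP : P.natDegree ≤ M) :
    ∫ s : ℝ, K.err (M + 1) s * P.eval (s : ℂ) = 0 := by
  have h := integral_iteratedDeriv_mul K.contDiff_bump K.hasCompactSupport_bump
    (g := fun j s => (Polynomial.derivative^[j] P).eval (s : ℂ)) (fun j s => by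
      rw [Function.iterate_succ_apply']
      exact ((Polynomial.derivative^[j] P).hasDerivAt (s : ℂ)).comp_ofReal) (M + 1) 0
  rw [Polynomial.iterate_derivative_eq_zero (by omega : P.natDegree < 0 + (M + 1))] at h
  simp only [Function.iterate_zero, id, Polynomial.eval_zero, mul_zero, integral_zero] at h
  simp_rw [err, mul_assoc]
  rw [integral_const_mul, h, mul_zero]

lemma kerExt_err_polynomial (P : Polynomial ℂ) (hP : P.natDegree ≤ M) {z : ℂ} (hz : 0 < z.im) :
    kerExt (K.err (M + 1)) (fun r => P.eval (r : ℂ)) z = 0 := by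
  rw [kerExt_eq _ _ hz]
  have h := K.integral_err_mul_polynomial
    (P.comp (Polynomial.C (z.re : ℂ) - Polynomial.X * Polynomial.C (z.im : ℂ))) (by
      refine Polynomial.natDegree_comp_le.trans ?_
      refine le_trans (Nat.mul_le_mul hP ?_) (mul_one M).le
      refine (Polynomial.natDegree_sub_le _ _).trans (max_le (by simp) ?_)
      exact (Polynomial.natDegree_mul_C_le _ _).trans Polynomial.natDegree_X_le)
  rw [← h]
  congr 1; ext s
  rw [Polynomial.eval_comp]
  simp only [Polynomial.eval_sub, Polynomial.eval_mul, Polynomial.eval_C, Polynomial.eval_X]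
  push_cast
  rfl

lemma iteratedDeriv_comp_sub_div {B : ℝ → ℝ} (hB : ContDiff ℝ ((⊤ : ℕ∞) : WithTop ℕ∞) B) (x y : ℝ)
    (k : ℕ) : iteratedDeriv k (fun r => B ((x - r) / y))
      = fun r => (-1) ^ k * (y ^ k)⁻¹ * iteratedDeriv k B ((x - r) / y) := by
  induction k with
  | zero => ext r; simp
  | succ k ih =>
    rw [iteratedDeriv_succ, ih]
    ext r
    have h0 : HasDerivAt (fun r : ℝ => (x - r) / y) (-1 / y) r := by
      simpa using ((hasDerivAt_id r).const_sub x).div_const y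
    have h1 : HasDerivAt (iteratedDeriv k B) (iteratedDeriv (k + 1) B ((x - r) / y)) ((x - r) / y) := by
      rw [iteratedDeriv_succ]
      exact ((hB.differentiable_iteratedDeriv k (by exact_mod_cast WithTop.coe_lt_top _)) _).hasDerivAt
    have h2 := ((h1.comp r h0).const_mul ((-1) ^ k * (y ^ k)⁻¹)).deriv
    simp only [Function.comp_def] at h2
    rw [h2, pow_succ, pow_succ, mul_inv]
    ring

/-- The rescaled bump derivative of order `n - k` is an admissible test function supported in the
window. Differentiating it `k` times in `r` produces `(-1) ^ k y ^ (-k)`, whose sign cancels the one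
in the definition of the weak derivative. -/
lemma kerExt_err_weakDeriv {k n : ℕ} {Ω : Set ℝ} {F G : ℝ → ℂ} (h : IsWeakDeriv k Ω F G)
    (hkn : k ≤ n) {z : ℂ} (hz : 0 < z.im) (hΩ : Icc (z.re - z.im) (z.re + z.im) ⊆ Ω) :
    kerExt (K.err n) F z = (z.im : ℂ) ^ k * kerExt (K.err (n - k)) G z := by
  set B := iteratedDeriv (n - k) K.bump with hB
  have hBs : ContDiff ℝ ((⊤ : ℕ∞) : WithTop ℕ∞) B := K.contDiff_iteratedDeriv_bump _
  have hit : iteratedDeriv k B = iteratedDeriv n K.bump := by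
    rw [hB, iteratedDeriv_eq_iterate, iteratedDeriv_eq_iterate, iteratedDeriv_eq_iterate,
      ← Function.iterate_add_apply, Nat.add_sub_cancel' hkn]
  have hsupp : Function.support (fun r => B ((z.re - r) / z.im)) ⊆ Icc (z.re - z.im) (z.re + z.im) := by
    intro r hr
    by_contra hcon
    refine hr (K.iteratedDeriv_bump_eq_zero _ ?_)
    rw [abs_div, abs_of_pos hz, one_lt_div hz]
    by_contra h2
    have := abs_le.1 (not_lt.1 h2)
    exact hcon ⟨by linarith, by linarith⟩
  have hts : tsupport (fun r => B ((z.re - r) / z.im)) ⊆ Icc (z.re - z.im) (z.re + z.im) :=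
    closure_minimal hsupp isClosed_Icc
  have key := h.2.2 (fun r => B ((z.re - r) / z.im)) (hBs.comp (by fun_prop))
    (isCompact_Icc.of_isClosed_subset (isClosed_tsupport _) hts) (hts.trans hΩ)
  rw [iteratedDeriv_comp_sub_div hBs, hit] at key
  simp only [Complex.real_smul] at key
  have e1 : ∀ r, (((-1) ^ k * (z.im ^ k)⁻¹ * iteratedDeriv n K.bump ((z.re - r) / z.im) : ℝ) : ℂ) * F r
      = ((-1) ^ k * ((z.im : ℂ) ^ k)⁻¹) * (((iteratedDeriv n K.bump ((z.re - r) / z.im) : ℝ) : ℂ) * F r) := by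
    intro r; push_cast; ring
  simp_rw [e1] at key
  rw [integral_const_mul, mul_assoc] at key
  have key2 := mul_left_cancel₀ (pow_ne_zero k (by norm_num : (-1 : ℂ) ≠ 0)) key
  have hne : (z.im : ℂ) ^ k ≠ 0 := pow_ne_zero _ (by exact_mod_cast hz.ne')
  rw [inv_mul_eq_iff_eq_mul₀ hne] at key2
  simp only [kerExt, err, mul_assoc]
  rw [integral_const_mul, integral_const_mul, key2]
  ring

end ExtensionKernel

/-! ### Local estimates for the extended phase. -/

/-- Induction on `n`: the remainder vanishes at `x` and its derivative is the remainder of one order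
less, so the mean value inequality gains one power of `|r - x|`. Factorial gains are discarded. -/
lemma abs_sub_taylor_le {n : ℕ} (g : ℕ → ℝ → ℝ) {x ρ B a : ℝ} (hB : 0 ≤ B) (ha : 0 ≤ a)
    (hg : ∀ j < n, ∀ r, |r - x| ≤ ρ → HasDerivAt (g j) (g (j + 1) r) r)
    (h : ∀ r, |r - x| ≤ ρ → |g n r - g n x| ≤ B * |r - x| ^ a) {r : ℝ} (hr : |r - x| ≤ ρ) :
    |g 0 r - ∑ j ∈ Finset.range (n + 1), g j x / (j.factorial : ℝ) * (r - x) ^ j|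
      ≤ B * |r - x| ^ (a + n) := by
  induction n generalizing g r with
  | zero => simpa using h r hr
  | succ n ih =>
    have ih' := fun {u : ℝ} (hu : |u - x| ≤ ρ) => ih (fun j => g (j + 1))
      (fun j hj u hu => hg (j + 1) (by omega) u hu) h hu
    set R : ℝ → ℝ := fun u => g 0 u - ∑ j ∈ Finset.range (n + 1 + 1), g j x / (j.factorial : ℝ) * (u - x) ^ j
      with hR
    set R' : ℝ → ℝ := fun u => g 1 u - ∑ j ∈ Finset.range (n + 1), g (j + 1) x / (j.factorial : ℝ) * (u - x) ^ j
      with hR'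
    have hder : ∀ u, |u - x| ≤ ρ → HasDerivAt R (R' u) u := by
      intro u hu
      refine (hg 0 (by omega) u hu).sub ?_
      have h1 : ∀ j ∈ Finset.range (n + 1 + 1), HasDerivAt
          (fun u : ℝ => g j x / (j.factorial : ℝ) * (u - x) ^ j)
          (g j x / (j.factorial : ℝ) * (j * (u - x) ^ (j - 1))) u := by
        intro j _
        have := (((hasDerivAt_id u).sub_const x).pow j).const_mul (g j x / (j.factorial : ℝ))
        simpa using this
      refine (HasDerivAt.fun_sum h1).congr_deriv ?_
      rw [Finset.sum_range_succ']
      simp only [Nat.cast_zero, zero_mul, mul_zero, add_zero, Nat.add_sub_cancel]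
      refine Finset.sum_congr rfl fun j _ => ?_
      rw [Nat.factorial_succ]
      have : (j.factorial : ℝ) ≠ 0 := by exact_mod_cast j.factorial_ne_zero
      push_cast
      field_simp
    have hx0 : R x = 0 := by
      simp only [hR, sub_self]
      rw [Finset.sum_range_succ']
      simp
    have hconv : Convex ℝ {u : ℝ | |u - x| ≤ |r - x|} := by
      have : {u : ℝ | |u - x| ≤ |r - x|} = Metric.closedBall x |r - x| := by
        ext u; simp [Real.dist_eq]
      rw [this]; exact convex_closedBall _ _
    have hmvt := hconv.norm_image_sub_le_of_norm_hasDerivWithin_le (f := R) (f' := R')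
      (C := B * |r - x| ^ (a + n))
      (fun u hu => (hder u (le_trans hu hr)).hasDerivWithinAt)
      (fun u hu => (ih' (le_trans hu hr)).trans (by
        refine mul_le_mul_of_nonneg_left ?_ hB
        exact Real.rpow_le_rpow (abs_nonneg _) hu (by positivity)))
      (show x ∈ {u : ℝ | |u - x| ≤ |r - x|} by simp) (show r ∈ {u : ℝ | |u - x| ≤ |r - x|} by simp)
    rw [hx0, sub_zero, Real.norm_eq_abs, Real.norm_eq_abs] at hmvt
    refine hmvt.trans (le_of_eq ?_)
    push_cast
    rw [← add_assoc, Real.rpow_add_one' (abs_nonneg _) (by positivity), mul_assoc]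

/-- A phase with a globally defined scale function, positive exactly where the phase is
controlled. -/
structure ScaledPhase (κ : ℕ) (α : ℝ) (φ ℓ : ℝ → ℝ) (A c : ℝ) : Prop where
  nonneg : ∀ x, 0 ≤ ℓ x
  lipschitz : ∀ x y, |ℓ x - ℓ y| ≤ |x - y|
  contDiffOn : ContDiffOn ℝ ((κ + 1 : ℕ) : WithTop ℕ∞) φ {x | 0 < ℓ x}
  deriv_pos : ∀ x, 0 < ℓ x → 0 < deriv φ x
  deriv_bound : ∀ x, 0 < ℓ x → ∀ j : ℕ, 1 ≤ j → j ≤ κ →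
    |iteratedDeriv (j + 1) φ x| * ℓ x ^ j ≤ A * deriv φ x
  holder_bound : ∀ x y, 0 < ℓ x → 0 < ℓ y → |y - x| ≤ c * ℓ x →
    |iteratedDeriv (κ + 1) φ y - iteratedDeriv (κ + 1) φ x|
      ≤ A * deriv φ x * ℓ x ^ (-((κ : ℝ) + α)) * |y - x| ^ α

namespace ScaledPhase

variable {κ : ℕ} {α : ℝ} {φ ℓ : ℝ → ℝ} {A c : ℝ}

lemma continuous_scale (h : ScaledPhase κ α φ ℓ A c) : Continuous ℓ :=
  (LipschitzWith.of_dist_le_mul (K := 1) fun x y => by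
    simpa [Real.dist_eq] using h.lipschitz x y).continuous

lemma isOpen (h : ScaledPhase κ α φ ℓ A c) : IsOpen {x | 0 < ℓ x} :=
  isOpen_lt continuous_const h.continuous_scale

lemma hasDerivAt (h : ScaledPhase κ α φ ℓ A c) {j : ℕ} (hj : j ≤ κ) {r : ℝ} (hr : 0 < ℓ r) :
    HasDerivAt (iteratedDeriv j φ) (iteratedDeriv (j + 1) φ r) r := by
  have h1 := h.contDiffOn.differentiableOn_iteratedDerivWithin (m := j)
    (by exact_mod_cast Nat.lt_succ_of_le hj) h.isOpen.uniqueDiffOn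
  have h2 := (h1 r hr).differentiableAt (h.isOpen.mem_nhds hr)
  have h3 : iteratedDerivWithin j φ {x | 0 < ℓ x} =ᶠ[𝓝 r] iteratedDeriv j φ := by
    filter_upwards [h.isOpen.mem_nhds hr] with u hu using iteratedDerivWithin_of_isOpen h.isOpen hu
  rw [iteratedDeriv_succ]
  exact (h2.congr_of_eventuallyEq h3.symm).hasDerivAt

lemma continuousOn_deriv (h : ScaledPhase κ α φ ℓ A c) : ContinuousOn (deriv φ) {x | 0 < ℓ x} :=
  h.contDiffOn.continuousOn_deriv_of_isOpen h.isOpen (by exact_mod_cast Nat.le_add_left 1 κ)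

lemma continuousOn (h : ScaledPhase κ α φ ℓ A c) : ContinuousOn φ {x | 0 < ℓ x} :=
  h.contDiffOn.continuousOn

end ScaledPhase

/-- The bracket bounds the relative oscillation of `φ'` on a window of radius `ℓ / N`: `κ / N` comes
from the intermediate Taylor terms, `N ^ (-γ)` from the Hölder remainder. -/
lemma exists_large_scale (κ : ℕ) {A γ δ : ℝ} (hγ : 0 < γ) (hδ : 0 < δ) (N0 : ℝ) :
    ∃ N : ℝ, N0 ≤ N ∧ 2 ≤ N ∧ A * (κ / N + N ^ (-γ)) ≤ δ := by
  have h1 : Tendsto (fun N : ℝ => A * (κ / N + N ^ (-γ))) atTop (𝓝 (A * (0 + 0))) :=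
    ((tendsto_const_nhds.div_atTop tendsto_id).add (tendsto_rpow_neg_atTop hγ)).const_mul _
  rw [add_zero, mul_zero] at h1
  obtain ⟨N, h2, h3, h4⟩ := ((h1.eventually_le_const hδ).and
    ((eventually_ge_atTop N0).and (eventually_ge_atTop 2))).exists
  exact ⟨N, h3, h4, h2⟩

lemma polynomial_taylor_natDegree_le (a : ℕ → ℂ) (x : ℂ) (n : ℕ) :
    (∑ j ∈ Finset.range (n + 1), Polynomial.C (a j) * (Polynomial.X - Polynomial.C x) ^ j).natDegree
      ≤ n := by
  refine Polynomial.natDegree_sum_le_of_forall_le _ _ fun j hj => ?_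
  refine (Polynomial.natDegree_C_mul_le _ _).trans ?_
  refine (Polynomial.natDegree_pow_le).trans ?_
  rw [Polynomial.natDegree_X_sub_C, mul_one]
  exact Nat.lt_succ_iff.1 (Finset.mem_range.1 hj)

/-- The error kernel annihilates Taylor polynomials, so that it only sees the remainder. -/
lemma ExtensionKernel.norm_kerExt_err_le {M : ℕ} (K : ExtensionKernel M) {C : ℝ}
    (hC : ∀ s, ‖K.err (M + 1) s‖ ≤ C) {u : ℝ → ℝ} {z : ℂ} (hz : 0 < z.im)
    (hu : ContinuousOn u (Icc (z.re - z.im) (z.re + z.im))) {n : ℕ} (hn : n ≤ M) (a : ℕ → ℝ) {δ : ℝ}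
    (h : ∀ r, |r - z.re| ≤ z.im →
      |u r - ∑ j ∈ Finset.range (n + 1), a j / (j.factorial : ℝ) * (r - z.re) ^ j| ≤ δ) :
    ‖kerExt (K.err (M + 1)) (fun r => ((u r : ℝ) : ℂ)) z‖ ≤ 2 * C * δ := by
  set P : Polynomial ℂ := ∑ j ∈ Finset.range (n + 1),
    Polynomial.C (((a j / (j.factorial : ℝ) : ℝ)) : ℂ) *
      (Polynomial.X - Polynomial.C (z.re : ℂ)) ^ j with hP
  have h0 := K.kerExt_err_polynomial P
    ((polynomial_taylor_natDegree_le (fun j => ((a j / (j.factorial : ℝ) : ℝ) : ℂ)) z.re n).trans hn) hz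
  have h1 := (K.isUnitKernel_err (M + 1)).norm_kerExt_sub_le hC hz
    (u := fun r => ((u r : ℝ) : ℂ)) (v := fun r => P.eval (r : ℂ))
    (Complex.continuous_ofReal.comp_continuousOn hu) (by fun_prop) (δ := δ) (fun r hr => ?_)
  · rwa [h0, sub_zero] at h1
  · have h2 : P.eval (r : ℂ) = ((∑ j ∈ Finset.range (n + 1), a j / (j.factorial : ℝ) * (r - z.re) ^ j : ℝ) : ℂ) := by
      rw [hP, Polynomial.eval_finsetSum]
      push_cast
      simp
    rw [h2, ← Complex.ofReal_sub, Complex.norm_real]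
    exact h r hr

/-- On windows of radius at most `ℓ / N` the derivative `φ'` is almost constant and `φ` almost
affine, so the extensions stay close to `φ'(x)` and `φ(x) + i y φ'(x)`. The error kernel removes the
Taylor polynomials, of degree `κ + 1 ≤ M` for `φ` and `κ` for `φ'`; only the Hölder remainders
remain, and they carry the factor `(y / ℓ) ^ γ`. -/
theorem ScaledPhase.local_estimates {κ M : ℕ} {α A c : ℝ} (K : ExtensionKernel M) (hM : κ + 1 ≤ M)
    (hα : 0 ≤ α) (hγ : 0 < (κ : ℝ) + α) (hA : 0 < A) (hc : 0 < c) (N0 : ℝ) :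
    ∃ N C : ℝ, N0 ≤ N ∧ 2 ≤ N ∧ 0 < C ∧ ∀ φ ℓ : ℝ → ℝ, ScaledPhase κ α φ ℓ A c → ∀ z : ℂ,
      0 < z.im → N * z.im ≤ ℓ z.re →
      (∀ r, |r - z.re| ≤ z.im → 0 < ℓ r ∧ deriv φ z.re ≤ 2 * deriv φ r ∧
        deriv φ r ≤ 2 * deriv φ z.re ∧ ℓ r ≤ 2 * ℓ z.re ∧ ℓ z.re ≤ 2 * ℓ r) ∧
      ‖kerExt K.ker (fun r => ((deriv φ r : ℝ) : ℂ)) z - deriv φ z.re‖ ≤ deriv φ z.re / 2 ∧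
      deriv φ z.re * z.im / 2 ≤ (kerExt K.ker (fun r => ((φ r : ℝ) : ℂ)) z).im ∧
      ‖kerExt (K.err (M + 1)) (fun r => ((φ r : ℝ) : ℂ)) z‖
        ≤ C * deriv φ z.re * z.im * (z.im / ℓ z.re) ^ ((κ : ℝ) + α) ∧
      ‖kerExt (K.err (M + 1)) (fun r => ((deriv φ r : ℝ) : ℂ)) z‖
        ≤ C * deriv φ z.re * (z.im / ℓ z.re) ^ ((κ : ℝ) + α) := by
  obtain ⟨CK, hCK0, hCK⟩ := K.isUnitKernel.bounded
  obtain ⟨CE, hCE0, hCE⟩ := (K.isUnitKernel_err (M + 1)).bounded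
  set γ := (κ : ℝ) + α with hγdef
  -- The tolerance `1/2` makes `φ'` comparable within factors of two. The tolerance `1 / (4 CK)`
  -- leaves half of the main term after averaging against a kernel bounded by `CK` on `[-1, 1]`.
  -- Requiring `N ≥ c⁻¹` puts the window inside the range of the Hölder condition.
  obtain ⟨N, hN1, hN2, hN3⟩ := exists_large_scale κ (A := A) hγ
    (show 0 < min (1 / 2) (1 / (4 * CK)) by positivity) (max N0 c⁻¹)
  refine ⟨N, 2 * CE * A, (le_max_left _ _).trans hN1, hN2, by positivity, fun φ ℓ h z hz hzℓ => ?_⟩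
  set x := z.re
  set y := z.im
  set ε := A * (κ / N + N ^ (-γ)) with hε
  have hε1 : ε ≤ 1 / 2 := hN3.trans (min_le_left _ _)
  have hε2 : 2 * CK * ε ≤ 1 / 2 := by
    have := hN3.trans (min_le_right _ _)
    calc 2 * CK * ε ≤ 2 * CK * (1 / (4 * CK)) := by gcongr
      _ = 1 / 2 := by field_simp; norm_num
  have hN0 : 0 < N := by linarith
  have hℓx : 0 < ℓ x := lt_of_lt_of_le (by positivity) hzℓ
  have hy2 : 2 * y ≤ ℓ x := le_trans (by gcongr) hzℓ
  have hμ : 0 < deriv φ x := h.deriv_pos x hℓx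
  have hcy : y ≤ c * ℓ x := by
    have h1 : c⁻¹ ≤ N := (le_max_right _ _).trans hN1
    have : c⁻¹ * y ≤ ℓ x := le_trans (by gcongr) hzℓ
    calc y = c * (c⁻¹ * y) := by field_simp
      _ ≤ c * ℓ x := by gcongr
  have hℓr : ∀ r, |r - x| ≤ y → 0 < ℓ r ∧ ℓ r ≤ 2 * ℓ x ∧ ℓ x ≤ 2 * ℓ r := by
    intro r hr
    have h1 := abs_le.1 ((h.lipschitz r x).trans hr)
    exact ⟨by linarith, by linarith, by linarith⟩
  set B := A * deriv φ x * ℓ x ^ (-γ) with hBdef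
  have hB : 0 ≤ B := by positivity
  have hBy : ∀ b : ℝ, 0 ≤ b → B * y ^ (γ + b) = A * deriv φ x * y ^ b * (y / ℓ x) ^ γ := by
    intro b hb
    rw [hBdef, Real.div_rpow hz.le hℓx.le, Real.rpow_neg hℓx.le, Real.rpow_add hz]
    field_simp
  have hhol : ∀ r, |r - x| ≤ y → |iteratedDeriv (κ + 1) φ r - iteratedDeriv (κ + 1) φ x|
      ≤ B * |r - x| ^ α := fun r hr => h.holder_bound x r hℓx (hℓr r hr).1 (hr.trans hcy)
  have hTφ : ∀ r, |r - x| ≤ y → |φ r - ∑ j ∈ Finset.range (κ + 1 + 1),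
      iteratedDeriv j φ x / (j.factorial : ℝ) * (r - x) ^ j|
      ≤ A * deriv φ x * y * (y / ℓ x) ^ γ := by
    intro r hr
    have := abs_sub_taylor_le (n := κ + 1) (fun j => iteratedDeriv j φ) hB hα
      (fun j hj r hr => h.hasDerivAt (by omega) (hℓr r hr).1) hhol hr
    refine (this.trans ?_)
    have h2 := hBy 1 zero_le_one
    rw [Real.rpow_one] at h2
    rw [← h2]
    refine mul_le_mul_of_nonneg_left ?_ hB
    have : α + ((κ + 1 : ℕ) : ℝ) = γ + 1 := by rw [hγdef]; push_cast; ring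
    rw [this]
    exact Real.rpow_le_rpow (abs_nonneg _) hr (by positivity)
  have hTμ : ∀ r, |r - x| ≤ y → |deriv φ r - ∑ j ∈ Finset.range (κ + 1),
      iteratedDeriv (j + 1) φ x / (j.factorial : ℝ) * (r - x) ^ j|
      ≤ A * deriv φ x * (y / ℓ x) ^ γ := by
    intro r hr
    have := abs_sub_taylor_le (n := κ) (fun j => iteratedDeriv (j + 1) φ) hB hα
      (fun j hj r hr => h.hasDerivAt (by omega) (hℓr r hr).1) hhol hr
    simp only [zero_add, iteratedDeriv_one] at this
    refine (this.trans ?_)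
    have h2 := hBy 0 le_rfl
    rw [Real.rpow_zero, mul_one] at h2
    rw [← h2]
    refine mul_le_mul_of_nonneg_left ?_ hB
    have : α + κ = γ + 0 := by rw [hγdef]; ring
    rw [this]
    exact Real.rpow_le_rpow (abs_nonneg _) hr (by positivity)
  have hyℓ : y / ℓ x ≤ N⁻¹ := by
    rw [div_le_iff₀ hℓx, inv_mul_eq_div, le_div_iff₀ hN0]; linarith
  have hyℓ1 : y / ℓ x ≤ 1 := hyℓ.trans (inv_le_one_of_one_le₀ (by linarith))
  have hμr : ∀ r, |r - x| ≤ y → |deriv φ r - deriv φ x| ≤ ε * deriv φ x := by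
    intro r hr
    have h1 := hTμ r hr
    rw [Finset.sum_range_succ'] at h1
    have h2 : |∑ j ∈ Finset.range κ, iteratedDeriv (j + 1 + 1) φ x / ((j + 1).factorial : ℝ) * (r - x) ^ (j + 1)|
        ≤ ∑ j ∈ Finset.range κ, A * deriv φ x * N⁻¹ := by
      refine (Finset.abs_sum_le_sum_abs _ _).trans (Finset.sum_le_sum fun j hj => ?_)
      have hd := h.deriv_bound x hℓx (j + 1) (by omega) (by have := Finset.mem_range.1 hj; omega)
      have hf : (1 : ℝ) ≤ ((j + 1).factorial : ℝ) := by
        exact_mod_cast Nat.one_le_iff_ne_zero.2 (Nat.factorial_ne_zero _)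
      rw [abs_mul, abs_div, abs_pow, Nat.abs_cast]
      calc |iteratedDeriv (j + 1 + 1) φ x| / ((j + 1).factorial : ℝ) * |r - x| ^ (j + 1)
          ≤ |iteratedDeriv (j + 1 + 1) φ x| * y ^ (j + 1) := by
            gcongr
            exact div_le_self (abs_nonneg _) hf
        _ = |iteratedDeriv (j + 1 + 1) φ x| * ℓ x ^ (j + 1) * (y / ℓ x) ^ (j + 1) := by
            rw [div_pow]; field_simp
        _ ≤ (A * deriv φ x) * N⁻¹ := by
            refine mul_le_mul hd ?_ (by positivity) (by positivity)
            refine le_trans ?_ hyℓ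
            exact pow_le_of_le_one (by positivity) hyℓ1 (by omega)
    rw [Finset.sum_const, Finset.card_range, nsmul_eq_mul] at h2
    have h3 : (y / ℓ x) ^ γ ≤ N ^ (-γ) := by
      rw [Real.rpow_neg hN0.le, ← Real.inv_rpow hN0.le]
      exact Real.rpow_le_rpow (by positivity) hyℓ hγ.le
    simp only [zero_add, Nat.factorial_zero, Nat.cast_one, div_one, pow_zero, mul_one,
      iteratedDeriv_one] at h1
    have h4 : A * deriv φ x * (y / ℓ x) ^ γ ≤ A * deriv φ x * N ^ (-γ) := by gcongr
    have h5 : ε * deriv φ x = κ * (A * deriv φ x * N⁻¹) + A * deriv φ x * N ^ (-γ) := by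
      rw [hε]; field_simp
    rw [h5]
    rw [abs_le] at h1 h2 ⊢
    constructor <;> linarith [h1.1, h1.2, h2.1, h2.2]
  have hsub : ∀ r ∈ Icc (x - y) (x + y), 0 < ℓ r := fun r hr =>
    (hℓr r (abs_le.2 ⟨by linarith [hr.1], by linarith [hr.2]⟩)).1
  have hcφ : ContinuousOn φ (Icc (x - y) (x + y)) := h.continuousOn.mono hsub
  have hcμ : ContinuousOn (deriv φ) (Icc (x - y) (x + y)) := h.continuousOn_deriv.mono hsub
  refine ⟨fun r hr => ?_, ?_, ?_, ?_, ?_⟩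
  · have h1 := abs_le.1 (hμr r hr)
    have h2 : ε * deriv φ x ≤ 1 / 2 * deriv φ x := by gcongr
    obtain ⟨h3, h4, h5⟩ := hℓr r hr
    exact ⟨h3, by linarith, by linarith, h4, h5⟩
  · have h1 := K.isUnitKernel.norm_kerExt_sub_le hCK hz (u := fun r => ((deriv φ r : ℝ) : ℂ))
      (v := fun r => ((deriv φ x : ℝ) : ℂ) + 0 * ((r : ℂ) - z.re)) (δ := ε * deriv φ x)
      (Complex.continuous_ofReal.comp_continuousOn hcμ) (by fun_prop) (fun r hr => by
        simp only [zero_mul, add_zero]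
        rw [← Complex.ofReal_sub, Complex.norm_real]
        exact hμr r hr)
    rw [K.kerExt_ker_affine _ _ hz, mul_zero, add_zero] at h1
    refine h1.trans ?_
    calc 2 * CK * (ε * deriv φ x) = (2 * CK * ε) * deriv φ x := by ring
      _ ≤ 1 / 2 * deriv φ x := by gcongr
      _ = deriv φ x / 2 := by ring
  · have hlin : ∀ r, |r - x| ≤ y → |φ r - (φ x + deriv φ x * (r - x))| ≤ y * (ε * deriv φ x) := by
      intro r hr
      have hconv : Convex ℝ {u : ℝ | |u - x| ≤ y} := by
        have : {u : ℝ | |u - x| ≤ y} = Metric.closedBall x y := by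
          ext u; simp [Real.dist_eq]
        rw [this]; exact convex_closedBall _ _
      have hmvt := hconv.norm_image_sub_le_of_norm_hasDerivWithin_le
        (f := fun u => φ u - deriv φ x * u) (f' := fun u => deriv φ u - deriv φ x)
        (C := ε * deriv φ x) (fun u hu => by
          have h1 := h.hasDerivAt (Nat.zero_le κ) (hℓr u hu).1
          simp only [iteratedDeriv_zero, zero_add, iteratedDeriv_one] at h1
          have h2 := h1.sub ((hasDerivAt_id u).const_mul (deriv φ x))
          rw [mul_one] at h2
          exact h2.hasDerivWithinAt)
        (fun u hu => hμr u hu)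
        (show x ∈ {u : ℝ | |u - x| ≤ y} by simpa using hz.le) (show r ∈ {u : ℝ | |u - x| ≤ y} from hr)
      rw [Real.norm_eq_abs, Real.norm_eq_abs] at hmvt
      have hε0 : 0 ≤ ε * deriv φ x := (abs_nonneg _).trans (hμr r hr)
      calc |φ r - (φ x + deriv φ x * (r - x))|
          = |φ r - deriv φ x * r - (φ x - deriv φ x * x)| := by congr 1; ring
        _ ≤ ε * deriv φ x * |r - x| := hmvt
        _ ≤ ε * deriv φ x * y := by gcongr
        _ = _ := by ring
    have h1 := K.isUnitKernel.norm_kerExt_sub_le hCK hz (u := fun r => ((φ r : ℝ) : ℂ))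
      (v := fun r => (φ x : ℂ) + deriv φ x * ((r : ℂ) - z.re)) (δ := y * (ε * deriv φ x))
      (Complex.continuous_ofReal.comp_continuousOn hcφ) (by fun_prop) (fun r hr => by
        have e : ((φ r : ℝ) : ℂ) - ((φ x : ℂ) + deriv φ x * ((r : ℂ) - z.re))
          = ((φ r - (φ x + deriv φ x * (r - x)) : ℝ) : ℂ) := by push_cast; ring
        rw [e, Complex.norm_real]
        exact hlin r hr)
    rw [K.kerExt_ker_affine _ _ hz] at h1
    have h2 := (abs_le.1 ((Complex.abs_im_le_norm _).trans h1)).1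
    have h3 : ((φ x : ℂ) + Complex.I * z.im * deriv φ x).im = y * deriv φ x := by
      simp; exact Or.inl rfl
    rw [Complex.sub_im, h3] at h2
    have h4 : 2 * CK * (y * (ε * deriv φ x)) ≤ 1 / 2 * (y * deriv φ x) := by
      calc 2 * CK * (y * (ε * deriv φ x)) = (2 * CK * ε) * (y * deriv φ x) := by ring
        _ ≤ _ := by gcongr
    linarith
  · refine (K.norm_kerExt_err_le hCE hz hcφ hM (fun j => iteratedDeriv j φ x) hTφ).trans (le_of_eq ?_)
    ring
  · refine (K.norm_kerExt_err_le hCE hz hcμ (by omega : κ ≤ M) (fun j => iteratedDeriv (j + 1) φ x) hTμ).trans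
      (le_of_eq ?_)
    ring

/-! ### Antiholomorphic derivatives, cutoffs and Green's theorem. -/

section Wirtinger

variable {f g : ℂ → ℂ} {z : ℂ}

lemma dbar_congr (h : f =ᶠ[𝓝 z] g) : dbar f z = dbar g z := by
  rw [dbar, dbar, h.fderiv_eq]

lemma dbar_const (a : ℂ) : dbar (fun _ => a) z = 0 := by simp [dbar]

lemma dbar_mul (hf : DifferentiableAt ℝ f z) (hg : DifferentiableAt ℝ g z) :
    dbar (fun w => f w * g w) z = dbar f z * g z + f z * dbar g z := by
  rw [dbar, dbar, dbar, fderiv_fun_mul hf hg]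
  simp
  ring

lemma dbar_add (hf : DifferentiableAt ℝ f z) (hg : DifferentiableAt ℝ g z) :
    dbar (fun w => f w + g w) z = dbar f z + dbar g z := by
  rw [dbar, dbar, dbar, fderiv_fun_add hf hg]
  simp
  ring

lemma dbar_const_mul (a : ℂ) (hf : DifferentiableAt ℝ f z) :
    dbar (fun w => a * f w) z = a * dbar f z := by
  rw [dbar_mul (differentiableAt_const a) hf, dbar_const, zero_mul, zero_add]

lemma dbar_eq_zero (hf : DifferentiableAt ℂ f z) : dbar f z = 0 := by
  rw [dbar, (hf.hasFDerivAt.restrictScalars ℝ).fderiv]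
  have : fderiv ℂ f z Complex.I = Complex.I * fderiv ℂ f z 1 := by
    rw [← smul_eq_mul, ← map_smul, smul_eq_mul, mul_one]
  simp only [ContinuousLinearMap.coe_restrictScalars', this]
  linear_combination (fderiv ℂ f z 1) * Complex.I_mul_I

lemma dbar_comp (hg : DifferentiableAt ℂ g (f z)) (hf : DifferentiableAt ℝ f z) :
    dbar (fun w => g (f w)) z = deriv g (f z) * dbar f z := by
  have h : HasFDerivAt (fun w => g (f w)) _ z :=
    (hg.hasDerivAt.hasFDerivAt.restrictScalars ℝ).comp z hf.hasFDerivAt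
  rw [dbar, dbar, h.fderiv]
  simp
  ring

end Wirtinger

lemma exists_smoothTransition_deriv_le : ∃ C : ℝ, 0 < C ∧ ∀ s, |deriv Real.smoothTransition s| ≤ C := by
  have hc : Continuous (deriv Real.smoothTransition) :=
    (Real.smoothTransition.contDiff (n := 1)).continuous_deriv le_rfl
  have hcs : HasCompactSupport (deriv Real.smoothTransition) := by
    refine HasCompactSupport.intro (isCompact_Icc (a := (0 : ℝ)) (b := 1)) fun s hs => ?_
    rw [mem_Icc, not_and_or, not_le, not_le] at hs
    rcases hs with hs | hs
    · have : Real.smoothTransition =ᶠ[𝓝 s] fun _ => 0 := by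
        filter_upwards [eventually_lt_nhds hs] with u hu
          using Real.smoothTransition.zero_of_nonpos hu.le
      rw [this.deriv_eq]; simp
    · have : Real.smoothTransition =ᶠ[𝓝 s] fun _ => 1 := by
        filter_upwards [eventually_gt_nhds hs] with u hu
          using Real.smoothTransition.one_of_one_le hu.le
      rw [this.deriv_eq]; simp
  obtain ⟨C, hC⟩ := hc.bounded_above_of_compact_support hcs
  exact ⟨max C 1, by positivity, fun s => (hC s).trans (le_max_left _ _)⟩

/-- A derivative kernel has mean zero, so `u` may be replaced by `u - u(x)`, which is at most `y` on
the window. This gives the cutoff derivatives of size `1 / y` although `u` need not be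
differentiable. -/
lemma IsUnitKernel.norm_kerExt_deriv_le {K : ℝ → ℂ} (hK : IsUnitKernel K) {C : ℝ}
    (hC : ∀ s, ‖_root_.deriv K s‖ ≤ C) {u : ℝ → ℝ} (hu : ∀ x y, |u x - u y| ≤ |x - y|) {z : ℂ}
    (hz : 0 < z.im) : ‖kerExt (_root_.deriv K) (fun r => ((u r : ℝ) : ℂ)) z‖ ≤ 2 * C * z.im := by
  have hcont : Continuous u := (LipschitzWith.of_dist_le_mul (K := 1) fun x y => by
    simpa [Real.dist_eq] using hu x y).continuous
  have h1 := hK.deriv.norm_kerExt_sub_le hC hz (u := fun r => ((u r : ℝ) : ℂ))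
    (v := fun _ => ((u z.re : ℝ) : ℂ)) (δ := z.im) (by fun_prop) (by fun_prop) (fun r hr => by
      rw [← Complex.ofReal_sub, Complex.norm_real]
      exact (hu r z.re).trans hr)
  have h2 : kerExt (_root_.deriv K) (fun _ => ((u z.re : ℝ) : ℂ)) z = 0 := by
    rw [kerExt_eq _ _ hz, integral_mul_const, hK.integral_deriv, zero_mul]
  rwa [h2, sub_zero] at h1

/-- A `C¹` cutoff to the region below the graph of a `1`-Lipschitz function. -/
theorem ExtensionKernel.exists_cutoff {M : ℕ} (K : ExtensionKernel M) (N : ℝ) :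
    ∃ N' C : ℝ, N ≤ N' ∧ 0 < C ∧ ∀ u : ℝ → ℝ, (∀ x y, |u x - u y| ≤ |x - y|) → Integrable u →
      ∃ θ : ℂ → ℝ, (∀ z, 0 ≤ θ z ∧ θ z ≤ 1) ∧ ∀ z : ℂ, 0 < z.im →
        ContDiffAt ℝ 1 θ z ∧ (u z.re < N * z.im → θ =ᶠ[𝓝 z] fun _ => 0) ∧
        (N' * z.im < u z.re → θ =ᶠ[𝓝 z] fun _ => 1) ∧
        ‖dbar (fun w => (θ w : ℂ)) z‖ ≤ C / z.im := by
  obtain ⟨C0, hC0, hK0⟩ := K.isUnitKernel.bounded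
  obtain ⟨C1, hC1, hK1⟩ := K.isUnitKernel.deriv.bounded
  obtain ⟨C2, hC2, hK2⟩ := K.isUnitKernel.id_mul.deriv.bounded
  obtain ⟨Cχ, hCχ, hχ⟩ := exists_smoothTransition_deriv_le
  -- The cutoff is a smooth step in the real part of the averaged `u` divided by `y`, since `u` is
  -- only Lipschitz. Averaging changes `u` by at most `2 C0 y`, which accounts for the margins in
  -- `N1` and `N'`.
  set N1 := N + 2 * C0 with hN1
  refine ⟨N1 + 1 + 2 * C0, Cχ * (2 * C1 + (2 * C2 + (|N1| + 1))), by linarith, by positivity,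
    fun u hu hui => ?_⟩
  have hcont : Continuous u := (LipschitzWith.of_dist_le_mul (K := 1) fun x y => by
    simpa [Real.dist_eq] using hu x y).continuous
  have hui' : Integrable fun r => ((u r : ℝ) : ℂ) := hui.ofReal
  set a : ℂ → ℂ := kerExt K.ker (fun r => ((u r : ℝ) : ℂ)) with ha
  set σ : ℂ → ℝ := fun z => (a z).re * z.im⁻¹ with hσ
  have hab : ∀ z : ℂ, 0 < z.im → |(a z).re - u z.re| ≤ 2 * C0 * z.im := by
    intro z hz
    have h1 := K.isUnitKernel.norm_kerExt_sub_le hK0 hz (u := fun r => ((u r : ℝ) : ℂ))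
      (v := fun r => ((u z.re : ℝ) : ℂ) + 0 * ((r : ℂ) - z.re)) (δ := z.im) (by fun_prop)
      (by fun_prop) (fun r hr => by
        rw [zero_mul, add_zero, ← Complex.ofReal_sub, Complex.norm_real]
        exact (hu r z.re).trans hr)
    rw [K.kerExt_ker_affine _ _ hz, mul_zero, add_zero] at h1
    have := (Complex.abs_re_le_norm _).trans h1
    simpa using this
  have hda : ∀ z : ℂ, 0 < z.im → HasFDerivAt a _ z := fun z hz =>
    K.isUnitKernel.hasFDerivAt_kerExt hui' hz
  have hσd : ∀ z : ℂ, 0 < z.im → ContDiffAt ℝ 1 σ z := fun z hz =>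
    (Complex.reCLM.contDiff.contDiffAt.comp z (K.isUnitKernel.contDiffAt_kerExt hui' hz)).mul
      (ContDiffAt.inv Complex.imCLM.contDiff.contDiffAt hz.ne')
  have hσc : ∀ z : ℂ, 0 < z.im → ContinuousAt σ z := fun z hz => (hσd z hz).continuousAt
  set θ : ℂ → ℝ := fun z => Real.smoothTransition (σ z - N1) with hθ
  have hθd : ∀ z : ℂ, 0 < z.im → ContDiffAt ℝ 1 θ z := fun z hz =>
    (Real.smoothTransition.contDiff.contDiffAt).comp z ((hσd z hz).sub contDiffAt_const)
  have hlow : ∀ z : ℂ, σ z < N1 → 0 < z.im → θ =ᶠ[𝓝 z] fun _ => 0 := by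
    intro z h hz
    filter_upwards [(hσc z hz).eventually_lt_const h] with w hw
    exact Real.smoothTransition.zero_of_nonpos (by linarith)
  have hhigh : ∀ z : ℂ, N1 + 1 < σ z → 0 < z.im → θ =ᶠ[𝓝 z] fun _ => 1 := by
    intro z h hz
    filter_upwards [(hσc z hz).eventually_const_lt h] with w hw
    exact Real.smoothTransition.one_of_one_le (by linarith)
  refine ⟨θ, fun z => ⟨Real.smoothTransition.nonneg _, Real.smoothTransition.le_one _⟩,
    fun z hz => ⟨hθd z hz, fun h => ?_, fun h => ?_, ?_⟩⟩
  · refine hlow z ?_ hz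
    have := (abs_le.1 (hab z hz)).2
    simp only [hσ]
    rw [← div_eq_mul_inv, div_lt_iff₀ hz]
    rw [hN1]
    nlinarith
  · refine hhigh z ?_ hz
    have := (abs_le.1 (hab z hz)).1
    simp only [hσ]
    rw [← div_eq_mul_inv, lt_div_iff₀ hz]
    nlinarith
  · by_cases h1 : σ z < N1
    · rw [dbar_congr (g := fun _ => ((0 : ℝ) : ℂ)) ((hlow z h1 hz).mono fun w hw => by simp only [hw]), dbar_const]
      simp; positivity
    by_cases h2 : N1 + 1 < σ z
    · rw [dbar_congr (g := fun _ => ((1 : ℝ) : ℂ)) ((hhigh z h2 hz).mono fun w hw => by simp only [hw]), dbar_const]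
      simp; positivity
    rw [not_lt] at h1 h2
    -- Only the transition zone is left, where `σ` is bounded; this controls the term `σ / y` from
    -- differentiating the division by `y`.
    have hσabs : |σ z| ≤ |N1| + 1 := by
      rw [abs_le]
      constructor
      · linarith [neg_abs_le N1]
      · linarith [le_abs_self N1]
    have b1 := K.isUnitKernel.norm_kerExt_deriv_le hK1 hu hz
    have b2 := K.isUnitKernel.id_mul.norm_kerExt_deriv_le hK2 hu hz
    set k1 := kerExt (deriv K.ker) (fun r => ((u r : ℝ) : ℂ)) z
    set k2 := kerExt (deriv fun s : ℝ => (s : ℂ) * K.ker s) (fun r => ((u r : ℝ) : ℂ)) z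
    set χ' := deriv Real.smoothTransition (σ z - N1) with hχ'
    have ds : HasFDerivAt σ _ z := (Complex.reCLM.hasFDerivAt.comp z (hda z hz)).mul
      ((hasDerivAt_inv hz.ne').comp_hasFDerivAt z (Complex.imCLM.hasFDerivAt (x := z)))
    have dχ : HasDerivAt Real.smoothTransition χ' (σ z - N1) :=
      ((Real.smoothTransition.contDiff (n := 1)).differentiable (by norm_num) (σ z - N1)).hasDerivAt
    have ds' := ds.sub_const N1
    have dθ := HasDerivAt.comp_hasFDerivAt (f := fun w => σ w - N1) z dχ ds'
    have dθ' := Complex.ofRealCLM.hasFDerivAt.comp z dθ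
    change HasFDerivAt (fun w => (θ w : ℂ)) _ z at dθ'
    have e : dbar (fun w => (θ w : ℂ)) z = ((χ' * (z.im⁻¹ * (z.im⁻¹ * k1.re)) : ℝ) : ℂ) +
        Complex.I * ((χ' * (-(σ z * z.im⁻¹) - z.im⁻¹ * (z.im⁻¹ * k2.re)) : ℝ) : ℂ) := by
      rw [dbar, dθ'.fderiv]
      have h1 : ∀ w : ℂ, ((z.im : ℂ)⁻¹ * w).re = z.im⁻¹ * w.re := by
        intro w
        rw [← Complex.ofReal_inv, Complex.re_ofReal_mul]
      have ha' : (a z).re = σ z * z.im := by simp only [hσ]; field_simp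
      simp only [ContinuousLinearMap.comp_apply, _root_.smul_apply, _root_.add_apply,
        _root_.sub_apply, ContinuousLinearMap.smulRight_apply, Complex.reCLM_apply,
        Complex.imCLM_apply, Complex.ofRealCLM_apply, Complex.one_re, Complex.one_im,
        Complex.I_re, Complex.I_im, Function.comp_apply, smul_eq_mul, one_smul, zero_smul, sub_zero,
        zero_sub, Complex.neg_re, h1, ha']
      congr 2
      · congr 1; ring
      · congr 1; field_simp; ring
    rw [e]
    have hy : 0 < z.im⁻¹ := inv_pos.2 hz
    have t1 : |z.im⁻¹ * (z.im⁻¹ * k1.re)| ≤ 2 * C1 * z.im⁻¹ := by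
      rw [abs_mul, abs_mul, abs_of_pos hy]
      have := (Complex.abs_re_le_norm k1).trans b1
      calc z.im⁻¹ * (z.im⁻¹ * |k1.re|) ≤ z.im⁻¹ * (z.im⁻¹ * (2 * C1 * z.im)) := by gcongr
        _ = 2 * C1 * z.im⁻¹ := by field_simp
    have t2 : |-(σ z * z.im⁻¹) - z.im⁻¹ * (z.im⁻¹ * k2.re)| ≤ (2 * C2 + (|N1| + 1)) * z.im⁻¹ := by
      refine (abs_sub _ _).trans ?_
      rw [abs_neg, abs_mul (σ z), abs_mul z.im⁻¹ (z.im⁻¹ * k2.re), abs_mul z.im⁻¹ k2.re, abs_of_pos hy]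
      have := (Complex.abs_re_le_norm k2).trans b2
      calc |σ z| * z.im⁻¹ + z.im⁻¹ * (z.im⁻¹ * |k2.re|)
          ≤ (|N1| + 1) * z.im⁻¹ + z.im⁻¹ * (z.im⁻¹ * (2 * C2 * z.im)) := by gcongr
        _ = (2 * C2 + (|N1| + 1)) * z.im⁻¹ := by
          have : z.im⁻¹ * (z.im⁻¹ * (2 * C2 * z.im)) = 2 * C2 * z.im⁻¹ := by field_simp
          rw [this]; ring
    refine (norm_add_le _ _).trans ?_
    rw [norm_mul, Complex.norm_I, one_mul, Complex.norm_real, Complex.norm_real, Real.norm_eq_abs,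
      Real.norm_eq_abs, abs_mul, abs_mul χ', div_eq_mul_inv]
    calc |χ'| * |z.im⁻¹ * (z.im⁻¹ * k1.re)| + |χ'| * |-(σ z * z.im⁻¹) - z.im⁻¹ * (z.im⁻¹ * k2.re)|
        ≤ Cχ * (2 * C1 * z.im⁻¹) + Cχ * ((2 * C2 + (|N1| + 1)) * z.im⁻¹) := by
          gcongr
          · exact hχ _
          · exact hχ _
      _ = _ := by ring

/-- Green's theorem on a half plane for compactly supported functions. -/
theorem enorm_integral_le_lintegral_dbar {W : ℂ → ℂ} {ε R : ℝ} (hεR : ε < R) (hR0 : 0 < R)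
    (hW : ∀ z : ℂ, ε ≤ z.im → ContDiffAt ℝ 1 W z)
    (hre : ∀ z : ℂ, ε ≤ z.im → R ≤ |z.re| → W z = 0) (him : ∀ z : ℂ, R ≤ z.im → W z = 0) :
    ‖∫ x : ℝ, W (x + ε * Complex.I)‖ₑ
      ≤ ∫⁻ x : ℝ, ∫⁻ y in Ioi ε, ‖dbar W (x + y * Complex.I)‖ₑ := by
  have hdc : ∀ z : ℂ, ε ≤ z.im → ContinuousAt (fderiv ℝ W) z := fun z hz =>
    ((hW z hz).fderiv_right (m := 0) (by norm_num)).continuousAt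
  have hrect : ∀ z ∈ uIcc (-R) R ×ℂ uIcc ε R, ε ≤ z.im := by
    intro z hz
    have := hz.2
    rw [uIcc_of_le hεR.le] at this
    exact this.1
  -- The rectangle is large enough that `W` vanishes on its top and lateral sides, so the boundary
  -- integral is the one along the bottom.
  have key := Complex.integral_boundary_rect_of_hasFDerivAt_real_off_countable W (fderiv ℝ W)
    (⟨-R, ε⟩ : ℂ) (⟨R, R⟩ : ℂ) ∅ countable_empty
    (fun z hz => (hW z (hrect z hz)).continuousAt.continuousWithinAt)
    (fun z hz => ((hW z (by
      have := hz.1.2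
      simp only [min_eq_left hεR.le] at this
      exact this.1.le)).differentiableAt one_ne_zero).hasFDerivAt) (by
      refine ContinuousOn.integrableOn_compact (isCompact_uIcc.reProdIm isCompact_uIcc) fun z hz => ?_
      have hc := hdc z (hrect z hz)
      have h1 : ContinuousAt (fun z => Complex.I • fderiv ℝ W z 1 - fderiv ℝ W z Complex.I) z := by
        fun_prop
      exact h1.continuousWithinAt)
  simp only at key
  have z1 : ∫ x : ℝ in (-R)..R, W (x + (R : ℝ) * Complex.I) = 0 := by
    rw [intervalIntegral.integral_congr (g := fun _ => 0) (fun x _ => him _ (by simp))]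
    simp
  have z2 : ∫ y : ℝ in ε..R, W ((R : ℝ) + y * Complex.I) = 0 := by
    rw [intervalIntegral.integral_congr (g := fun _ => 0) (fun y hy => hre _ ?_ ?_)]
    · simp
    · rw [uIcc_of_le hεR.le] at hy; simpa using hy.1
    · simp [le_abs_self]
  have z3 : ∫ y : ℝ in ε..R, W (((-R : ℝ) : ℂ) + y * Complex.I) = 0 := by
    rw [intervalIntegral.integral_congr (g := fun _ => 0) (fun y hy => hre _ ?_ ?_)]
    · simp
    · rw [uIcc_of_le hεR.le] at hy; simpa using hy.1
    · simp [le_abs_self]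
  rw [z1, z2, z3] at key
  simp only [smul_zero, sub_zero, add_zero] at key
  have e0 : ∫ x : ℝ, W (x + ε * Complex.I) = ∫ x : ℝ in (-R)..R, W (x + ε * Complex.I) := by
    rw [intervalIntegral.integral_of_le (by linarith), setIntegral_eq_integral_of_forall_compl_eq_zero]
    intro x hx
    refine hre _ (by simp) ?_
    simp only [Complex.add_re, Complex.ofReal_re, Complex.mul_re, Complex.I_re, mul_zero,
      Complex.ofReal_im, Complex.I_im, mul_one, sub_self, add_zero]
    by_contra hcon
    rw [not_le, abs_lt] at hcon
    exact hx ⟨hcon.1, hcon.2.le⟩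
  rw [e0, key, intervalIntegral.integral_of_le (by linarith)]
  refine (enorm_integral_le_lintegral_enorm _).trans ((setLIntegral_le_lintegral _ _).trans ?_)
  refine lintegral_mono fun x => ?_
  simp only
  rw [intervalIntegral.integral_of_le hεR.le]
  refine (enorm_integral_le_lintegral_enorm _).trans ?_
  refine (lintegral_mono_set Ioc_subset_Ioi_self).trans ?_
  refine lintegral_mono fun y => le_of_eq ?_
  have : Complex.I • fderiv ℝ W (x + y * Complex.I) 1 - fderiv ℝ W (x + y * Complex.I) Complex.I
      = Complex.I * dbar W (x + y * Complex.I) := by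
    rw [dbar, smul_eq_mul]
    linear_combination -(fderiv ℝ W (x + y * Complex.I) Complex.I) * Complex.I_mul_I
  rw [this, enorm_mul]
  simp [enorm_eq_nnnorm]

/-- Averages at points near `z` only see the window of twice the radius. Cutting `u` off there
carries the results for integrable functions over to locally integrable ones. -/
lemma IsUnitKernel.kerExt_eventuallyEq_indicator {K : ℝ → ℂ} (hK : IsUnitKernel K) (u : ℝ → ℂ) {z : ℂ}
    (hz : 0 < z.im) : kerExt K u =ᶠ[𝓝 z]
      kerExt K ((Icc (z.re - 2 * z.im) (z.re + 2 * z.im)).indicator u) := by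
  have hz2 : 0 < z.im / 2 := by positivity
  have h1 : ∀ᶠ w : ℂ in 𝓝 z, |w.re - z.re| < z.im / 2 := by
    have : ContinuousAt (fun w : ℂ => |w.re - z.re|) z := by fun_prop
    exact this.eventually_lt_const (by simpa using hz)
  have h2 : ∀ᶠ w : ℂ in 𝓝 z, |w.im - z.im| < z.im / 2 := by
    have : ContinuousAt (fun w : ℂ => |w.im - z.im|) z := by fun_prop
    exact this.eventually_lt_const (by simpa using hz)
  filter_upwards [h1, h2] with w hw1 hw2
  rw [abs_lt] at hw1 hw2
  refine hK.kerExt_congr (by linarith) fun r hr => ?_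
  rw [abs_le] at hr
  rw [indicator_of_mem]
  constructor <;> linarith

lemma IsUnitKernel.contDiffAt_kerExt_of_integrableOn {K : ℝ → ℂ} (hK : IsUnitKernel K) {u : ℝ → ℂ}
    {z : ℂ} (hz : 0 < z.im) (hu : IntegrableOn u (Icc (z.re - 2 * z.im) (z.re + 2 * z.im))) :
    ContDiffAt ℝ 1 (kerExt K u) z :=
  (hK.contDiffAt_kerExt ((integrable_indicator_iff measurableSet_Icc).2 hu) hz).congr_of_eventuallyEq
    (hK.kerExt_eventuallyEq_indicator u hz)

lemma ExtensionKernel.dbar_kerExt_of_integrableOn {M : ℕ} (K : ExtensionKernel M) {u : ℝ → ℂ}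
    {z : ℂ} (hz : 0 < z.im) (hu : IntegrableOn u (Icc (z.re - 2 * z.im) (z.re + 2 * z.im))) :
    dbar (kerExt K.ker u) z = (z.im : ℂ)⁻¹ * kerExt (K.err (M + 1)) u z := by
  rw [dbar_congr (K.isUnitKernel.kerExt_eventuallyEq_indicator u hz),
    K.dbar_kerExt ((integrable_indicator_iff measurableSet_Icc).2 hu) hz,
    ← ((K.isUnitKernel_err (M + 1)).kerExt_eventuallyEq_indicator u hz).self_of_nhds]

/-! ### The almost analytic extension of the oscillating factor. -/

/-- The almost analytic extension of `(φ')^γ e^{i t φ}`. -/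
noncomputable def phaseExt {M : ℕ} (K : ExtensionKernel M) (t γ : ℝ) (φ : ℝ → ℝ) (z : ℂ) : ℂ :=
  Complex.exp (Complex.I * t * kerExt K.ker (fun r => ((φ r : ℝ) : ℂ)) z +
    γ * Complex.log (kerExt K.ker (fun r => ((deriv φ r : ℝ) : ℂ)) z))

lemma mem_slitPlane_of_norm_sub_le {w : ℂ} {m : ℝ} (hm : 0 < m) (h : ‖w - m‖ ≤ m / 2) :
    w ∈ Complex.slitPlane ∧ m / 2 ≤ ‖w‖ ∧ ‖w‖ ≤ 2 * m := by
  have h1 := (abs_le.1 ((Complex.abs_re_le_norm _).trans h)).1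
  have h2 := norm_le_norm_add_norm_sub' w (m : ℂ)
  have h4 : m / 2 ≤ w.re := by
    simp only [Complex.sub_re, Complex.ofReal_re] at h1
    linarith
  rw [Complex.norm_real, Real.norm_of_nonneg hm.le] at h2
  refine ⟨Or.inl (by linarith), h4.trans ((le_abs_self _).trans (Complex.abs_re_le_norm _)), by linarith⟩

/-- Leibniz and chain rules. The exponential factors out and the holomorphic `H` contributes no
derivative, so the four sources of error, namely cutoff, phase, logarithm of `Λ` and data, stand
apart. -/
lemma dbar_product {θ Φ Λ Q H : ℂ → ℂ} {z : ℂ} {t γ : ℝ} (hθ : DifferentiableAt ℝ θ z)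
    (hΦ : DifferentiableAt ℝ Φ z) (hΛ : DifferentiableAt ℝ Λ z) (hs : Λ z ∈ Complex.slitPlane)
    (hQ : DifferentiableAt ℝ Q z) (hH : DifferentiableAt ℂ H z) :
    dbar (fun w => θ w * Complex.exp (Complex.I * t * Φ w + γ * Complex.log (Λ w)) * Q w * H w) z
      = Complex.exp (Complex.I * t * Φ z + γ * Complex.log (Λ z)) * H z *
        (dbar θ z * Q z + θ z * (Complex.I * t * dbar Φ z + γ * (dbar Λ z / Λ z)) * Q z +
          θ z * dbar Q z) := by
  have hlog : DifferentiableAt ℝ (fun w => Complex.log (Λ w)) z :=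
    ((Complex.differentiableAt_log hs).restrictScalars ℝ).comp z hΛ
  have h1 : DifferentiableAt ℝ (fun w => Complex.I * t * Φ w) z := hΦ.const_mul _
  have h2 : DifferentiableAt ℝ (fun w => (γ : ℂ) * Complex.log (Λ w)) z := hlog.const_mul _
  have h3 : DifferentiableAt ℝ (fun w => Complex.I * t * Φ w + γ * Complex.log (Λ w)) z := h1.add h2
  have h4 : DifferentiableAt ℝ
      (fun w => Complex.exp (Complex.I * t * Φ w + γ * Complex.log (Λ w))) z := by
    exact ((Complex.differentiableAt_exp (𝕜 := ℂ)).restrictScalars ℝ).comp z h3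
  have h5 := hθ.fun_mul h4
  have h6 := h5.fun_mul hQ
  rw [dbar_mul h6 (hH.restrictScalars ℝ), dbar_mul h5 hQ, dbar_mul hθ h4,
    dbar_comp (g := Complex.exp) Complex.differentiableAt_exp h3, dbar_add h1 h2,
    dbar_const_mul _ hΦ, dbar_const_mul _ hlog,
    dbar_comp (g := Complex.log) (Complex.differentiableAt_log hs) hΛ, dbar_eq_zero hH,
    Complex.deriv_exp, (Complex.hasDerivAt_log hs).deriv]
  ring

lemma norm_phaseExt_le {M : ℕ} (K : ExtensionKernel M) {t γ m : ℝ} {φ : ℝ → ℝ} {z : ℂ} (ht : 0 < t)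
    (hγ : 0 < γ) (hm : 0 < m)
    (h1 : ‖kerExt K.ker (fun r => ((deriv φ r : ℝ) : ℂ)) z - m‖ ≤ m / 2)
    (h2 : m * z.im / 2 ≤ (kerExt K.ker (fun r => ((φ r : ℝ) : ℂ)) z).im) :
    ‖phaseExt K t γ φ z‖ ≤ Real.exp (-(t * m * z.im / 2)) * (2 * m) ^ γ := by
  obtain ⟨h3, h4, h5⟩ := mem_slitPlane_of_norm_sub_le hm h1
  have hpos : 0 < ‖kerExt K.ker (fun r => ((deriv φ r : ℝ) : ℂ)) z‖ := lt_of_lt_of_le (by positivity) h4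
  rw [phaseExt, Complex.exp_add, norm_mul, Complex.norm_exp, Complex.norm_exp]
  gcongr
  · have : (Complex.I * t * kerExt K.ker (fun r => ((φ r : ℝ) : ℂ)) z).re
        = -(t * (kerExt K.ker (fun r => ((φ r : ℝ) : ℂ)) z).im) := by
      simp [Complex.mul_re, Complex.mul_im]
    rw [this]
    have := mul_le_mul_of_nonneg_left h2 ht.le
    linarith
  · rw [Complex.re_ofReal_mul, Complex.log_re, mul_comm, ← Real.rpow_def_of_pos hpos]
    exact Real.rpow_le_rpow hpos.le h5 hγ.le

/-- With `a = t φ'` this trades the large factor produced by differentiating `e^{itΦ}` for `1 / y`,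
at the price of half the exponential decay. -/
lemma mul_exp_neg_half_le {a y : ℝ} (hy : 0 < y) :
    a * Real.exp (-(a * y / 2)) ≤ 4 * y⁻¹ * Real.exp (-(a * y / 4)) := by
  have h1 : a * y / 4 ≤ Real.exp (a * y / 4) := by linarith [Real.add_one_le_exp (a * y / 4)]
  have h2 : Real.exp (-(a * y / 4)) = Real.exp (a * y / 4) * Real.exp (-(a * y / 2)) := by
    rw [← Real.exp_add]; ring_nf
  rw [h2]
  have h3 : a ≤ 4 * y⁻¹ * Real.exp (a * y / 4) := by
    calc a = 4 * y⁻¹ * (a * y / 4) := by field_simp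
      _ ≤ _ := by gcongr
  calc a * Real.exp (-(a * y / 2)) ≤ (4 * y⁻¹ * Real.exp (a * y / 4)) * Real.exp (-(a * y / 2)) := by
        gcongr
    _ = _ := by ring

/-- The cutoff is chosen before `t`, `F` and `H`, so that one construction serves both uses. The
continuity and the bound by `φ' ^ γ` feed the passage to the boundary. The last estimate feeds
Green's theorem: the indicator comes from the cutoff, `(y / ℓ) ^ γ` from the phase and from the
logarithm, and `y ^ k` from moving `k` derivatives onto `F`. -/
theorem ScaledPhase.exists_extension {κ M k : ℕ} {α A c : ℝ} (K : ExtensionKernel M) (hM : κ + 1 ≤ M)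
    (hk : k ≤ M + 1) (hα : 0 ≤ α) (hγ : 0 < (κ : ℝ) + α) (hA : 0 < A) (hc : 0 < c) :
    ∃ N' C : ℝ, 0 < N' ∧ 0 < C ∧ ∀ φ ℓ : ℝ → ℝ, ScaledPhase κ α φ ℓ A c → ∀ u : ℝ → ℝ,
      (∀ x y, |u x - u y| ≤ |x - y|) → (∀ x, u x ≤ ℓ x) → Integrable u →
      ∃ θ : ℂ → ℝ, (∀ z, 0 ≤ θ z ∧ θ z ≤ 1) ∧
        (∀ z, 0 < z.im → N' * z.im < u z.re → θ z = 1) ∧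
        ∀ t : ℝ, 0 < t →
        (∀ z, 0 < z.im → ContinuousAt (fun w => (θ w : ℂ) * phaseExt K t (κ + α) φ w) z) ∧
        (∀ z, 0 < z.im → θ z = 0 ∨ 4 * z.im ≤ u z.re ∧ ∀ r, |r - z.re| ≤ z.im →
          ‖(θ z : ℂ) * phaseExt K t (κ + α) φ z‖ ≤ C * deriv φ r ^ ((κ : ℝ) + α)) ∧
        ∀ F G : ℝ → ℂ, IsWeakDeriv k {x | 0 < ℓ x} F G → ∀ H : ℂ → ℂ,
        (∀ z, 0 < z.im → DifferentiableAt ℂ H z) →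
        (∀ z, 0 < z.im → ContDiffAt ℝ 1
          (fun w => (θ w : ℂ) * phaseExt K t (κ + α) φ w * kerExt K.ker F w * H w) z) ∧
        ∀ z, 0 < z.im →
          dbar (fun w => (θ w : ℂ) * phaseExt K t (κ + α) φ w * kerExt K.ker F w * H w) z = 0 ∨
          (∀ r, |r - z.re| ≤ z.im → z.im ≤ u r ∧ 0 < ℓ r ∧ deriv φ z.re ≤ 2 * deriv φ r ∧
            deriv φ r ≤ 2 * deriv φ z.re ∧ ℓ r ≤ 2 * ℓ z.re) ∧
          ‖dbar (fun w => (θ w : ℂ) * phaseExt K t (κ + α) φ w * kerExt K.ker F w * H w) z‖ ≤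
            C * (Real.exp (-(t * deriv φ z.re * z.im / 4)) * deriv φ z.re ^ ((κ : ℝ) + α)) * z.im⁻¹ *
            (((if u z.re ≤ N' * z.im then 1 else 0) + (z.im / ℓ z.re) ^ ((κ : ℝ) + α)) *
              ‖kerExt K.ker F z‖ + z.im ^ k * ‖kerExt (K.err (M + 1 - k)) G z‖) * ‖H z‖ := by
  -- With `N ≥ 4` the support of the cutoff lies in `u(x) ≥ 4 y`, so even the window of radius `2 y`
  -- stays inside `{ℓ > 0}`.
  obtain ⟨N, C1, hN4, hN2, hC1, hloc⟩ := ScaledPhase.local_estimates K hM hα hγ hA hc 4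
  obtain ⟨N', Cθ, hNN', hCθ, hcut⟩ := K.exists_cutoff N
  set γ := (κ : ℝ) + α with hγdef
  -- The summands belong to the cutoff, the phase (the `4` from trading `t φ'` for `1 / y`), the
  -- logarithm (the `2` because the extension of `φ'` is at least `φ' / 2`) and the data.
  set D := Cθ + 4 * C1 + 2 * γ * C1 + 1 with hD
  have hD0 : 0 < D := by positivity
  have hD1 : 1 ≤ D := by
    have : 0 < Cθ + 4 * C1 + 2 * γ * C1 := by positivity
    linarith
  refine ⟨N', 4 ^ γ * D, by linarith, by positivity, fun φ ℓ h u hu huℓ hui => ?_⟩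
  obtain ⟨θ, hθ01, hθ⟩ := hcut u hu hui
  have hgood : ∀ z : ℂ, 0 < z.im → N * z.im ≤ u z.re → ∀ r ∈ Icc (z.re - 2 * z.im) (z.re + 2 * z.im),
      0 < ℓ r := by
    intro z hz hNz r hr
    have h1 : |u z.re - u r| ≤ 2 * z.im := (hu _ _).trans (abs_le.2 ⟨by linarith [hr.2], by linarith [hr.1]⟩)
    have h2 : 4 * z.im ≤ u z.re := le_trans (by gcongr) hNz
    have := (abs_le.1 h1).2
    linarith [huℓ r]
  have hμpos : ∀ z : ℂ, 0 < z.im → N * z.im ≤ u z.re → 0 < deriv φ z.re := fun z hz hNz =>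
    h.deriv_pos _ (hgood z hz hNz _ ⟨by linarith, by linarith⟩)
  have hΦc : ∀ z : ℂ, 0 < z.im → N * z.im ≤ u z.re →
      IntegrableOn (fun r => ((φ r : ℝ) : ℂ)) (Icc (z.re - 2 * z.im) (z.re + 2 * z.im)) :=
    fun z hz hNz => (Complex.continuous_ofReal.comp_continuousOn
      (h.continuousOn.mono (hgood z hz hNz))).integrableOn_Icc
  have hΛc : ∀ z : ℂ, 0 < z.im → N * z.im ≤ u z.re →
      IntegrableOn (fun r => ((deriv φ r : ℝ) : ℂ)) (Icc (z.re - 2 * z.im) (z.re + 2 * z.im)) :=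
    fun z hz hNz => (Complex.continuous_ofReal.comp_continuousOn
      (h.continuousOn_deriv.mono (hgood z hz hNz))).integrableOn_Icc
  have hθC : ∀ z : ℂ, 0 < z.im → ContDiffAt ℝ 1 (fun w => (θ w : ℂ)) z := fun z hz =>
    Complex.ofRealCLM.contDiff.contDiffAt.comp z (hθ z hz).1
  have hEC : ∀ t : ℝ, ∀ z : ℂ, 0 < z.im → N * z.im ≤ u z.re →
      ContDiffAt ℝ 1 (phaseExt K t γ φ) z := by
    intro t z hz hNz
    obtain ⟨-, h2, -⟩ := hloc φ ℓ h z hz (hNz.trans (huℓ _))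
    have hs := (mem_slitPlane_of_norm_sub_le (hμpos z hz hNz) h2).1
    have c1 := K.isUnitKernel.contDiffAt_kerExt_of_integrableOn hz (hΦc z hz hNz)
    have c2 := K.isUnitKernel.contDiffAt_kerExt_of_integrableOn hz (hΛc z hz hNz)
    have c3 : ContDiffAt ℝ 1 Complex.log (kerExt K.ker (fun r => ((deriv φ r : ℝ) : ℂ)) z) :=
      (Complex.contDiffAt_log hs).restrict_scalars ℝ
    exact Complex.contDiff_exp.contDiffAt.comp z
      ((contDiffAt_const.mul c1).add (contDiffAt_const.mul (c3.comp z c2)))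
  refine ⟨θ, hθ01, fun z hz hz' => ((hθ z hz).2.2.1 hz').self_of_nhds, fun t ht => ⟨fun z hz => ?_,
    fun z hz => ?_, fun F G hFG H hH => ?_⟩⟩
  · by_cases hNz : N * z.im ≤ u z.re
    · exact (hθC z hz).continuousAt.mul (hEC t z hz hNz).continuousAt
    · have : (fun w => (θ w : ℂ) * phaseExt K t γ φ w) =ᶠ[𝓝 z] fun _ => 0 := by
        filter_upwards [(hθ z hz).2.1 (not_le.1 hNz)] with w hw
        simp [hw]
      exact this.continuousAt
  · by_cases hNz : N * z.im ≤ u z.re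
    · refine Or.inr ⟨le_trans (by gcongr) hNz, fun r hr => ?_⟩
      obtain ⟨h1, h2, h3, -⟩ := hloc φ ℓ h z hz (hNz.trans (huℓ _))
      have hμ := hμpos z hz hNz
      have hb := norm_phaseExt_le K ht hγ hμ h2 h3
      rw [norm_mul, Complex.norm_real, Real.norm_of_nonneg (hθ01 z).1]
      have hle := (h1 r hr).2.1
      calc θ z * ‖phaseExt K t γ φ z‖ ≤ 1 * (Real.exp (-(t * deriv φ z.re * z.im / 2)) * (2 * deriv φ z.re) ^ γ) := by
            gcongr
            exact (hθ01 z).2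
        _ ≤ 1 * (1 * (4 * deriv φ r) ^ γ) := by
            rw [one_mul, one_mul]
            refine mul_le_mul ?_ (Real.rpow_le_rpow (by positivity) (by linarith) hγ.le)
              (by positivity) zero_le_one
            rw [Real.exp_le_one_iff]
            have : 0 ≤ t * deriv φ z.re * z.im / 2 := by positivity
            linarith
        _ ≤ 4 ^ γ * D * deriv φ r ^ γ := by
            have hr0 : 0 ≤ deriv φ r := by linarith
            rw [one_mul, one_mul, Real.mul_rpow (by norm_num) hr0]
            have : (0 : ℝ) ≤ 4 ^ γ * deriv φ r ^ γ := by positivity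
            nlinarith
    · exact Or.inl ((hθ z hz).2.1 (not_le.1 hNz)).self_of_nhds
  have hzero : ∀ z : ℂ, 0 < z.im → ¬ N * z.im ≤ u z.re →
      (fun w => (θ w : ℂ) * phaseExt K t γ φ w * kerExt K.ker F w * H w) =ᶠ[𝓝 z] fun _ => 0 := by
    intro z hz hNz
    filter_upwards [(hθ z hz).2.1 (not_le.1 hNz)] with w hw
    simp [hw]
  have hFint : ∀ z : ℂ, 0 < z.im → N * z.im ≤ u z.re →
      IntegrableOn F (Icc (z.re - 2 * z.im) (z.re + 2 * z.im)) := fun z hz hNz =>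
    hFG.1.integrableOn_compact_subset (hgood z hz hNz) isCompact_Icc
  have hHd : ∀ z : ℂ, 0 < z.im → ContDiffAt ℝ 1 H z := by
    intro z hz
    have hopen : IsOpen {w : ℂ | 0 < w.im} := isOpen_lt continuous_const Complex.continuous_im
    have : DifferentiableOn ℂ H {w : ℂ | 0 < w.im} := fun w hw => (hH w hw).differentiableWithinAt
    exact ((this.contDiffOn hopen (n := 1)).contDiffAt (hopen.mem_nhds hz)).restrict_scalars ℝ
  refine ⟨fun z hz => ?_, fun z hz => ?_⟩
  · by_cases hNz : N * z.im ≤ u z.re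
    · exact (((hθC z hz).mul (hEC t z hz hNz)).mul
        (K.isUnitKernel.contDiffAt_kerExt_of_integrableOn hz (hFint z hz hNz))).mul (hHd z hz)
    · exact contDiffAt_const.congr_of_eventuallyEq (hzero z hz hNz)
  by_cases hNz : N * z.im ≤ u z.re
  swap
  · left
    rw [dbar_congr (hzero z hz hNz), dbar_const]
  right
  obtain ⟨h1, h2, h3, h4, h5⟩ := hloc φ ℓ h z hz (hNz.trans (huℓ _))
  have hμ := hμpos z hz hNz
  obtain ⟨hs, hs1, hs2⟩ := mem_slitPlane_of_norm_sub_le hμ h2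
  refine ⟨fun r hr => ⟨?_, (h1 r hr).1, (h1 r hr).2.1, (h1 r hr).2.2.1, (h1 r hr).2.2.2.1⟩, ?_⟩
  · have h6 := (abs_le.1 ((hu r z.re).trans hr)).1
    have : 4 * z.im ≤ u z.re := le_trans (by gcongr) hNz
    linarith
  have c0 := (hθC z hz).differentiableAt one_ne_zero
  have c1 := (K.isUnitKernel.contDiffAt_kerExt_of_integrableOn hz (hΦc z hz hNz)).differentiableAt one_ne_zero
  have c2 := (K.isUnitKernel.contDiffAt_kerExt_of_integrableOn hz (hΛc z hz hNz)).differentiableAt one_ne_zero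
  have c3 := (K.isUnitKernel.contDiffAt_kerExt_of_integrableOn hz (hFint z hz hNz)).differentiableAt one_ne_zero
  have hd := dbar_product (t := t) (γ := γ) c0 c1 c2 hs c3 (hH z hz)
  have hb := norm_phaseExt_le K ht hγ hμ h2 h3
  unfold phaseExt at hb ⊢
  rw [hd, norm_mul, norm_mul]
  have e3 : dbar (kerExt K.ker F) z
      = (z.im : ℂ)⁻¹ * ((z.im : ℂ) ^ k * kerExt (K.err (M + 1 - k)) G z) := by
    rw [K.dbar_kerExt_of_integrableOn hz (hFint z hz hNz), K.kerExt_err_weakDeriv hFG hk hz]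
    exact fun r hr => hgood z hz hNz r ⟨by linarith [hr.1], by linarith [hr.2]⟩
  have e1 := K.dbar_kerExt_of_integrableOn hz (hΦc z hz hNz)
  have e2 := K.dbar_kerExt_of_integrableOn hz (hΛc z hz hNz)
  have hℓ : 0 < ℓ z.re := hgood z hz hNz _ ⟨by linarith, by linarith⟩
  set m := deriv φ z.re
  set y := z.im
  set a := kerExt K.ker F z
  set b := kerExt (K.err (M + 1 - k)) G z
  set ρ := (y / ℓ z.re) ^ γ with hρ
  have hρ0 : 0 ≤ ρ := by positivity
  set χ : ℝ := if u z.re ≤ N' * y then 1 else 0 with hχ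
  have hχ0 : 0 ≤ χ := by rw [hχ]; split_ifs <;> norm_num
  have hy : ‖(y : ℂ)⁻¹‖ = y⁻¹ := by
    rw [norm_inv, Complex.norm_real, Real.norm_of_nonneg hz.le]
  have n0 : ‖dbar (fun w => (θ w : ℂ)) z‖ ≤ Cθ * y⁻¹ * χ := by
    rw [hχ]
    split_ifs with hle
    · rw [mul_one, ← div_eq_mul_inv]; exact (hθ z hz).2.2.2
    · have := (hθ z hz).2.2.1 (not_le.1 hle)
      rw [dbar_congr (g := fun _ => ((1 : ℝ) : ℂ)) (this.mono fun w hw => by simp only [hw]), dbar_const]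
      simp
  have n1 : ‖dbar (kerExt K.ker fun r => ((φ r : ℝ) : ℂ)) z‖ ≤ C1 * m * ρ := by
    rw [e1, norm_mul, hy]
    calc y⁻¹ * ‖kerExt (K.err (M + 1)) (fun r => ((φ r : ℝ) : ℂ)) z‖ ≤ y⁻¹ * (C1 * m * y * ρ) := by gcongr
      _ = C1 * m * ρ := by field_simp
  have n2 : ‖dbar (kerExt K.ker fun r => ((deriv φ r : ℝ) : ℂ)) z /
      kerExt K.ker (fun r => ((deriv φ r : ℝ) : ℂ)) z‖ ≤ 2 * C1 * y⁻¹ * ρ := by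
    rw [norm_div, e2, norm_mul, hy, div_le_iff₀ (lt_of_lt_of_le (by positivity) hs1)]
    calc y⁻¹ * ‖kerExt (K.err (M + 1)) (fun r => ((deriv φ r : ℝ) : ℂ)) z‖ ≤ y⁻¹ * (C1 * m * ρ) := by gcongr
      _ = 2 * C1 * y⁻¹ * ρ * (m / 2) := by ring
      _ ≤ _ := by gcongr
  have n3 : ‖dbar (kerExt K.ker F) z‖ = y⁻¹ * (y ^ k * ‖b‖) := by
    rw [e3, norm_mul, norm_mul, hy, norm_pow, Complex.norm_real, Real.norm_of_nonneg hz.le]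
  have nθ : ‖(θ z : ℂ)‖ ≤ 1 := by
    rw [Complex.norm_real, Real.norm_of_nonneg (hθ01 z).1]; exact (hθ01 z).2
  have hbr : ‖dbar (fun w => (θ w : ℂ)) z * a + θ z * (Complex.I * t *
      dbar (kerExt K.ker fun r => ((φ r : ℝ) : ℂ)) z + γ * (dbar (kerExt K.ker fun r => ((deriv φ r : ℝ) : ℂ)) z /
      kerExt K.ker (fun r => ((deriv φ r : ℝ) : ℂ)) z)) * a + θ z * dbar (kerExt K.ker F) z‖
      ≤ (Cθ * y⁻¹ * χ) * ‖a‖ + 1 * (t * (C1 * m * ρ) + γ * (2 * C1 * y⁻¹ * ρ)) * ‖a‖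
        + 1 * (y⁻¹ * (y ^ k * ‖b‖)) := by
    refine (norm_add₃_le).trans ?_
    rw [norm_mul, norm_mul, norm_mul, norm_mul, n3]
    have : ‖Complex.I * t * dbar (kerExt K.ker fun r => ((φ r : ℝ) : ℂ)) z +
        γ * (dbar (kerExt K.ker fun r => ((deriv φ r : ℝ) : ℂ)) z /
        kerExt K.ker (fun r => ((deriv φ r : ℝ) : ℂ)) z)‖
        ≤ t * (C1 * m * ρ) + γ * (2 * C1 * y⁻¹ * ρ) := by
      refine (norm_add_le _ _).trans ?_
      rw [norm_mul, norm_mul, norm_mul, Complex.norm_I, one_mul, Complex.norm_real, Complex.norm_real,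
        Real.norm_of_nonneg ht.le, Real.norm_of_nonneg hγ.le]
      gcongr
    gcongr
  have x1 := mul_exp_neg_half_le (a := t * m) hz
  have x2 : Real.exp (-(t * m * y / 2)) ≤ Real.exp (-(t * m * y / 4)) := by
    apply Real.exp_le_exp.2
    have : 0 ≤ t * m * y := by positivity
    linarith
  set X := Real.exp (-(t * m * y / 2))
  set Y := Real.exp (-(t * m * y / 4))
  have hX : 0 < X := Real.exp_pos _
  have hY : 0 < Y := Real.exp_pos _
  have hyi : 0 < y⁻¹ := inv_pos.2 hz
  have hmain : X * ((Cθ * y⁻¹ * χ) * ‖a‖ + 1 * (t * (C1 * m * ρ) + γ * (2 * C1 * y⁻¹ * ρ)) * ‖a‖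
        + 1 * (y⁻¹ * (y ^ k * ‖b‖))) ≤ D * Y * y⁻¹ * ((χ + ρ) * ‖a‖ + y ^ k * ‖b‖) := by
    have t1 : X * (Cθ * y⁻¹ * χ * ‖a‖) ≤ Y * (Cθ * y⁻¹ * χ * ‖a‖) := by gcongr
    have t2 : X * (t * (C1 * m * ρ) * ‖a‖) ≤ (4 * y⁻¹ * Y) * (C1 * ρ * ‖a‖) := by
      calc X * (t * (C1 * m * ρ) * ‖a‖) = (t * m * X) * (C1 * ρ * ‖a‖) := by ring
        _ ≤ _ := by gcongr
    have t3 : X * (γ * (2 * C1 * y⁻¹ * ρ) * ‖a‖) ≤ Y * (γ * (2 * C1 * y⁻¹ * ρ) * ‖a‖) := by gcongr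
    have t4 : X * (y⁻¹ * (y ^ k * ‖b‖)) ≤ Y * (y⁻¹ * (y ^ k * ‖b‖)) := by gcongr
    have p1 : 0 ≤ Y * y⁻¹ * χ * ‖a‖ := by positivity
    have p2 : 0 ≤ Y * y⁻¹ * ρ * ‖a‖ := by positivity
    have p3 : 0 ≤ Y * y⁻¹ * (y ^ k * ‖b‖) := by positivity
    have q1 : Cθ * (Y * y⁻¹ * χ * ‖a‖) ≤ D * (Y * y⁻¹ * χ * ‖a‖) := by
      refine mul_le_mul_of_nonneg_right ?_ p1
      have : 0 ≤ 4 * C1 + 2 * γ * C1 := by positivity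
      linarith
    have q2 : (4 * C1 + 2 * γ * C1) * (Y * y⁻¹ * ρ * ‖a‖) ≤ D * (Y * y⁻¹ * ρ * ‖a‖) := by
      refine mul_le_mul_of_nonneg_right ?_ p2
      linarith
    have q3 : 1 * (Y * y⁻¹ * (y ^ k * ‖b‖)) ≤ D * (Y * y⁻¹ * (y ^ k * ‖b‖)) :=
      mul_le_mul_of_nonneg_right hD1 p3
    linarith
  calc _ ≤ (X * (2 * m) ^ γ) * ‖H z‖ * ((Cθ * y⁻¹ * χ) * ‖a‖ +
        1 * (t * (C1 * m * ρ) + γ * (2 * C1 * y⁻¹ * ρ)) * ‖a‖ + 1 * (y⁻¹ * (y ^ k * ‖b‖))) := by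
        gcongr
    _ = (2 * m) ^ γ * ‖H z‖ * (X * ((Cθ * y⁻¹ * χ) * ‖a‖ +
        1 * (t * (C1 * m * ρ) + γ * (2 * C1 * y⁻¹ * ρ)) * ‖a‖ + 1 * (y⁻¹ * (y ^ k * ‖b‖)))) := by ring
    _ ≤ (4 ^ γ * m ^ γ) * ‖H z‖ * (D * Y * y⁻¹ * ((χ + ρ) * ‖a‖ + y ^ k * ‖b‖)) := by
        gcongr
        rw [← Real.mul_rpow (by norm_num) hμ.le]
        apply Real.rpow_le_rpow (by positivity) _ hγ.le
        linarith
    _ = _ := by ring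

/-! ### Truncated scales and integration of the weights in `y`. -/

/-- A scale function cut off to a bounded interval. -/
noncomputable def truncScale (ℓ : ℝ → ℝ) (R x : ℝ) : ℝ := min (ℓ x) (max (R - |x|) 0)

section truncScale

variable {ℓ : ℝ → ℝ} {R : ℝ}

lemma truncScale_lipschitz (h : ∀ x y, |ℓ x - ℓ y| ≤ |x - y|) (x y : ℝ) :
    |truncScale ℓ R x - truncScale ℓ R y| ≤ |x - y| := by
  refine (abs_min_sub_min_le_max _ _ _ _).trans (max_le (h x y) ?_)
  refine (abs_max_sub_max_le_max _ _ _ _).trans (max_le ?_ (by simp))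
  rw [sub_sub_sub_cancel_left, abs_sub_comm x y]
  exact abs_abs_sub_abs_le y x

lemma truncScale_nonneg (h : ∀ x, 0 ≤ ℓ x) (x : ℝ) : 0 ≤ truncScale ℓ R x :=
  le_min (h x) (le_max_right _ _)

lemma truncScale_le (x : ℝ) : truncScale ℓ R x ≤ ℓ x := min_le_left _ _

lemma truncScale_le_radius (hR : 0 ≤ R) (x : ℝ) : truncScale ℓ R x ≤ R :=
  (min_le_right _ _).trans (max_le (by linarith [abs_nonneg x]) hR)

lemma truncScale_le_zero {x : ℝ} (hx : R ≤ |x|) : truncScale ℓ R x ≤ 0 :=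
  (min_le_right _ _).trans (max_le (by linarith) le_rfl)

lemma continuous_truncScale (h : Continuous ℓ) : Continuous (truncScale ℓ R) :=
  h.min ((continuous_const.sub continuous_abs).max continuous_const)

lemma integrable_truncScale (h : Continuous ℓ) (h0 : ∀ x, 0 ≤ ℓ x) : Integrable (truncScale ℓ R) := by
  refine (continuous_truncScale h).integrable_of_hasCompactSupport
    (HasCompactSupport.intro (isCompact_Icc (a := -R) (b := R)) fun x hx => ?_)
  refine le_antisymm (truncScale_le_zero ?_) (truncScale_nonneg h0 x)
  by_contra hcon
  exact hx (abs_le.1 (not_le.1 hcon).le)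

lemma eventually_truncScale_eq (ℓ : ℝ → ℝ) (x : ℝ) : ∀ᶠ R in atTop, truncScale ℓ R x = ℓ x := by
  filter_upwards [eventually_ge_atTop (ℓ x + |x|)] with R hR
  exact min_eq_left (le_max_of_le_left (by linarith))

end truncScale

/-- For fixed `s` and `y` the shear is a translation in `x`, so Tonelli removes it; the factor `2`
is the length of the range of `s`. -/
lemma lintegral_shear_le {B : ℝ → ℝ → ℝ≥0∞} (hB : Measurable (Function.uncurry B)) {ε : ℝ}
    (hε : 0 ≤ ε) :
    ∫⁻ x : ℝ, ∫⁻ y in Ioi ε, ∫⁻ s in Icc (-1 : ℝ) 1, B (x - s * y) y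
      ≤ 2 * ∫⁻ r : ℝ, ∫⁻ y in Ioi (0 : ℝ), B r y := by
  have hm : Measurable fun q : ℝ × ℝ × ℝ => B (q.1 - q.2.2 * q.2.1) q.2.1 :=
    hB.comp (by fun_prop : Measurable fun q : ℝ × ℝ × ℝ => (q.1 - q.2.2 * q.2.1, q.2.1))
  have hm1 : Measurable fun q : ℝ × ℝ => ∫⁻ s in Icc (-1 : ℝ) 1, B (q.1 - s * q.2) q.2 := by
    have : Measurable fun q : (ℝ × ℝ) × ℝ => B (q.1.1 - q.2 * q.1.2) q.1.2 :=
      hB.comp (by fun_prop : Measurable fun q : (ℝ × ℝ) × ℝ => (q.1.1 - q.2 * q.1.2, q.1.2))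
    exact this.lintegral_prod_right'
  rw [lintegral_lintegral_swap hm1.aemeasurable]
  have h1 : ∀ y : ℝ, ∫⁻ x : ℝ, ∫⁻ s in Icc (-1 : ℝ) 1, B (x - s * y) y = 2 * ∫⁻ r : ℝ, B r y := by
    intro y
    rw [lintegral_lintegral_swap]
    · have : ∀ s : ℝ, ∫⁻ x : ℝ, B (x - s * y) y = ∫⁻ r : ℝ, B r y := fun s =>
        lintegral_sub_right_eq_self (fun r => B r y) (s * y)
      simp_rw [this]
      rw [setLIntegral_const, Real.volume_Icc, mul_comm]
      norm_num
    · exact (hB.comp (by fun_prop : Measurable fun q : ℝ × ℝ => (q.1 - q.2 * y, y))).aemeasurable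
  simp_rw [h1]
  refine (lintegral_mono_set (Ioi_subset_Ioi hε)).trans ?_
  rw [lintegral_const_mul' _ _ (by norm_num), lintegral_lintegral_swap hB.aemeasurable]

lemma lintegral_rpow_mul_exp {γ a : ℝ} (hγ : 0 < γ) (ha : 0 < a) :
    ∫⁻ y in Ioi (0 : ℝ), ENNReal.ofReal (y ^ (γ - 1) * Real.exp (-(a * y)))
      = ENNReal.ofReal (a ^ (-γ) * Real.Gamma γ) := by
  have h := Real.integral_rpow_mul_exp_neg_mul_Ioi hγ ha
  have hi : IntegrableOn (fun y : ℝ => y ^ (γ - 1) * Real.exp (-(a * y))) (Ioi 0) := by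
    by_contra hcon
    rw [integral_undef hcon] at h
    have h1 : 0 < Real.Gamma γ := Real.Gamma_pos_of_pos hγ
    have h2 : 0 < (1 / a) ^ γ := by positivity
    have := mul_pos h2 h1
    linarith
  rw [← ofReal_integral_eq_lintegral_ofReal hi, h]
  · rw [one_div, Real.inv_rpow ha.le, Real.rpow_neg ha.le]
  · filter_upwards [ae_restrict_mem measurableSet_Ioi] with y hy
    have : (0 : ℝ) < y := hy
    positivity

/-- The weight of `f` in the estimate of the antiholomorphic derivative. -/
noncomputable def errWeight (N t γ m l v y : ℝ) : ℝ :=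
  Real.exp (-(t * m * y / 8)) * y⁻¹ * ((if v ≤ N * y then 1 else 0) + (y / l) ^ γ)

/-- The weight of the derivative datum in the estimate of the antiholomorphic derivative. -/
noncomputable def dataWeight (t γ : ℝ) (k : ℕ) (m y : ℝ) : ℝ :=
  Real.exp (-(t * m * y / 8)) * m ^ γ * y⁻¹ * y ^ k

/-- The Gamma integral of `y ^ (γ - 1) e^{-tmy/8}` gives `(t m) ^ (-γ)`. If `v = l`, the indicator
forces `y ≥ l / N`, so it is at most `N ^ γ (y / l) ^ γ` and is absorbed. If `v < l`, the indicator
term is at most `N / v` on an interval of length `v`; this bounded excess is recorded separately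
because it disappears with the truncation. -/
lemma lintegral_errWeight_le {N t γ m l v : ℝ} (hN : 1 ≤ N) (ht : 0 < t) (hγ : 0 < γ) (hm : 0 < m)
    (hl : 0 < l) (hvl : v ≤ l) :
    ∫⁻ y in Ioc 0 v, ENNReal.ofReal (errWeight N t γ m l v y)
      ≤ ENNReal.ofReal ((1 + N ^ γ) * (8 ^ γ * Real.Gamma γ) + N) *
        (ENNReal.ofReal (t ^ (-γ) * ((m * l) ^ γ)⁻¹) + if v < l then 1 else 0) := by
  have hG : 0 < Real.Gamma γ := Real.Gamma_pos_of_pos hγ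
  have hN0 : 0 < N := by linarith
  have hpt : ∀ y ∈ Ioc 0 v, ENNReal.ofReal (errWeight N t γ m l v y)
      ≤ ENNReal.ofReal ((1 + N ^ γ) * (l ^ γ)⁻¹) *
        ENNReal.ofReal (y ^ (γ - 1) * Real.exp (-(t * m / 8 * y))) +
        (if v < l then ENNReal.ofReal (N / v) else 0) := by
    rintro y ⟨hy, hyv⟩
    have e1 : Real.exp (-(t * m * y / 8)) * y⁻¹ * (y / l) ^ γ
        = (l ^ γ)⁻¹ * (y ^ (γ - 1) * Real.exp (-(t * m / 8 * y))) := by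
      rw [Real.div_rpow hy.le hl.le, Real.rpow_sub_one hy.ne',
        show t * m * y / 8 = t * m / 8 * y by ring]
      field_simp
    have hE : 0 ≤ (l ^ γ)⁻¹ * (y ^ (γ - 1) * Real.exp (-(t * m / 8 * y))) := by positivity
    have hNg : 0 ≤ N ^ γ := by positivity
    rw [← ENNReal.ofReal_mul (by positivity), errWeight, mul_add, e1]
    split_ifs with h1 h2 h2
    · rw [← ENNReal.ofReal_add (by positivity) (div_nonneg hN0.le (by linarith))]
      apply ENNReal.ofReal_le_ofReal
      have h3 : Real.exp (-(t * m * y / 8)) * y⁻¹ * 1 ≤ N / v := by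
        have hv : 0 < v := lt_of_lt_of_le hy hyv
        have : Real.exp (-(t * m * y / 8)) ≤ 1 := by
          rw [Real.exp_le_one_iff]
          have : 0 ≤ t * m * y / 8 := by positivity
          linarith
        calc Real.exp (-(t * m * y / 8)) * y⁻¹ * 1 ≤ 1 * y⁻¹ * 1 := by gcongr
          _ = y⁻¹ := by ring
          _ ≤ N / v := by
            rw [inv_eq_one_div, div_le_div_iff₀ hy hv]; linarith
      nlinarith [mul_nonneg hNg hE]
    · rw [add_zero]
      apply ENNReal.ofReal_le_ofReal
      have hvl' : v = l := le_antisymm hvl (not_lt.1 h2)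
      have h3 : 1 ≤ N ^ γ * (y / l) ^ γ := by
        rw [← Real.mul_rpow hN0.le (by positivity)]
        apply Real.one_le_rpow _ hγ.le
        rw [← mul_div_assoc, one_le_div hl]; linarith
      have h4 : Real.exp (-(t * m * y / 8)) * y⁻¹ * 1
          ≤ N ^ γ * (Real.exp (-(t * m * y / 8)) * y⁻¹ * (y / l) ^ γ) := by
        calc Real.exp (-(t * m * y / 8)) * y⁻¹ * 1
            ≤ Real.exp (-(t * m * y / 8)) * y⁻¹ * (N ^ γ * (y / l) ^ γ) := by gcongr
          _ = _ := by ring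
      rw [e1] at h4
      linarith
    · rw [mul_zero, zero_add]
      refine le_trans (ENNReal.ofReal_le_ofReal ?_) (le_add_of_nonneg_right (zero_le))
      nlinarith [mul_nonneg hNg hE]
    · rw [mul_zero, zero_add, add_zero]
      apply ENNReal.ofReal_le_ofReal
      nlinarith [mul_nonneg hNg hE]
  refine (setLIntegral_mono_ae' measurableSet_Ioc (Eventually.of_forall hpt)).trans ?_
  rw [lintegral_add_right _ measurable_const, lintegral_const_mul' _ _ ENNReal.ofReal_ne_top, mul_add]
  refine add_le_add ?_ ?_
  · refine (mul_le_mul_right (lintegral_mono_set Ioc_subset_Ioi_self) _).trans ?_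
    rw [lintegral_rpow_mul_exp hγ (by positivity), ← ENNReal.ofReal_mul (by positivity),
      ← ENNReal.ofReal_mul (by positivity)]
    apply ENNReal.ofReal_le_ofReal
    have e2 : (t * m / 8) ^ (-γ) = t ^ (-γ) * (m ^ γ)⁻¹ * 8 ^ γ := by
      rw [Real.div_rpow (by positivity) (by norm_num), Real.mul_rpow ht.le hm.le, Real.rpow_neg hm.le,
        Real.rpow_neg (by norm_num : (0 : ℝ) ≤ 8)]
      field_simp
    rw [e2, Real.mul_rpow hm.le hl.le, mul_inv]
    have h0 : 0 ≤ N * (t ^ (-γ) * ((m ^ γ)⁻¹ * (l ^ γ)⁻¹)) := by positivity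
    nlinarith
  · split_ifs with h
    · rw [mul_one, setLIntegral_const, Real.volume_Ioc, sub_zero]
      by_cases hv : 0 < v
      · rw [← ENNReal.ofReal_mul (by positivity)]
        apply ENNReal.ofReal_le_ofReal
        rw [div_mul_cancel₀ _ hv.ne']
        have : 0 ≤ (1 + N ^ γ) * (8 ^ γ * Real.Gamma γ) := by positivity
        linarith
      · rw [ENNReal.ofReal_of_nonpos (not_lt.1 hv), mul_zero]; exact (zero_le)
    · simp

/-- Since `β + γ ≤ k`, the surplus power `y ^ (k - γ - β)` is at most `l ^ (k - γ - β)` for `y ≤ l`.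
The rest is a Gamma integral, whose `m ^ (-γ)` cancels the `m ^ γ` of the weight. This is where the
relation between `p`, `q`, `k` and `γ` is needed. -/
lemma lintegral_dataWeight_le {t γ m l v β : ℝ} {k : ℕ} (ht : 0 < t) (hγ : 0 < γ)
    (hβ : β + γ ≤ k) (hm : 0 < m) (hvl : v ≤ l) :
    ∫⁻ y in Ioc 0 v, ENNReal.ofReal (dataWeight t γ k m y) * ENNReal.ofReal (y ^ (-β))
      ≤ ENNReal.ofReal (8 ^ γ * Real.Gamma γ) *
        ENNReal.ofReal (t ^ (-γ) * l ^ ((k : ℝ) - γ - β)) := by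
  have hG : 0 < Real.Gamma γ := Real.Gamma_pos_of_pos hγ
  by_cases hv : v ≤ 0
  · rw [Ioc_eq_empty (not_lt.2 hv)]; simp
  have hl : 0 < l := lt_of_lt_of_le (not_le.1 hv) hvl
  have hpt : ∀ y ∈ Ioc 0 v, ENNReal.ofReal (dataWeight t γ k m y) * ENNReal.ofReal (y ^ (-β))
      ≤ ENNReal.ofReal (m ^ γ * l ^ ((k : ℝ) - γ - β)) *
        ENNReal.ofReal (y ^ (γ - 1) * Real.exp (-(t * m / 8 * y))) := by
    rintro y ⟨hy, hyv⟩
    rw [← ENNReal.ofReal_mul (by unfold dataWeight; positivity), ← ENNReal.ofReal_mul (by positivity)]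
    apply ENNReal.ofReal_le_ofReal
    have e1 : y⁻¹ * y ^ k * y ^ (-β) = y ^ ((k : ℝ) - γ - β) * y ^ (γ - 1) := by
      rw [← Real.rpow_neg_one, ← Real.rpow_natCast, ← Real.rpow_add hy, ← Real.rpow_add hy,
        ← Real.rpow_add hy]
      congr 1; ring
    rw [dataWeight, show t * m * y / 8 = t * m / 8 * y by ring]
    calc Real.exp (-(t * m / 8 * y)) * m ^ γ * y⁻¹ * y ^ k * y ^ (-β)
        = Real.exp (-(t * m / 8 * y)) * m ^ γ * (y⁻¹ * y ^ k * y ^ (-β)) := by ring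
      _ = Real.exp (-(t * m / 8 * y)) * m ^ γ * (y ^ ((k : ℝ) - γ - β) * y ^ (γ - 1)) := by rw [e1]
      _ ≤ Real.exp (-(t * m / 8 * y)) * m ^ γ * (l ^ ((k : ℝ) - γ - β) * y ^ (γ - 1)) := by
          gcongr
          · linarith
          · linarith
      _ = _ := by ring
  refine (setLIntegral_mono_ae' measurableSet_Ioc (Eventually.of_forall hpt)).trans ?_
  rw [lintegral_const_mul' _ _ ENNReal.ofReal_ne_top]
  refine (mul_le_mul_right (lintegral_mono_set Ioc_subset_Ioi_self) _).trans (le_of_eq ?_)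
  rw [lintegral_rpow_mul_exp hγ (by positivity), ← ENNReal.ofReal_mul (by positivity),
    ← ENNReal.ofReal_mul (by positivity)]
  congr 1
  rw [Real.div_rpow (by positivity) (by norm_num), Real.mul_rpow ht.le hm.le, Real.rpow_neg hm.le,
    Real.rpow_neg (by norm_num : (0 : ℝ) ≤ 8)]
  field_simp

/-- The density, in the coordinates `(r, y)`, that dominates the antiholomorphic derivative. -/
noncomputable def dbarDensity (N t γ β : ℝ) (k : ℕ) (φ ℓ u : ℝ → ℝ) (f G : ℝ → ℂ) (n h0 : ℝ → ℝ≥0∞)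
    (r y : ℝ) : ℝ≥0∞ :=
  if y ≤ u r then
    ENNReal.ofReal (errWeight N t γ (deriv φ r) (ℓ r) (u r) y) * (‖f r‖ₑ * n r) +
      ENNReal.ofReal (dataWeight t γ k (deriv φ r) y) * ENNReal.ofReal (y ^ (-β)) * (‖G r‖ₑ * h0 r)
  else 0

lemma measurable_dbarDensity (N t γ β : ℝ) (k : ℕ) (φ : ℝ → ℝ) {ℓ u : ℝ → ℝ} {f G : ℝ → ℂ}
    {n h0 : ℝ → ℝ≥0∞} (hℓ : Measurable ℓ) (hu : Measurable u) (hf : Measurable f) (hG : Measurable G)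
    (hn : Measurable n) (hh : Measurable h0) :
    Measurable (Function.uncurry (dbarDensity N t γ β k φ ℓ u f G n h0)) := by
  have hd : Measurable (deriv φ) := measurable_deriv φ
  unfold Function.uncurry dbarDensity errWeight dataWeight
  refine Measurable.ite (measurableSet_le measurable_snd (hu.comp measurable_fst)) ?_ measurable_const
  refine Measurable.add (Measurable.mul (ENNReal.measurable_ofReal.comp ?_) ?_) (Measurable.mul ?_ ?_)
  · refine Measurable.mul (by fun_prop) (Measurable.add ?_ (by fun_prop))
    exact Measurable.ite (measurableSet_le (hu.comp measurable_fst) (by fun_prop)) measurable_const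
      measurable_const
  · exact (hf.comp measurable_fst).enorm.mul (hn.comp measurable_fst)
  · fun_prop
  · exact (hG.comp measurable_fst).enorm.mul (hh.comp measurable_fst)

lemma lintegral_dbarDensity_le {N t γ β : ℝ} {k : ℕ} {φ ℓ u : ℝ → ℝ} {f G : ℝ → ℂ}
    {n h0 : ℝ → ℝ≥0∞} (hN : 1 ≤ N) (ht : 0 < t) (hγ : 0 < γ) (hβ : β + γ ≤ k)
    (hφ : ∀ x, 0 < ℓ x → 0 < deriv φ x) (huℓ : ∀ x, u x ≤ ℓ x) (hℓ : Measurable ℓ)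
    (hu : Measurable u) (hf : Measurable f) (hn : Measurable n) :
    ∫⁻ r : ℝ, ∫⁻ y in Ioi (0 : ℝ), dbarDensity N t γ β k φ ℓ u f G n h0 r y
      ≤ ENNReal.ofReal ((1 + N ^ γ) * (8 ^ γ * Real.Gamma γ) + N) *
        ((∫⁻ r in {r | 0 < ℓ r}, (ENNReal.ofReal (t ^ (-γ) * ((deriv φ r * ℓ r) ^ γ)⁻¹) +
          if u r < ℓ r then 1 else 0) * (‖f r‖ₑ * n r)) +
        ∫⁻ r in {r | 0 < ℓ r}, ENNReal.ofReal (t ^ (-γ) * ℓ r ^ ((k : ℝ) - γ - β)) *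
          (‖G r‖ₑ * h0 r)) := by
  have hG : 0 < Real.Gamma γ := Real.Gamma_pos_of_pos hγ
  have hset : MeasurableSet {r | 0 < ℓ r} := measurableSet_lt measurable_const hℓ
  set C := ENNReal.ofReal ((1 + N ^ γ) * (8 ^ γ * Real.Gamma γ) + N)
  have hC : ENNReal.ofReal (8 ^ γ * Real.Gamma γ) ≤ C := by
    apply ENNReal.ofReal_le_ofReal
    have : 0 ≤ N ^ γ * (8 ^ γ * Real.Gamma γ) := by positivity
    nlinarith
  have hmeas : Measurable fun r => (ENNReal.ofReal (t ^ (-γ) * ((deriv φ r * ℓ r) ^ γ)⁻¹) +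
      if u r < ℓ r then (1 : ℝ≥0∞) else 0) * (‖f r‖ₑ * n r) := by
    have hd : Measurable (deriv φ) := measurable_deriv φ
    have a1 : Measurable fun r => ENNReal.ofReal (t ^ (-γ) * ((deriv φ r * ℓ r) ^ γ)⁻¹) := by fun_prop
    have a2 : Measurable fun r => if u r < ℓ r then (1 : ℝ≥0∞) else 0 :=
      Measurable.ite (measurableSet_lt hu hℓ) measurable_const measurable_const
    exact (a1.add a2).mul (hf.enorm.mul hn)
  rw [← lintegral_add_left hmeas]
  rw [← lintegral_const_mul' _ _ ENNReal.ofReal_ne_top, ← lintegral_indicator hset]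
  refine lintegral_mono fun r => ?_
  have hcut : ∫⁻ y in Ioi (0 : ℝ), dbarDensity N t γ β k φ ℓ u f G n h0 r y
      = ∫⁻ y in Ioc 0 (u r), (ENNReal.ofReal (errWeight N t γ (deriv φ r) (ℓ r) (u r) y) * (‖f r‖ₑ * n r) +
      ENNReal.ofReal (dataWeight t γ k (deriv φ r) y) * ENNReal.ofReal (y ^ (-β)) * (‖G r‖ₑ * h0 r)) := by
    rw [← lintegral_indicator measurableSet_Ioi, ← lintegral_indicator measurableSet_Ioc]
    refine lintegral_congr fun y => ?_
    by_cases h1 : 0 < y <;> by_cases h2 : y ≤ u r <;>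
      simp [indicator, dbarDensity, h1, h2]
  rw [hcut]
  by_cases hr : 0 < ℓ r
  · rw [indicator_of_mem (by exact hr)]
    have m1 : Measurable fun y => ENNReal.ofReal (errWeight N t γ (deriv φ r) (ℓ r) (u r) y) := by
      unfold errWeight
      refine ENNReal.measurable_ofReal.comp (Measurable.mul (by fun_prop) (Measurable.add ?_ (by fun_prop)))
      exact Measurable.ite (measurableSet_le measurable_const (by fun_prop)) measurable_const
        measurable_const
    have m2 : Measurable fun y => ENNReal.ofReal (dataWeight t γ k (deriv φ r) y) * ENNReal.ofReal (y ^ (-β)) := by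
      unfold dataWeight; fun_prop
    rw [lintegral_add_left (m1.mul_const _), lintegral_mul_const _ m1, lintegral_mul_const _ m2, mul_add]
    refine add_le_add ?_ ?_
    · exact (mul_le_mul' (lintegral_errWeight_le hN ht hγ (hφ r hr) hr (huℓ r)) le_rfl).trans
        (mul_assoc _ _ _).le
    · exact (mul_le_mul' ((lintegral_dataWeight_le ht hγ hβ (hφ r hr) (huℓ r)).trans
        (mul_le_mul' hC le_rfl)) le_rfl).trans (mul_assoc _ _ _).le
  · rw [indicator_of_notMem (by exact hr), Ioc_eq_empty (not_lt.2 ((huℓ r).trans (not_lt.1 hr)))]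
    simp

/-- Weights at the centre `x` of a window are replaced by weights at a point `r` in it, in
preparation for Tonelli. The factors of two weaken the exponential rate from `1/4` to `1/8`, and the
Lipschitz bound for `u` raises `N'` to `N' + 1`. -/
lemma weights_comparable {N' t γ mx mr lx lr ux ur y : ℝ} (k : ℕ) (ht : 0 < t) (hγ : 0 < γ) (hy : 0 < y)
    (hmx : 0 < mx) (h1 : mx ≤ 2 * mr) (h2 : mr ≤ 2 * mx) (hlr : 0 < lr) (h3 : lr ≤ 2 * lx)
    (hur : |ur - ux| ≤ y) :
    Real.exp (-(t * mx * y / 4)) * mx ^ γ * y⁻¹ * ((if ux ≤ N' * y then 1 else 0) + (y / lx) ^ γ)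
      ≤ 4 ^ γ * (errWeight (N' + 1) t γ mr lr ur y * mr ^ γ) ∧
    Real.exp (-(t * mx * y / 4)) * mx ^ γ * y⁻¹ * y ^ k ≤ 4 ^ γ * dataWeight t γ k mr y := by
  have hmr : 0 < mr := by linarith
  have hlx : 0 < lx := by linarith
  have e1 : Real.exp (-(t * mx * y / 4)) ≤ Real.exp (-(t * mr * y / 8)) := by
    apply Real.exp_le_exp.2
    have : t * mr * y ≤ t * (2 * mx) * y := by gcongr
    linarith
  have e2 : mx ^ γ ≤ 2 ^ γ * mr ^ γ := by
    rw [← Real.mul_rpow (by norm_num) hmr.le]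
    exact Real.rpow_le_rpow hmx.le h1 hγ.le
  have h2γ : (1 : ℝ) ≤ 2 ^ γ := Real.one_le_rpow (by norm_num) hγ.le
  have e4 : (4 : ℝ) ^ γ = 2 ^ γ * 2 ^ γ := by
    rw [← Real.mul_rpow (by norm_num) (by norm_num)]; norm_num
  have e3 : (if ux ≤ N' * y then (1 : ℝ) else 0) + (y / lx) ^ γ
      ≤ 2 ^ γ * ((if ur ≤ (N' + 1) * y then 1 else 0) + (y / lr) ^ γ) := by
    rw [mul_add]
    refine add_le_add ?_ ?_
    · have := (abs_le.1 hur).2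
      split_ifs with ha hb hb
      · linarith
      · exact absurd (by linarith) hb
      · linarith
      · simp
    · rw [← Real.mul_rpow (by norm_num) (by positivity)]
      apply Real.rpow_le_rpow (by positivity) _ hγ.le
      rw [← mul_div_assoc, div_le_div_iff₀ hlx hlr]
      nlinarith
  have p0 : 0 ≤ (if ux ≤ N' * y then (1 : ℝ) else 0) + (y / lx) ^ γ := by
    split_ifs <;> positivity
  refine ⟨?_, ?_⟩
  · calc _ ≤ Real.exp (-(t * mr * y / 8)) * (2 ^ γ * mr ^ γ) * y⁻¹ *
          (2 ^ γ * ((if ur ≤ (N' + 1) * y then 1 else 0) + (y / lr) ^ γ)) := by gcongr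
      _ = _ := by rw [errWeight, e4]; ring
  · calc _ ≤ Real.exp (-(t * mr * y / 8)) * (2 ^ γ * mr ^ γ) * y⁻¹ * y ^ k := by gcongr
      _ ≤ 2 ^ γ * (Real.exp (-(t * mr * y / 8)) * (2 ^ γ * mr ^ γ) * y⁻¹ * y ^ k) :=
          le_mul_of_one_le_left (by positivity) h2γ
      _ = _ := by rw [dataWeight, e4]; ring

/-- Every quantity is transported from `z` to the point `r` over which the kernels average. The
weight `φ' ^ γ` turns `F` back into `f`, and the majorants `n`, `h0` can be evaluated at `r` because
`z` lies in the cone with vertex `r`. The area integral becomes a shear of a fixed density. -/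
lemma enorm_le_lintegral_dbarDensity {M k : ℕ} (K : ExtensionKernel M) {N' C t γ β : ℝ} {CK CE : ℝ≥0}
    (hCK : ∀ s, ‖K.ker s‖ ≤ CK) (hCE : ∀ s, ‖K.err (M + 1 - k) s‖ ≤ CE) (hC : 0 < C)
    (ht : 0 < t) (hγ : 0 < γ) {φ ℓ u : ℝ → ℝ} {f G : ℝ → ℂ} {n h0 : ℝ → ℝ≥0∞} (hf : Measurable f)
    (hu : ∀ x y, |u x - u y| ≤ |x - y|)
    {z w v : ℂ} (hz : 0 < z.im) (hm : 0 < deriv φ z.re)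
    (hcomp : ∀ r, |r - z.re| ≤ z.im → z.im ≤ u r ∧ 0 < ℓ r ∧ deriv φ z.re ≤ 2 * deriv φ r ∧
            deriv φ r ≤ 2 * deriv φ z.re ∧ ℓ r ≤ 2 * ℓ z.re)
    (hn : ∀ r, |r - z.re| ≤ z.im → ‖v‖ₑ ≤ n r)
    (hh : ∀ r, |r - z.re| ≤ z.im → ‖v‖ₑ ≤ h0 r * ENNReal.ofReal (z.im ^ (-β)))
    (hw : ‖w‖ ≤ C * (Real.exp (-(t * deriv φ z.re * z.im / 4)) * deriv φ z.re ^ γ) * z.im⁻¹ *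
            (((if u z.re ≤ N' * z.im then 1 else 0) + (z.im / ℓ z.re) ^ γ) *
              ‖kerExt K.ker (fun x => f x / ((deriv φ x ^ γ : ℝ) : ℂ)) z‖ +
              z.im ^ k * ‖kerExt (K.err (M + 1 - k)) G z‖) * ‖v‖) :
    ‖w‖ₑ ≤ ENNReal.ofReal (C * 4 ^ γ) * (CK + CE) * ∫⁻ s in Icc (-1 : ℝ) 1,
      dbarDensity (N' + 1) t γ β k φ ℓ u f G n h0 (z.re - s * z.im) z.im := by
  set F := fun x => f x / ((deriv φ x ^ γ : ℝ) : ℂ) with hF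
  have hFm : Measurable F := hf.div (Complex.measurable_ofReal.comp ((measurable_deriv φ).pow_const γ))
  set y := z.im
  set x := z.re
  set c1 := Real.exp (-(t * deriv φ x * y / 4)) * deriv φ x ^ γ * y⁻¹ *
    ((if u x ≤ N' * y then 1 else 0) + (y / ℓ x) ^ γ) with hc1
  set c2 := Real.exp (-(t * deriv φ x * y / 4)) * deriv φ x ^ γ * y⁻¹ * y ^ k with hc2
  have hlx : 0 < ℓ x := (hcomp x (by simpa using hz.le)).2.1
  have hc10 : 0 ≤ c1 := by
    have : 0 ≤ (if u x ≤ N' * y then (1 : ℝ) else 0) + (y / ℓ x) ^ γ := by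
      split_ifs <;> positivity
    positivity
  have hc20 : 0 ≤ c2 := by positivity
  have b1 : ‖w‖ₑ ≤ ENNReal.ofReal C * (ENNReal.ofReal c1 * ‖kerExt K.ker F z‖ₑ * ‖v‖ₑ +
      ENNReal.ofReal c2 * ‖kerExt (K.err (M + 1 - k)) G z‖ₑ * ‖v‖ₑ) := by
    rw [← ofReal_norm w, ← ofReal_norm v, ← ofReal_norm (kerExt K.ker F z),
      ← ofReal_norm (kerExt (K.err (M + 1 - k)) G z), ← ENNReal.ofReal_mul hc10,
      ← ENNReal.ofReal_mul (by positivity), ← ENNReal.ofReal_mul hc20,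
      ← ENNReal.ofReal_mul (by positivity), ← ENNReal.ofReal_add (by positivity) (by positivity),
      ← ENNReal.ofReal_mul hC.le]
    apply ENNReal.ofReal_le_ofReal
    refine hw.trans (le_of_eq ?_)
    rw [hc1, hc2]; ring
  have b2 := K.isUnitKernel.enorm_kerExt_le hCK F hz
  have b3 := (K.isUnitKernel_err (M + 1 - k)).enorm_kerExt_le hCE G hz
  have b4 : ENNReal.ofReal c1 * ‖kerExt K.ker F z‖ₑ * ‖v‖ₑ ≤ (CK + CE : ℝ≥0∞) *
      ∫⁻ s in Icc (-1 : ℝ) 1, ENNReal.ofReal c1 * ‖v‖ₑ * ‖F (x - s * y)‖ₑ := by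
    rw [lintegral_const_mul' _ _ (ENNReal.mul_ne_top ENNReal.ofReal_ne_top enorm_ne_top)]
    calc _ ≤ ENNReal.ofReal c1 * (CK * ∫⁻ s in Icc (-1 : ℝ) 1, ‖F (x - s * y)‖ₑ) * ‖v‖ₑ := by gcongr
      _ = CK * (ENNReal.ofReal c1 * ‖v‖ₑ * ∫⁻ s in Icc (-1 : ℝ) 1, ‖F (x - s * y)‖ₑ) := by ring
      _ ≤ _ := by gcongr; exact le_self_add
  have b5 : ENNReal.ofReal c2 * ‖kerExt (K.err (M + 1 - k)) G z‖ₑ * ‖v‖ₑ ≤ (CK + CE : ℝ≥0∞) *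
      ∫⁻ s in Icc (-1 : ℝ) 1, ENNReal.ofReal c2 * ‖v‖ₑ * ‖G (x - s * y)‖ₑ := by
    rw [lintegral_const_mul' _ _ (ENNReal.mul_ne_top ENNReal.ofReal_ne_top enorm_ne_top)]
    calc _ ≤ ENNReal.ofReal c2 * (CE * ∫⁻ s in Icc (-1 : ℝ) 1, ‖G (x - s * y)‖ₑ) * ‖v‖ₑ := by gcongr
      _ = CE * (ENNReal.ofReal c2 * ‖v‖ₑ * ∫⁻ s in Icc (-1 : ℝ) 1, ‖G (x - s * y)‖ₑ) := by ring
      _ ≤ _ := by gcongr; exact le_add_self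
  refine b1.trans ((mul_le_mul_right (add_le_add b4 b5) _).trans ?_)
  have hmF : Measurable fun s : ℝ => ENNReal.ofReal c1 * ‖v‖ₑ * ‖F (x - s * y)‖ₑ :=
    ((hFm.comp (by fun_prop : Measurable fun s : ℝ => x - s * y)).enorm).const_mul _
  rw [← mul_add, ← lintegral_add_left hmF,
    ENNReal.ofReal_mul hC.le, mul_assoc, mul_assoc, mul_left_comm (ENNReal.ofReal (4 ^ γ)),
    ← lintegral_const_mul' (ENNReal.ofReal (4 ^ γ)) _ ENNReal.ofReal_ne_top]
  gcongr ENNReal.ofReal C * ((CK + CE) * ?_)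
  refine setLIntegral_mono_ae' measurableSet_Icc (Eventually.of_forall fun s hs => ?_)
  have hr : |x - s * y - x| ≤ y := by
    rw [sub_sub_cancel_left, abs_neg, abs_mul, abs_of_pos hz]
    exact mul_le_of_le_one_left hz.le (abs_le.2 hs)
  set r := x - s * y
  obtain ⟨q1, q2, q3, q4, q5⟩ := hcomp r hr
  obtain ⟨w1, w2⟩ := weights_comparable (N' := N') (ux := u x) (ur := u r) k ht hγ hz hm q3 q4 q2 q5
    ((hu r x).trans hr)
  have hmr : 0 < deriv φ r := by linarith
  have hfF : ENNReal.ofReal (deriv φ r ^ γ) * ‖F r‖ₑ = ‖f r‖ₑ := by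
    rw [← ofReal_norm, ← ofReal_norm, ← ENNReal.ofReal_mul (by positivity)]
    congr 1
    rw [hF]
    simp only
    rw [norm_div, Complex.norm_real, Real.norm_of_nonneg (by positivity)]
    field_simp
  have hdw : 0 ≤ 4 ^ γ * (errWeight (N' + 1) t γ (deriv φ r) (ℓ r) (u r) y * deriv φ r ^ γ) := hc10.trans w1
  rw [dbarDensity, if_pos q1, mul_add]
  refine add_le_add ?_ ?_
  · calc ENNReal.ofReal c1 * ‖v‖ₑ * ‖F r‖ₑ
        ≤ ENNReal.ofReal (4 ^ γ * (errWeight (N' + 1) t γ (deriv φ r) (ℓ r) (u r) y * deriv φ r ^ γ)) *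
          n r * ‖F r‖ₑ := by
          gcongr
          exact hn r hr
      _ = ENNReal.ofReal (4 ^ γ) * (ENNReal.ofReal (errWeight (N' + 1) t γ (deriv φ r) (ℓ r) (u r) y) *
          ((ENNReal.ofReal (deriv φ r ^ γ) * ‖F r‖ₑ) * n r)) := by
          rw [ENNReal.ofReal_mul (by positivity), ENNReal.ofReal_mul' (by positivity)]
          ring
      _ = _ := by rw [hfF]
  · calc ENNReal.ofReal c2 * ‖v‖ₑ * ‖G r‖ₑ
        ≤ ENNReal.ofReal (4 ^ γ * dataWeight t γ k (deriv φ r) y) *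
          (h0 r * ENNReal.ofReal (y ^ (-β))) * ‖G r‖ₑ := by
          gcongr
          exact hh r hr
      _ = _ := by
          rw [ENNReal.ofReal_mul (by positivity)]
          ring

/-! ### Boundary values of the extension. -/

lemma ExtensionKernel.tendsto_kerExt {M : ℕ} (K : ExtensionKernel M) {v : ℝ → ℂ} {U : Set ℝ}
    (hU : IsOpen U) (hv : ContinuousOn v U) {r : ℝ} (hr : r ∈ U) :
    Tendsto (kerExt K.ker v) (𝓝[{z : ℂ | 0 < z.im}] (r : ℂ)) (𝓝 (v r)) := by
  obtain ⟨C, hC0, hC⟩ := K.isUnitKernel.bounded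
  rw [Metric.tendsto_nhds]
  intro δ hδ
  have hcont : ContinuousAt v r := hv.continuousAt (hU.mem_nhds hr)
  have h1 : ∀ᶠ x in 𝓝 r, x ∈ U ∧ dist (v x) (v r) ≤ δ / (4 * C) := by
    have h0 : ∀ᶠ x in 𝓝 r, x ∈ U := hU.mem_nhds hr
    refine h0.and ?_
    have := (Metric.tendsto_nhds.1 hcont) (δ / (4 * C)) (by positivity)
    exact this.mono fun x hx => hx.le
  obtain ⟨η, hη, hball⟩ := Metric.eventually_nhds_iff_ball.1 h1
  have h2 : ∀ᶠ z : ℂ in 𝓝 (r : ℂ), |z.re - r| + z.im < η := by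
    have : ContinuousAt (fun z : ℂ => |z.re - r| + z.im) (r : ℂ) := by fun_prop
    exact this.eventually_lt_const (by simpa using hη)
  filter_upwards [mem_nhdsWithin_of_mem_nhds h2, self_mem_nhdsWithin] with z hz1 hz2
  have hz2' : 0 < z.im := hz2
  have hin : ∀ x, |x - z.re| ≤ z.im → x ∈ Metric.ball r η := by
    intro x hx
    rw [Metric.mem_ball, Real.dist_eq]
    have := abs_add_le (x - z.re) (z.re - r)
    rw [sub_add_sub_cancel] at this
    linarith
  have h3 := K.isUnitKernel.norm_kerExt_sub_le hC hz2' (u := v)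
    (v := fun x => v r + 0 * ((x : ℂ) - z.re)) (δ := δ / (4 * C))
    (hv.mono fun x hx => (hball x (hin x (abs_le.2 ⟨by linarith [hx.1], by linarith [hx.2]⟩))).1)
    (by fun_prop) (fun x hx => by
      rw [zero_mul, add_zero, ← dist_eq_norm]
      exact (hball x (hin x hx)).2)
  rw [K.kerExt_ker_affine _ _ hz2', mul_zero, add_zero] at h3
  rw [dist_eq_norm]
  calc _ ≤ 2 * C * (δ / (4 * C)) := h3
    _ = δ / 2 := by field_simp; norm_num
    _ < δ := by linarith

lemma ScaledPhase.tendsto_phaseExt {κ M : ℕ} {α A c : ℝ} {φ ℓ : ℝ → ℝ} (K : ExtensionKernel M)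
    (h : ScaledPhase κ α φ ℓ A c) (t γ : ℝ) {r : ℝ} (hr : 0 < ℓ r) :
    Tendsto (phaseExt K t γ φ) (𝓝[{z : ℂ | 0 < z.im}] (r : ℂ))
      (𝓝 (Complex.exp (Complex.I * ((t * φ r : ℝ) : ℂ)) * ((deriv φ r ^ γ : ℝ) : ℂ))) := by
  have hμ := h.deriv_pos r hr
  have h1 := K.tendsto_kerExt h.isOpen (Complex.continuous_ofReal.comp_continuousOn h.continuousOn) hr
  have h2 := K.tendsto_kerExt h.isOpen
    (Complex.continuous_ofReal.comp_continuousOn h.continuousOn_deriv) hr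
  have hs : ((deriv φ r : ℝ) : ℂ) ∈ Complex.slitPlane := by
    rw [Complex.ofReal_mem_slitPlane]; exact hμ
  have h3 := (continuousAt_clog hs).tendsto.comp h2
  have h4 := (Complex.continuous_exp.tendsto _).comp
    ((h1.const_mul (Complex.I * t)).add (h3.const_mul (γ : ℂ)))
  refine (h4.congr fun z => rfl).trans (le_of_eq ?_)
  congr 1
  rw [Complex.exp_add, Complex.ofReal_cpow hμ.le, Complex.cpow_def_of_ne_zero (by exact_mod_cast hμ.ne')]
  simp only [Function.comp_apply]
  push_cast
  ring_nf

/-- Fubini moves the average from `F`, which is only locally integrable, to the continuous factor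
`a`; the limit `ε → 0` can then be taken pointwise in `r`. As `a` vanishes unless `u ≥ 4 ε`, only
the values of `F` on the compact set `u ≥ 3 ε` matter. -/
theorem integral_line_eq {M : ℕ} (K : ExtensionKernel M) {u : ℝ → ℝ} {U : Set ℝ} {F : ℝ → ℂ}
    {a Q : ℂ → ℂ} (hu : ∀ x y, |u x - u y| ≤ |x - y|) (hcomp : ∀ δ > 0, IsCompact {r | δ ≤ u r})
    (hU : ∀ r, 0 < u r → r ∈ U) (hF : LocallyIntegrableOn F U)
    (ha : ∀ z : ℂ, 0 < z.im → ContinuousAt a z) (ha0 : ∀ z : ℂ, 0 < z.im → u z.re < 4 * z.im → a z = 0)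
    (hQ : ∀ z, Q z = a z * kerExt K.ker F z) {ε : ℝ} (hε : 0 < ε) :
    ∫ x : ℝ, Q (x + ε * Complex.I)
      = ∫ r : ℝ, F r * ∫ s : ℝ, K.ker s * a ((r + s * ε : ℝ) + ε * Complex.I) := by
  have hKc := K.isUnitKernel.continuous
  obtain ⟨C, hC0, hC⟩ := K.isUnitKernel.bounded
  set b : ℝ → ℂ := fun x => a (x + ε * Complex.I) with hb
  have hbc : Continuous b := by
    refine continuous_iff_continuousAt.2 fun x => ContinuousAt.comp (ha _ (by simpa using hε)) ?_
    fun_prop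
  have hb0 : ∀ x, u x < 4 * ε → b x = 0 := fun x hx => ha0 _ (by simpa using hε) (by simpa using hx)
  have hbcs : HasCompactSupport b := by
    refine HasCompactSupport.intro (hcomp (4 * ε) (by positivity)) fun x hx => hb0 x ?_
    exact not_le.1 hx
  have hbi : Integrable b := hbc.integrable_of_hasCompactSupport hbcs
  set S := {r | 3 * ε ≤ u r} with hS
  have hSm : MeasurableSet S := (hcomp (3 * ε) (by positivity)).isClosed.measurableSet
  set F' : ℝ → ℂ := S.indicator F with hF'
  have hF'i : Integrable F' := (integrable_indicator_iff hSm).2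
    (hF.integrableOn_compact_subset (fun r hr => hU r (lt_of_lt_of_le (by positivity) hr))
      (hcomp (3 * ε) (by positivity)))
  have hpt : ∀ x : ℝ, Q (x + ε * Complex.I)
      = ∫ r, (ε : ℂ)⁻¹ * (b x * (K.ker ((x - r) / ε) * F' r)) := by
    intro x
    rw [hQ, integral_const_mul, integral_const_mul]
    by_cases hx : u x < 4 * ε
    · have h0 : a (x + ε * Complex.I) = 0 := hb0 x hx
      rw [h0, hb0 x hx]; simp
    · have : kerExt K.ker F (x + ε * Complex.I) = kerExt K.ker F' (x + ε * Complex.I) := by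
        refine K.isUnitKernel.kerExt_congr (by simpa using hε) fun r hr => ?_
        have hr' : |r - x| ≤ ε := by simpa using hr
        rw [hF', indicator_of_mem]
        have := (abs_le.1 ((hu r x).trans hr')).1
        show 3 * ε ≤ u r
        linarith [not_lt.1 hx]
      rw [this, kerExt]
      simp only [Complex.add_re, Complex.ofReal_re, Complex.mul_re, Complex.I_re, mul_zero,
        Complex.ofReal_im, Complex.I_im, mul_one, sub_self, add_zero, Complex.add_im, Complex.mul_im,
        zero_add]
      rw [hb]
      ring
  simp_rw [hpt]
  rw [integral_integral_swap]
  · congr 1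
    ext r
    have e1 : ∀ x : ℝ, (ε : ℂ)⁻¹ * (b x * (K.ker ((x - r) / ε) * F' r))
        = F' r * ((ε : ℂ)⁻¹ * (K.ker ((x - r) / ε) * b x)) := fun x => by ring
    simp_rw [e1]
    rw [integral_const_mul, integral_const_mul]
    have e2 := Measure.integral_comp_mul_right (fun v => K.ker (v / ε) * b (r + v)) ε
    have e3 := integral_sub_right_eq_self (fun v => K.ker (v / ε) * b (r + v)) r (μ := volume)
    simp only [add_sub_cancel] at e3
    simp only [mul_div_cancel_right₀ _ hε.ne'] at e2
    rw [← e3, abs_of_pos (inv_pos.2 hε), Complex.real_smul, Complex.ofReal_inv] at e2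
    rw [← e2]
    by_cases hr : r ∈ S
    · rw [hF', indicator_of_mem hr]
    · rw [hF', indicator_of_notMem hr, zero_mul, eq_comm]
      rw [integral_eq_zero_of_ae, mul_zero]
      refine Eventually.of_forall fun s => ?_
      by_cases hs : 1 < |s|
      · simp [K.isUnitKernel.eq_zero s hs]
      · have h1 : |u (r + s * ε) - u r| ≤ ε := by
          refine (hu _ _).trans ?_
          rw [add_sub_cancel_left, abs_mul, abs_of_pos hε]
          exact mul_le_of_le_one_left hε.le (not_lt.1 hs)
        have h2 : u r < 3 * ε := not_le.1 hr
        have h3 : b (r + s * ε) = 0 := hb0 _ (by linarith [(abs_le.1 h1).2])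
        have h4 : a ((r + s * ε : ℝ) + ε * Complex.I) = 0 := h3
        simp only [h4, mul_zero]
        rfl
  · have h1 : Integrable (fun q : ℝ × ℝ => b q.1 * F' q.2) (volume.prod volume) := hbi.mul_prod hF'i
    have h2 : Integrable (fun q : ℝ × ℝ => K.ker ((q.1 - q.2) / ε) * (b q.1 * F' q.2))
        (volume.prod volume) :=
      h1.bdd_mul (c := C) (hKc.comp (by fun_prop : Continuous fun q : ℝ × ℝ => (q.1 - q.2) / ε)).aestronglyMeasurable
        (Eventually.of_forall fun q => hC _)
    refine (h2.const_mul (ε : ℂ)⁻¹).congr (Eventually.of_forall fun q => ?_)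
    simp only [Function.uncurry]
    ring

/-- Dominated convergence. The averaged factor at `r` is at most a constant times `φ'(r) ^ γ n(r)`,
and `|F| φ' ^ γ = |f|`, so `|f| n` dominates. The kernel has integral one, so the limit is the
boundary value itself; where `u ≤ 0` the integrand vanishes for every `ε`. -/
theorem tendsto_integral_line {κ M : ℕ} {α A c : ℝ} {φ ℓ u : ℝ → ℝ} (K : ExtensionKernel M)
    (h : ScaledPhase κ α φ ℓ A c) {t γ N' C : ℝ} {θ : ℂ → ℝ} {f : ℝ → ℂ} {H : ℂ → ℂ} {n : ℝ → ℝ≥0∞}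
    (hu : ∀ x y, |u x - u y| ≤ |x - y|) (huℓ : ∀ x, u x ≤ ℓ x)
    (hcomp : ∀ δ > 0, IsCompact {r | δ ≤ u r})
    (hθ1 : ∀ z, 0 < z.im → N' * z.im < u z.re → θ z = 1)
    (hcont : ∀ z, 0 < z.im → ContinuousAt (fun w => (θ w : ℂ) * phaseExt K t γ φ w) z)
    (hbd : ∀ z, 0 < z.im → θ z = 0 ∨ 4 * z.im ≤ u z.re ∧ ∀ r, |r - z.re| ≤ z.im →
          ‖(θ z : ℂ) * phaseExt K t γ φ z‖ ≤ C * deriv φ r ^ γ) (hC : 0 < C)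
    (hf : Measurable f) (hn : Measurable n)
    (hF : LocallyIntegrableOn (fun x => f x / ((deriv φ x ^ γ : ℝ) : ℂ)) {x | 0 < ℓ x})
    (hH : Continuous H) (hHb : ∃ B, ∀ z, ‖H z‖ ≤ B)
    (hHn : ∀ z : ℂ, 0 < z.im → ∀ r, |r - z.re| ≤ z.im → ‖H z‖ₑ ≤ n r)
    (hfn : ∫⁻ r in {r | 0 < ℓ r}, ‖f r‖ₑ * n r ≠ ⊤) :
    Tendsto (fun ε : ℝ => ∫ x : ℝ, (θ (x + ε * Complex.I) : ℂ) * phaseExt K t γ φ (x + ε * Complex.I) *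
        kerExt K.ker (fun x => f x / ((deriv φ x ^ γ : ℝ) : ℂ)) (x + ε * Complex.I) *
        H (x + ε * Complex.I)) (𝓝[>] 0)
      (𝓝 (∫ r, {r | 0 < u r}.indicator
        (fun r => Complex.exp (Complex.I * ((t * φ r : ℝ) : ℂ)) * f r * H r) r)) := by
  set F : ℝ → ℂ := fun x => f x / ((deriv φ x ^ γ : ℝ) : ℂ) with hFdef
  have hFm : Measurable F := hf.div (Complex.measurable_ofReal.comp ((measurable_deriv φ).pow_const γ))
  obtain ⟨B, hB⟩ := hHb
  obtain ⟨CK, hCK0, hCK⟩ := K.isUnitKernel.bounded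
  have hKc := K.isUnitKernel.continuous
  set a : ℂ → ℂ := fun z => (θ z : ℂ) * phaseExt K t γ φ z * H z with ha
  have hac : ∀ z : ℂ, 0 < z.im → ContinuousAt a z := fun z hz => (hcont z hz).mul hH.continuousAt
  have ha0 : ∀ z : ℂ, 0 < z.im → u z.re < 4 * z.im → a z = 0 := by
    intro z hz hlt
    rcases hbd z hz with h0 | ⟨h0, -⟩
    · simp [ha, h0]
    · linarith
  have hab : ∀ z : ℂ, 0 < z.im → ∀ r, |r - z.re| ≤ z.im → 0 < ℓ r →
      ‖a z‖ ≤ C * deriv φ r ^ γ * ‖H z‖ := by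
    intro z hz r hr hlr
    have hμ := h.deriv_pos r hlr
    rw [ha]; simp only [norm_mul (_ * _) (H z)]
    rcases hbd z hz with h0 | ⟨-, h0⟩
    · simp only [h0, Complex.ofReal_zero, zero_mul, norm_zero]; positivity
    · gcongr
      exact h0 r hr
  have hUm : MeasurableSet {r | 0 < u r} := by
    have : Continuous u := (LipschitzWith.of_dist_le_mul (K := 1) fun x y => by
      simpa [Real.dist_eq] using hu x y).continuous
    exact (isOpen_lt continuous_const this).measurableSet
  have hlm : MeasurableSet {r | 0 < ℓ r} := h.isOpen.measurableSet
  set g : ℝ → ℝ → ℂ := fun ε r => F r * ∫ s : ℝ, K.ker s * a ((r + s * ε : ℝ) + ε * Complex.I) with hg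
  have hline : ∀ ε : ℝ, 0 < ε → ∫ x : ℝ, (θ (x + ε * Complex.I) : ℂ) *
      phaseExt K t γ φ (x + ε * Complex.I) * kerExt K.ker F (x + ε * Complex.I) *
      H (x + ε * Complex.I) = ∫ r, g ε r := fun ε hε =>
    integral_line_eq K hu hcomp (fun r hr => lt_of_lt_of_le hr (huℓ r)) hF hac ha0
      (Q := fun z => (θ z : ℂ) * phaseExt K t γ φ z * kerExt K.ker F z * H z)
      (fun z => by simp only [ha]; ring) hε
  have hzero : ∀ ε : ℝ, 0 < ε → ∀ r, u r ≤ 0 → ∀ s, K.ker s * a ((r + s * ε : ℝ) + ε * Complex.I) = 0 := by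
    intro ε hε r hr s
    by_cases hs : 1 < |s|
    · simp [K.isUnitKernel.eq_zero s hs]
    · have h1 : |u (r + s * ε) - u r| ≤ ε := by
        refine (hu _ _).trans ?_
        rw [add_sub_cancel_left, abs_mul, abs_of_pos hε]
        exact mul_le_of_le_one_left hε.le (not_lt.1 hs)
      rw [ha0 _ (by simpa using hε) (by
        simp only [Complex.add_re, Complex.ofReal_re, Complex.mul_re, Complex.I_re, mul_zero,
          Complex.ofReal_im, Complex.I_im, mul_one, sub_self, add_zero, Complex.add_im,
          Complex.mul_im, zero_add]
        linarith [(abs_le.1 h1).2]), mul_zero]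
  have hclose : ∀ ε : ℝ, 0 < ε → ∀ r s : ℝ, |s| ≤ 1 →
      |r - (((r + s * ε : ℝ) : ℂ) + ε * Complex.I).re| ≤ (((r + s * ε : ℝ) : ℂ) + ε * Complex.I).im := by
    intro ε hε r s hs
    simp only [Complex.add_re, Complex.ofReal_re, Complex.mul_re, Complex.I_re, mul_zero,
          Complex.ofReal_im, Complex.I_im, mul_one, sub_self, add_zero, Complex.add_im,
          Complex.mul_im, zero_add]
    rw [sub_add_cancel_left, abs_neg, abs_mul, abs_of_pos hε]
    exact mul_le_of_le_one_left hε.le hs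
  have hFf : ∀ r, 0 < ℓ r → F r * ((deriv φ r ^ γ : ℝ) : ℂ) = f r := by
    intro r hr
    have hμ := h.deriv_pos r hr
    have : ((deriv φ r ^ γ : ℝ) : ℂ) ≠ 0 := by
      exact_mod_cast (Real.rpow_pos_of_pos hμ γ).ne'
    simp only [hFdef]; field_simp
  have hnormF : ∀ r, 0 < ℓ r → ‖F r‖ * deriv φ r ^ γ = ‖f r‖ := by
    intro r hr
    have hμ := h.deriv_pos r hr
    rw [← hFf r hr, norm_mul, Complex.norm_real, Real.norm_of_nonneg (by positivity)]
  refine Tendsto.congr' (f₁ := fun ε => ∫ r, g ε r) ?_ ?_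
  · filter_upwards [self_mem_nhdsWithin] with ε hε using (hline ε hε).symm
  refine tendsto_integral_filter_of_dominated_convergence
    ({r | 0 < ℓ r}.indicator fun r => 2 * CK * C * (‖f r‖ₑ * n r).toReal) ?_ ?_ ?_ ?_
  · filter_upwards [self_mem_nhdsWithin] with ε hε
    have hε' : 0 < ε := hε
    refine hFm.aestronglyMeasurable.mul ?_
    have hc : Continuous fun q : ℝ × ℝ => K.ker q.2 * a ((q.1 + q.2 * ε : ℝ) + ε * Complex.I) := by
      refine (hKc.comp continuous_snd).mul ?_
      refine continuous_iff_continuousAt.2 fun q => ?_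
      refine ContinuousAt.comp (f := fun q : ℝ × ℝ => (((q.1 + q.2 * ε : ℝ) : ℂ) + ε * Complex.I))
        (hac _ (by simpa using hε')) ?_
      fun_prop
    exact (hc.stronglyMeasurable.integral_prod_right' (ν := volume)).aestronglyMeasurable
  · filter_upwards [self_mem_nhdsWithin] with ε hε
    have hε' : 0 < ε := hε
    have hae : ∀ᵐ r ∂(volume.restrict {r | 0 < ℓ r}), ‖f r‖ₑ * n r < ⊤ :=
      ae_lt_top (hf.enorm.mul hn) hfn
    rw [ae_restrict_iff' hlm] at hae
    filter_upwards [hae] with r hr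
    by_cases hur : 0 < u r
    · have hlr : 0 < ℓ r := lt_of_lt_of_le hur (huℓ r)
      rw [indicator_of_mem (by exact hlr)]
      have hfin := hr hlr
      have hμ := h.deriv_pos r hlr
      have hI : ‖F r‖ * ‖∫ s : ℝ, K.ker s * a ((r + s * ε : ℝ) + ε * Complex.I)‖
          ≤ ∫ s, (Icc (-1 : ℝ) 1).indicator (fun _ => CK * C * (‖f r‖ₑ * n r).toReal) s := by
        rw [← norm_mul, ← integral_const_mul]
        refine norm_integral_le_of_norm_le
          ((integrable_indicator_iff measurableSet_Icc).2 (integrableOn_const (by simp)))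
          (Eventually.of_forall fun s => ?_)
        by_cases hs : s ∈ Icc (-1 : ℝ) 1
        · rw [indicator_of_mem hs]
          have hs' : |s| ≤ 1 := abs_le.2 hs
          set z : ℂ := ((r + s * ε : ℝ) : ℂ) + ε * Complex.I
          have hz : 0 < z.im := by simpa [z] using hε'
          have h1 := hab z hz r (hclose ε hε' r s hs') hlr
          have h2 : ‖f r‖ * ‖H z‖ ≤ (‖f r‖ₑ * n r).toReal := by
            rw [← toReal_enorm (f r), ← toReal_enorm (H z), ← ENNReal.toReal_mul]
            exact ENNReal.toReal_mono hfin.ne (by gcongr; exact hHn z hz r (hclose ε hε' r s hs'))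
          rw [norm_mul, norm_mul]
          calc ‖F r‖ * (‖K.ker s‖ * ‖a z‖) ≤ ‖F r‖ * (CK * (C * deriv φ r ^ γ * ‖H z‖)) := by
                gcongr
                exact hCK s
            _ = CK * C * ((‖F r‖ * deriv φ r ^ γ) * ‖H z‖) := by ring
            _ ≤ CK * C * (‖f r‖ₑ * n r).toReal := by
                rw [hnormF r hlr]; gcongr
        · rw [K.isUnitKernel.eq_zero s (not_le.1 fun h => hs (abs_le.1 h))]
          simp only [zero_mul, mul_zero, norm_zero]
          exact indicator_nonneg (fun _ _ => by positivity) _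
      rw [hg]
      simp only [norm_mul]
      refine hI.trans (le_of_eq ?_)
      rw [integral_indicator measurableSet_Icc, setIntegral_const, smul_eq_mul, measureReal_def,
        Real.volume_Icc, ENNReal.toReal_ofReal (by norm_num)]
      ring
    · have : g ε r = 0 := by
        simp only [hg, hzero ε hε' r (not_lt.1 hur), integral_zero, mul_zero]
      rw [this, norm_zero]
      exact indicator_nonneg (fun _ _ => by positivity) _
  · rw [integrable_indicator_iff hlm]
    exact (integrable_toReal_of_lintegral_ne_top (hf.enorm.mul hn).aemeasurable hfn).const_mul _
  · refine Eventually.of_forall fun r => ?_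
    by_cases hur : 0 < u r
    · have hlr : 0 < ℓ r := lt_of_lt_of_le hur (huℓ r)
      have hμ := h.deriv_pos r hlr
      rw [indicator_of_mem (by exact hur)]
      set L : ℂ := Complex.exp (Complex.I * ((t * φ r : ℝ) : ℂ)) * ((deriv φ r ^ γ : ℝ) : ℂ) * H r with hL
      have hlim : Tendsto a (𝓝[{z : ℂ | 0 < z.im}] (r : ℂ)) (𝓝 L) := by
        have h1 : ∀ᶠ z : ℂ in 𝓝[{z : ℂ | 0 < z.im}] (r : ℂ), phaseExt K t γ φ z * H z = a z := by
          have hcu : Continuous u := (LipschitzWith.of_dist_le_mul (K := 1) fun x y => by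
            simpa [Real.dist_eq] using hu x y).continuous
          have h2 : ∀ᶠ z : ℂ in 𝓝 (r : ℂ), N' * z.im < u z.re := by
            have c1 : ContinuousAt (fun z : ℂ => u z.re - N' * z.im) (r : ℂ) := by fun_prop
            have := c1.eventually_const_lt (u := 0) (by simpa using hur)
            exact this.mono fun z hz => by linarith
          filter_upwards [mem_nhdsWithin_of_mem_nhds h2, self_mem_nhdsWithin] with z hz1 hz2
          simp only [ha]
          rw [hθ1 z hz2 hz1]; simp
        refine Tendsto.congr' h1 ((h.tendsto_phaseExt K t γ hlr).mul ?_)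
        exact (hH.tendsto (r : ℂ)).mono_left nhdsWithin_le_nhds
      have hpath : ∀ s : ℝ, Tendsto (fun ε : ℝ => ((r + s * ε : ℝ) : ℂ) + ε * Complex.I) (𝓝[>] 0)
          (𝓝[{z : ℂ | 0 < z.im}] (r : ℂ)) := by
        intro s
        refine tendsto_nhdsWithin_iff.2 ⟨?_, ?_⟩
        · have : ContinuousAt (fun ε : ℝ => ((r + s * ε : ℝ) : ℂ) + ε * Complex.I) 0 := by fun_prop
          have h2 := this.tendsto
          simp only [mul_zero, add_zero, Complex.ofReal_zero, zero_mul] at h2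
          exact h2.mono_left nhdsWithin_le_nhds
        · filter_upwards [self_mem_nhdsWithin] with ε hε
          simpa using hε
      have hinner : Tendsto (fun ε : ℝ => ∫ s : ℝ, K.ker s * a ((r + s * ε : ℝ) + ε * Complex.I)) (𝓝[>] 0)
          (𝓝 (∫ s : ℝ, K.ker s * L)) := by
        refine tendsto_integral_filter_of_dominated_convergence
          (fun s => ‖K.ker s‖ * (C * deriv φ r ^ γ * B)) ?_ ?_ ?_ ?_
        · filter_upwards [self_mem_nhdsWithin] with ε hε
          refine (hKc.mul (continuous_iff_continuousAt.2 fun s => ?_)).aestronglyMeasurable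
          refine ContinuousAt.comp (f := fun s : ℝ => (((r + s * ε : ℝ) : ℂ) + ε * Complex.I))
            (hac _ (by simpa using hε)) ?_
          fun_prop
        · filter_upwards [self_mem_nhdsWithin] with ε hε
          refine Eventually.of_forall fun s => ?_
          rw [norm_mul]
          by_cases hs : 1 < |s|
          · simp [K.isUnitKernel.eq_zero s hs]
          · have hε' : 0 < ε := hε
            have hz : 0 < (((r + s * ε : ℝ) : ℂ) + ε * Complex.I).im := by simpa using hε'
            have h1 := hab _ hz r (hclose ε hε' r s (not_lt.1 hs)) hlr
            gcongr
            exact h1.trans (by gcongr; exact hB _)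
        · exact K.isUnitKernel.integrable.norm.mul_const _
        · exact Eventually.of_forall fun s => (hlim.comp (hpath s)).const_mul _
      rw [integral_mul_const, K.integral_ker, one_mul] at hinner
      refine (hinner.const_mul (F r)).trans (le_of_eq ?_)
      congr 1
      rw [hL, ← hFf r hlr]
      ring
    · rw [indicator_of_notMem (by exact hur)]
      refine Tendsto.congr' (f₁ := fun _ => 0) ?_ tendsto_const_nhds
      filter_upwards [self_mem_nhdsWithin] with ε hε
      simp only [hg, hzero ε hε r (not_lt.1 hur), integral_zero, mul_zero]

/-! ### The oscillatory integral against a holomorphic function. -/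

/-- Green's theorem above the line at height `ε`, for the scale truncated at radius `R`; then `ε →
0` recovers the boundary integral and `R → ∞` removes the truncation. The two majorants of `H` serve
the two kinds of error: `n` goes with `f`, and `h0 y ^ (-β)` with the derivative datum. -/
theorem ScaledPhase.enorm_integral_le {κ k : ℕ} {α A c β : ℝ} (hα : 0 ≤ α) (hγ : 0 < (κ : ℝ) + α)
    (hA : 0 < A) (hc : 0 < c) (hβ : β + ((κ : ℝ) + α) ≤ k) :
    ∃ C : ℝ≥0, ∀ φ ℓ : ℝ → ℝ, ScaledPhase κ α φ ℓ A c → ∀ t : ℝ, 0 < t → ∀ f G : ℝ → ℂ,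
      Measurable f → Measurable G →
      IsWeakDeriv k {x | 0 < ℓ x} (fun x => f x / ((deriv φ x ^ ((κ : ℝ) + α) : ℝ) : ℂ)) G →
      ∀ (H : ℂ → ℂ) (n h0 : ℝ → ℝ≥0∞), Continuous H → (∃ B, ∀ z, ‖H z‖ ≤ B) →
      (∀ z, 0 < z.im → DifferentiableAt ℂ H z) → Measurable n → Measurable h0 →
      (∀ z : ℂ, 0 < z.im → ∀ r, |r - z.re| ≤ z.im →
        ‖H z‖ₑ ≤ n r ∧ ‖H z‖ₑ ≤ h0 r * ENNReal.ofReal (z.im ^ (-β))) →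
      ∫⁻ r in {r | 0 < ℓ r}, ‖f r‖ₑ * n r ≠ ⊤ →
      ‖∫ r in {r | 0 < ℓ r}, Complex.exp (Complex.I * ((t * φ r : ℝ) : ℂ)) * f r * H r‖ₑ ≤
        C * ((∫⁻ r in {r | 0 < ℓ r}, ENNReal.ofReal (t ^ (-((κ : ℝ) + α)) *
            ((deriv φ r * ℓ r) ^ ((κ : ℝ) + α))⁻¹) * (‖f r‖ₑ * n r)) +
          ∫⁻ r in {r | 0 < ℓ r}, ENNReal.ofReal (t ^ (-((κ : ℝ) + α)) *
            ℓ r ^ ((k : ℝ) - ((κ : ℝ) + α) - β)) * (‖G r‖ₑ * h0 r)) := by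
  -- This order is large enough to annihilate the Taylor polynomials of degree `κ + 1` and to
  -- release `k` derivatives.
  obtain ⟨K⟩ := exists_extensionKernel (k + κ + 1) (by omega)
  obtain ⟨N', C1, hN', hC1, hext⟩ := ScaledPhase.exists_extension (k := k) K (by omega) (by omega)
    hα hγ hA hc
  obtain ⟨CK, hCK0, hCK⟩ := K.isUnitKernel.bounded
  obtain ⟨CE, hCE0, hCE⟩ := (K.isUnitKernel_err (k + κ + 1 + 1 - k)).bounded
  lift CK to ℝ≥0 using hCK0.le
  lift CE to ℝ≥0 using hCE0.le
  set γ := (κ : ℝ) + α with hγdef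
  set C2 : ℝ≥0∞ := ENNReal.ofReal (C1 * 4 ^ γ) * (CK + CE) * (2 *
    ENNReal.ofReal ((1 + (N' + 1) ^ γ) * (8 ^ γ * Real.Gamma γ) + (N' + 1))) with hC2
  have hC2top : C2 ≠ ⊤ := by
    refine ENNReal.mul_ne_top (ENNReal.mul_ne_top ENNReal.ofReal_ne_top (by simp))
      (ENNReal.mul_ne_top (by simp) ENNReal.ofReal_ne_top)
  refine ⟨C2.toNNReal, fun φ ℓ h t ht f G hf hG hFG H n h0 hH hHb hHd hn hh0 hmaj hfn => ?_⟩
  rw [ENNReal.coe_toNNReal hC2top]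
  set F : ℝ → ℂ := fun x => f x / ((deriv φ x ^ γ : ℝ) : ℂ) with hFdef
  have hℓc := h.continuous_scale
  have hlm : MeasurableSet {r | 0 < ℓ r} := h.isOpen.measurableSet
  set osc : ℝ → ℂ := fun r => Complex.exp (Complex.I * ((t * φ r : ℝ) : ℂ)) * f r * H r with hosc
  set T1 : ℝ≥0∞ := ∫⁻ r in {r | 0 < ℓ r}, ENNReal.ofReal (t ^ (-γ) *
            ((deriv φ r * ℓ r) ^ γ)⁻¹) * (‖f r‖ₑ * n r) with hT1
  set T2 : ℝ≥0∞ := ∫⁻ r in {r | 0 < ℓ r}, ENNReal.ofReal (t ^ (-γ) *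
            ℓ r ^ ((k : ℝ) - γ - β)) * (‖G r‖ₑ * h0 r) with hT2
  -- The excess left by the cutoff where truncation made `u` smaller than `ℓ`; it carries no decay
  -- in `t` and is removed only by the limit in `R`.
  set tail : ℝ → ℝ≥0∞ := fun R => ∫⁻ r in {r | 0 < ℓ r},
    (if truncScale ℓ R r < ℓ r then 1 else 0) * (‖f r‖ₑ * n r) with htail
  have step : ∀ R : ℝ, 0 < R → ‖∫ r, {r | 0 < truncScale ℓ R r}.indicator osc r‖ₑ
      ≤ C2 * ((T1 + tail R) + T2) := by
    intro R hR
    set u := truncScale ℓ R with hu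
    have hulip := truncScale_lipschitz (R := R) h.lipschitz
    have hucont : Continuous u := continuous_truncScale hℓc
    obtain ⟨θ, hθ01, hθ1, hθ⟩ := hext φ ℓ h u hulip (fun x => truncScale_le x)
      (integrable_truncScale hℓc h.nonneg)
    obtain ⟨hcont, hbd, hW⟩ := hθ t ht
    obtain ⟨hWc, hWd⟩ := hW F G hFG H hHd
    have hcomp : ∀ δ > 0, IsCompact {r | δ ≤ u r} := by
      intro δ hδ
      refine isCompact_Icc.of_isClosed_subset (isClosed_le continuous_const hucont)
        (fun r hr => ?_ : _ ⊆ Icc (-R) R)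
      by_contra hcon
      have h1 : R ≤ |r| := by
        by_contra h2
        exact hcon (abs_le.1 (not_le.1 h2).le)
      have h3 : u r ≤ 0 := truncScale_le_zero h1
      have h4 : δ ≤ u r := hr
      linarith
    have hlim := tendsto_integral_line K h (u := u) hulip (fun x => truncScale_le x) hcomp hθ1 hcont hbd
      hC1 hf hn hFG.1 hH hHb (fun z hz r hr => (hmaj z hz r hr).1) hfn
    refine le_of_tendsto ((continuous_enorm.tendsto _).comp hlim) ?_
    filter_upwards [self_mem_nhdsWithin] with ε hε
    have hε' : 0 < ε := hε
    simp only [Function.comp_apply]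
    have hθ0 : ∀ z : ℂ, 0 < z.im → u z.re < 4 * z.im → θ z = 0 := by
      intro z hz hlt
      rcases hbd z hz with h1 | ⟨h1, -⟩
      · exact h1
      · linarith
    -- The cutoff vanishes unless `4 y ≤ u(x)`, and `u` is at most `R` and vanishes for `|x| ≥ R`,
    -- so a rectangle of this size contains the support.
    refine (enorm_integral_le_lintegral_dbar (ε := ε) (R := R + ε + 1)
      (W := fun w => (θ w : ℂ) * phaseExt K t γ φ w * kerExt K.ker F w * H w) (by linarith) (by linarith)
      (fun z hz => hWc z (by linarith)) (fun z hz hre => ?_) (fun z hz => ?_)).trans ?_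
    · have hz0 : 0 < z.im := by linarith
      have : u z.re ≤ 0 := truncScale_le_zero (by linarith)
      simp [hθ0 z hz0 (by linarith)]
    · have hz0 : 0 < z.im := by linarith
      have : u z.re ≤ R := truncScale_le_radius hR.le _
      simp [hθ0 z hz0 (by linarith)]
    set B := dbarDensity (N' + 1) t γ β k φ ℓ u f G n h0 with hB
    have hBm : Measurable (Function.uncurry B) :=
      measurable_dbarDensity _ _ _ _ _ _ hℓc.measurable hucont.measurable hf hG hn hh0
    have hpt : ∀ x y : ℝ, y ∈ Ioi ε →
        ‖dbar (fun w => (θ w : ℂ) * phaseExt K t γ φ w * kerExt K.ker F w * H w) (x + y * Complex.I)‖ₑ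
        ≤ ENNReal.ofReal (C1 * 4 ^ γ) * (CK + CE) * ∫⁻ s in Icc (-1 : ℝ) 1, B (x - s * y) y := by
      intro x y hy
      have hy0 : 0 < y := hε'.trans hy
      set z : ℂ := x + y * Complex.I with hz
      have hzre : z.re = x := by simp [hz]
      have hzim : z.im = y := by simp [hz]
      have hz0 : 0 < z.im := by rw [hzim]; exact hy0
      rcases hWd z hz0 with h1 | ⟨h1, h2⟩
      · rw [h1, enorm_zero]; exact zero_le
      · have := enorm_le_lintegral_dbarDensity K hCK hCE hC1 ht hγ (β := β) (n := n) (h0 := h0) hf hulip hz0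
          (h.deriv_pos _ (h1 z.re (by simpa using hz0.le)).2.1) h1
          (fun r hr => (hmaj z hz0 r hr).1) (fun r hr => (hmaj z hz0 r hr).2) h2
        rwa [hzre, hzim] at this
    calc _ ≤ ∫⁻ x : ℝ, ∫⁻ y in Ioi ε, ENNReal.ofReal (C1 * 4 ^ γ) * (CK + CE) *
          ∫⁻ s in Icc (-1 : ℝ) 1, B (x - s * y) y :=
          lintegral_mono fun x => setLIntegral_mono_ae' measurableSet_Ioi
            (Eventually.of_forall fun y hy => hpt x y hy)
      _ = ENNReal.ofReal (C1 * 4 ^ γ) * (CK + CE) *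
          ∫⁻ x : ℝ, ∫⁻ y in Ioi ε, ∫⁻ s in Icc (-1 : ℝ) 1, B (x - s * y) y := by
          have hne : ENNReal.ofReal (C1 * 4 ^ γ) * (CK + CE) ≠ ⊤ :=
            ENNReal.mul_ne_top ENNReal.ofReal_ne_top (by simp)
          rw [← lintegral_const_mul' _ _ hne]
          refine lintegral_congr fun x => ?_
          rw [lintegral_const_mul' _ _ hne]
      _ ≤ ENNReal.ofReal (C1 * 4 ^ γ) * (CK + CE) * (2 * ∫⁻ r : ℝ, ∫⁻ y in Ioi (0 : ℝ), B r y) := by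
          gcongr
          exact lintegral_shear_le hBm hε'.le
      _ ≤ ENNReal.ofReal (C1 * 4 ^ γ) * (CK + CE) * (2 *
          (ENNReal.ofReal ((1 + (N' + 1) ^ γ) * (8 ^ γ * Real.Gamma γ) + (N' + 1)) *
            ((T1 + tail R) + T2))) := by
          gcongr
          refine (lintegral_dbarDensity_le (by linarith) ht hγ hβ h.deriv_pos (fun x => truncScale_le x)
            hℓc.measurable hucont.measurable hf hn).trans ?_
          gcongr
          rw [hT1, htail]
          simp only
          rw [← lintegral_add_left']
          · refine lintegral_mono fun r => le_of_eq ?_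
            simp only
            rw [add_mul]
          · have hd : Measurable (deriv φ) := measurable_deriv φ
            have hℓm := hℓc.measurable
            have a1 : Measurable fun r => ENNReal.ofReal (t ^ (-γ) * ((deriv φ r * ℓ r) ^ γ)⁻¹) := by
              fun_prop
            exact (a1.mul (hf.enorm.mul hn)).aemeasurable
      _ = _ := by rw [hC2]; ring
  have hfm : AEStronglyMeasurable (fun r => Complex.exp (Complex.I * ((t * φ r : ℝ) : ℂ)) * f r * H r)
      (volume.restrict {r | 0 < ℓ r}) := by
    have h1 : AEStronglyMeasurable (fun r => Complex.exp (Complex.I * ((t * φ r : ℝ) : ℂ)))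
        (volume.restrict {r | 0 < ℓ r}) := by
      refine ContinuousOn.aestronglyMeasurable ?_ hlm
      refine Complex.continuous_exp.comp_continuousOn (continuousOn_const.mul ?_)
      exact Complex.continuous_ofReal.comp_continuousOn (continuousOn_const.mul h.continuousOn)
    exact (h1.mul hf.aestronglyMeasurable).mul
      ((hH.comp Complex.continuous_ofReal).aestronglyMeasurable)
  have hHn : ∀ r : ℝ, ‖H r‖ₑ ≤ n r := by
    intro r
    have hpath : Tendsto (fun ε : ℝ => (r : ℂ) + ε * Complex.I) (𝓝[>] 0) (𝓝 (r : ℂ)) := by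
      have : ContinuousAt (fun ε : ℝ => (r : ℂ) + ε * Complex.I) 0 := by fun_prop
      have h2 := this.tendsto
      simp only [add_zero, Complex.ofReal_zero, zero_mul] at h2
      exact h2.mono_left nhdsWithin_le_nhds
    refine le_of_tendsto ((continuous_enorm.tendsto _).comp ((hH.tendsto _).comp hpath)) ?_
    filter_upwards [self_mem_nhdsWithin] with ε hε
    have hε' : 0 < ε := hε
    refine (hmaj _ (by simpa using hε') r ?_).1
    simpa using hε'.le
  have hnorm : ∀ r, ‖osc r‖ₑ ≤ ‖f r‖ₑ * n r := by
    intro r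
    have h1 : ‖Complex.exp (Complex.I * ((t * φ r : ℝ) : ℂ))‖ₑ = 1 := by
      rw [← ofReal_norm, mul_comm, Complex.norm_exp_ofReal_mul_I, ENNReal.ofReal_one]
    rw [hosc]
    simp only [enorm_mul]
    rw [h1, one_mul]
    gcongr
    exact hHn r
  have hposR : ∀ r R, 0 < truncScale ℓ R r → 0 < ℓ r := fun r R hr => lt_of_lt_of_le hr (truncScale_le r)
  have hLHS : Tendsto (fun R => ∫ r, {r | 0 < truncScale ℓ R r}.indicator osc r) atTop
      (𝓝 (∫ r in {r | 0 < ℓ r}, osc r)) := by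
    have e1 : ∀ R, ∫ r, {r | 0 < truncScale ℓ R r}.indicator osc r
        = ∫ r in {r | 0 < ℓ r}, {r | 0 < truncScale ℓ R r}.indicator osc r := by
      intro R
      rw [setIntegral_eq_integral_of_forall_compl_eq_zero]
      intro r hr
      exact indicator_of_notMem (s := {r | 0 < truncScale ℓ R r}) (f := osc)
        (fun hcon => hr (hposR r R hcon))
    simp_rw [e1]
    refine tendsto_integral_filter_of_dominated_convergence (fun r => (‖f r‖ₑ * n r).toReal) ?_ ?_ ?_ ?_
    · refine Eventually.of_forall fun R => hfm.indicator ?_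
      exact (isOpen_lt continuous_const (continuous_truncScale hℓc)).measurableSet
    · refine Eventually.of_forall fun R => ?_
      filter_upwards [ae_lt_top (hf.enorm.mul hn) hfn] with r hr
      refine (norm_indicator_le_norm_self _ _).trans ?_
      rw [← toReal_enorm]
      exact ENNReal.toReal_mono hr.ne (hnorm r)
    · exact integrable_toReal_of_lintegral_ne_top (hf.enorm.mul hn).aemeasurable hfn
    · filter_upwards [ae_restrict_mem hlm] with r hr
      refine tendsto_const_nhds.congr' ?_
      filter_upwards [eventually_truncScale_eq ℓ r] with R hR
      rw [indicator_of_mem]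
      show 0 < truncScale ℓ R r
      rw [hR]; exact hr
  -- At each point the truncated scale eventually equals `ℓ`, and `|f| n` dominates.
  have htail0 : Tendsto tail atTop (𝓝 0) := by
    have := tendsto_lintegral_filter_of_dominated_convergence
      (μ := volume.restrict {r | 0 < ℓ r}) (l := (atTop : Filter ℝ))
      (F := fun R r => (if truncScale ℓ R r < ℓ r then (1 : ℝ≥0∞) else 0) * (‖f r‖ₑ * n r))
      (f := fun _ => 0) (fun r => ‖f r‖ₑ * n r) (Eventually.of_forall fun R => ?_)
      (Eventually.of_forall fun R => Eventually.of_forall fun r => ?_) hfn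
      (Eventually.of_forall fun r => ?_)
    · rw [lintegral_zero] at this; exact this
    · have a2 : Measurable fun r => if truncScale ℓ R r < ℓ r then (1 : ℝ≥0∞) else 0 :=
        Measurable.ite (measurableSet_lt (continuous_truncScale hℓc).measurable hℓc.measurable)
          measurable_const measurable_const
      exact a2.mul (hf.enorm.mul hn)
    · split_ifs
      · rw [one_mul]
      · rw [zero_mul]; exact zero_le
    · refine tendsto_const_nhds.congr' ?_
      filter_upwards [eventually_truncScale_eq ℓ r] with R hR
      simp [hR]
  have hRHS : Tendsto (fun R => C2 * ((T1 + tail R) + T2)) atTop (𝓝 (C2 * ((T1 + 0) + T2))) :=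
    ENNReal.Tendsto.const_mul ((htail0.const_add T1).add_const T2) (Or.inr hC2top)
  rw [add_zero] at hRHS
  refine le_of_tendsto_of_tendsto ((continuous_enorm.tendsto _).comp hLHS) hRHS ?_
  filter_upwards [eventually_gt_atTop 0] with R hR using step R hR

/-! ### From admissible scales on `Ω` to the theorem. -/

/-- The segment from a point of `Ω` to a point outside meets the boundary, where `ℓ` tends to zero;
hence `ℓ(x)` is at most the distance to the complement and the extension by zero is still
`1`-Lipschitz. -/
theorem IsAdmissible.scaledPhase {κ : ℕ} {α A c : ℝ} {Ω : Set ℝ} {φ ℓ : ℝ → ℝ} (hA : 0 < A)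
    (hΩ : IsOpen Ω) (hφ : IsPhase κ α Ω φ) (hℓ : IsAdmissible κ α Ω φ ℓ A c) :
    ScaledPhase κ α φ (Ω.indicator ℓ) A c := by
  have hpos : ∀ x, 0 < Ω.indicator ℓ x → x ∈ Ω := fun x hx => by
    by_contra hcon
    rw [indicator_of_notMem hcon] at hx
    exact lt_irrefl _ hx
  have key : ∀ x ∈ Ω, ∀ y ∉ Ω, ℓ x ≤ |x - y| := by
    intro x hx y hy
    obtain ⟨b, hb, hbΩ⟩ : ∃ b ∈ uIcc x y, b ∈ frontier Ω := by
      by_contra! hcon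
      have hout : ∀ b ∈ uIcc x y, b ∉ Ω → b ∈ (closure Ω)ᶜ := fun b hb hbΩ hcl =>
        hcon b hb ⟨hcl, by rwa [hΩ.interior_eq]⟩
      obtain ⟨b, -, hb1, hb2⟩ := isPreconnected_uIcc Ω (closure Ω)ᶜ hΩ
        isClosed_closure.isOpen_compl (fun b hb => or_iff_not_imp_left.2 (hout b hb))
        ⟨x, left_mem_uIcc, hx⟩ ⟨y, right_mem_uIcc, hout y right_mem_uIcc hy⟩
      exact hb2 (subset_closure hb1)
    have hne : (𝓝[Ω] b).NeBot := mem_closure_iff_nhdsWithin_neBot.1 (frontier_subset_closure hbΩ)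
    have hlim : Tendsto (fun z => ℓ z + |x - z|) (𝓝[Ω] b) (𝓝 (0 + |x - b|)) :=
      (hℓ.boundary b hbΩ).add
        ((continuous_const.sub continuous_id).abs.continuousWithinAt)
    refine (ge_of_tendsto hlim ?_).trans ?_
    · filter_upwards [self_mem_nhdsWithin] with z hz
      linarith [(abs_le.1 (hℓ.lipschitz x hx z hz)).2]
    · rw [zero_add, abs_sub_comm x b, abs_sub_comm x y]
      exact abs_sub_left_of_mem_uIcc hb
  refine ⟨fun x => indicator_nonneg hℓ.nonneg x, fun x y => ?_,
    hφ.contDiffOn.mono fun x hx => hpos x hx, fun x hx => hφ.deriv_pos x (hpos x hx),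
    fun x hx j hj1 hj2 => ?_, fun x y hx hy hxy => ?_⟩
  · by_cases hx : x ∈ Ω <;> by_cases hy : y ∈ Ω
    · rw [indicator_of_mem hx, indicator_of_mem hy]; exact hℓ.lipschitz x hx y hy
    · rw [indicator_of_mem hx, indicator_of_notMem hy, sub_zero, abs_of_nonneg (hℓ.nonneg x hx)]
      exact key x hx y hy
    · rw [indicator_of_notMem hx, indicator_of_mem hy, zero_sub, abs_neg,
        abs_of_nonneg (hℓ.nonneg y hy), abs_sub_comm]
      exact key y hy x hx
    · rw [indicator_of_notMem hx, indicator_of_notMem hy, sub_zero, abs_zero]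
      exact abs_nonneg _
  · have := hℓ.deriv_bound x (hpos x hx) j hj1 hj2
    rwa [abs_of_pos (hφ.deriv_pos x (hpos x hx)), ← indicator_of_mem (hpos x hx) ℓ] at this
  · have hxΩ := hpos x hx
    have hd := hφ.deriv_pos x hxΩ
    rw [indicator_of_mem hxΩ] at hx hxy ⊢
    rcases eq_or_ne y x with rfl | hne
    · rw [sub_self, abs_zero]; positivity
    · have := hℓ.holder_bound x hxΩ y (hpos y hy) hne hxy
      rw [abs_of_pos hd, abs_sub_comm (iteratedDeriv (κ + 1) φ x), abs_sub_comm x] at this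
      have hyx : 0 < |y - x| ^ α := Real.rpow_pos_of_pos (abs_pos.2 (sub_ne_zero.2 hne)) _
      have hγ : 0 < ℓ x ^ ((κ : ℝ) + α) := Real.rpow_pos_of_pos hx _
      rw [Real.rpow_neg hx.le, ← div_eq_mul_inv, div_mul_eq_mul_div, le_div_iff₀ hγ]
      rw [div_mul_eq_mul_div, div_le_iff₀ hyx] at this
      exact this

/-- It allows the passage from `Ω` to `{ℓ > 0}` and from `f`, `G` to measurable representatives in
one stroke. -/
theorem IsWeakDeriv.congr_ae {k : ℕ} {Ω Ω' : Set ℝ} {F F' G G' : ℝ → ℂ} (h : IsWeakDeriv k Ω F G)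
    (hΩ' : MeasurableSet Ω') (hsub : Ω' ⊆ Ω) (hF : F =ᵐ[volume.restrict Ω'] F')
    (hG : G =ᵐ[volume.restrict Ω'] G') : IsWeakDeriv k Ω' F' G' := by
  have hloc : ∀ {u v : ℝ → ℂ}, LocallyIntegrableOn u Ω volume → u =ᵐ[volume.restrict Ω'] v →
      LocallyIntegrableOn v Ω' volume := by
    intro u v hu huv x hx
    obtain ⟨U, hU, hUu⟩ := hu.mono_set hsub x hx
    refine ⟨U ∩ Ω', inter_mem hU self_mem_nhdsWithin, ?_⟩
    exact (hUu.mono_set inter_subset_left).congr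
      (ae_mono (Measure.restrict_mono inter_subset_right le_rfl) huv)
  have hint : ∀ {u v : ℝ → ℂ} {χ : ℝ → ℝ}, Function.support χ ⊆ Ω' →
      u =ᵐ[volume.restrict Ω'] v → ∫ x, χ x • u x = ∫ x, χ x • v x := by
    intro u v χ hχ huv
    refine integral_congr_ae ?_
    filter_upwards [(ae_restrict_iff' hΩ').1 huv] with x hx
    by_cases hxΩ : x ∈ Ω'
    · simp only [hx hxΩ]
    · have : χ x = 0 := by
        by_contra hcon
        exact hxΩ (hχ hcon)
      simp only [this, zero_smul]
  refine ⟨hloc h.1 hF, hloc h.2.1 hG, fun ψ hψ hc hψs => ?_⟩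
  have hs' : Function.support (iteratedDeriv k ψ) ⊆ Ω' := by
    have hsupp : ∀ (n : ℕ) (χ : ℝ → ℝ), Function.support (deriv^[n] χ) ⊆ tsupport χ := by
      intro n
      induction n with
      | zero => exact fun χ => subset_tsupport χ
      | succ n ih =>
        intro χ
        rw [Function.iterate_succ_apply]
        exact (ih (deriv χ)).trans (closure_minimal support_deriv_subset isClosed_closure)
    rw [iteratedDeriv_eq_iterate]
    exact (hsupp k ψ).trans hψs
  rw [← hint hs' hF, ← hint ((subset_tsupport ψ).trans hψs) hG]
  exact h.2.2 ψ hψ hc (hψs.trans hsub)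

/-- Hölder with exponents `q` and `q'`. The endpoint `q = 1` has no finite conjugate exponent, but
there `θ = 0` and the claim is an equality. -/
theorem lintegral_mul_rpow_le {μ : Measure ℝ} {q θ s : ℝ} (hq : 1 ≤ q)
    (hθ : θ = s * (1 - 1 / q)) {a N : ℝ → ℝ≥0∞} (ha : AEMeasurable a μ) (hN : AEMeasurable N μ) :
    ∫⁻ x, a x * N x ^ θ ∂μ ≤ (∫⁻ x, a x ^ q ∂μ) ^ (1 / q) * (∫⁻ x, N x ^ s ∂μ) ^ (1 - 1 / q) := by
  rcases hq.eq_or_lt with rfl | hq1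
  · simp [hθ]
  · have hq' := Real.HolderConjugate.conjExponent hq1
    refine (ENNReal.lintegral_mul_le_Lp_mul_Lq μ hq' ha (hN.pow_const θ)).trans (le_of_eq ?_)
    have e : 1 - 1 / q = 1 / q.conjExponent := by
      have := hq'.inv_add_inv_eq_one
      rw [one_div, one_div]; linarith
    have e2 : θ * q.conjExponent = s := by
      rw [hθ, e, mul_assoc, one_div_mul_cancel hq'.symm.pos.ne', mul_one]
    rw [← e]
    simp_rw [← ENNReal.rpow_mul, e2]

/-- Pointwise decay of a function on the half-plane with an `L^s` nontangential majorant. -/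
theorem enorm_le_of_nontangential_majorant {s β θ : ℝ} (hs : 0 < s) (hβ : 0 ≤ β) (hθ0 : 0 ≤ θ)
    (hθ : θ + s * β = 1) {H : ℂ → ℂ} {N : ℝ → ℝ≥0∞}
    (hN : ∀ z : ℂ, 0 < z.im → ∀ r, |r - z.re| ≤ z.im → ‖H z‖ₑ ≤ N r) {z : ℂ} (hz : 0 < z.im)
    {r : ℝ} (hr : |r - z.re| ≤ z.im) :
    ‖H z‖ₑ ≤ (N r ^ θ * (∫⁻ x, N x ^ s) ^ β) * ENNReal.ofReal (z.im ^ (-β)) := by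
  -- The majorant is at least `|H(z)|` on an interval of length `y`. The resulting decay `y ^ (-1 /
  -- s)` is interpolated with the bound by `N(r)` through `|H| = |H| ^ θ |H| ^ (s β)`.
  have h1 : ‖H z‖ₑ ^ s * ENNReal.ofReal z.im ≤ ∫⁻ x, N x ^ s := by
    calc ‖H z‖ₑ ^ s * ENNReal.ofReal z.im
        ≤ ‖H z‖ₑ ^ s * volume (Icc (z.re) (z.re + z.im)) := by
          rw [Real.volume_Icc]; ring_nf; exact le_rfl
      _ = ∫⁻ x in Icc (z.re) (z.re + z.im), ‖H z‖ₑ ^ s := by rw [setLIntegral_const]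
      _ ≤ ∫⁻ x in Icc (z.re) (z.re + z.im), N x ^ s := by
          refine setLIntegral_mono' measurableSet_Icc fun x hx => ?_
          refine ENNReal.rpow_le_rpow (hN z hz x ?_) hs.le
          rw [abs_le]; constructor <;> linarith [hx.1, hx.2]
      _ ≤ ∫⁻ x, N x ^ s := setLIntegral_le_lintegral _ _
  have h2 : ‖H z‖ₑ ^ s ≤ (∫⁻ x, N x ^ s) * (ENNReal.ofReal z.im)⁻¹ := by
    rw [← div_eq_mul_inv]
    exact (ENNReal.le_div_iff_mul_le (Or.inl (by simpa using hz)) (Or.inl ENNReal.ofReal_ne_top)).2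
      h1
  have h3 := ENNReal.rpow_le_rpow h2 hβ
  rw [ENNReal.mul_rpow_of_nonneg _ _ hβ, ← ENNReal.rpow_mul, ← ENNReal.rpow_neg_one,
    ← ENNReal.rpow_mul, neg_one_mul, ENNReal.ofReal_rpow_of_pos hz] at h3
  calc ‖H z‖ₑ = ‖H z‖ₑ ^ θ * ‖H z‖ₑ ^ (s * β) := by
        rw [← ENNReal.rpow_add_of_nonneg _ _ hθ0 (by positivity), hθ, ENNReal.rpow_one]
    _ ≤ N r ^ θ * ((∫⁻ x, N x ^ s) ^ β * ENNReal.ofReal (z.im ^ (-β))) :=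
        mul_le_mul' (ENNReal.rpow_le_rpow (hN z hz r hr) hθ0) h3
    _ = _ := by rw [mul_assoc]

/-- With `s = p'`, the choices `β = 1/q - 1/p` and `θ = s (1 - 1/q)` satisfy `θ + s β = 1`, as the
decay estimate requires. Then `N ^ θ` lies in the dual of `L^q`, and the powers of `∫ N ^ s` add up
to `β + 1 - 1/q = 1/s`, that is, to one `L^{p'}` norm of `N`. -/
theorem ScaledPhase.enorm_integral_mul_hardyExt_le {κ k : ℕ} {α p q A c : ℝ} (hα : 0 ≤ α)
    (hγ : 0 < (κ : ℝ) + α) (hp : 1 < p) (hq : 1 ≤ q) (hqp : q ≤ p)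
    (hpq : 1 / q ≤ 1 / p + k - ((κ : ℝ) + α)) (hA : 0 < A) (hc : 0 < c) :
    ∃ C : ℝ≥0, ∀ φ ℓ : ℝ → ℝ, ScaledPhase κ α φ ℓ A c → ∀ t : ℝ, 0 < t → ∀ f G : ℝ → ℂ,
      Measurable f → Measurable G → MemLp f (ENNReal.ofReal p) (volume.restrict {x | 0 < ℓ x}) →
      IsWeakDeriv k {x | 0 < ℓ x} (fun x => f x / ((deriv φ x ^ ((κ : ℝ) + α) : ℝ) : ℂ)) G →
      ∀ v : 𝓢(ℝ, ℂ),
      ‖∫ r in {r | 0 < ℓ r}, Complex.exp (Complex.I * ((t * φ r : ℝ) : ℂ)) * f r * hardyExt v r‖ₑ ≤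
        C * ENNReal.ofReal (t ^ (-((κ : ℝ) + α))) *
          (weightedNorm p ((κ : ℝ) + α) {x | 0 < ℓ x} φ ℓ f +
            eLpNorm (fun x => ℓ x ^ ((k : ℝ) - ((κ : ℝ) + α) + 1 / p - 1 / q) • G x)
              (ENNReal.ofReal q) (volume.restrict {x | 0 < ℓ x})) *
          eLpNorm v (ENNReal.ofReal p.conjExponent) volume := by
  have hp' := Real.HolderConjugate.conjExponent hp
  set s := p.conjExponent with hsdef
  have hs0 : 0 < s := hp'.symm.pos
  have hp0 : 0 < p := hp'.pos
  have hq0 : 0 < q := by linarith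
  set γ := (κ : ℝ) + α with hγdef
  set β := 1 / q - 1 / p with hβdef
  have hβ0 : 0 ≤ β := sub_nonneg.2 (one_div_le_one_div_of_le hq0 hqp)
  have hβk : β + γ ≤ k := by linarith
  have hinv : 1 / p + 1 / s = 1 := by
    have := hp'.inv_add_inv_eq_one
    rw [one_div, one_div]; exact this
  set θ := s * (1 - 1 / q) with hθdef
  have hθ0 : 0 ≤ θ := by
    refine mul_nonneg hs0.le (sub_nonneg.2 ?_)
    rw [div_le_one hq0]; exact hq
  have hθβ : θ + s * β = 1 := by
    have : θ + s * β = s * (1 / s) := by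
      rw [hθdef, hβdef, show 1 / s = 1 - 1 / p by linarith]; ring
    rw [this, mul_one_div_cancel hs0.ne']
  obtain ⟨C1, hC1⟩ := ScaledPhase.enorm_integral_le hα hγ hA hc hβk
  obtain ⟨C2, hC2⟩ := exists_nontangential_majorant hp'.symm.lt
  refine ⟨C1 * C2 ^ (1 / s), fun φ ℓ h t ht f G hf hG hfp hFG v => ?_⟩
  obtain ⟨N, hNm, hNmaj, hNint⟩ := hC2 v
  set S : Set ℝ := {x | 0 < ℓ x} with hS
  have hSm : MeasurableSet S := h.isOpen.measurableSet
  set M := ∫⁻ x, N x ^ s with hM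
  have hvn := eLpNorm_ofReal_eq hs0 v volume
  have hMv : M ^ (1 / s) ≤ (C2 ^ (1 / s) : ℝ≥0) * eLpNorm v (ENNReal.ofReal s) volume := by
    rw [hvn, ENNReal.coe_rpow_of_nonneg _ (by positivity),
      ← ENNReal.mul_rpow_of_nonneg _ _ (by positivity)]
    exact ENNReal.rpow_le_rpow hNint (by positivity)
  have hMtop : M ^ (1 / s) ≠ ⊤ :=
    (hMv.trans_lt (ENNReal.mul_lt_top ENNReal.coe_lt_top (memLp_schwartz v s).2)).ne
  have hNz : ∀ z : ℂ, 0 < z.im → ∀ r, |r - z.re| ≤ z.im → ‖hardyExt v z‖ₑ ≤ N r := by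
    intro z hz r hr
    have h1 := hNmaj r ((z.re - r) / z.im) z.im ?_ hz
    · rw [div_mul_cancel₀ _ hz.ne', add_sub_cancel, Complex.re_add_im] at h1
      exact h1
    · rw [abs_div, abs_of_pos hz, div_le_one hz, abs_sub_comm]; exact hr
  have hNS : (∫⁻ x in S, N x ^ s) ≤ M := setLIntegral_le_lintegral _ _
  have hfn : ∫⁻ r in S, ‖f r‖ₑ * N r ≠ ⊤ := by
    refine ne_top_of_le_ne_top (ENNReal.mul_ne_top hfp.2.ne hMtop) ?_
    rw [eLpNorm_ofReal_eq hp0]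
    refine (ENNReal.lintegral_mul_le_Lp_mul_Lq _ hp' hf.enorm.aemeasurable
      hNm.aemeasurable).trans ?_
    gcongr
  have main := hC1 φ ℓ h t ht f G hf hG hFG (hardyExt v) N (fun r => N r ^ θ * M ^ β)
    (continuous_hardyExt v) ⟨_, norm_hardyExt_le v⟩ (fun z hz => differentiableAt_hardyExt v hz)
    hNm ((hNm.pow_const θ).mul_const _) (fun z hz r hr => ⟨hNz z hz r hr,
      enorm_le_of_nontangential_majorant hs0 hβ0 hθ0 hθβ hNz hz hr⟩) hfn
  have htγ : 0 ≤ t ^ (-γ) := Real.rpow_nonneg ht.le _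
  have hℓm : Measurable ℓ := h.continuous_scale.measurable
  have b1 : ∫⁻ r in S, ENNReal.ofReal (t ^ (-γ) * ((deriv φ r * ℓ r) ^ γ)⁻¹) * (‖f r‖ₑ * N r)
      ≤ ENNReal.ofReal (t ^ (-γ)) * (weightedNorm p γ S φ ℓ f * M ^ (1 / s)) := by
    have e : ∫⁻ r in S, ENNReal.ofReal (t ^ (-γ) * ((deriv φ r * ℓ r) ^ γ)⁻¹) * (‖f r‖ₑ * N r)
        = ∫⁻ r in S, ENNReal.ofReal (t ^ (-γ)) *
          ((‖f r‖ₑ / ENNReal.ofReal ((deriv φ r * ℓ r) ^ γ)) * N r) := by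
      refine setLIntegral_congr_fun hSm fun r hr => ?_
      have hpos : 0 < (deriv φ r * ℓ r) ^ γ :=
        Real.rpow_pos_of_pos (mul_pos (h.deriv_pos r hr) hr) _
      rw [ENNReal.ofReal_mul htγ, ENNReal.ofReal_inv_of_pos hpos, div_eq_mul_inv]
      ring
    have hm : Measurable fun r => ‖f r‖ₑ / ENNReal.ofReal ((deriv φ r * ℓ r) ^ γ) :=
      hf.enorm.div (((measurable_deriv φ).mul hℓm).pow_const γ).ennreal_ofReal
    have hm2 : Measurable fun r => ‖f r‖ₑ / ENNReal.ofReal ((deriv φ r * ℓ r) ^ γ) * N r :=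
      hm.mul hNm
    rw [e, lintegral_const_mul _ hm2]
    gcongr
    rw [weightedNorm, eLpNorm_ofReal_eq hp0]
    refine (ENNReal.lintegral_mul_le_Lp_mul_Lq _ hp' hm.aemeasurable hNm.aemeasurable).trans ?_
    simp only [enorm_eq_self]
    gcongr
  have b2 : ∫⁻ r in S, ENNReal.ofReal (t ^ (-γ) * ℓ r ^ ((k : ℝ) - γ - β)) *
        (‖G r‖ₑ * (N r ^ θ * M ^ β))
      ≤ ENNReal.ofReal (t ^ (-γ)) * (eLpNorm (fun x => ℓ x ^ ((k : ℝ) - γ + 1 / p - 1 / q) • G x)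
        (ENNReal.ofReal q) (volume.restrict S) * M ^ (1 / s)) := by
    have hexp : (k : ℝ) - γ - β = (k : ℝ) - γ + 1 / p - 1 / q := by rw [hβdef]; ring
    have hm : Measurable fun x => ℓ x ^ ((k : ℝ) - γ + 1 / p - 1 / q) • G x :=
      (hℓm.pow_const _).smul hG
    have e : ∫⁻ r in S, ENNReal.ofReal (t ^ (-γ) * ℓ r ^ ((k : ℝ) - γ - β)) *
          (‖G r‖ₑ * (N r ^ θ * M ^ β))
        = ∫⁻ r in S, (ENNReal.ofReal (t ^ (-γ)) * M ^ β) *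
          (‖ℓ r ^ ((k : ℝ) - γ + 1 / p - 1 / q) • G r‖ₑ * N r ^ θ) := by
      refine setLIntegral_congr_fun hSm fun r hr => ?_
      rw [ENNReal.ofReal_mul htγ, hexp, enorm_smul,
        Real.enorm_of_nonneg (Real.rpow_nonneg (h.nonneg r) _)]
      ring
    have hm2 : Measurable fun r => ‖ℓ r ^ ((k : ℝ) - γ + 1 / p - 1 / q) • G r‖ₑ * N r ^ θ :=
      hm.enorm.mul (hNm.pow_const θ)
    rw [e, lintegral_const_mul _ hm2, mul_assoc]
    refine mul_le_mul_right ?_ _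
    refine (mul_le_mul_right (lintegral_mul_rpow_le hq hθdef hm.enorm.aemeasurable
      hNm.aemeasurable) _).trans ?_
    rw [eLpNorm_ofReal_eq hq0, mul_left_comm]
    have hsum : 1 / s = β + (1 - 1 / q) := by rw [hβdef]; linarith
    have h1q : 0 ≤ 1 - 1 / q := by
      rw [sub_nonneg, div_le_one hq0]; exact hq
    rw [hsum, ENNReal.rpow_add_of_nonneg _ _ hβ0 h1q]
    gcongr
  refine main.trans ((mul_le_mul_right (add_le_add b1 b2) _).trans ?_)
  rw [← mul_add, ← add_mul]
  refine le_trans ?_ (le_of_eq_of_le (by push_cast; ring :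
    (C1 : ℝ≥0∞) * (ENNReal.ofReal (t ^ (-γ)) * ((weightedNorm p γ S φ ℓ f +
      eLpNorm (fun x => ℓ x ^ ((k : ℝ) - γ + 1 / p - 1 / q) • G x) (ENNReal.ofReal q)
        (volume.restrict S)) * ((C2 ^ (1 / s) : ℝ≥0) *
          eLpNorm v (ENNReal.ofReal s) volume))) = _) le_rfl)
  gcongr

theorem enorm_oscillating (t : ℝ) (φ : ℝ → ℝ) (f : ℝ → ℂ) (Ω : Set ℝ) (x : ℝ) :
    ‖oscillating t φ f Ω x‖ₑ = ‖Ω.indicator f x‖ₑ := by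
  rw [oscillating]
  by_cases hx : x ∈ Ω
  · rw [indicator_of_mem hx, indicator_of_mem hx, enorm_mul, ← ofReal_norm (Complex.exp _),
      mul_comm Complex.I, Complex.norm_exp_ofReal_mul_I, ENNReal.ofReal_one, one_mul]
  · rw [indicator_of_notMem hx, indicator_of_notMem hx]

theorem eLpNorm_oscillating (t : ℝ) (φ : ℝ → ℝ) (f : ℝ → ℂ) {Ω : Set ℝ} (hΩ : IsOpen Ω)
    (p : ℝ≥0∞) :
    eLpNorm (oscillating t φ f Ω) p volume = eLpNorm f p (volume.restrict Ω) := by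
  rw [← eLpNorm_indicator_eq_eLpNorm_restrict hΩ.measurableSet]
  exact eLpNorm_congr_enorm_ae (Eventually.of_forall fun x => enorm_oscillating t φ f Ω x)

theorem memLp_oscillating (t : ℝ) {φ : ℝ → ℝ} {f : ℝ → ℂ} {Ω : Set ℝ} (hΩ : IsOpen Ω)
    (hφ : ContinuousOn φ Ω) {p : ℝ≥0∞} (hf : MemLp f p (volume.restrict Ω)) :
    MemLp (oscillating t φ f Ω) p volume := by
  refine ⟨?_, by rw [eLpNorm_oscillating t φ f hΩ]; exact hf.2⟩
  rw [oscillating, aestronglyMeasurable_indicator_iff hΩ.measurableSet]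
  refine AEStronglyMeasurable.mul ?_ hf.1
  refine ContinuousOn.aestronglyMeasurable ?_ hΩ.measurableSet
  exact Complex.continuous_exp.comp_continuousOn (continuousOn_const.mul
    (Complex.continuous_ofReal.comp_continuousOn (continuousOn_const.mul hφ)))

/-- For `γ > 0` the weight vanishes where `ℓ` does, so the quotient is infinite unless `f` vanishes
too. The part of `Ω` with `ℓ = 0` therefore drops out of the integral. -/
theorem ae_eq_zero_of_weightedNorm_ne_top {p γ : ℝ} (hp : 0 < p) (hγ : 0 < γ) {Ω : Set ℝ}
    (hΩ : IsOpen Ω) {φ ℓ : ℝ → ℝ} (hℓ : ContinuousOn ℓ Ω) {f : ℝ → ℂ}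
    (hf : AEStronglyMeasurable f (volume.restrict Ω)) (h : weightedNorm p γ Ω φ ℓ f ≠ ⊤) :
    ∀ᵐ x ∂volume.restrict Ω, ℓ x = 0 → f x = 0 := by
  have hm : AEMeasurable (fun x => ‖f x‖ₑ / ENNReal.ofReal ((deriv φ x * ℓ x) ^ γ))
      (volume.restrict Ω) :=
    hf.enorm.div (((measurable_deriv φ).aemeasurable.mul
      (hℓ.aemeasurable hΩ.measurableSet)).pow_const γ).ennreal_ofReal
  have hlt : ∀ᵐ x ∂volume.restrict Ω,
      (‖f x‖ₑ / ENNReal.ofReal ((deriv φ x * ℓ x) ^ γ)) ^ p < ⊤ := by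
    refine ae_lt_top' (hm.pow_const p) fun hcon => h ?_
    rw [weightedNorm, eLpNorm_ofReal_eq hp]
    simp only [enorm_eq_self]
    rw [hcon, ENNReal.top_rpow_of_pos (by positivity)]
  filter_upwards [hlt] with x hx hx0
  by_contra hne
  rw [hx0, mul_zero, Real.zero_rpow hγ.ne', ENNReal.ofReal_zero,
    ENNReal.div_zero (by simpa using hne), ENNReal.top_rpow_of_pos hp] at hx
  exact lt_irrefl _ hx

theorem eLpNorm_le_of_isAdmissible {κ k : ℕ} {α p q A c : ℝ} (hα : 0 ≤ α)
    (hγ : 0 < (κ : ℝ) + α) (hp : 1 < p) (hq : 1 ≤ q) (hqp : q ≤ p)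
    (hpq : 1 / q ≤ 1 / p + k - ((κ : ℝ) + α)) (hA : 0 < A) (hc : 0 < c) :
    ∃ C : ℝ≥0, ∀ (Ω : Set ℝ) (φ ℓ : ℝ → ℝ), IsOpen Ω → IsPhase κ α Ω φ →
      IsAdmissible κ α Ω φ ℓ A c →
      ∀ t : ℝ, 0 < t → ∀ f : ℝ → ℂ, MemLp f (ENNReal.ofReal p) (volume.restrict Ω) →
        ∀ h : ℝ → ℂ, IsCMinus (ENNReal.ofReal p) (oscillating t φ f Ω) h →
          ∀ G : ℝ → ℂ,
            IsWeakDeriv k Ω (fun x => f x / ((deriv φ x ^ ((κ : ℝ) + α) : ℝ) : ℂ)) G →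
            eLpNorm h (ENNReal.ofReal p) volume ≤
              C * ENNReal.ofReal (t ^ (-((κ : ℝ) + α))) *
                (weightedNorm p ((κ : ℝ) + α) Ω φ ℓ f +
                  eLpNorm (fun x => ℓ x ^ ((k : ℝ) - ((κ : ℝ) + α) + 1 / p - 1 / q) • G x)
                    (ENNReal.ofReal q) (volume.restrict Ω)) := by
  obtain ⟨C, hC⟩ := ScaledPhase.enorm_integral_mul_hardyExt_le hα hγ hp hq hqp hpq hA hc
  have hp' := Real.HolderConjugate.conjExponent hp
  -- The constant must be nonzero for the right-hand side to be infinite when the weighted norm is,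
  -- because `0 * ∞ = 0`.
  refine ⟨C + 1, fun Ω φ ℓ hΩ hφ hℓ t ht f hf h hh G hFG => ?_⟩
  set γ := (κ : ℝ) + α with hγdef
  have hsc := hℓ.scaledPhase hA hΩ hφ
  set L := Ω.indicator ℓ with hL
  have hLΩ : ∀ x ∈ Ω, L x = ℓ x := fun x hx => indicator_of_mem hx ℓ
  have hpos : {x | 0 < L x} ⊆ Ω := fun x hx => by
    by_contra hcon
    rw [mem_ofPred_eq, hL, indicator_of_notMem hcon] at hx
    exact lt_irrefl _ hx
  have hSm : MeasurableSet {x | 0 < L x} := hsc.isOpen.measurableSet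
  have hℓc : ContinuousOn ℓ Ω := hsc.continuous_scale.continuousOn.congr fun x hx => (hLΩ x hx).symm
  have htpos : 0 < ENNReal.ofReal (t ^ (-γ)) := ENNReal.ofReal_pos.2 (Real.rpow_pos_of_pos ht _)
  by_cases htop : weightedNorm p γ Ω φ ℓ f = ⊤
  · rw [htop, top_add, ENNReal.mul_top]
    · exact le_top
    · exact mul_ne_zero (by simp) htpos.ne'
  have hzero := ae_eq_zero_of_weightedNorm_ne_top hp'.pos hγ hΩ hℓc hf.1 htop
  have hGm := hFG.2.1.aestronglyMeasurable
  set f' := hf.1.mk f with hf'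
  set G' := hGm.mk G with hG'
  have hff : f =ᵐ[volume.restrict Ω] f' := hf.1.ae_eq_mk
  have hGG : G =ᵐ[volume.restrict Ω] G' := hGm.ae_eq_mk
  have hff' := ae_restrict_of_ae_restrict_of_subset hpos hff
  have hGG' := ae_restrict_of_ae_restrict_of_subset hpos hGG
  have hW : weightedNorm p γ {x | 0 < L x} φ L f' ≤ weightedNorm p γ Ω φ ℓ f := by
    refine le_trans (le_of_eq ?_) (eLpNorm_mono_measure _ (Measure.restrict_mono hpos le_rfl))
    refine eLpNorm_congr_ae ?_
    filter_upwards [hff', ae_restrict_mem hSm] with x hx hxS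
    rw [hx, hLΩ x (hpos hxS)]
  have hE : eLpNorm (fun x => L x ^ ((k : ℝ) - γ + 1 / p - 1 / q) • G' x)
      (ENNReal.ofReal q) (volume.restrict {x | 0 < L x}) ≤
      eLpNorm (fun x => ℓ x ^ ((k : ℝ) - γ + 1 / p - 1 / q) • G x)
      (ENNReal.ofReal q) (volume.restrict Ω) := by
    refine le_trans (le_of_eq ?_) (eLpNorm_mono_measure _ (Measure.restrict_mono hpos le_rfl))
    refine eLpNorm_congr_ae ?_
    filter_upwards [hGG', ae_restrict_mem hSm] with x hx hxS
    rw [hx, hLΩ x (hpos hxS)]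
  have hweak : IsWeakDeriv k {x | 0 < L x} (fun x => f' x / ((deriv φ x ^ γ : ℝ) : ℂ)) G' := by
    refine hFG.congr_ae hSm hpos ?_ hGG'
    filter_upwards [hff'] with x hx
    rw [hx]
  have hf'p : MemLp f' (ENNReal.ofReal p) (volume.restrict {x | 0 < L x}) :=
    (hf.ae_eq hff).mono_measure (Measure.restrict_mono hpos le_rfl)
  refine eLpNorm_le_of_forall_schwartz hp' hh.2.1 fun v => ?_
  rw [hh.integral_mul_eq hp' v]
  have hint : ∫ x : ℝ, oscillating t φ f Ω x * hardyExt v x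
      = ∫ x in {x | 0 < L x}, Complex.exp (Complex.I * ((t * φ x : ℝ) : ℂ)) * f' x *
          hardyExt v x := by
    rw [← integral_indicator hSm]
    refine integral_congr_ae ?_
    filter_upwards [(ae_restrict_iff' hΩ.measurableSet).1 hzero,
      (ae_restrict_iff' hΩ.measurableSet).1 hff] with x hx0 hxf
    by_cases hx : 0 < L x
    · rw [indicator_of_mem (show x ∈ {x | 0 < L x} from hx), oscillating,
        indicator_of_mem (hpos hx), hxf (hpos hx)]
    · rw [indicator_of_notMem (show x ∉ {x | 0 < L x} from hx), oscillating]
      by_cases hxΩ : x ∈ Ω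
      · rw [indicator_of_mem hxΩ, hx0 hxΩ, mul_zero, zero_mul]
        exact le_antisymm (by rw [← hLΩ x hxΩ]; exact not_lt.1 hx) (hℓ.nonneg x hxΩ)
      · rw [indicator_of_notMem hxΩ, zero_mul]
  rw [hint]
  refine (hC φ L hsc t ht f' G' hf.1.stronglyMeasurable_mk.measurable
    hGm.stronglyMeasurable_mk.measurable hf'p hweak v).trans ?_
  have hCC : (C : ℝ≥0∞) ≤ ((C + 1 : ℝ≥0) : ℝ≥0∞) := ENNReal.coe_le_coe.2 (by simp)
  gcongr

theorem theorem3 (κ : ℕ) (α : ℝ) (hα : α ∈ Set.Icc (0 : ℝ) 1)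
    (p q : ℝ) (hp : 1 < p) (hq : 1 ≤ q) (hqp : q ≤ p)
    (k : ℕ) (hk : (κ : ℝ) + α ≤ k) (hpq : 1 / q ≤ 1 / p + k - ((κ : ℝ) + α))
    (A c : ℝ) (hA : 0 < A) (hc : 0 < c) :
    ∃ C : ℝ≥0, ∀ (Ω : Set ℝ) (φ ℓ : ℝ → ℝ), IsOpen Ω → IsPhase κ α Ω φ →
      IsAdmissible κ α Ω φ ℓ A c →
      ∀ t : ℝ, 0 < t → ∀ f : ℝ → ℂ, MemLp f (ENNReal.ofReal p) (volume.restrict Ω) →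
        (∃ h : ℝ → ℂ, IsCMinus (ENNReal.ofReal p) (oscillating t φ f Ω) h) ∧
        ∀ h : ℝ → ℂ, IsCMinus (ENNReal.ofReal p) (oscillating t φ f Ω) h →
          ∀ G : ℝ → ℂ,
            IsWeakDeriv k Ω (fun x => f x / ((deriv φ x ^ ((κ : ℝ) + α) : ℝ) : ℂ)) G →
            eLpNorm h (ENNReal.ofReal p) volume ≤
              C * ENNReal.ofReal (t ^ (-((κ : ℝ) + α))) *
                (weightedNorm p ((κ : ℝ) + α) Ω φ ℓ f +
                  eLpNorm (fun x => ℓ x ^ ((k : ℝ) - ((κ : ℝ) + α) + 1 / p - 1 / q) • G x)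
                    (ENNReal.ofReal q) (volume.restrict Ω)) := by
  have hexists : ∀ (Ω : Set ℝ) (φ : ℝ → ℝ), IsOpen Ω → IsPhase κ α Ω φ → ∀ (t : ℝ) (f : ℝ → ℂ),
      MemLp f (ENNReal.ofReal p) (volume.restrict Ω) →
      ∃ h : ℝ → ℂ, IsCMinus (ENNReal.ofReal p) (oscillating t φ f Ω) h :=
    fun Ω φ hΩ hφ t f hf => exists_isCMinus hp (memLp_oscillating t hΩ hφ.contDiffOn.continuousOn hf)
  have hγ : 0 ≤ (κ : ℝ) + α := add_nonneg (Nat.cast_nonneg κ) hα.1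
  -- For `γ = 0` the extension argument breaks down, but the weight and the power of `t` are one,
  -- and the boundedness of `C_-` suffices.
  rcases hγ.eq_or_lt with hγ0 | hγ0
  · obtain ⟨C, hC⟩ := IsCMinus.eLpNorm_le hp
    refine ⟨C, fun Ω φ ℓ hΩ hφ hℓ t ht f hf => ⟨hexists Ω φ hΩ hφ t f hf, fun h hh G hG => ?_⟩⟩
    refine (hC _ h hh).trans ?_
    rw [eLpNorm_oscillating t φ f hΩ, ← hγ0, neg_zero, Real.rpow_zero, ENNReal.ofReal_one, mul_one]
    gcongr
    refine le_add_of_le_of_nonneg (le_of_eq ?_) zero_le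
    simp_rw [weightedNorm, Real.rpow_zero, ENNReal.ofReal_one, div_one]
    exact (eLpNorm_enorm f).symm
  · obtain ⟨C, hC⟩ := eLpNorm_le_of_isAdmissible hα.1 hγ0 hp hq hqp hpq hA hc
    exact ⟨C, fun Ω φ ℓ hΩ hφ hℓ t ht f hf =>
      ⟨hexists Ω φ hΩ hφ t f hf, hC Ω φ ℓ hΩ hφ hℓ t ht f hf⟩⟩
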